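/- **Setting.** Let $N\ge 3$, let $n=\lfloor N/2\rfloor$, and for $1\le i\le N$ put $i'=N+1-i$. Let $q\in\mathbb C\setminus\{0\}$ be not a root of unity, and fix a square root $q^{1/2}$. Put $[a]=\frac{1-q^a}{1-q}$, $[a]_q=\frac{q^a-q^{-a}}{q-q^{-1}}$, and $(\rho_1,\dots,\rho_N)=(n-\tfrac12,\dots,\tfrac12,0,-\tfrac12,\dots,-n+\tfrac12)$ if $N=2n+1$, $(\rho_1,\dots,\rho_N)=(n-1,\dots,1,0,0,-1,\dots,-n+1)$ if $N=2n$. Let $\mathcal A=\mathbb C_q[x_1,\dots,x_N]$ be the associative unital algebra generated by $x_1,\dots,x_N$ with relations $x_ix_j=qx_jx_i$ ($i<j$, $i\ne j'$); $x_{i'}x_i-x_ix_{i'}=\frac{q-q^{-1}}{q^{\rho_i-1}+q^{-\rho_i+1}}\sum_{j=i+1}^{(i+1)'}q^{\rho_{j'}}x_jx_{j'}$ ($i<n$); and $x_{n'}x_n-x_nx_{n'}=(q^{1/2}-q^{-1/2})x_{n+1}^2$ if $N=2n+1$, $x_{n'}x_n=x_nx_{n'}$ if $N=2n$. For $\nu\in\mathbb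 Z_{\ge0}^N$ let ${\bf x}^\nu=x_1^{\nu_1}\cdots x_N^{\nu_N}$; these monomials form a basis of $\mathcal A$ (this is part of the assertion), so operators on $\mathcal A$ may be defined on them. Let $\varepsilon_i$ be the $i$-th unit vector and let $\mathcal A_m$ be the span of the ${\bf x}^\nu$ with $\nu_1+\dots+\nu_N=m$. Define $\partial_1,\dots,\partial_N$ by $\partial_k{\bf x}^\nu=[\nu_k]_q\,q^{\nu_{k+1}+\dots+\nu_N}{\bf x}^{\nu-\varepsilon_k}$ for $k\le n$; $\partial_{n+1}{\bf x}^\nu=[\nu_{n+1}]\,q^{\nu_{n+2}+\dots+\nu_N}{\bf x}^{\nu-\varepsilon_{n+1}}$ if $N=2n+1$; and, for $k\le n$, $$\partial_{k'}{\bf x}^\nu=[\nu_{k'}]_q\,q^{\nu_k+\nu_{k'+1}+\dots+\nu_N}{\bf x}^{\nu-\varepsilon_{k'}}+\sum_{j=k+1}^n[\nu_j]_q[\nu_{j'}]_q(q-q^{-1})q^{\rho_k-\rho_j+d_{kj}}{\bf x}^{\nu+\varepsilon_k-\varepsilon_j-\varepsilon_{j'}}+[\nu_{n+1}-1][\nu_{n+1}]\tfrac{q-q^{-1}}{1+q}q^{\rho_k+2+e_k}{\bf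 x}^{\nu+\varepsilon_k-2\varepsilon_{n+1}},$$ where $d_{kj}=\nu_k+\dots+\nu_{j-1}+\nu_{j'+1}+\dots+\nu_N$, $e_k=\nu_k+\dots+\nu_N-2\nu_{n+1}$, and the last term is omitted if $N=2n$. Let $\hat Q$ be left multiplication by $Q=\sum_iq^{\rho_{i'}}x_ix_{i'}$, let $\Delta_q=\sum_iq^{\rho_i}\partial_i\partial_{i'}$, let $\gamma{\bf x}^\nu=(\nu_1+\dots+\nu_N){\bf x}^\nu$, and let $\mathcal H_m=\{p\in\mathcal A_m:\Delta_qp=0\}$. $U_q(\mathrm{sl}_2)$ is generated by $k^{\pm1},e,f$ with $ke=q^2ek$, $kf=q^{-2}fk$, $ef-fe=\frac{k-k^{-1}}{q-q^{-1}}$. For $l\in\frac12\mathbb Z_{>0}$, $D_l$ is its discrete series representation with lowest weight $l$: it has the basis $|r\rangle$, $r\ge0$, with $k|r\rangle=q^{2r+l}|r\rangle$, $e|r\rangle=[r+l]_q|r+1\rangle$, $f|r\rangle=-[r]_q|r-1\rangle$. $U_q(\mathrm{so}_N)$ is generated by $E_i,F_i,K_i^{\pm1}$ ($1\le i\le n$),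 with commuting $K_i$ and, for the simple roots $\alpha_i=\varepsilon_i-\varepsilon_{i+1}$ ($i<n$), $\alpha_n=\varepsilon_n$ ($N=2n+1$) or $\alpha_n=\varepsilon_{n-1}+\varepsilon_n$ ($N=2n$), the relations $K_iE_j=q^{(\alpha_i,\alpha_j)}E_jK_i$, $K_iF_j=q^{-(\alpha_i,\alpha_j)}F_jK_i$, $E_iF_j-F_jE_i=\delta_{ij}\frac{K_i-K_i^{-1}}{q-q^{-1}}$ and the $q$-Serre relations for the $E_i$ and for the $F_i$ (with $q_i=q^{(\alpha_i,\alpha_i)/2}$). For $1\le a,b\le N$ put $$\mathsf E_{a,b}{\bf x}^\nu=[\nu_b]_q\,q^{\nu_a-\nu_b+1}{\bf x}^{\nu+\varepsilon_a-\varepsilon_b}-[\nu_{a'}]_q\,q^{\nu_a-\nu_b-\nu_{a'}+\nu_{b'}+1}{\bf x}^{\nu+\varepsilon_{b'}-\varepsilon_{a'}},$$ $$\mathsf F_{a,b}{\bf x}^\nu=[\nu_a]_q\,q^{-\nu_a+\nu_b-\nu_{b'}+\nu_{a'}+1}{\bf x}^{\nu-\varepsilon_a+\varepsilon_b}-[\nu_{b'}]_q\,q^{-\nu_{b'}+\nu_{a'}+1}{\bf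 x}^{\nu-\varepsilon_{b'}+\varepsilon_{a'}}.$$ The natural action $L$ of $U_q(\mathrm{so}_N)$ on $\mathcal A$ is given by $L(K_i){\bf x}^\nu=q^{(\alpha_i,\lambda)}{\bf x}^\nu$ with $\lambda=\sum_{j\le n}(\nu_j-\nu_{j'})\varepsilon_j$; $L(E_i)=\mathsf E_{i,i+1}$, $L(F_i)=\mathsf F_{i,i+1}$ for $i<n$; $L(E_n)=\mathsf E_{n-1,n+1}$, $L(F_n)=\mathsf F_{n-1,n+1}$ if $N=2n$; and, if $N=2n+1$, $$L(E_n){\bf x}^\nu=[\nu_{n+1}]q^{\nu_n-\nu_{n+1}+3/2}{\bf x}^{\nu+\varepsilon_n-\varepsilon_{n+1}}-[\nu_{n+2}]_qq^{\nu_n-\nu_{n+2}+1}{\bf x}^{\nu+\varepsilon_{n+1}-\varepsilon_{n+2}},$$ $$L(F_n){\bf x}^\nu=[\nu_n]_qq^{-\nu_n+\nu_{n+2}+1/2}{\bf x}^{\nu-\varepsilon_n+\varepsilon_{n+1}}-[\nu_{n+1}]q^{-\nu_{n+1}+\nu_{n+2}+1}{\bf x}^{\nu-\varepsilon_{n+1}+\varepsilon_{n+2}}.$$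 **Theorem.** The monomials ${\bf x}^\nu$ form a basis of $\mathcal A$, and the above formulas define a representation $L$ of $U_q(\mathrm{so}_N)$ on $\mathcal A$. Moreover: 1. The formulas $$\omega(k)=q^{N/2}q^{\gamma},\qquad \omega(e)=\hat Q,\qquad \omega(f)=-\frac{q^{N/2}}{(1+q^{N-2})^2}\,\Delta_q\,q^{-\gamma}$$ define a representation $\omega$ of $U_q(\mathrm{sl}_2)$ on $\mathcal A$. The operators $\omega(u)$, $u\in U_q(\mathrm{sl}_2)$, commute with the operators $L(X)$, $X\in U_q(\mathrm{so}_N)$; so there is a representation $\omega\times L$ of $U_q(\mathrm{sl}_2)\otimes U_q(\mathrm{so}_N)$ on $\mathcal A$. 2. For every $m\ge0$ the space $\mathcal H_m$ is invariant under $L$, and the representation $T_m$ of $U_q(\mathrm{so}_N)$ on it is irreducible with highest weight $(m,0,\dots,0)$. The representations $D_{m+N/2}$ and $D_{m+N/2}\times T_m$ are irreducible as well. 3. There is an isomorphism of representations of $U_q(\mathrm{sl}_2)\otimes U_q(\mathrm{so}_N)$ $$\bigoplus_{m=0}^\infty D_{m+N/2}\times T_m\;\cong\;\omega\times L ,$$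 which maps $|r\rangle\otimes h$ with $h\in\mathcal H_m$ to $\bigl(\prod_{j=0}^{r-1}[j+m+N/2]_q\bigr)^{-1}Q^rh$. 4. For $m\ne m'$ the representations $D_{m+N/2}$ and $D_{m'+N/2}$ are inequivalent, and so are $T_m$ and $T_{m'}$. Thus in the decomposition each irreducible representation of one algebra determines that of the other, i.e. $(U_q(\mathrm{sl}_2),U_q(\mathrm{so}_N))$ is a dual pair under the action on $\mathcal A$. -/

import Mathlib

open scoped TensorProduct DirectSum

noncomputable section

namespace QEuclid

/-! Throughout, `s` is a nonzero complex number and `q = s ^ 2`, so `s ^ a` plays the role of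
`q ^ (a / 2)` for `a : ℤ`.  Indices are `0`-based: the index `i ∈ {1, …, N}` of the mathematics is
the element of value `i - 1` of `Fin N`, and `i' = N + 1 - i` is `i.rev`.
The rank is `n = N / 2` (integral part). -/

/-- `[a]_q = (q ^ a - q ^ (-a)) / (q - q⁻¹)`. -/
def qNum (s : ℂ) (a : ℤ) : ℂ := ((s ^ 2) ^ a - (s ^ 2) ^ (-a)) / (s ^ 2 - (s ^ 2)⁻¹)

/-- `[a / 2]_q = (q ^ (a / 2) - q ^ (-a / 2)) / (q - q⁻¹)`. -/
def qNumHalf (s : ℂ) (a : ℤ) : ℂ := (s ^ a - s ^ (-a)) / (s ^ 2 - (s ^ 2)⁻¹)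

/-- `[a] = (1 - q ^ a) / (1 - q)`. -/
def qNumOne (s : ℂ) (a : ℤ) : ℂ := (1 - (s ^ 2) ^ a) / (1 - s ^ 2)

/-- `2 ρ_i`, where `ρ = (n - 1/2, …, 1/2, 0, -1/2, …, -n + 1/2)` for `N = 2n + 1` and
`ρ = (n - 1, …, 1, 0, 0, -1, …, -n + 1)` for `N = 2n`. -/
def twoRho {N : ℕ} (i : Fin N) : ℤ :=
  if i < i.rev then (N : ℤ) - 2 - 2 * (i : ℕ)
  else if i = i.rev then 0
  else (N : ℤ) - 2 * (i : ℕ)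

/-! ### The quantum Euclidean space -/

/-- The free generator with index `i`. -/
abbrev fx {N : ℕ} (i : Fin N) : FreeAlgebra ℂ (Fin N) := FreeAlgebra.ι ℂ i

/-- Defining relations of the algebra of polynomials on the quantum Euclidean space. -/
inductive SpaceRel (s : ℂ) (N : ℕ) : FreeAlgebra ℂ (Fin N) → FreeAlgebra ℂ (Fin N) → Prop
  /-- `x_i x_j = q x_j x_i` for `i < j`, `i ≠ j'`. -/
  | comm (i j : Fin N) (hij : i < j) (h : i ≠ j.rev) :
      SpaceRel s N (fx i * fx j) ((s ^ 2) • (fx j * fx i))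
  /-- `x_{i'} x_i - x_i x_{i'} = (q - q⁻¹) / (q ^ (ρ_i - 1) + q ^ (- ρ_i + 1)) *
  ∑_{i < j < i'} q ^ ρ_{j'} x_j x_{j'}` for `i < n`. -/
  | radial (i : Fin N) (hi : (i : ℕ) + 1 < N / 2) :
      SpaceRel s N (fx i.rev * fx i - fx i * fx i.rev)
        (((s ^ 2 - (s ^ 2)⁻¹) / (s ^ (twoRho i - 2) + s ^ (-twoRho i + 2))) •
          ∑ j ∈ Finset.Ioo i i.rev, s ^ twoRho j.rev • (fx j * fx j.rev))
  /-- `x_{n'} x_n - x_n x_{n'} = (q ^ (1/2) - q ^ (-1/2)) x_{n+1} ^ 2` for `N = 2n + 1`. -/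
  | middle_odd (i m : Fin N) (hi : (i : ℕ) + 1 = N / 2) (hm : m = m.rev) :
      SpaceRel s N (fx i.rev * fx i - fx i * fx i.rev) ((s - s⁻¹) • fx m ^ 2)
  /-- `x_{n'} x_n = x_n x_{n'}` for `N = 2n`. -/
  | middle_even (i : Fin N) (hi : (i : ℕ) + 1 = N / 2) (hN : Even N) :
      SpaceRel s N (fx i.rev * fx i) (fx i * fx i.rev)

/-- The algebra `𝒜 = ℂ_q[x_1, …, x_N]` of polynomials on the quantum Euclidean space. -/
abbrev Space (s : ℂ) (N : ℕ) : Type := RingQuot (SpaceRel s N)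

/-- The generators `x_i` of `𝒜`. -/
def x (s : ℂ) {N : ℕ} (i : Fin N) : Space s N := RingQuot.mkAlgHom ℂ (SpaceRel s N) (fx i)

/-- The ordered monomial `x_1 ^ ν_1 ⋯ x_N ^ ν_N`. -/
def mono (s : ℂ) {N : ℕ} (ν : Fin N → ℕ) : Space s N := (List.ofFn fun i => x s i ^ ν i).prod

/-- The space `𝒜_m` of homogeneous polynomials of degree `m`. -/
def homog (s : ℂ) (N m : ℕ) : Submodule ℂ (Space s N) :=
  Submodule.span ℂ {a | ∃ ν : Fin N → ℕ, ∑ i, ν i = m ∧ a = mono s ν}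

/-- The ordered monomials form a basis of `𝒜`. -/
def MonomialsFormBasis (s : ℂ) (N : ℕ) : Prop :=
  LinearIndependent ℂ (fun ν : Fin N → ℕ => mono s ν) ∧
    Submodule.span ℂ (Set.range fun ν : Fin N → ℕ => mono s ν) = ⊤

open Classical in
/-- The linear operator on `𝒜` that takes the prescribed value `φ ν` on each ordered monomial
`x^ν`.  It exists and is unique as soon as the monomials form a basis of `𝒜`. -/
def monoOp (s : ℂ) {N : ℕ} (φ : (Fin N → ℕ) → Space s N) : Module.End ℂ (Space s N) :=
  if h : ∃ T : Module.End ℂ (Space s N), ∀ ν, T (mono s ν) = φ ν then h.choose else 0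

theorem monoOp_mono {s : ℂ} {N : ℕ} (hb : MonomialsFormBasis s N)
    (φ : (Fin N → ℕ) → Space s N) (ν : Fin N → ℕ) : monoOp s φ (mono s ν) = φ ν := by
  have h : ∃ T : Module.End ℂ (Space s N), ∀ ν, T (mono s ν) = φ ν := by
    let b := Module.Basis.mk hb.1 hb.2.ge
    refine ⟨b.constr ℂ φ, fun ν => ?_⟩
    have := b.constr_basis ℂ φ ν
    rwa [Module.Basis.mk_apply] at this
  unfold monoOp
  rw [dif_pos h]
  exact h.choose_spec ν

/-! ### The differential operators, the squared radius and the Laplace operator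

In the formulas below the subtraction of exponents is truncated; whenever it truncates, the
scalar in front of the monomial vanishes. -/

/-- The partial derivative `∂_i`, for `k ≤ n`, `k'` and (for `N = 2n + 1`) `n + 1`:
* `∂_k x^ν = [ν_k]_q q^(ν_{k+1} + ⋯ + ν_{1'}) x^(ν - ε_k)`;
* `∂_{n+1} x^ν = [ν_{n+1}] q^(ν_{n'} + ⋯ + ν_{1'}) x^(ν - ε_{n+1})`;
* `∂_{k'} x^ν = [ν_{k'}]_q q^(ν_k + ν_{(k-1)'} + ⋯ + ν_{1'}) x^(ν - ε_{k'})
  + ∑_{k < j ≤ n} [ν_j]_q [ν_{j'}]_q (q - q⁻¹) q^(ρ_k - ρ_j) q^(d_{kj}) x^(ν + ε_k - ε_j - ε_{j'})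
  + [ν_{n+1} - 1] [ν_{n+1}] ((q - q⁻¹) / (1 + q)) q^(ρ_k + 2) q^(e_k) x^(ν + ε_k - 2 ε_{n+1})`,
  the last term being present for `N = 2n + 1` only, where
  `d_{kj} = ν_k + ⋯ + ν_{j-1} + ν_{(j-1)'} + ⋯ + ν_{1'}` and
  `e_k = ν_k + ⋯ + ν_{1'} - 2 ν_{n+1}`. -/
def partialD (s : ℂ) {N : ℕ} (i : Fin N) : Module.End ℂ (Space s N) :=
  monoOp s fun ν =>
    if i < i.rev then
      (qNum s (ν i) * (s ^ 2) ^ (∑ j ∈ Finset.Ioi i, (ν j : ℤ))) • mono s (ν - Pi.single i 1)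
    else if i = i.rev then
      (qNumOne s (ν i) * (s ^ 2) ^ (∑ j ∈ Finset.Ioi i, (ν j : ℤ))) • mono s (ν - Pi.single i 1)
    else
      let k := i.rev
      (qNum s (ν i) * (s ^ 2) ^ ((ν k : ℤ) + ∑ j ∈ Finset.Ioi i, (ν j : ℤ))) •
          mono s (ν - Pi.single i 1) +
        (∑ j ∈ Finset.univ.filter (fun j : Fin N => k < j ∧ j < j.rev),
          (qNum s (ν j) * qNum s (ν j.rev) * (s ^ 2 - (s ^ 2)⁻¹) *
              s ^ (twoRho k - twoRho j) *
              (s ^ 2) ^ ((∑ l ∈ Finset.Ico k j, (ν l : ℤ)) + ∑ l ∈ Finset.Ioi j.rev, (ν l : ℤ))) •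
            mono s (ν + Pi.single k 1 - Pi.single j 1 - Pi.single j.rev 1)) +
        ∑ m ∈ Finset.univ.filter (fun m : Fin N => m = m.rev),
          (qNumOne s ((ν m : ℤ) - 1) * qNumOne s (ν m) * ((s ^ 2 - (s ^ 2)⁻¹) / (1 + s ^ 2)) *
              s ^ (twoRho k + 4) *
              (s ^ 2) ^ ((∑ l ∈ Finset.Ici k, (ν l : ℤ)) - 2 * ν m)) •
            mono s (ν + Pi.single k 1 - Pi.single m 2)

/-- The operator `x̂_i` of left multiplication by `x_i`. -/
def xHat (s : ℂ) {N : ℕ} (i : Fin N) : Module.End ℂ (Space s N) := LinearMap.mulLeft ℂ (x s i)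

/-- `Q̂ = ∑ q^ρ_{i'} x̂_i x̂_{i'}`. -/
def QHat (s : ℂ) (N : ℕ) : Module.End ℂ (Space s N) :=
  ∑ i : Fin N, s ^ twoRho i.rev • (xHat s i * xHat s i.rev)

/-- The `q`-Laplace operator `Δ_q = ∑ q^ρ_i ∂_i ∂_{i'}`. -/
def laplace (s : ℂ) (N : ℕ) : Module.End ℂ (Space s N) :=
  ∑ i : Fin N, s ^ twoRho i • (partialD s i * partialD s i.rev)

/-- The operator `q ^ (c γ)`, where `γ x^ν = (ν_1 + ⋯ + ν_N) x^ν`. -/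
def qPowGamma (s : ℂ) (N : ℕ) (c : ℤ) : Module.End ℂ (Space s N) :=
  monoOp s fun ν => (s ^ 2) ^ (c * ∑ i, (ν i : ℤ)) • mono s ν

/-- The space `ℋ_m` of homogeneous `q`-harmonic polynomials of degree `m`. -/
def harmonicSpace (s : ℂ) (N m : ℕ) : Submodule ℂ (Space s N) :=
  homog s N m ⊓ LinearMap.ker (laplace s N)

/-! ### The quantum algebra `U_q(sl_2)` and its discrete series -/

/-- Generators of `U_q(sl_2)`. -/
inductive Sl2Gen
  | e | f | k | kinv

/-- Defining relations of `U_q(sl_2)`. -/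
inductive Sl2Rel (s : ℂ) : FreeAlgebra ℂ Sl2Gen → FreeAlgebra ℂ Sl2Gen → Prop
  | k_kinv : Sl2Rel s (FreeAlgebra.ι ℂ .k * FreeAlgebra.ι ℂ .kinv) 1
  | kinv_k : Sl2Rel s (FreeAlgebra.ι ℂ .kinv * FreeAlgebra.ι ℂ .k) 1
  | k_e : Sl2Rel s (FreeAlgebra.ι ℂ .k * FreeAlgebra.ι ℂ .e)
      ((s ^ 2) ^ 2 • (FreeAlgebra.ι ℂ .e * FreeAlgebra.ι ℂ .k))
  | k_f : Sl2Rel s (FreeAlgebra.ι ℂ .k * FreeAlgebra.ι ℂ .f)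
      ((s ^ 2) ^ (-2 : ℤ) • (FreeAlgebra.ι ℂ .f * FreeAlgebra.ι ℂ .k))
  | e_f : Sl2Rel s
      (FreeAlgebra.ι ℂ .e * FreeAlgebra.ι ℂ .f - FreeAlgebra.ι ℂ .f * FreeAlgebra.ι ℂ .e)
      ((s ^ 2 - (s ^ 2)⁻¹)⁻¹ • (FreeAlgebra.ι ℂ .k - FreeAlgebra.ι ℂ .kinv))

/-- The quantum algebra `U_q(sl_2)`. -/
abbrev Usl2 (s : ℂ) : Type := RingQuot (Sl2Rel s)

/-- The generators of `U_q(sl_2)`. -/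
def sl2 (s : ℂ) (g : Sl2Gen) : Usl2 s := RingQuot.mkAlgHom ℂ (Sl2Rel s) (FreeAlgebra.ι ℂ g)

/-- The operators of the discrete series representation with lowest weight `l = L / 2`, on the space
with basis `|r⟩`, `r = 0, 1, 2, …`: `k |r⟩ = q ^ (2 r + l) |r⟩`, `e |r⟩ = [r + l]_q |r + 1⟩`,
`f |r⟩ = - [r]_q |r - 1⟩`. -/
def discreteGen (s : ℂ) (L : ℕ) : Sl2Gen → Module.End ℂ (ℕ →₀ ℂ)
  | .e => Finsupp.lsum ℂ fun r => qNumHalf s (2 * r + L) • Finsupp.lsingle (r + 1)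
  | .f => Finsupp.lsum ℂ fun r => (-qNum s r) • Finsupp.lsingle (r - 1)
  | .k => Finsupp.lsum ℂ fun r => s ^ (4 * r + L : ℤ) • Finsupp.lsingle r
  | .kinv => Finsupp.lsum ℂ fun r => s ^ (-(4 * r + L : ℤ)) • Finsupp.lsingle r

theorem discreteGen_rel {s : ℂ} (hs : s ≠ 0) (L : ℕ) ⦃a b : FreeAlgebra ℂ Sl2Gen⦄
    (h : Sl2Rel s a b) :
    FreeAlgebra.lift ℂ (discreteGen s L) a = FreeAlgebra.lift ℂ (discreteGen s L) b := by
  have hE (r : ℕ) (c : ℂ) : discreteGen s L .e (Finsupp.single r c) =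
      Finsupp.single (r + 1) (qNumHalf s (2 * r + L) * c) := by simp [discreteGen]
  have hF (r : ℕ) (c : ℂ) : discreteGen s L .f (Finsupp.single r c) =
      Finsupp.single (r - 1) (-qNum s r * c) := by simp [discreteGen]
  have hK (r : ℕ) (c : ℂ) : discreteGen s L .k (Finsupp.single r c) =
      Finsupp.single r (s ^ (4 * r + L : ℤ) * c) := by simp [discreteGen]
  have hK' (r : ℕ) (c : ℂ) : discreteGen s L .kinv (Finsupp.single r c) =
      Finsupp.single r (s ^ (-(4 * r + L : ℤ)) * c) := by simp [discreteGen]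
  cases h <;> refine Finsupp.lhom_ext fun r c => ?_
  case k_kinv =>
    simp only [map_mul, FreeAlgebra.lift_ι_apply, Module.End.mul_apply, hK, hK', map_one,
      Module.End.one_apply, ← mul_assoc, ← zpow_add₀ hs]
    simp
  case kinv_k =>
    simp only [map_mul, FreeAlgebra.lift_ι_apply, Module.End.mul_apply, hK, hK', map_one,
      Module.End.one_apply, ← mul_assoc, ← zpow_add₀ hs]
    simp
  case k_e =>
    simp only [map_mul, map_smul, FreeAlgebra.lift_ι_apply, Module.End.mul_apply, hK, hE,
      LinearMap.smul_apply, Finsupp.smul_single, smul_eq_mul]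
    have : s ^ (4 * ((r + 1 : ℕ) : ℤ) + L) = (s ^ 2) ^ 2 * s ^ (4 * r + L : ℤ) := by
      rw [← pow_mul, ← zpow_natCast, ← zpow_add₀ hs]; congr 1; push_cast; ring
    rw [this]; congr 1; ring
  case k_f =>
    simp only [map_mul, map_smul, FreeAlgebra.lift_ι_apply, Module.End.mul_apply, hK, hF,
      LinearMap.smul_apply, Finsupp.smul_single, smul_eq_mul]
    rcases r with _ | r
    · simp [qNum]
    · have : s ^ (4 * ((r + 1 - 1 : ℕ) : ℤ) + L) =
          (s ^ 2) ^ (-2 : ℤ) * s ^ (4 * ((r + 1 : ℕ) : ℤ) + L : ℤ) := by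
        rw [← zpow_natCast s 2, ← zpow_mul, ← zpow_add₀ hs]; congr 1; push_cast; ring
      rw [this]; congr 1; ring
  case e_f =>
    simp only [map_mul, map_sub, map_smul, FreeAlgebra.lift_ι_apply, Module.End.mul_apply, hK, hK',
      hF, hE, LinearMap.smul_apply, LinearMap.sub_apply, Finsupp.smul_single, smul_eq_mul,
      ← Finsupp.single_sub]
    have key : qNumHalf s (2 * r + L) * qNum s (r + 1) - qNumHalf s (2 * r - 2 + L) * qNum s r =
        (s ^ 2 - (s ^ 2)⁻¹)⁻¹ * (s ^ (4 * r + L : ℤ) - s ^ (-(4 * r + L : ℤ))) := by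
      by_cases hd : s ^ 2 - (s ^ 2)⁻¹ = 0
      · simp [qNum, qNumHalf, hd]
      have h2 (a : ℤ) : (s ^ 2) ^ a = s ^ a * s ^ a := by
        rw [← zpow_natCast, ← zpow_mul, ← zpow_add₀ hs]; congr 1; push_cast; ring
      have hsub : (s ^ (2 * r + L : ℤ) - s ^ (-(2 * r + L : ℤ))) *
            (s ^ (2 * (r : ℤ) + 2) - s ^ (-(2 * (r : ℤ) + 2))) -
          (s ^ (2 * r - 2 + L : ℤ) - s ^ (-(2 * r - 2 + L : ℤ))) *
            (s ^ (2 * (r : ℤ)) - s ^ (-(2 * (r : ℤ)))) =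
          (s ^ 2 - (s ^ 2)⁻¹) * (s ^ (4 * r + L : ℤ) - s ^ (-(4 * r + L : ℤ))) := by
        have e1 : s ^ 2 = s ^ (2 : ℤ) := by norm_cast
        rw [e1, ← zpow_neg]
        simp only [sub_mul, mul_sub, ← zpow_add₀ hs]
        ring_nf
      have h3 (a : ℤ) : (s ^ 2) ^ a = s ^ (2 * a) := by
        rw [h2, ← zpow_add₀ hs]; congr 1; ring
      unfold qNum qNumHalf
      rw [h3, h3, h3, h3]
      rw [show 2 * ((r : ℤ) + 1) = 2 * r + 2 by ring,
        show 2 * -((r : ℤ) + 1) = -(2 * r + 2) by ring,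
        show 2 * -(r : ℤ) = -(2 * r) by ring]
      rw [div_mul_div_comm, div_mul_div_comm, ← sub_div, hsub, inv_mul_eq_div]
      exact mul_div_mul_left _ _ hd
    rcases r with _ | r
    · rw [show qNum s ((0 : ℕ) : ℤ) = 0 by simp [qNum]] at key ⊢
      simp only [Nat.zero_sub, neg_zero, zero_mul, mul_zero, Finsupp.single_zero, zero_sub,
        sub_zero, zero_add, Nat.sub_self, ← Finsupp.single_neg] at key ⊢
      congr 1
      have := congrArg (· * c) key
      beta_reduce at this
      push_cast at this ⊢
      simp only [zero_add] at this ⊢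
      linear_combination this
    · simp only [Nat.add_sub_cancel, ← Finsupp.single_sub]
      congr 1
      have := congrArg (· * c) key
      beta_reduce at this
      push_cast at this ⊢
      rw [show 2 * ((r : ℤ) + 1) - 2 + L = 2 * r + L by ring] at this
      linear_combination this

/-- The representation `D_{L/2}` of `U_q(sl_2)` of the discrete series with lowest weight `L / 2`. -/
def discreteSeries {s : ℂ} (hs : s ≠ 0) (L : ℕ) : Usl2 s →ₐ[ℂ] Module.End ℂ (ℕ →₀ ℂ) :=
  RingQuot.liftAlgHom ℂ ⟨FreeAlgebra.lift ℂ (discreteGen s L), discreteGen_rel hs L⟩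

/-! ### The quantum algebra `U_q(so_N)` -/

/-- The simple roots of `so_N` in orthogonal coordinates: `α_i = ε_i - ε_{i+1}` for `i < n`, and
`α_n = ε_n` for `N = 2n + 1`, `α_n = ε_{n-1} + ε_n` for `N = 2n`. -/
def simpleRoot {N : ℕ} (i : Fin (N / 2)) : Fin (N / 2) → ℤ :=
  if h : (i : ℕ) + 1 < N / 2 then Pi.single i 1 - Pi.single ⟨(i : ℕ) + 1, h⟩ 1
  else if N % 2 = 1 then Pi.single i 1
  else Pi.single ⟨(i : ℕ) - 1, by omega⟩ 1 + Pi.single i 1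

/-- The standard scalar product of weights, for which `(ε_i, ε_j) = δ_{ij}`. -/
def wtDot {n : ℕ} (a b : Fin n → ℤ) : ℤ := ∑ i, a i * b i

/-- Generators `E_i`, `F_i`, `K_i`, `K_i⁻¹` of `U_q(so_N)`. -/
inductive SoGen (n : ℕ)
  | E (i : Fin n) | F (i : Fin n) | K (i : Fin n) | Kinv (i : Fin n)

/-- The free generators. -/
abbrev fg {n : ℕ} (g : SoGen n) : FreeAlgebra ℂ (SoGen n) := FreeAlgebra.ι ℂ g

/-- Defining relations of `U_q(so_N)`.  With `a_{ij} = 2 (α_i, α_j) / (α_i, α_i)` and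
`q_i = q ^ ((α_i, α_i) / 2)`, the three `q`-Serre relations for `E` (and for `F`) are the cases
`a_{ij} = 0, -1, -2` of `∑ (-1)^r [1 - a_{ij}; r]_{q_i} E_i^(1 - a_{ij} - r) E_j E_i^r = 0`. -/
inductive SoRel (s : ℂ) (N : ℕ) :
    FreeAlgebra ℂ (SoGen (N / 2)) → FreeAlgebra ℂ (SoGen (N / 2)) → Prop
  | K_Kinv (i) : SoRel s N (fg (.K i) * fg (.Kinv i)) 1
  | Kinv_K (i) : SoRel s N (fg (.Kinv i) * fg (.K i)) 1
  | K_K (i j) : SoRel s N (fg (.K i) * fg (.K j)) (fg (.K j) * fg (.K i))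
  | K_E (i j) : SoRel s N (fg (.K i) * fg (.E j))
      ((s ^ 2) ^ wtDot (simpleRoot i) (simpleRoot j) • (fg (.E j) * fg (.K i)))
  | K_F (i j) : SoRel s N (fg (.K i) * fg (.F j))
      ((s ^ 2) ^ (-wtDot (simpleRoot i) (simpleRoot j)) • (fg (.F j) * fg (.K i)))
  | E_F (i) : SoRel s N (fg (.E i) * fg (.F i) - fg (.F i) * fg (.E i))
      ((s ^ 2 - (s ^ 2)⁻¹)⁻¹ • (fg (.K i) - fg (.Kinv i)))
  | E_F_ne (i j) (h : i ≠ j) : SoRel s N (fg (.E i) * fg (.F j)) (fg (.F j) * fg (.E i))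
  | serreE_zero (i j) (h : wtDot (simpleRoot i) (simpleRoot j) = 0) :
      SoRel s N (fg (.E i) * fg (.E j)) (fg (.E j) * fg (.E i))
  | serreE_one (i j)
      (h : 2 * wtDot (simpleRoot i) (simpleRoot j) = -wtDot (simpleRoot i) (simpleRoot i))
      (t : ℂ) (ht : t = s ^ wtDot (simpleRoot i) (simpleRoot i)) :
      SoRel s N (fg (.E i) ^ 2 * fg (.E j) - (t + t⁻¹) • (fg (.E i) * fg (.E j) * fg (.E i)) +
        fg (.E j) * fg (.E i) ^ 2) 0
  | serreE_two (i j)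
      (h : wtDot (simpleRoot i) (simpleRoot j) = -wtDot (simpleRoot i) (simpleRoot i))
      (t : ℂ) (ht : t = s ^ wtDot (simpleRoot i) (simpleRoot i)) :
      SoRel s N (fg (.E i) ^ 3 * fg (.E j)
        - (t ^ 2 + 1 + (t ^ 2)⁻¹) • (fg (.E i) ^ 2 * fg (.E j) * fg (.E i))
        + (t ^ 2 + 1 + (t ^ 2)⁻¹) • (fg (.E i) * fg (.E j) * fg (.E i) ^ 2)
        - fg (.E j) * fg (.E i) ^ 3) 0
  | serreF_zero (i j) (h : wtDot (simpleRoot i) (simpleRoot j) = 0) :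
      SoRel s N (fg (.F i) * fg (.F j)) (fg (.F j) * fg (.F i))
  | serreF_one (i j)
      (h : 2 * wtDot (simpleRoot i) (simpleRoot j) = -wtDot (simpleRoot i) (simpleRoot i))
      (t : ℂ) (ht : t = s ^ wtDot (simpleRoot i) (simpleRoot i)) :
      SoRel s N (fg (.F i) ^ 2 * fg (.F j) - (t + t⁻¹) • (fg (.F i) * fg (.F j) * fg (.F i)) +
        fg (.F j) * fg (.F i) ^ 2) 0
  | serreF_two (i j)
      (h : wtDot (simpleRoot i) (simpleRoot j) = -wtDot (simpleRoot i) (simpleRoot i))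
      (t : ℂ) (ht : t = s ^ wtDot (simpleRoot i) (simpleRoot i)) :
      SoRel s N (fg (.F i) ^ 3 * fg (.F j)
        - (t ^ 2 + 1 + (t ^ 2)⁻¹) • (fg (.F i) ^ 2 * fg (.F j) * fg (.F i))
        + (t ^ 2 + 1 + (t ^ 2)⁻¹) • (fg (.F i) * fg (.F j) * fg (.F i) ^ 2)
        - fg (.F j) * fg (.F i) ^ 3) 0

/-- The quantum algebra `U_q(so_N)`. -/
abbrev Uso (s : ℂ) (N : ℕ) : Type := RingQuot (SoRel s N)

/-- The generators of `U_q(so_N)`. -/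
def so (s : ℂ) (N : ℕ) (g : SoGen (N / 2)) : Uso s N := RingQuot.mkAlgHom ℂ (SoRel s N) (fg g)

/-! ### The natural action of `U_q(so_N)` on `𝒜` -/

/-- The weight `(ν_1 - ν_{1'}, …, ν_n - ν_{n'})` of the monomial `x^ν`. -/
def monoWt {N : ℕ} (ν : Fin N → ℕ) : Fin (N / 2) → ℤ := fun i =>
  let a : Fin N := ⟨i, by omega⟩
  (ν a : ℤ) - ν a.rev

/-- The operator `x^ν ↦ [ν_b]_q q^(ν_a - ν_b + 1) x^(ν + ε_a - ε_b)
- [ν_{a'}]_q q^(ν_a - ν_b - ν_{a'} + ν_{b'} + 1) x^(ν + ε_{b'} - ε_{a'})`. -/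
def raiseOp (s : ℂ) {N : ℕ} (a b : Fin N) : Module.End ℂ (Space s N) :=
  monoOp s fun ν =>
    (qNum s (ν b) * (s ^ 2) ^ ((ν a : ℤ) - ν b + 1)) • mono s (ν + Pi.single a 1 - Pi.single b 1) -
    (qNum s (ν a.rev) * (s ^ 2) ^ ((ν a : ℤ) - ν b - ν a.rev + ν b.rev + 1)) •
      mono s (ν + Pi.single b.rev 1 - Pi.single a.rev 1)

/-- The operator `x^ν ↦ [ν_a]_q q^(-ν_a + ν_b - ν_{b'} + ν_{a'} + 1) x^(ν - ε_a + ε_b)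
- [ν_{b'}]_q q^(-ν_{b'} + ν_{a'} + 1) x^(ν - ε_{b'} + ε_{a'})`. -/
def lowerOp (s : ℂ) {N : ℕ} (a b : Fin N) : Module.End ℂ (Space s N) :=
  monoOp s fun ν =>
    (qNum s (ν a) * (s ^ 2) ^ (-(ν a : ℤ) + ν b - ν b.rev + ν a.rev + 1)) •
      mono s (ν - Pi.single a 1 + Pi.single b 1) -
    (qNum s (ν b.rev) * (s ^ 2) ^ (-(ν b.rev : ℤ) + ν a.rev + 1)) •
      mono s (ν - Pi.single b.rev 1 + Pi.single a.rev 1)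

/-- The operator `E_n` for `N = 2n + 1`, with `a = n` and `c = n + 1`:
`x^ν ↦ [ν_{n+1}] q^(ν_n - ν_{n+1} + 3/2) x^(ν + ε_n - ε_{n+1})
- [ν_{n+2}]_q q^(ν_n - ν_{n+2} + 1) x^(ν + ε_{n+1} - ε_{n+2})`. -/
def raiseOdd (s : ℂ) {N : ℕ} (a c : Fin N) : Module.End ℂ (Space s N) :=
  monoOp s fun ν =>
    (qNumOne s (ν c) * s ^ (2 * ((ν a : ℤ) - ν c) + 3)) •
      mono s (ν + Pi.single a 1 - Pi.single c 1) -
    (qNum s (ν a.rev) * (s ^ 2) ^ ((ν a : ℤ) - ν a.rev + 1)) •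
      mono s (ν + Pi.single c 1 - Pi.single a.rev 1)

/-- The operator `F_n` for `N = 2n + 1`, with `a = n` and `c = n + 1`:
`x^ν ↦ [ν_n]_q q^(-ν_n + ν_{n+2} + 1/2) x^(ν - ε_n + ε_{n+1})
- [ν_{n+1}] q^(-ν_{n+1} + ν_{n+2} + 1) x^(ν - ε_{n+1} + ε_{n+2})`. -/
def lowerOdd (s : ℂ) {N : ℕ} (a c : Fin N) : Module.End ℂ (Space s N) :=
  monoOp s fun ν =>
    (qNum s (ν a) * s ^ (2 * (-(ν a : ℤ) + ν a.rev) + 1)) •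
      mono s (ν - Pi.single a 1 + Pi.single c 1) -
    (qNumOne s (ν c) * (s ^ 2) ^ (-(ν c : ℤ) + ν a.rev + 1)) •
      mono s (ν - Pi.single c 1 + Pi.single a.rev 1)

/-- The operators by which the generators of `U_q(so_N)` act on `𝒜`.  For `i < n` the operators
`E_i`, `F_i` are `raiseOp`, `lowerOp` at `(a, b) = (i, i + 1)`; for `N = 2n` the operators `E_n`,
`F_n` are `raiseOp`, `lowerOp` at `(a, b) = (n - 1, n + 1)`, where `(n + 1)' = n`. -/
def soOp (s : ℂ) (N : ℕ) : SoGen (N / 2) → Module.End ℂ (Space s N)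
  | .E i =>
      if (i : ℕ) + 1 < N / 2 then raiseOp s ⟨i, by omega⟩ ⟨(i : ℕ) + 1, by omega⟩
      else if N % 2 = 1 then raiseOdd s ⟨i, by omega⟩ ⟨(i : ℕ) + 1, by omega⟩
      else raiseOp s ⟨(i : ℕ) - 1, by omega⟩ ⟨(i : ℕ) + 1, by omega⟩
  | .F i =>
      if (i : ℕ) + 1 < N / 2 then lowerOp s ⟨i, by omega⟩ ⟨(i : ℕ) + 1, by omega⟩
      else if N % 2 = 1 then lowerOdd s ⟨i, by omega⟩ ⟨(i : ℕ) + 1, by omega⟩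
      else lowerOp s ⟨(i : ℕ) - 1, by omega⟩ ⟨(i : ℕ) + 1, by omega⟩
  | .K i => monoOp s fun ν => (s ^ 2) ^ wtDot (simpleRoot i) (monoWt ν) • mono s ν
  | .Kinv i => monoOp s fun ν => (s ^ 2) ^ (-wtDot (simpleRoot i) (monoWt ν)) • mono s ν

/-! ### Representations -/

section Rep

variable {U U' V W : Type*} [Ring U] [Algebra ℂ U] [Ring U'] [Algebra ℂ U']
  [AddCommMonoid V] [Module ℂ V] [AddCommMonoid W] [Module ℂ W]

/-- Irreducibility of a representation of an algebra. -/
def IsIrred (ρ : U →ₐ[ℂ] Module.End ℂ V) : Prop :=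
  Nontrivial V ∧ ∀ S : Submodule ℂ V, (∀ u : U, ∀ v ∈ S, ρ u v ∈ S) → S = ⊥ ∨ S = ⊤

/-- Equivalence of two representations of an algebra. -/
def RepEquiv (ρ : U →ₐ[ℂ] Module.End ℂ V) (σ : U →ₐ[ℂ] Module.End ℂ W) : Prop :=
  ∃ Φ : V ≃ₗ[ℂ] W, ∀ (u : U) (v : V), Φ (ρ u v) = σ u (Φ v)

/-- The representation `ρ × σ` of `U ⊗ U'` on `V ⊗ W`. -/
def outerTensor (ρ : U →ₐ[ℂ] Module.End ℂ V) (σ : U' →ₐ[ℂ] Module.End ℂ W) :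
    U ⊗[ℂ] U' →ₐ[ℂ] Module.End ℂ (V ⊗[ℂ] W) :=
  (Module.endTensorEndAlgHom (R := ℂ) (S := ℂ) (A := ℂ)).comp (Algebra.TensorProduct.map ρ σ)

end Rep

/-- The representation `T` of `U_q(so_N)` is irreducible with highest weight `μ` (in orthogonal
coordinates). -/
def IsIrredHighestWeight {s : ℂ} {N : ℕ} {V : Type*} [AddCommMonoid V] [Module ℂ V]
    (T : Uso s N →ₐ[ℂ] Module.End ℂ V) (μ : Fin (N / 2) → ℤ) : Prop :=
  IsIrred T ∧ ∃ v : V, v ≠ 0 ∧ ∀ i,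
    T (so s N (.E i)) v = 0 ∧ T (so s N (.K i)) v = (s ^ 2) ^ wtDot (simpleRoot i) μ • v

end QEuclid

end

open scoped TensorProduct DirectSum
open QEuclid

/-!
# The dual pair `(U_q(sl_2), U_q(so_N))` on the quantum Euclidean space

Write `q = s ^ 2` and `i' = i.rev`.

**Reduction to scalar identities.** The free algebra acts on the space of Laurent monomials
(functions of finite support on `ℤ ^ N`), where `x_i` acts by an explicit combination of *weighted
shifts* `shiftOp φ δ : x^ν ↦ φ ν x^(ν + δ)`, modelled on left multiplication by `x_i`.  The defining
relations of `𝒜` hold for these operators (`xOp_rel`), and applying an element of `𝒜` to the trivial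
monomial gives a linear map `toLaurent` that sends each ordered monomial to the Laurent monomial with
the same exponent.  So the ordered monomials are independent; they span because reordering a word
terminates (`wordProd_mem_span`).  Moreover `toLaurent` is injective, and every operator in question
extends to Laurent monomials along it (`Extends`), where boundary cases disappear and two weighted
shifts compose to a third one.  A relation between operators thus becomes a rational identity in the
powers of `q` with exponents `ν_i`.

**The relations.** Written in terms of the `x_i` and `∂_i`, both `Q` and `Δ_q` are complicated, but
both telescope (`sum_interval`): up to scalar factors they become sums `radSum` and `lapSum` over the
pairs `{j, j'}` of a single weighted shift by `± (ε_j + ε_{j'})`.  The pairs behave like the factors of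
a tensor product of representations of `U_q(sl_2)`, so the commutator of the two sums is computed by
induction over the pairs (`radSum_lapSum_commutator`).  A simple root operator of `U_q(so_N)` moves
exponents between two consecutive pairs, or between the innermost pair and the middle position, and
commutes with the sum of the two summands concerned (`raiseExt_radSum`, `raiseExt_lapSum` and their
short analogues); with the others it commutes trivially.  It is a difference of two weighted shifts
that `q`-commute with each other, and this reduces the `q`-Serre relations to those for single shifts
(`serreOne_add`) or to the vanishing of an iterated `q`-commutator (`serreTwo_of_qcomm`).

**The decomposition.** For a harmonic `h` of degree `m` the vectors `Q ^ r h` span a copy of the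
discrete series, which gives an intertwining map `⨁ D_{m + N/2} ⊗ ℋ_m → 𝒜`.  It is surjective by
induction on the degree: `f` maps the part of the image of degree `d + 2` onto the part of degree `d`,
so subtracting an element of the image makes any polynomial harmonic (`homog_le_ladderSpan`).  It is
injective since `f` is locally nilpotent: a nonzero kernel would contain a nonzero vector killed by
`f`, but such vectors have the form `∑ |0⟩ ⊗ h_m` (`ladderSumMap_injective`).

**Irreducibility.** A nonzero subspace of `ℋ_m` that is stable under the raising operators contains a
*primitive* vector, one killed by all of them.  For such a vector the equations `E_i a = 0` are
recurrences that carry a nonvanishing coefficient outwards (`raiseExt_replace`), so it is determined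
by its coefficients at the monomials in `x_1` and `x_N` alone.  The vectors `Q ^ b x_1 ^ k` are
primitive and realize every possibility, so a harmonic primitive vector of degree `m` is a multiple of
`x_1 ^ m` (`exists_eq_smul_topMono`).  Hence every nonzero invariant subspace of `ℋ_m` contains
`x_1 ^ m`.  There is a bilinear form on `𝒜` with orthogonal monomials for which `E_i` is adjoint to a
multiple of `F_i K_i` (`form_E`).  The orthogonal complement in `ℋ_m` of an invariant subspace is
stable under the `E_i` and does not contain the non-isotropic vector `x_1 ^ m`, so it vanishes, and
the subspace is all of `ℋ_m` (`eq_harmonicSpace_of_invariant`).  For `D_l` and `D_l ⊗ T_m` the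
lowest weight vectors are used in the same way as a source of vectors in a given submodule.
Comparison of highest and of lowest weights gives the inequivalences.
-/

noncomputable section

namespace QEuclid

/-! ### Weighted shift operators on Laurent monomials -/

/-- Exponents of Laurent monomials in `N` variables. -/
abbrev Lat (N : ℕ) : Type := Fin N → ℤ

/-- The space with basis the Laurent monomials.  The ordered monomials of `𝒜` are identified with
the basis vectors whose exponents are nonnegative. -/
abbrev LaurentSpace (N : ℕ) : Type := Lat N →₀ ℂ

/-- The power `q ^ a` of `q = s ^ 2`. -/
def qp (s : ℂ) (a : ℤ) : ℂ := (s ^ 2) ^ a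

/-- The linear form `ν ↦ ∑ c_l ν_l` on exponents. -/
def lin {N : ℕ} (c : Fin N → ℤ) (ν : Lat N) : ℤ := ∑ l, c l * ν l

/-- The weighted shift `ν ↦ φ(ν) (ν + δ)` of Laurent monomials. -/
def shiftOp {N : ℕ} (φ : Lat N → ℂ) (δ : Lat N) : Module.End ℂ (LaurentSpace N) :=
  Finsupp.lsum ℂ fun ν => φ ν • Finsupp.lsingle (ν + δ)

section basic

variable {s : ℂ} {N : ℕ}

theorem qp_ne (hs : s ≠ 0) (a : ℤ) : qp s a ≠ 0 := zpow_ne_zero _ (pow_ne_zero _ hs)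

theorem qp_add (hs : s ≠ 0) (a b : ℤ) : qp s (a + b) = qp s a * qp s b :=
  zpow_add₀ (pow_ne_zero _ hs) a b

theorem qp_sub (hs : s ≠ 0) (a b : ℤ) : qp s (a - b) = qp s a * (qp s b)⁻¹ := by
  rw [← div_eq_mul_inv]; exact zpow_sub₀ (pow_ne_zero _ hs) a b

theorem qp_neg (a : ℤ) : qp s (-a) = (qp s a)⁻¹ := zpow_neg _ _

theorem qp_two_mul (hs : s ≠ 0) (a : ℤ) : qp s (2 * a) = qp s a * qp s a := by
  rw [two_mul, qp_add hs]

theorem qp_zero : qp s 0 = 1 := zpow_zero _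

theorem qp_one : qp s 1 = s ^ 2 := zpow_one _

theorem qp_two : qp s 2 = s ^ 4 := by
  rw [qp, show (2 : ℤ) = ((2 : ℕ) : ℤ) from rfl, zpow_natCast, ← pow_mul]

theorem zpow_eq_qp (a : ℤ) : (s ^ 2) ^ a = qp s a := rfl

theorem zpow_two_mul_eq_qp (a : ℤ) : s ^ (2 * a) = qp s a := by
  rw [qp, zpow_mul]; norm_cast

theorem qNum_eq (a : ℤ) : qNum s a = (qp s a - (qp s a)⁻¹) / (s ^ 2 - (s ^ 2)⁻¹) := by
  rw [qNum, zpow_neg]; rfl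

theorem qNumOne_eq (a : ℤ) : qNumOne s a = (1 - qp s a) / (1 - s ^ 2) := rfl

theorem lin_add (c : Fin N → ℤ) (ν μ : Lat N) : lin c (ν + μ) = lin c ν + lin c μ := by
  simp [lin, mul_add, Finset.sum_add_distrib]

theorem lin_neg (c : Fin N → ℤ) (ν : Lat N) : lin c (-ν) = -lin c ν := by
  simp [lin]

theorem lin_sub (c : Fin N → ℤ) (ν μ : Lat N) : lin c (ν - μ) = lin c ν - lin c μ := by
  simp [lin, mul_sub, Finset.sum_sub_distrib]

theorem lin_single (c : Fin N → ℤ) (a : Fin N) (t : ℤ) : lin c (Pi.single a t) = c a * t := by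
  simp [lin, Pi.single_apply]

@[simp] theorem shiftOp_single (φ : Lat N → ℂ) (δ ν : Lat N) (c : ℂ) :
    shiftOp φ δ (Finsupp.single ν c) = Finsupp.single (ν + δ) (φ ν * c) := by
  simp [shiftOp]

theorem shiftOp_mul (φ ψ : Lat N → ℂ) (δ ε : Lat N) :
    shiftOp φ δ * shiftOp ψ ε = shiftOp (fun ν => φ (ν + ε) * ψ ν) (ε + δ) := by
  refine Finsupp.lhom_ext fun ν c => ?_
  simp only [Module.End.mul_apply, shiftOp_single, mul_assoc, add_assoc]

theorem shiftOp_add (φ ψ : Lat N → ℂ) (δ : Lat N) :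
    shiftOp φ δ + shiftOp ψ δ = shiftOp (fun ν => φ ν + ψ ν) δ := by
  refine Finsupp.lhom_ext fun ν c => ?_
  simp [add_mul]

theorem shiftOp_sub (φ ψ : Lat N → ℂ) (δ : Lat N) :
    shiftOp φ δ - shiftOp ψ δ = shiftOp (fun ν => φ ν - ψ ν) δ := by
  refine Finsupp.lhom_ext fun ν c => ?_
  simp [sub_mul]

theorem shiftOp_smul (t : ℂ) (φ : Lat N → ℂ) (δ : Lat N) :
    t • shiftOp φ δ = shiftOp (fun ν => t * φ ν) δ := by
  refine Finsupp.lhom_ext fun ν c => ?_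
  simp only [LinearMap.smul_apply, shiftOp_single, Finsupp.smul_single, smul_eq_mul, mul_assoc]

theorem shiftOp_neg (φ : Lat N → ℂ) (δ : Lat N) :
    -shiftOp φ δ = shiftOp (fun ν => -φ ν) δ := by
  refine Finsupp.lhom_ext fun ν c => ?_
  simp

theorem shiftOp_congr {φ ψ : Lat N → ℂ} {δ ε : Lat N} (hδ : δ = ε) (h : ∀ ν, φ ν = ψ ν) :
    shiftOp φ δ = shiftOp ψ ε := by
  rw [hδ, funext h]

theorem shiftOp_eq_zero {φ : Lat N → ℂ} {δ : Lat N} (h : ∀ ν, φ ν = 0) : shiftOp φ δ = 0 := by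
  refine Finsupp.lhom_ext fun ν c => ?_
  simp [h]

/-- Two weighted shifts commute up to the factor `t` when their weights do. -/
theorem shiftOp_comm {φ ψ : Lat N → ℂ} {δ ε : Lat N} (t : ℂ)
    (h : ∀ ν, φ (ν + ε) * ψ ν = t * (ψ (ν + δ) * φ ν)) :
    shiftOp φ δ * shiftOp ψ ε = t • (shiftOp ψ ε * shiftOp φ δ) := by
  rw [shiftOp_mul, shiftOp_mul, shiftOp_smul]
  exact shiftOp_congr (add_comm _ _) h

theorem shiftOp_commute {φ ψ : Lat N → ℂ} {δ ε : Lat N}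
    (h : ∀ ν, φ (ν + ε) * ψ ν = ψ (ν + δ) * φ ν) :
    Commute (shiftOp φ δ) (shiftOp ψ ε) := by
  rw [Commute, SemiconjBy, shiftOp_mul, shiftOp_mul]
  exact shiftOp_congr (add_comm _ _) h

/-- The sum of the exponents to the left of position `k`. -/
def leftSum {N : ℕ} (k : ℕ) (ν : Lat N) : ℤ := lin (fun l => if (l : ℕ) < k then 1 else 0) ν

/-- The sum of the exponents strictly between the positions `k` and `k'`. -/
def innerSum {N : ℕ} (k : ℕ) (ν : Lat N) : ℤ :=
  lin (fun l => if k < (l : ℕ) ∧ k < (l.rev : ℕ) then 1 else 0) ν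

/-- The sum of the exponents at the positions `l` for which `l` or `l'` lies to the left of `k`. -/
def outerSum {N : ℕ} (k : ℕ) (ν : Lat N) : ℤ :=
  lin (fun l => if (l : ℕ) < k ∨ (l.rev : ℕ) < k then 1 else 0) ν

/-- The degree of a Laurent monomial. -/
def totalDeg {N : ℕ} (ν : Lat N) : ℤ := lin (fun _ => 1) ν

end basic

/-! ### The quantum Euclidean space acting on Laurent monomials -/

/-- The summand of the squared radius that raises the exponents at `j` and `j'`. -/
def radTerm (s : ℂ) {N : ℕ} (j : Fin N) : Module.End ℂ (LaurentSpace N) :=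
  shiftOp (fun ν => qp s (j : ℕ) * (if j = j.rev then (s + s⁻¹)⁻¹ else 1) *
    (qp s (innerSum j ν))⁻¹) (Pi.single j 1 + Pi.single j.rev 1)

/-- The pairs `{j, j'}` inside `[k, k']`, each represented by its left member. -/
def pairsFrom (N k : ℕ) : Finset (Fin N) :=
  Finset.univ.filter fun j => k ≤ (j : ℕ) ∧ (j : ℕ) ≤ (j.rev : ℕ)

/-- The part of the squared radius that involves only the positions from `k` to `k'`, up to a
weight depending on the exponents at the positions left of `k`. -/
def radSum (s : ℂ) (N k : ℕ) : Module.End ℂ (LaurentSpace N) :=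
  ∑ j ∈ pairsFrom N k, radTerm s j

/-- The part of left multiplication by `x_i`, for `i` to the right of the centre, that moves `x_i`
to its place without interaction with `x_{i'}`. -/
def passOp (s : ℂ) {N : ℕ} (i : Fin N) : Module.End ℂ (LaurentSpace N) :=
  shiftOp (fun ν => (qp s (leftSum i ν))⁻¹ * qp s (ν i.rev)) (Pi.single i 1)

/-- The weighted lowering operator at `k` coming from the interaction of `x_{k'}` with `x_k`. -/
def contractOp (s : ℂ) {N : ℕ} (k : Fin N) : Module.End ℂ (LaurentSpace N) :=
  shiftOp (fun ν => (qp s (k : ℕ))⁻¹ * (qp s (leftSum k ν))⁻¹ * (1 - (qp s (2 * ν k))⁻¹))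
    (-Pi.single k 1)

/-- Left multiplication by `x_i` for `i` not to the right of the centre. -/
def leftMulOp (s : ℂ) {N : ℕ} (i : Fin N) : Module.End ℂ (LaurentSpace N) :=
  shiftOp (fun ν => (qp s (leftSum i ν))⁻¹) (Pi.single i 1)

/-- The operator by which `x_i` acts on Laurent monomials. -/
def xOp (s : ℂ) {N : ℕ} (i : Fin N) : Module.End ℂ (LaurentSpace N) :=
  if (i : ℕ) ≤ (i.rev : ℕ) then leftMulOp s i
  else passOp s i + contractOp s i.rev * radSum s N (i.rev + 1)

section

variable {s : ℂ} {N : ℕ}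

theorem mem_pairsFrom {k : ℕ} {j : Fin N} :
    j ∈ pairsFrom N k ↔ k ≤ (j : ℕ) ∧ (j : ℕ) ≤ (j.rev : ℕ) := by simp [pairsFrom]

theorem radSum_eq_add {k : Fin N} (hk : (k : ℕ) ≤ (k.rev : ℕ)) :
    radSum s N k = radTerm s k + radSum s N (k + 1) := by
  have : pairsFrom N k = insert k (pairsFrom N (k + 1)) := by
    ext j
    simp only [mem_pairsFrom, Finset.mem_insert, Fin.ext_iff]
    have := Fin.val_rev k; have := Fin.val_rev j
    omega
  rw [radSum, this, Finset.sum_insert (by simp [mem_pairsFrom]), radSum]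

theorem radSum_eq_zero {k : ℕ} (hk : N < 2 * k + 1) : radSum s N k = 0 := by
  rw [radSum, Finset.sum_eq_zero]
  intro j hj
  rw [mem_pairsFrom, Fin.val_rev] at hj
  omega

theorem commute_radSum {A : Module.End ℂ (LaurentSpace N)} {k : ℕ}
    (h : ∀ j : Fin N, k ≤ (j : ℕ) → (j : ℕ) ≤ (j.rev : ℕ) → Commute A (radTerm s j)) :
    Commute A (radSum s N k) :=
  Commute.sum_right _ _ _ fun j hj => h j (mem_pairsFrom.1 hj).1 (mem_pairsFrom.1 hj).2

theorem mul_radSum {A : Module.End ℂ (LaurentSpace N)} {k : ℕ} (t : ℂ)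
    (h : ∀ j : Fin N, k ≤ (j : ℕ) → (j : ℕ) ≤ (j.rev : ℕ) →
      A * radTerm s j = t • (radTerm s j * A)) :
    A * radSum s N k = t • (radSum s N k * A) := by
  rw [radSum, Finset.mul_sum, Finset.sum_mul, Finset.smul_sum]
  exact Finset.sum_congr rfl fun j hj => h j (mem_pairsFrom.1 hj).1 (mem_pairsFrom.1 hj).2

theorem leftMulOp_radTerm (hs : s ≠ 0) {i j : Fin N} (hi : (i : ℕ) ≤ (i.rev : ℕ))
    (hj : (j : ℕ) ≤ (j.rev : ℕ)) : Commute (leftMulOp s i) (radTerm s j) := by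
  have := Fin.val_rev i; have := Fin.val_rev j; have := Fin.rev_rev j; have := i.2
  refine shiftOp_commute fun ν => ?_
  simp only [leftSum, innerSum, lin_add, lin_single, mul_one]
  split_ifs <;> first
    | (exfalso; omega)
    | (simp only [qp_add hs, add_zero, mul_inv]; ring)

theorem passOp_radTerm_of_le (hs : s ≠ 0) {i j : Fin N} (hi : (i.rev : ℕ) < (i : ℕ))
    (hj : (j : ℕ) ≤ (i.rev : ℕ)) : Commute (passOp s i) (radTerm s j) := by
  have h1 := Fin.val_rev i; have h2 := Fin.val_rev j; have h3 := i.2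
  refine shiftOp_commute fun ν => ?_
  simp only [leftSum, innerSum, lin_add, lin_single, mul_one, Pi.add_apply,
    Pi.single_apply, Fin.ext_iff]
  split_ifs <;> first
    | (exfalso; omega)
    | (simp only [add_zero, qp_add hs, mul_inv]; field_simp [qp_ne hs])

theorem passOp_radTerm_of_lt (hs : s ≠ 0) {i j : Fin N} (hi : (i.rev : ℕ) < (j : ℕ))
    (hj : (j : ℕ) ≤ (j.rev : ℕ)) :
    passOp s i * radTerm s j = (qp s 2)⁻¹ • (radTerm s j * passOp s i) := by
  have h1 := Fin.val_rev i; have h2 := Fin.val_rev j; have h3 := i.2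
  refine shiftOp_comm _ fun ν => ?_
  simp only [leftSum, innerSum, lin_add, lin_single, mul_one, Pi.add_apply,
    Pi.single_apply, Fin.ext_iff]
  split_ifs <;> first
    | (exfalso; omega)
    | (simp only [add_zero, qp_add hs, mul_inv, qp_one, qp_two]; field_simp [qp_ne hs])

theorem contractOp_radTerm_of_lt (hs : s ≠ 0) {k j : Fin N} (hk : (k : ℕ) < (k.rev : ℕ))
    (hj : (j : ℕ) < (k : ℕ)) :
    contractOp s k * radTerm s j = (qp s 2)⁻¹ • (radTerm s j * contractOp s k) := by
  have h1 := Fin.val_rev k; have h2 := Fin.val_rev j; have h3 := k.2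
  refine shiftOp_comm _ fun ν => ?_
  simp only [leftSum, innerSum, lin_add, lin_neg, lin_single, mul_one, Pi.add_apply,
    Pi.single_apply, Fin.ext_iff]
  split_ifs <;> first
    | (exfalso; omega)
    | (simp only [add_zero, qp_add hs, qp_neg, mul_inv, qp_one, qp_two]; field_simp [qp_ne hs])

theorem contractOp_radTerm_of_gt {k j : Fin N}
    (hj : (j : ℕ) ≤ (j.rev : ℕ)) (hk : (k : ℕ) < (j : ℕ)) :
    Commute (contractOp s k) (radTerm s j) := by
  have h1 := Fin.val_rev k; have h2 := Fin.val_rev j; have h3 := k.2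
  refine shiftOp_commute fun ν => ?_
  simp only [leftSum, innerSum, lin_add, lin_neg, lin_single, mul_one, Pi.add_apply,
    Pi.single_apply, Fin.ext_iff]
  split_ifs <;> first
    | (exfalso; omega)
    | (simp only [add_zero, neg_zero]; ring)

theorem radTerm_radTerm (hs : s ≠ 0) {j l : Fin N} (hj : (j : ℕ) < (l : ℕ))
    (hl : (l : ℕ) ≤ (l.rev : ℕ)) :
    radTerm s j * radTerm s l = (qp s 2)⁻¹ • (radTerm s l * radTerm s j) := by
  have h1 := Fin.val_rev l; have h2 := Fin.val_rev j; have h3 := l.2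
  refine shiftOp_comm _ fun ν => ?_
  simp only [innerSum, lin_add, lin_single, mul_one]
  rw [if_pos (show (j : ℕ) < l ∧ (j : ℕ) < l.rev by omega),
    if_pos (show (j : ℕ) < l.rev ∧ (j : ℕ) < l.rev.rev by rw [Fin.rev_rev]; omega),
    if_neg (show ¬ ((l : ℕ) < j ∧ (l : ℕ) < j.rev) by omega),
    if_neg (show ¬ ((l : ℕ) < j.rev ∧ (l : ℕ) < j.rev.rev) by rw [Fin.rev_rev]; omega)]
  simp only [add_zero, qp_add hs, mul_inv, qp_one, qp_two]
  field_simp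

/-- `x_{k'}` commutes with the squared radius of every larger interval `[m, m']`, up to the
weights left out of `radSum`. -/
theorem contractOp_radTerm_self (hs : s ≠ 0) {i : Fin N} (hi : (i.rev : ℕ) < (i : ℕ)) :
    contractOp s i.rev * radTerm s i.rev - (qp s 2)⁻¹ • (radTerm s i.rev * contractOp s i.rev) =
      (1 - (qp s 2)⁻¹) • passOp s i := by
  have h1 := Fin.val_rev i; have h3 := i.2
  have hne : i.rev ≠ i := fun h => by rw [h] at hi; omega
  simp only [contractOp, radTerm, passOp, shiftOp_mul, shiftOp_smul, Fin.rev_rev]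
  rw [shiftOp_congr (δ := -Pi.single i.rev 1 + (Pi.single i.rev 1 + Pi.single i 1))
    (ε := Pi.single i.rev 1 + Pi.single i 1 + -Pi.single i.rev 1)
    (by abel) fun _ => rfl, shiftOp_sub]
  refine shiftOp_congr (by abel) fun ν => ?_
  have hl : leftSum (i : ℕ) ν = leftSum (i.rev : ℕ) ν + ν i.rev + innerSum (i.rev : ℕ) ν := by
    have : ν i.rev = lin (Pi.single i.rev 1) ν := by simp [lin, Pi.single_apply]
    rw [this]
    simp only [leftSum, innerSum, lin, ← Finset.sum_add_distrib, ← add_mul]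
    refine Finset.sum_congr rfl fun l _ => ?_
    congr 1
    have := Fin.val_rev l; have := l.2
    simp only [Pi.single_apply, Fin.ext_iff]
    split_ifs <;> omega
  rw [hl]
  simp only [leftSum, innerSum, lin_add, lin_neg, lin_single, mul_one, Pi.add_apply,
    Pi.single_apply, if_neg hne, if_true, lt_self_iff_false, false_and, if_false,
    if_neg hi.not_gt, Fin.rev_rev]
  simp only [add_zero, neg_zero, qp_add hs, qp_two_mul hs, mul_inv, qp_one, qp_two]
  have := qp_ne hs (ν i.rev)
  have := qp_ne hs (i.rev : ℕ)
  field_simp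
  ring

theorem xOp_of_le {i : Fin N} (hi : (i : ℕ) ≤ (i.rev : ℕ)) : xOp s i = leftMulOp s i := if_pos hi

theorem xOp_of_lt {i : Fin N} (hi : (i.rev : ℕ) < (i : ℕ)) :
    xOp s i = passOp s i + contractOp s i.rev * radSum s N (i.rev + 1) := if_neg (by omega)

theorem leftMulOp_radSum (hs : s ≠ 0) {i : Fin N} (hi : (i : ℕ) ≤ (i.rev : ℕ)) (k : ℕ) :
    Commute (leftMulOp s i) (radSum s N k) :=
  commute_radSum fun _ _ hj => leftMulOp_radTerm hs hi hj

theorem contractOp_radSum {k : Fin N} {m : ℕ} (hm : (k : ℕ) < m) :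
    Commute (contractOp s k) (radSum s N m) :=
  commute_radSum fun _ h hj => contractOp_radTerm_of_gt hj (by omega)

theorem passOp_radSum (hs : s ≠ 0) {i : Fin N} {m : ℕ} (hm : (i.rev : ℕ) < m) :
    passOp s i * radSum s N m = (qp s 2)⁻¹ • (radSum s N m * passOp s i) :=
  mul_radSum _ fun _ h hj => passOp_radTerm_of_lt hs (by omega) hj

theorem radTerm_radSum (hs : s ≠ 0) {j : Fin N} {m : ℕ} (hm : (j : ℕ) < m) :
    radTerm s j * radSum s N m = (qp s 2)⁻¹ • (radSum s N m * radTerm s j) :=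
  mul_radSum _ fun _ h hj => radTerm_radTerm hs (by omega) hj

theorem xOp_radTerm_of_lt (hs : s ≠ 0) {i j : Fin N} (hi : (i.rev : ℕ) < (i : ℕ))
    (hj : (j : ℕ) < (i.rev : ℕ)) : Commute (xOp s i) (radTerm s j) := by
  have h2 : qp s 2 ≠ 0 := qp_ne hs 2
  rw [xOp_of_lt hi]
  refine (passOp_radTerm_of_le hs hi hj.le).add_left ?_
  have e1 := contractOp_radTerm_of_lt hs (k := i.rev) (by rwa [Fin.rev_rev]) hj
  have e2 := radTerm_radSum hs (m := i.rev + 1) (hj.trans (Nat.lt_succ_self _))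
  have e3 : radSum s N (i.rev + 1) * radTerm s j = qp s 2 • (radTerm s j * radSum s N (i.rev +
    1)) := by
    rw [e2, smul_smul, mul_inv_cancel₀ h2, one_smul]
  rw [Commute, SemiconjBy, mul_assoc, e3, mul_smul_comm, ← mul_assoc, e1, smul_mul_assoc, smul_smul,
    mul_inv_cancel₀ h2, one_smul, mul_assoc]

/-- The weights of the two terms of `x_{k'}` are such that it commutes with the squared radius of
every larger interval. -/
theorem xOp_radSum_of_le (hs : s ≠ 0) {i : Fin N} (hi : (i.rev : ℕ) < (i : ℕ)) {m : ℕ}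
    (hm : m ≤ (i.rev : ℕ)) : Commute (xOp s i) (radSum s N m) := by
  have h2 : qp s 2 ≠ 0 := qp_ne hs 2
  induction hd : (i.rev : ℕ) - m generalizing m with
  | succ d ih =>
    have hlt : m < N := by have := i.rev.2; omega
    rw [show m = ((⟨m, hlt⟩ : Fin N) : ℕ) from rfl, radSum_eq_add
      (by rw [Fin.val_rev]; have := Fin.val_rev i; have := i.2; simp only; omega)]
    exact (xOp_radTerm_of_lt hs hi (by simp only; omega)).add_right (ih (by simp only; omega)
      (by simp only; omega))
  | zero =>
    obtain rfl : m = i.rev := by omega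
    rw [radSum_eq_add (by rw [Fin.rev_rev]; omega), xOp_of_lt hi]
    set S := passOp s i
    set D := contractOp s i.rev
    set p := radTerm s i.rev
    set P := radSum s N (i.rev + 1)
    have e1 : S * p = p * S := passOp_radTerm_of_le hs hi le_rfl
    have e2 : S * P = (qp s 2)⁻¹ • (P * S) := passOp_radSum hs (Nat.lt_succ_self _)
    have e3 : D * P = P * D := contractOp_radSum (Nat.lt_succ_self _)
    have e4 : p * P = (qp s 2)⁻¹ • (P * p) := radTerm_radSum hs (Nat.lt_succ_self _)
    have e5 : D * p = (qp s 2)⁻¹ • (p * D) + (1 - (qp s 2)⁻¹) • S := by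
      rw [← contractOp_radTerm_self hs hi]; abel
    rw [Commute, SemiconjBy]
    have e6 : D * P * p = (qp s 2)⁻¹ • (P * p * D) + (1 - (qp s 2)⁻¹) • (P * S) := by
      rw [e3, mul_assoc, e5, mul_add, mul_smul_comm, mul_smul_comm, mul_assoc]
    have e7 : p * (D * P) = (qp s 2)⁻¹ • (P * p * D) := by
      rw [e3, ← mul_assoc, e4, smul_mul_assoc]
    have e8 : P * (D * P) = D * P * P := by rw [e3, mul_assoc, e3]
    rw [add_mul, mul_add, mul_add, add_mul, mul_add, mul_add, e1, e2, e6, e7, e8]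
    module

/-! ### The defining relations of the quantum Euclidean space -/

theorem leftMulOp_leftMulOp (hs : s ≠ 0) {i j : Fin N} (hij : i < j) :
    leftMulOp s i * leftMulOp s j = s ^ 2 • (leftMulOp s j * leftMulOp s i) := by
  refine shiftOp_comm _ fun ν => ?_
  rw [Fin.lt_def] at hij
  simp only [leftSum, lin_add, lin_single, mul_one, if_neg hij.not_gt, if_pos hij, add_zero,
    qp_add hs, mul_inv, qp_one]
  field_simp

theorem leftMulOp_passOp (hs : s ≠ 0) {i j : Fin N} (hi : (i : ℕ) < (j : ℕ)) (h : i ≠ j.rev) :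
    leftMulOp s i * passOp s j = s ^ 2 • (passOp s j * leftMulOp s i) := by
  refine shiftOp_comm _ fun ν => ?_
  simp only [leftSum, lin_add, lin_single, mul_one, if_neg hi.not_gt, if_pos hi, add_zero,
    qp_add hs, mul_inv, qp_one, Pi.add_apply, Pi.single_apply, if_neg h.symm]
  field_simp

theorem leftMulOp_contractOp (hs : s ≠ 0) {i k : Fin N} (h : i ≠ k) :
    leftMulOp s i * contractOp s k = s ^ 2 • (contractOp s k * leftMulOp s i) := by
  refine shiftOp_comm _ fun ν => ?_
  have h' : (i : ℕ) ≠ k := fun e => h (Fin.ext e)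
  simp only [leftSum, lin_add, lin_neg, lin_single, mul_one, Pi.add_apply, Pi.single_apply,
    if_neg h.symm]
  split_ifs <;> first
    | (exfalso; omega)
    | (simp only [add_zero, neg_zero, qp_add hs, qp_neg, mul_inv, qp_one]; field_simp)

theorem passOp_passOp (hs : s ≠ 0) {i j : Fin N} (hij : (i : ℕ) < (j : ℕ)) (h : i ≠ j.rev)  :
    passOp s i * passOp s j = s ^ 2 • (passOp s j * passOp s i) := by
  refine shiftOp_comm _ fun ν => ?_
  have h' : i.rev ≠ j := fun e => h (by rw [← e, Fin.rev_rev])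
  simp only [leftSum, lin_add, lin_single, mul_one, if_neg hij.not_gt, if_pos hij, add_zero,
    qp_add hs, mul_inv, qp_one, Pi.add_apply, Pi.single_apply, if_neg h.symm, if_neg h']
  field_simp

theorem passOp_contractOp (hs : s ≠ 0) {i k : Fin N} (hik : (k : ℕ) < (i : ℕ)) (h : i ≠ k.rev)
    (hk : k ≠ i) : passOp s i * contractOp s k = s ^ 2 • (contractOp s k * passOp s i) := by
  refine shiftOp_comm _ fun ν => ?_
  have h' : i.rev ≠ k := fun e => h (by rw [← e, Fin.rev_rev])
  simp only [leftSum, lin_add, lin_neg, lin_single, mul_one, if_neg hik.not_gt, if_pos hik,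
    add_zero,
    neg_zero, qp_neg, qp_add hs, mul_inv, qp_one, Pi.add_apply, Pi.neg_apply, Pi.single_apply,
    if_neg hk, if_neg h']
  field_simp

theorem contractOp_contractOp (hs : s ≠ 0) {l k : Fin N} (hlk : (l : ℕ) < (k : ℕ)) :
    contractOp s k * contractOp s l = s ^ 2 • (contractOp s l * contractOp s k) := by
  refine shiftOp_comm _ fun ν => ?_
  have h : l ≠ k := by rintro rfl; omega
  simp only [leftSum, lin_add, lin_neg, lin_single, mul_one, if_neg hlk.not_gt, if_pos hlk,
    add_zero,
    neg_zero, qp_neg, qp_add hs, mul_inv, qp_one, Pi.add_apply, Pi.neg_apply, Pi.single_apply,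
    if_neg h, if_neg h.symm]
  field_simp

theorem xOp_comm (hs : s ≠ 0) {i j : Fin N} (hij : i < j) (h : i ≠ j.rev) :
    xOp s i * xOp s j = s ^ 2 • (xOp s j * xOp s i) := by
  have hij' : (i : ℕ) < j := hij
  have hv : (i : ℕ) ≠ j.rev := fun e => h (Fin.ext e)
  have h1 := Fin.val_rev i; have h2 := Fin.val_rev j
  have hi2 := i.2; have hj2 := j.2
  have h' : i.rev ≠ j := fun e => h (by rw [← e, Fin.rev_rev])
  rcases le_or_gt (j : ℕ) j.rev with hj | hj
  · rw [xOp_of_le hj, xOp_of_le (by omega), leftMulOp_leftMulOp hs hij]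
  rcases le_or_gt (i : ℕ) i.rev with hi | hi
  · rw [xOp_of_le hi, xOp_of_lt hj, mul_add, leftMulOp_passOp hs hij' h, ← mul_assoc,
      leftMulOp_contractOp hs h, smul_mul_assoc, mul_assoc,
      (leftMulOp_radSum hs hi _).eq, ← mul_assoc, ← smul_add, ← add_mul]
  · have e1 : xOp s i * passOp s j = s ^ 2 • (passOp s j * xOp s i) := by
      have a1 : contractOp s i.rev * passOp s j = (s ^ 2)⁻¹ • (passOp s j * contractOp s i.rev) :=
        by
        rw [passOp_contractOp hs (by omega) (by rw [Fin.rev_rev]; exact hij.ne') (by exact h'),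
          smul_smul, inv_mul_cancel₀ (pow_ne_zero _ hs), one_smul]
      have a2 : radSum s N (i.rev + 1) * passOp s j =
          qp s 2 • (passOp s j * radSum s N (i.rev + 1)) := by
        rw [passOp_radSum hs (by omega), smul_smul, mul_inv_cancel₀ (qp_ne hs 2), one_smul]
      rw [xOp_of_lt hi, add_mul, passOp_passOp hs hij' h, mul_assoc, a2, mul_smul_comm, ← mul_assoc,
        a1, smul_mul_assoc, smul_smul, mul_add, smul_add, mul_assoc, qp_two]
      congr 2
      field_simp
    have e2 : xOp s i * contractOp s j.rev = s ^ 2 • (contractOp s j.rev * xOp s i) := by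
      rw [xOp_of_lt hi, add_mul, passOp_contractOp hs (by omega) (by rw [Fin.rev_rev]; exact hij.ne)
        h.symm, mul_assoc, (contractOp_radSum (k := j.rev) (m := i.rev + 1) (by omega)).symm.eq,
        ← mul_assoc, contractOp_contractOp hs (by omega), smul_mul_assoc, mul_add, smul_add,
        mul_assoc]
    rw [xOp_of_lt hj, mul_add, e1, ← mul_assoc, e2, smul_mul_assoc, mul_assoc,
      (xOp_radSum_of_le hs hi (by omega)).eq, ← mul_assoc, ← smul_add, ← add_mul]

/-- Left multiplication by the squared radius of the interval `[k, k']`, normalized to begin with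
`x_k x_{k'}`. -/
def radOp (s : ℂ) (N k : ℕ) : Module.End ℂ (LaurentSpace N) :=
  shiftOp (fun ν => (qp s k)⁻¹ * (qp s (2 * leftSum k ν))⁻¹) 0 * radSum s N k

theorem leftSum_succ (k : Fin N) (ν : Lat N) : leftSum (k + 1) ν = leftSum k ν + ν k := by
  have : ν k = lin (Pi.single k 1) ν := by simp [lin, Pi.single_apply]
  rw [this]
  simp only [leftSum, lin, ← Finset.sum_add_distrib, ← add_mul]
  refine Finset.sum_congr rfl fun l _ => ?_
  congr 1
  simp only [Pi.single_apply, Fin.ext_iff]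
  split_ifs <;> omega

/-- The first hypothesis of `sum_interval`, for `y_i = x_i x_{i'}`: only the part of `x_{k'}` that
lowers the exponent at `k` fails to commute with `x_k`. -/
theorem xOp_rev_mul_sub (hs : s ≠ 0) {k : Fin N} (hk : (k : ℕ) < (k.rev : ℕ)) :
    xOp s k.rev * xOp s k - xOp s k * xOp s k.rev =
      (s ^ 2 - (s ^ 2)⁻¹) • radOp s N (k + 1) := by
  have hne : k.rev ≠ k := fun h => by rw [h] at hk; omega
  have e1 : leftMulOp s k * passOp s k.rev = passOp s k.rev * leftMulOp s k := by
    refine shiftOp_commute fun ν => ?_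
    simp only [leftSum, lin_add, lin_single, mul_one, if_neg hk.not_gt, if_pos hk, add_zero,
      qp_add hs, mul_inv, qp_one, Pi.add_apply, Fin.rev_rev, Pi.single_eq_same]
    field_simp
  have e2 : contractOp s k * leftMulOp s k - leftMulOp s k * contractOp s k =
      (s ^ 2 - (s ^ 2)⁻¹) • shiftOp (fun ν => (qp s (k + 1 : ℕ))⁻¹ *
        (qp s (2 * leftSum (k + 1) ν))⁻¹) 0 := by
    simp only [contractOp, leftMulOp, shiftOp_mul, shiftOp_smul]
    rw [shiftOp_congr (δ := -Pi.single k 1 + Pi.single k 1)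
      (ε := Pi.single k 1 + -Pi.single k 1) (by abel) fun _ => rfl, shiftOp_sub]
    refine shiftOp_congr (by abel) fun ν => ?_
    rw [leftSum_succ]
    simp only [leftSum, lin_add, lin_neg, lin_single, mul_one, lt_self_iff_false, if_false,
      add_zero, neg_zero, qp_two_mul hs, qp_add hs, Pi.add_apply, Pi.single_eq_same,
      Nat.cast_add, Nat.cast_one, qp_one, mul_inv]
    field_simp [qp_ne hs]
    ring
  have hk' : (k.rev.rev : ℕ) < k.rev := by rwa [Fin.rev_rev]
  rw [xOp_of_lt hk', xOp_of_le hk.le, Fin.rev_rev, radOp, add_mul, mul_add, e1, mul_assoc,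
    (leftMulOp_radSum hs hk.le (k + 1)).symm.eq, ← mul_assoc, ← mul_assoc, ← smul_mul_assoc, ← e2,
    sub_mul (contractOp s k * leftMulOp s k)]
  abel

/-- The second hypothesis of `sum_interval`, for `y_i = x_i x_{i'}`. -/
theorem radOp_eq_add (hs : s ≠ 0) {k : Fin N} (hk : (k : ℕ) < (k.rev : ℕ)) :
    radOp s N k = xOp s k * xOp s k.rev + s ^ 2 • radOp s N (k + 1) := by
  have hne : k.rev ≠ k := fun h => by rw [h] at hk; omega
  have hk' : (k.rev.rev : ℕ) < k.rev := by rwa [Fin.rev_rev]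
  have e1 : shiftOp (fun ν => (qp s k)⁻¹ * (qp s (2 * leftSum k ν))⁻¹) 0 * radTerm s k =
      leftMulOp s k * passOp s k.rev := by
    simp only [radTerm, leftMulOp, passOp, shiftOp_mul]
    refine shiftOp_congr (by abel) fun ν => ?_
    have hl : leftSum (k.rev : ℕ) ν = leftSum (k : ℕ) ν + ν k + innerSum (k : ℕ) ν := by
      have : ν k = lin (Pi.single k 1) ν := by simp [lin, Pi.single_apply]
      rw [this]
      simp only [leftSum, innerSum, lin, ← Finset.sum_add_distrib, ← add_mul]
      refine Finset.sum_congr rfl fun l _ => ?_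
      congr 1
      have := Fin.val_rev l; have := l.2; have := Fin.val_rev k; have := k.2
      simp only [Pi.single_apply, Fin.ext_iff]
      split_ifs <;> omega
    rw [hl, if_neg hne.symm]
    simp only [leftSum, lin_add, lin_single, mul_one, lt_self_iff_false, if_false, Fin.rev_rev,
      if_neg hk.not_gt, add_zero, qp_add hs, mul_inv, qp_two_mul hs]
    field_simp [qp_ne hs]
  have e2 : shiftOp (fun ν => (qp s k)⁻¹ * (qp s (2 * leftSum k ν))⁻¹) 0 =
      leftMulOp s k * contractOp s k +
        s ^ 2 • shiftOp (fun ν => (qp s (k + 1 : ℕ))⁻¹ * (qp s (2 * leftSum (k + 1) ν))⁻¹) 0 := by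
    simp only [contractOp, leftMulOp, shiftOp_mul, shiftOp_smul]
    rw [shiftOp_congr (δ := -Pi.single k 1 + Pi.single k 1) (ε := 0) (by abel) fun _ => rfl,
      shiftOp_add]
    refine shiftOp_congr rfl fun ν => ?_
    rw [leftSum_succ]
    simp only [leftSum, lin_add, lin_neg, lin_single, mul_one, lt_self_iff_false, if_false,
      add_zero, neg_zero, qp_two_mul hs, qp_add hs, Nat.cast_add, Nat.cast_one, qp_one, mul_inv]
    field_simp [qp_ne hs]
    ring
  rw [radOp, radSum_eq_add hk.le, mul_add, e1]
  conv_lhs => rw [e2]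
  rw [xOp_of_lt hk', xOp_of_le hk.le, Fin.rev_rev, radOp, add_mul, mul_add, smul_mul_assoc,
    ← mul_assoc, add_assoc]

theorem radOp_middle (hs : s ≠ 0) (h2 : s ^ 2 + 1 ≠ 0) {m : Fin N} (hm : m = m.rev) :
    xOp s m * xOp s m = (s + s⁻¹) • radOp s N m := by
  have hv : (m : ℕ) = m.rev := congrArg Fin.val hm
  have h1 := Fin.val_rev m
  rw [radOp, radSum_eq_add hv.le, radSum_eq_zero (by omega), add_zero, xOp_of_le hv.le]
  simp only [radTerm, leftMulOp, shiftOp_mul, shiftOp_smul, ← hm, if_true]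
  refine shiftOp_congr (by abel) fun ν => ?_
  have h0 : innerSum (m : ℕ) ν = 0 := by
    unfold innerSum lin
    refine Finset.sum_eq_zero fun l _ => ?_
    have := Fin.val_rev l
    dsimp only
    rw [if_neg (by omega), zero_mul]
  rw [h0]
  simp only [leftSum, lin_add, lin_single, mul_one, lt_self_iff_false, if_false, add_zero,
    qp_two_mul hs, qp_zero, mul_inv, inv_one]
  have := qp_ne hs (lin (fun l => if (l : ℕ) < (m : ℕ) then 1 else 0) ν)
  have := qp_ne hs (m : ℕ)
  field_simp

/-- In any algebra, elements `y_i` (in the role of `x_i x_{i'}`) and `R_k` (the normalized squared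
radii) with `y_{k'} - y_k = (q - q⁻¹) R_{k+1}` and `R_k = y_k + q R_{k+1}` satisfy
`∑_{k ≤ i ≤ k'} q ^ ρ_{i'} y_i = (q ^ ρ_k + q ^ (-ρ_k)) R_k`. -/
theorem sum_interval {A : Type*} [AddCommGroup A] [Module ℂ A] (hs : s ≠ 0)
    (y : Fin N → A) (R : ℕ → A)
    (h1 : ∀ k : Fin N, (k : ℕ) < (k.rev : ℕ) →
      y k.rev - y k = (s ^ 2 - (s ^ 2)⁻¹) • R (k + 1))
    (h2 : ∀ k : Fin N, (k : ℕ) < (k.rev : ℕ) → R k = y k + s ^ 2 • R (k + 1))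
    (h3 : ∀ k : Fin N, k = k.rev → y k = (s + s⁻¹) • R k)
    (h4 : N % 2 = 0 → R (N / 2) = 0) (k : ℕ) (hk : k ≤ N / 2) :
    ∑ i ∈ Finset.univ.filter (fun i : Fin N => k ≤ (i : ℕ) ∧ k ≤ (i.rev : ℕ)),
      s ^ twoRho i.rev • y i =
    (s ^ ((N : ℤ) - 2 - 2 * k) + s ^ (-((N : ℤ) - 2 - 2 * k))) • R k := by
  induction hd : N / 2 - k generalizing k with
  | zero =>
    obtain rfl : k = N / 2 := by omega
    rcases Nat.mod_two_eq_zero_or_one N with hN | hN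
    · rw [h4 hN, smul_zero]
      refine Finset.sum_eq_zero fun i hi => ?_
      have := Fin.val_rev i
      have := (Finset.mem_filter.1 hi).2
      omega
    · have hlt : N / 2 < N := by omega
      set m : Fin N := ⟨N / 2, hlt⟩ with hm
      have hmr : m = m.rev := by
        rw [Fin.ext_iff, Fin.val_rev, hm]; simp only; omega
      have hf : Finset.univ.filter
          (fun i : Fin N => N / 2 ≤ (i : ℕ) ∧ N / 2 ≤ (i.rev : ℕ)) = {m} := by
        ext i
        have := Fin.val_rev i
        simp only [Finset.mem_filter, Finset.mem_univ, true_and, Finset.mem_singleton,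
          Fin.ext_iff, hm]
        omega
      have ht : twoRho m.rev = 0 := by
        rw [← hmr, twoRho, if_neg (by rw [← hmr]; exact lt_irrefl _), if_pos hmr]
      rw [hf, Finset.sum_singleton, ht, zpow_zero, one_smul, h3 m hmr]
      have : (N : ℤ) - 2 - 2 * (N / 2 : ℕ) = -1 := by omega
      rw [this, neg_neg, zpow_one, zpow_neg_one, add_comm]
  | succ d ih =>
    have hlt : k < N := by omega
    set i : Fin N := ⟨k, hlt⟩ with hi
    have hki : (i : ℕ) = k := rfl
    have hr := Fin.val_rev i
    have hir : (i : ℕ) < (i.rev : ℕ) := by omega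
    have hf : Finset.univ.filter (fun j : Fin N => k ≤ (j : ℕ) ∧ k ≤ (j.rev : ℕ)) =
        insert i (insert i.rev
          (Finset.univ.filter fun j : Fin N => k + 1 ≤ (j : ℕ) ∧ k + 1 ≤ (j.rev : ℕ))) := by
      ext j
      have := Fin.val_rev j
      simp only [Finset.mem_filter, Finset.mem_univ, true_and, Finset.mem_insert, Fin.ext_iff]
      omega
    have hn1 : i ∉ insert i.rev
        (Finset.univ.filter fun j : Fin N => k + 1 ≤ (j : ℕ) ∧ k + 1 ≤ (j.rev : ℕ)) := by
      simp only [Finset.mem_filter, Finset.mem_univ, true_and, Finset.mem_insert, Fin.ext_iff]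
      omega
    have hn2 : i.rev ∉
        Finset.univ.filter fun j : Fin N => k + 1 ≤ (j : ℕ) ∧ k + 1 ≤ (j.rev : ℕ) := by
      simp only [Finset.mem_filter, Finset.mem_univ, true_and, Fin.rev_rev]
      omega
    set t : ℤ := (N : ℤ) - 2 - 2 * k with ht
    have t1 : twoRho i = t := by rw [twoRho, if_pos (Fin.lt_def.2 hir)]
    have t2 : twoRho i.rev = -t := by
      rw [twoRho, Fin.rev_rev, if_neg (Fin.lt_def.not.2 hir.not_gt),
        if_neg (fun h => by rw [h] at hir; omega), hr]
      omega
    have hy : y i.rev = y i + (s ^ 2 - (s ^ 2)⁻¹) • R (k + 1) := by rw [← h1 i hir]; abel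
    have hR := h2 i hir
    rw [hki] at hR
    rw [hf, Finset.sum_insert hn1, Finset.sum_insert hn2, ih (k + 1) (by omega) (by omega),
      Fin.rev_rev, t1, t2, hy, hR]
    have e1 : (N : ℤ) - 2 - 2 * (k + 1 : ℕ) = t - 2 := by push_cast; ring
    have e2 : s ^ (t - 2) = s ^ t * (s ^ 2)⁻¹ := by rw [zpow_sub₀ hs, div_eq_mul_inv]; norm_cast
    have e3 : s ^ (-(t - 2)) = s ^ (-t) * s ^ 2 := by
      rw [show -(t - 2) = -t + 2 by ring, zpow_add₀ hs]; norm_cast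
    rw [e1, e2, e3]
    module

end

section

variable {s : ℂ} {N : ℕ}

/-- `q = s ^ 2` is not a root of unity. -/
def NotRootOfUnity (s : ℂ) : Prop := ∀ k : ℕ, 0 < k → (s ^ 2) ^ k ≠ 1

theorem qp_eq_one_iff (hq : NotRootOfUnity s) {a : ℤ} : qp s a = 1 ↔ a = 0 := by
  refine ⟨fun h => ?_, fun h => by rw [h, qp_zero]⟩
  by_contra ha
  rcases Int.natAbs_eq a with h' | h'
  · refine hq a.natAbs (by omega) ?_
    rw [← zpow_natCast, ← h']; exact h
  · refine hq a.natAbs (by omega) ?_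
    rw [h', qp_neg, inv_eq_one] at h
    rw [← zpow_natCast]; exact h

theorem zpow_add_zpow_neg_ne_zero (hs : s ≠ 0) (hq : NotRootOfUnity s) (a : ℤ) :
    s ^ a + s ^ (-a) ≠ 0 := by
  intro h
  rcases eq_or_ne a 0 with rfl | ha
  · norm_num at h
  · have h1 : s ^ a * s ^ a = -1 := by
      have : s ^ a * s ^ (-a) = 1 := by rw [← zpow_add₀ hs]; simp
      linear_combination s ^ a * h - this
    have h2 : qp s (2 * a) = 1 := by
      rw [← zpow_two_mul_eq_qp, show 2 * (2 * a) = a + a + (a + a) by ring, zpow_add₀ hs,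
        zpow_add₀ hs, h1]
      norm_num
    have := (qp_eq_one_iff hq).1 h2
    omega

theorem sq_add_one_ne_zero (hs : s ≠ 0) (hq : NotRootOfUnity s) : s ^ 2 + 1 ≠ 0 := by
  have h := zpow_add_zpow_neg_ne_zero hs hq 1
  contrapose! h
  rw [zpow_one, zpow_neg_one]
  field_simp
  linear_combination h

theorem sq_sub_inv_ne_zero (hs : s ≠ 0) (hq : NotRootOfUnity s) : s ^ 2 - (s ^ 2)⁻¹ ≠ 0 := by
  intro h
  have : qp s 2 = 1 := by
    rw [qp_two]; field_simp at h; linear_combination h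
  exact two_ne_zero ((qp_eq_one_iff hq).1 this)

theorem pow_four_sub_one_ne_zero (hs : s ≠ 0) (hq : NotRootOfUnity s) : s ^ 4 - 1 ≠ 0 := by
  intro h
  refine sq_sub_inv_ne_zero hs hq ?_
  field_simp
  linear_combination h

theorem one_sub_sq_ne_zero (hq : NotRootOfUnity s) : 1 - s ^ 2 ≠ 0 := by
  intro h
  have : qp s 1 = 1 := by rw [qp_one]; linear_combination -h
  exact one_ne_zero ((qp_eq_one_iff hq).1 this)

theorem radOp_eq_zero {k : ℕ} (hk : N < 2 * k + 1) : radOp s N k = 0 := by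
  rw [radOp, radSum_eq_zero hk, mul_zero]

/-- The weighted sum of the `x_i x_{i'}` over the interval `[k, k']`, on Laurent monomials. -/
theorem sum_xOp_mul_xOp_rev (hs : s ≠ 0) (hq : NotRootOfUnity s) {k : ℕ} (hk : k ≤ N / 2) :
    ∑ i ∈ Finset.univ.filter (fun i : Fin N => k ≤ (i : ℕ) ∧ k ≤ (i.rev : ℕ)),
      s ^ twoRho i.rev • (xOp s i * xOp s i.rev) =
    (s ^ ((N : ℤ) - 2 - 2 * k) + s ^ (-((N : ℤ) - 2 - 2 * k))) • radOp s N k := by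
  refine sum_interval hs (fun i => xOp s i * xOp s i.rev) (radOp s N) (fun k hk => ?_)
    (fun k hk => radOp_eq_add hs hk) (fun k hk => ?_) (fun h => radOp_eq_zero (by omega)) k hk
  · rw [Fin.rev_rev]
    exact xOp_rev_mul_sub hs hk
  · rw [← hk]
    exact radOp_middle hs (sq_add_one_ne_zero hs hq) hk

/-- The operators of `x_i x_{i'}` and `x_{i'} x_i` differ by a multiple of the squared radius of the
interval `[i + 1, (i + 1)']`, which `sum_xOp_mul_xOp_rev` expresses by the products `x_j x_{j'}`. -/
theorem xOp_rel (hs : s ≠ 0) (hq : NotRootOfUnity s) ⦃a b : FreeAlgebra ℂ (Fin N)⦄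
    (h : SpaceRel s N a b) :
    FreeAlgebra.lift ℂ (xOp s) a = FreeAlgebra.lift ℂ (xOp s) b := by
  cases h with
  | comm i j hij h =>
    simp only [map_mul, map_smul, FreeAlgebra.lift_ι_apply]
    exact xOp_comm hs hij h
  | radial i hi =>
    have hr := Fin.val_rev i
    simp only [map_mul, map_smul, map_sub, map_sum, FreeAlgebra.lift_ι_apply]
    rw [xOp_rev_mul_sub hs (by omega)]
    have hI : Finset.Ioo i i.rev =
        Finset.univ.filter fun j : Fin N => i + 1 ≤ (j : ℕ) ∧ i + 1 ≤ (j.rev : ℕ) := by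
      ext j
      have := Fin.val_rev j
      simp only [Finset.mem_Ioo, Finset.mem_filter, Finset.mem_univ, true_and, Fin.lt_def]
      omega
    have ht : twoRho i = (N : ℤ) - 2 - 2 * i := by
      rw [twoRho, if_pos (Fin.lt_def.2 (by omega))]
    rw [hI, sum_xOp_mul_xOp_rev hs hq (by omega), ht, smul_smul]
    congr 1
    have h0 := zpow_add_zpow_neg_ne_zero hs hq ((N : ℤ) - 2 - 2 * i - 2)
    rw [show (N : ℤ) - 2 - 2 * (i + 1 : ℕ) = (N : ℤ) - 2 - 2 * i - 2 by push_cast; ring,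
      show -((N : ℤ) - 2 - 2 * i) + 2 = -((N : ℤ) - 2 - 2 * i - 2) by ring,
      div_mul_cancel₀ _ h0]
  | middle_odd i m hi hm =>
    have hr := Fin.val_rev i
    have hm' := Fin.val_rev m
    have hv : (m : ℕ) = m.rev := congrArg Fin.val hm
    have hi' := i.2
    simp only [map_mul, map_smul, map_sub, map_pow, FreeAlgebra.lift_ι_apply]
    rw [xOp_rev_mul_sub hs (by omega), pow_two (xOp s m),
      radOp_middle hs (sq_add_one_ne_zero hs hq) hm, smul_smul, show (i : ℕ) + 1 = m by omega]
    congr 1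
    field_simp
    ring
  | middle_even i hi hN =>
    have hr := Fin.val_rev i
    have hi' := i.2
    obtain ⟨t, ht⟩ := hN
    simp only [map_mul, FreeAlgebra.lift_ι_apply]
    have := xOp_rev_mul_sub hs (k := i) (by omega)
    rw [radOp_eq_zero (by omega), smul_zero] at this
    exact sub_eq_zero.1 this

/-- The representation of `𝒜` on Laurent monomials by left multiplication. -/
def spaceRep (hs : s ≠ 0) (hq : NotRootOfUnity s) :
    Space s N →ₐ[ℂ] Module.End ℂ (LaurentSpace N) :=
  RingQuot.liftAlgHom ℂ ⟨FreeAlgebra.lift ℂ (xOp s), xOp_rel hs hq⟩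

theorem spaceRep_x (hs : s ≠ 0) (hq : NotRootOfUnity s) (i : Fin N) :
    spaceRep hs hq (x s i) = xOp s i := by
  rw [spaceRep, x, RingQuot.liftAlgHom_mkAlgHom_apply, FreeAlgebra.lift_ι_apply]

/-- The exponent of an ordered monomial as an exponent of a Laurent monomial. -/
def toLat (ν : Fin N → ℕ) : Lat N := fun i => ν i

/-- The linear map from `𝒜` to the Laurent monomials that sends `1` to the trivial monomial and
commutes with left multiplications. -/
def toLaurent (hs : s ≠ 0) (hq : NotRootOfUnity s) : Space s N →ₗ[ℂ] LaurentSpace N :=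
  LinearMap.applyₗ (Finsupp.single 0 1) ∘ₗ (spaceRep hs hq).toLinearMap

theorem toLaurent_apply (hs : s ≠ 0) (hq : NotRootOfUnity s) (a : Space s N) :
    toLaurent hs hq a = spaceRep hs hq a (Finsupp.single 0 1) := rfl

theorem toLaurent_mul (hs : s ≠ 0) (hq : NotRootOfUnity s) (a b : Space s N) :
    toLaurent hs hq (a * b) = spaceRep hs hq a (toLaurent hs hq b) := by
  rw [toLaurent_apply, map_mul]; rfl

/-- When the exponents at the positions up to `i` vanish, `x_i` acts by raising the exponent at
`i`. -/
theorem xOp_single (i : Fin N) (ν : Lat N) (c : ℂ) (h : ∀ j ≤ i, j ≠ i → ν j = 0) :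
    xOp s i (Finsupp.single ν c) = Finsupp.single (ν + Pi.single i 1) c := by
  have hl : leftSum (i : ℕ) ν = 0 := by
    unfold leftSum lin
    refine Finset.sum_eq_zero fun l _ => ?_
    by_cases hl : (l : ℕ) < i
    · rw [h l (Fin.le_def.2 hl.le) (fun e => by rw [e] at hl; omega), mul_zero]
    · simp only [if_neg hl, zero_mul]
  rcases le_or_gt (i : ℕ) i.rev with hi | hi
  · rw [xOp_of_le hi, leftMulOp, shiftOp_single, hl, qp_zero, inv_one, one_mul]
  · have h0 : ν i.rev = 0 := h _ (Fin.le_def.2 hi.le) (fun e => by rw [e] at hi; omega)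
    rw [xOp_of_lt hi, (contractOp_radSum (Nat.lt_succ_self _)).eq, LinearMap.add_apply,
      Module.End.mul_apply, contractOp, shiftOp_single, h0, mul_zero, qp_zero, inv_one, sub_self,
      mul_zero, zero_mul, Finsupp.single_zero, map_zero, add_zero, passOp, shiftOp_single, hl, h0,
      qp_zero, inv_one, one_mul, one_mul]

theorem xOp_pow_single (i : Fin N) (ν : Lat N) (n : ℕ)
    (h : ∀ j ≤ i, j ≠ i → ν j = 0) :
    (xOp s i ^ n) (Finsupp.single ν 1) = Finsupp.single (ν + Pi.single i (n : ℤ)) 1 := by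
  induction n with
  | zero => simp
  | succ n ih =>
    rw [pow_succ', Module.End.mul_apply, ih, xOp_single]
    · rw [add_assoc, ← Pi.single_add]; push_cast; rfl
    · intro j hj hne
      rw [Pi.add_apply, h j hj hne, Pi.single_eq_of_ne hne, add_zero]

theorem toLaurent_mono (hs : s ≠ 0) (hq : NotRootOfUnity s) (ν : Fin N → ℕ) :
    toLaurent hs hq (mono s ν) = Finsupp.single (toLat ν) 1 := by
  have key (l : List (Fin N)) (hl : l.Pairwise (· < ·)) :
      toLaurent hs hq (l.map fun i => x s i ^ ν i).prod =
        Finsupp.single (fun i => if i ∈ l then (ν i : ℤ) else 0) 1 := by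
    induction l with
    | nil => simp [toLaurent_apply]; rfl
    | cons i l ih =>
      rw [List.pairwise_cons] at hl
      rw [List.map_cons, List.prod_cons, toLaurent_mul, ih hl.2, map_pow, spaceRep_x,
        xOp_pow_single]
      · congr 1
        ext j
        rw [Pi.add_apply, Pi.single_apply]
        by_cases hji : j = i
        · subst hji
          have : j ∉ l := fun hj => lt_irrefl _ (hl.1 j hj)
          simp [this]
        · simp [hji]
      · intro j hj hne
        exact if_neg fun hjl => (hl.1 j hjl).not_ge hj
  rw [mono, List.ofFn_eq_map, key _ (List.pairwise_lt_finRange N)]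
  congr 1
  ext i
  simp [toLat]

theorem toLat_injective : Function.Injective (toLat : (Fin N → ℕ) → Lat N) := fun ν μ h => by
  ext i
  exact Nat.cast_injective (R := ℤ) (congrFun h i)

theorem linearIndependent_mono (hs : s ≠ 0) (hq : NotRootOfUnity s) :
    LinearIndependent ℂ (fun ν : Fin N → ℕ => mono s ν) := by
  refine LinearIndependent.of_comp (toLaurent hs hq) ?_
  have : (toLaurent hs hq ∘ fun ν : Fin N → ℕ => mono s ν) =
      (fun ν : Lat N => Finsupp.single ν (1 : ℂ)) ∘ toLat := by
    ext1 ν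
    exact toLaurent_mono hs hq ν
  rw [this]
  exact (Finsupp.basisSingleOne (R := ℂ)).linearIndependent.comp _ toLat_injective

/-! ### The ordered monomials span -/

/-- The product of the generators along a word. -/
def wordProd (s : ℂ) (w : List (Fin N)) : Space s N := (w.map (x s)).prod

theorem wordProd_append (u v : List (Fin N)) :
    wordProd s (u ++ v) = wordProd s u * wordProd s v := by simp [wordProd]

theorem wordProd_of_sorted {w : List (Fin N)} (hw : w.Pairwise (· ≤ ·)) :
    wordProd s w = mono s fun i => w.count i := by
  have hperm : w.Perm ((List.finRange N).flatMap fun i => List.replicate (w.count i) i) := by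
    rw [List.perm_iff_count]
    intro a
    rw [List.count_flatMap]
    have : (List.map (List.count a ∘ fun i => List.replicate (List.count i w) i)
      (List.finRange N)) =
        (List.finRange N).map fun i => if i = a then w.count a else 0 := by
      refine List.map_congr_left fun i _ => ?_
      simp only [Function.comp, List.count_replicate, beq_iff_eq]
      split_ifs with h
      · rw [h]
      · rfl
    rw [this, ← Fin.sum_univ_def, Finset.sum_ite_eq', if_pos (Finset.mem_univ a)]
  have hs' : ((List.finRange N).flatMap fun i => List.replicate (w.count i) i).Pairwise (· ≤ ·) :=
    by
    rw [List.pairwise_flatMap]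
    refine ⟨fun i _ => List.pairwise_replicate.2 (Or.inr le_rfl), ?_⟩
    refine (List.pairwise_lt_finRange N).imp fun {a b} hab y hy z hz => ?_
    rw [(List.mem_replicate.1 hy).2, (List.mem_replicate.1 hz).2]
    exact hab.le
  have heq := hperm.eq_of_pairwise (fun a b _ _ h1 h2 => le_antisymm h1 h2) hw hs'
  conv_lhs => rw [heq]
  rw [wordProd, mono, List.ofFn_eq_map, List.map_flatMap]
  generalize List.finRange N = l
  induction l with
  | nil => rfl
  | cons i l ih =>
    rw [List.flatMap_cons, List.prod_append, ih, List.map_replicate, List.prod_replicate,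
      List.map_cons, List.prod_cons]

theorem sorted_or_descent (w : List (Fin N)) : w.Pairwise (· ≤ ·) ∨
    ∃ (u v : List (Fin N)) (i j : Fin N), i < j ∧ w = u ++ j :: i :: v := by
  induction w with
  | nil => exact Or.inl List.Pairwise.nil
  | cons a w ih =>
    rcases ih with ih | ⟨u, v, i, j, hij, rfl⟩
    · cases w with
      | nil => exact Or.inl (List.pairwise_singleton _ _)
      | cons b w =>
        rcases le_or_gt a b with hab | hab
        · refine Or.inl (List.pairwise_cons.2 ⟨fun c hc => ?_, ih⟩)
          rcases List.mem_cons.1 hc with rfl | hc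
          · exact hab
          · exact hab.trans ((List.pairwise_cons.1 ih).1 c hc)
        · exact Or.inr ⟨[], w, b, a, hab, rfl⟩
    · exact Or.inr ⟨a :: u, v, i, j, hij, rfl⟩

/-- The distance of `i` from the centre, doubled. -/
def spread (i : Fin N) : ℕ := ((i : ℤ) - (i.rev : ℕ)).natAbs

/-- A weight of words that decreases when a descent is sorted. -/
def disorder : List (Fin N) → ℕ
  | [] => 0
  | a :: w => (a : ℕ) * w.length + disorder w

theorem disorder_append (u v : List (Fin N)) :
    disorder (u ++ v) = disorder u + disorder v + (u.map (fun a : Fin N => (a : ℕ))).sum *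
      v.length := by
  induction u with
  | nil => simp [disorder]
  | cons a u ih => simp [disorder, ih]; ring

/-- The reordering of `x_{i'} x_i` produces only products of letters strictly closer to the centre.
-/
theorem x_rev_mul_x (i : Fin N) (hi : i < i.rev) :
    ∃ c : Fin N → ℂ, x s i.rev * x s i = x s i * x s i.rev +
      ∑ j ∈ Finset.Ioo i i.rev, c j • (x s j * x s j.rev) := by
  have hr := Fin.val_rev i
  have hi2 := i.2
  rw [Fin.lt_def] at hi
  rcases lt_or_eq_of_le (show (i : ℕ) + 1 ≤ N / 2 by omega) with h | h
  · have := RingQuot.mkAlgHom_rel ℂ (SpaceRel.radial (s := s) i h)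
    simp only [map_sub, map_mul, map_smul, map_sum] at this
    rw [Finset.smul_sum] at this
    simp only [smul_smul] at this
    exact ⟨_, (sub_eq_iff_eq_add'.1 this)⟩
  · rcases Nat.even_or_odd N with hN | hN
    · have := RingQuot.mkAlgHom_rel ℂ (SpaceRel.middle_even (s := s) i h hN)
      simp only [map_mul] at this
      refine ⟨0, ?_⟩
      simp only [Pi.zero_apply, zero_smul, Finset.sum_const_zero, add_zero]
      exact this
    · obtain ⟨t, ht⟩ := hN
      have hlt : (i : ℕ) + 1 < N := by omega
      set m : Fin N := ⟨i + 1, hlt⟩ with hm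
      have hmv : (m : ℕ) = i + 1 := rfl
      have hmr : m = m.rev := by rw [Fin.ext_iff, Fin.val_rev]; omega
      have := RingQuot.mkAlgHom_rel ℂ (SpaceRel.middle_odd (s := s) i m h hmr)
      simp only [map_sub, map_mul, map_smul, map_pow] at this
      refine ⟨fun _ => s - s⁻¹, ?_⟩
      have hI : Finset.Ioo i i.rev = {m} := by
        ext j
        simp only [Finset.mem_Ioo, Finset.mem_singleton, Fin.lt_def, Fin.ext_iff]
        omega
      rw [hI, Finset.sum_singleton, ← hmr, ← pow_two (x s m)]
      exact (sub_eq_iff_eq_add'.1 this)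

theorem x_mul_x_of_lt (hs : s ≠ 0) {i j : Fin N} (hij : i < j) (h : i ≠ j.rev) :
    x s j * x s i = (s ^ 2)⁻¹ • (x s i * x s j) := by
  have := RingQuot.mkAlgHom_rel ℂ (SpaceRel.comm (s := s) i j hij h)
  simp only [map_mul, map_smul] at this
  rw [x, x, this, smul_smul, inv_mul_cancel₀ (pow_ne_zero 2 hs), one_smul]

/-- Sorting a descent of a word either lowers its disorder or replaces two letters by letters
closer to the centre, so the rewriting terminates. -/
theorem wordProd_mem_span (hs : s ≠ 0) (w : List (Fin N)) :
    wordProd s w ∈ Submodule.span ℂ (Set.range fun ν : Fin N → ℕ => mono s ν) := by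
  induction hS : (w.map spread).sum using Nat.strong_induction_on generalizing w with
  | _ S ihS =>
  induction hD : disorder w using Nat.strong_induction_on generalizing w with
  | _ D ihD =>
  rcases sorted_or_descent w with hw | ⟨u, v, i, j, hij, rfl⟩
  · rw [wordProd_of_sorted hw]
    exact Submodule.subset_span ⟨_, rfl⟩
  have hij' : (i : ℕ) < j := hij
  have hprod (a b : Fin N) : wordProd s (u ++ a :: b :: v) =
      wordProd s u * ((x s a * x s b) * wordProd s v) := by
    rw [wordProd_append]; simp [wordProd, mul_assoc]
  have hswap : wordProd s (u ++ i :: j :: v) ∈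
      Submodule.span ℂ (Set.range fun ν : Fin N → ℕ => mono s ν) := by
    refine ihD _ ?_ _ ?_ rfl
    · rw [← hD, disorder_append, disorder_append]
      simp only [disorder, List.length_cons]
      have : (i : ℕ) * (v.length + 1) + (j : ℕ) * v.length <
        (j : ℕ) * (v.length + 1) + (i : ℕ) * v.length := by
        have e1 : (i : ℕ) * (v.length + 1) = i * v.length + i := by ring
        have e2 : (j : ℕ) * (v.length + 1) = j * v.length + j := by ring
        omega
      omega
    · rw [← hS]
      simp only [List.map_append, List.sum_append, List.map_cons, List.sum_cons]
      omega
  by_cases h : i = j.rev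
  · obtain rfl : j = i.rev := by rw [h, Fin.rev_rev]
    obtain ⟨c, hc⟩ := x_rev_mul_x (s := s) i hij
    rw [hprod, hc, add_mul, mul_add, ← hprod, Finset.sum_mul, Finset.mul_sum]
    refine Submodule.add_mem _ hswap (Submodule.sum_mem _ fun l hl => ?_)
    rw [smul_mul_assoc, mul_smul_comm, ← hprod]
    refine Submodule.smul_mem _ _ (ihS _ ?_ _ rfl)
    rw [← hS]
    simp only [List.map_append, List.sum_append, List.map_cons, List.sum_cons]
    have hl' := Finset.mem_Ioo.1 hl
    rw [Fin.lt_def, Fin.lt_def] at hl'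
    have h1 := Fin.val_rev l; have h2 := Fin.val_rev i
    have h3 : spread l + spread l.rev < spread i.rev + spread i := by
      unfold spread
      rw [Fin.rev_rev, Fin.rev_rev]
      omega
    omega
  · rw [hprod, x_mul_x_of_lt hs hij h, smul_mul_assoc, mul_smul_comm, ← hprod]
    exact Submodule.smul_mem _ _ hswap

/-- A subspace of `𝒜` that contains `1` and is stable under left multiplication by the generators
is everything. -/
theorem eq_top_of_x_mul_mem (W : Submodule ℂ (Space s N)) (h1 : 1 ∈ W)
    (hx : ∀ i, ∀ a ∈ W, x s i * a ∈ W) : W = ⊤ := by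
  have key (a : FreeAlgebra ℂ (Fin N)) :
      ∀ b ∈ W, RingQuot.mkAlgHom ℂ (SpaceRel s N) a * b ∈ W := by
    induction a using FreeAlgebra.induction with
    | grade0 r =>
      intro b hb
      rw [AlgHom.commutes, ← Algebra.smul_def]
      exact W.smul_mem r hb
    | grade1 i => exact hx i
    | mul a b ha hb =>
      intro c hc
      rw [map_mul, mul_assoc]
      exact ha _ (hb c hc)
    | add a b ha hb =>
      intro c hc
      rw [map_add, add_mul]
      exact W.add_mem (ha c hc) (hb c hc)
  rw [eq_top_iff]
  intro a _
  obtain ⟨b, rfl⟩ := RingQuot.mkAlgHom_surjective ℂ (SpaceRel s N) a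
  rw [← mul_one (RingQuot.mkAlgHom ℂ (SpaceRel s N) b)]
  exact key b 1 h1

theorem span_mono_eq_top (hs : s ≠ 0) :
    Submodule.span ℂ (Set.range fun ν : Fin N → ℕ => mono s ν) = ⊤ := by
  have hw : Submodule.span ℂ (Set.range (wordProd s (N := N))) = ⊤ := by
    refine eq_top_of_x_mul_mem _ (Submodule.subset_span ⟨[], rfl⟩) fun i a ha => ?_
    induction ha using Submodule.span_induction with
    | mem a ha =>
      obtain ⟨w, rfl⟩ := ha
      exact Submodule.subset_span ⟨i :: w, by simp [wordProd]⟩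
    | zero => rw [mul_zero]; exact Submodule.zero_mem _
    | add a b _ _ ha hb => rw [mul_add]; exact Submodule.add_mem _ ha hb
    | smul c a _ ha => rw [mul_smul_comm]; exact Submodule.smul_mem _ _ ha
  rw [eq_top_iff, ← hw, Submodule.span_le]
  rintro _ ⟨w, rfl⟩
  exact wordProd_mem_span hs w

theorem monomialsFormBasis (hs : s ≠ 0) (hq : NotRootOfUnity s) : MonomialsFormBasis s N :=
  ⟨linearIndependent_mono hs hq, span_mono_eq_top hs⟩

end

section

variable {s : ℂ} {N : ℕ}

/-! ### Transfer of operators to Laurent monomials -/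

theorem toLaurent_injective (hs : s ≠ 0) (hq : NotRootOfUnity s) :
    Function.Injective (toLaurent (N := N) hs hq) := by
  have hb := monomialsFormBasis (N := N) hs hq
  let b := Module.Basis.mk hb.1 hb.2.ge
  have hli : LinearIndependent ℂ (toLaurent hs hq ∘ b) := by
    have : toLaurent hs hq ∘ b = (fun ν : Lat N => Finsupp.single ν (1 : ℂ)) ∘ toLat := by
      ext1 ν
      rw [Function.comp, Module.Basis.mk_apply]
      exact toLaurent_mono hs hq ν
    rw [this]
    exact (Finsupp.basisSingleOne (R := ℂ)).linearIndependent.comp _ toLat_injective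
  refine (injective_iff_map_eq_zero _).2 fun a ha => ?_
  rw [← b.linearCombination_repr a, Finsupp.apply_linearCombination] at ha
  exact (LinearEquiv.map_eq_zero_iff b.repr).1 (linearIndependent_iff.1 hli _ ha)

/-- The operator `T'` on Laurent monomials extends the operator `T` on `𝒜`. -/
def Extends (hs : s ≠ 0) (hq : NotRootOfUnity s) (T : Module.End ℂ (Space s N))
    (T' : Module.End ℂ (LaurentSpace N)) : Prop :=
  ∀ a, toLaurent hs hq (T a) = T' (toLaurent hs hq a)

namespace Extends

variable {hs : s ≠ 0} {hq : NotRootOfUnity s} {T₁ T₂ : Module.End ℂ (Space s N)}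
  {T₁' T₂' : Module.End ℂ (LaurentSpace N)}

theorem mul (h1 : Extends hs hq T₁ T₁') (h2 : Extends hs hq T₂ T₂') :
    Extends hs hq (T₁ * T₂) (T₁' * T₂') := fun a => by
  rw [Module.End.mul_apply, h1, h2, Module.End.mul_apply]

theorem add (h1 : Extends hs hq T₁ T₁') (h2 : Extends hs hq T₂ T₂') :
    Extends hs hq (T₁ + T₂) (T₁' + T₂') := fun a => by
  rw [LinearMap.add_apply, map_add, h1, h2, LinearMap.add_apply]

theorem smul (c : ℂ) (h1 : Extends hs hq T₁ T₁') : Extends hs hq (c • T₁) (c • T₁') := fun a => by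
  rw [LinearMap.smul_apply, map_smul, h1, LinearMap.smul_apply]

theorem one : Extends hs hq (1 : Module.End ℂ (Space s N)) 1 := fun _ => rfl

theorem algebraMap (c : ℂ) :
    Extends hs hq (algebraMap ℂ (Module.End ℂ (Space s N)) c) (algebraMap ℂ _ c) := by
  rw [Algebra.algebraMap_eq_smul_one, Algebra.algebraMap_eq_smul_one]
  exact one.smul c

theorem sum {ι : Type*} (S : Finset ι) {T : ι → Module.End ℂ (Space s N)}
    {T' : ι → Module.End ℂ (LaurentSpace N)} (h : ∀ i, Extends hs hq (T i) (T' i)) :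
    Extends hs hq (∑ i ∈ S, T i) (∑ i ∈ S, T' i) := fun a => by
  rw [LinearMap.sum_apply, map_sum, LinearMap.sum_apply]
  exact Finset.sum_congr rfl fun i _ => h i a

theorem lift {ι : Type*} {T : ι → Module.End ℂ (Space s N)}
    {T' : ι → Module.End ℂ (LaurentSpace N)} (h : ∀ i, Extends hs hq (T i) (T' i))
    (u : FreeAlgebra ℂ ι) :
    Extends hs hq (FreeAlgebra.lift ℂ T u) (FreeAlgebra.lift ℂ T' u) := by
  induction u using FreeAlgebra.induction with
  | grade0 r => rw [AlgHom.commutes, AlgHom.commutes]; exact algebraMap r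
  | grade1 i => rw [FreeAlgebra.lift_ι_apply, FreeAlgebra.lift_ι_apply]; exact h i
  | mul a b ha hb => rw [map_mul, map_mul]; exact ha.mul hb
  | add a b ha hb => rw [map_add, map_add]; exact ha.add hb

/-- Operators on `𝒜` are equal if their extensions are. -/
theorem eq (h1 : Extends hs hq T₁ T₁') (h2 : Extends hs hq T₂ T₂') (h : T₁' = T₂') : T₁ = T₂ :=
  LinearMap.ext fun a => toLaurent_injective hs hq (by rw [h1, h2, h])

theorem congr (h1 : Extends hs hq T₁ T₁') (h : T₁' = T₂') : Extends hs hq T₁ T₂' := h ▸ h1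

end Extends

theorem mulLeft_extends (hs : s ≠ 0) (hq : NotRootOfUnity s) (i : Fin N) :
    Extends hs hq (xHat s i) (xOp s i) := fun a => by
  rw [xHat, LinearMap.mulLeft_apply, toLaurent_mul, spaceRep_x]

theorem monoOp_extends (hs : s ≠ 0) (hq : NotRootOfUnity s) {φ : (Fin N → ℕ) → Space s N}
    {T' : Module.End ℂ (LaurentSpace N)}
    (h : ∀ ν, toLaurent hs hq (φ ν) = T' (Finsupp.single (toLat ν) 1)) :
    Extends hs hq (monoOp s φ) T' := by
  have hb := monomialsFormBasis (N := N) hs hq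
  intro a
  have ha : a ∈ Submodule.span ℂ (Set.range fun ν : Fin N → ℕ => mono s ν) := by
    rw [hb.2]; trivial
  induction ha using Submodule.span_induction with
  | mem a ha =>
    obtain ⟨ν, rfl⟩ := ha
    rw [monoOp_mono hb, h, toLaurent_mono]
  | zero => simp
  | add a b _ _ ha hb => simp only [map_add, ha, hb]
  | smul c a _ ha => simp only [map_smul, ha]

theorem toLaurent_smul_mono (hs : s ≠ 0) (hq : NotRootOfUnity s) (c : ℂ) (μ : Fin N → ℕ) :
    toLaurent hs hq (c • mono s μ) = Finsupp.single (toLat μ) c := by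
  rw [map_smul, toLaurent_mono, Finsupp.smul_single, smul_eq_mul, mul_one]

/-- A term whose exponent has been truncated carries a vanishing scalar. -/
theorem single_toLat_eq {μ : Fin N → ℕ} {μ' : Lat N} {c c' : ℂ} (hc : c = c')
    (h : c ≠ 0 → toLat μ = μ') : Finsupp.single (toLat μ) c = Finsupp.single μ' c' := by
  subst hc
  by_cases h0 : c = 0
  · rw [h0, Finsupp.single_zero, Finsupp.single_zero]
  · rw [h h0]

theorem toLat_add (ν μ : Fin N → ℕ) : toLat (ν + μ) = toLat ν + toLat μ := by
  ext i; simp [toLat]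

theorem toLat_single (a : Fin N) (n : ℕ) : toLat (Pi.single a n) = Pi.single a (n : ℤ) := by
  ext i
  rw [toLat, Pi.single_apply, Pi.single_apply]
  split_ifs <;> rfl

theorem toLat_sub_single {ν : Fin N → ℕ} {a : Fin N} {n : ℕ} (h : n ≤ ν a) :
    toLat (ν - Pi.single a n) = toLat ν - Pi.single a (n : ℤ) := by
  ext i
  rw [toLat, Pi.sub_apply, Pi.sub_apply, toLat]
  by_cases hi : i = a
  · subst hi; simp [Nat.cast_sub h]
  · simp [hi]

theorem qNum_zero : qNum s 0 = 0 := by simp [qNum]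

theorem qNumOne_zero : qNumOne s 0 = 0 := by simp [qNumOne]

theorem one_le_of_qNum_ne {n : ℕ} (h : qNum s n ≠ 0) : 1 ≤ n := by
  rcases n with _ | n
  · exact absurd qNum_zero h
  · omega

theorem one_le_of_qNumOne_ne {n : ℕ} (h : qNumOne s n ≠ 0) : 1 ≤ n := by
  rcases n with _ | n
  · exact absurd qNumOne_zero h
  · omega

/-! ### The operators of the natural action of `U_q(so_N)` -/

/-- The operator that moves one unit of exponent from `b` to `a`. -/
def hopOp (s : ℂ) {N : ℕ} (a b : Fin N) : Module.End ℂ (LaurentSpace N) :=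
  shiftOp (fun ν => qNum s (ν b) * qp s (ν a - ν b + 1)) (Pi.single a 1 - Pi.single b 1)

/-- The operator that moves one unit of exponent from `a'` to `b'`, with the weight that the
coproduct attaches to it. -/
def hopOpRev (s : ℂ) {N : ℕ} (a b : Fin N) : Module.End ℂ (LaurentSpace N) :=
  shiftOp (fun ν => qNum s (ν a.rev) * qp s (ν a - ν b - ν a.rev + ν b.rev + 1))
    (Pi.single b.rev 1 - Pi.single a.rev 1)

/-- The analogue of `hopOp` for the short simple root. -/
def hopShort (s : ℂ) {N : ℕ} (a c : Fin N) : Module.End ℂ (LaurentSpace N) :=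
  shiftOp (fun ν => qNumOne s (ν c) * (qp s (ν a - ν c) * s ^ 3)) (Pi.single a 1 - Pi.single c 1)

/-- The analogue of `hopOpRev` for the short simple root. -/
def hopShortRev (s : ℂ) {N : ℕ} (a c : Fin N) : Module.End ℂ (LaurentSpace N) :=
  shiftOp (fun ν => qNum s (ν a.rev) * qp s (ν a - ν a.rev + 1))
    (Pi.single c 1 - Pi.single a.rev 1)

/-- The extension of `raiseOp`. -/
def raiseExt (s : ℂ) {N : ℕ} (a b : Fin N) : Module.End ℂ (LaurentSpace N) :=
  hopOp s a b - hopOpRev s a b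

/-- The extension of `raiseOdd`. -/
def raiseShortExt (s : ℂ) {N : ℕ} (a c : Fin N) : Module.End ℂ (LaurentSpace N) :=
  hopShort s a c - hopShortRev s a c

theorem raiseOp_extends (hs : s ≠ 0) (hq : NotRootOfUnity s) (a b : Fin N) :
    Extends hs hq (raiseOp s a b) (raiseExt s a b) := by
  refine monoOp_extends hs hq fun ν => ?_
  rw [map_sub, toLaurent_smul_mono, toLaurent_smul_mono, raiseExt, LinearMap.sub_apply, hopOp,
    hopOpRev, shiftOp_single, shiftOp_single, mul_one, mul_one]
  refine congrArg₂ _ (single_toLat_eq rfl fun h => ?_) (single_toLat_eq rfl fun h => ?_)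
  · have hb := one_le_of_qNum_ne (left_ne_zero_of_mul h)
    rw [toLat_sub_single (by rw [Pi.add_apply]; omega), toLat_add, toLat_single, add_sub_assoc]
    rfl
  · have hb := one_le_of_qNum_ne (left_ne_zero_of_mul h)
    rw [toLat_sub_single (by rw [Pi.add_apply]; omega), toLat_add, toLat_single, add_sub_assoc]
    rfl

/-- Interchanging `i` and `i'` turns raising operators into lowering operators. -/
theorem lowerOp_extends (hs : s ≠ 0) (hq : NotRootOfUnity s) (a b : Fin N) :
    Extends hs hq (lowerOp s a b) (-raiseExt s a.rev b.rev) := by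
  refine monoOp_extends hs hq fun ν => ?_
  rw [map_sub, toLaurent_smul_mono, toLaurent_smul_mono, raiseExt, LinearMap.neg_apply,
    LinearMap.sub_apply, neg_sub, hopOp, hopOpRev, shiftOp_single, shiftOp_single, mul_one, mul_one,
      Fin.rev_rev, Fin.rev_rev]
  refine congrArg₂ _ (single_toLat_eq ?_ fun h => ?_) (single_toLat_eq ?_ fun h => ?_)
  · simp only [toLat, qp]
    congr 2; ring
  · have hb := one_le_of_qNum_ne (left_ne_zero_of_mul h)
    rw [toLat_add, toLat_sub_single hb, toLat_single]
    push_cast; abel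
  · simp only [toLat, qp]
    congr 2; ring
  · have hb := one_le_of_qNum_ne (left_ne_zero_of_mul h)
    rw [toLat_add, toLat_sub_single hb, toLat_single]
    push_cast; abel

theorem zpow_odd (hs : s ≠ 0) (a : ℤ) (n : ℕ) : s ^ (2 * a + n) = qp s a * s ^ n := by
  rw [zpow_add₀ hs, zpow_two_mul_eq_qp, zpow_natCast]

theorem raiseOdd_extends (hs : s ≠ 0) (hq : NotRootOfUnity s) (a c : Fin N) :
    Extends hs hq (raiseOdd s a c) (raiseShortExt s a c) := by
  refine monoOp_extends hs hq fun ν => ?_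
  rw [map_sub, toLaurent_smul_mono, toLaurent_smul_mono, raiseShortExt, LinearMap.sub_apply,
    hopShort, hopShortRev, shiftOp_single, shiftOp_single, mul_one, mul_one]
  refine congrArg₂ _ (single_toLat_eq ?_ fun h => ?_) (single_toLat_eq rfl fun h => ?_)
  · rw [← zpow_odd hs]; rfl
  · have hb := one_le_of_qNumOne_ne (left_ne_zero_of_mul h)
    rw [toLat_sub_single (by rw [Pi.add_apply]; omega), toLat_add, toLat_single, add_sub_assoc]
    rfl
  · have hb := one_le_of_qNum_ne (left_ne_zero_of_mul h)
    rw [toLat_sub_single (by rw [Pi.add_apply]; omega), toLat_add, toLat_single, add_sub_assoc]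
    rfl

theorem lowerOdd_extends (hs : s ≠ 0) (hq : NotRootOfUnity s) (a c : Fin N) :
    Extends hs hq (lowerOdd s a c) (-s⁻¹ • raiseShortExt s a.rev c) := by
  refine monoOp_extends hs hq fun ν => ?_
  rw [map_sub, toLaurent_smul_mono, toLaurent_smul_mono, raiseShortExt, LinearMap.smul_apply,
    LinearMap.sub_apply, neg_smul, smul_sub, neg_sub,
    hopShort, hopShortRev, shiftOp_single, shiftOp_single, mul_one, mul_one, Fin.rev_rev,
    Finsupp.smul_single, Finsupp.smul_single]
  refine congrArg₂ _ (single_toLat_eq ?_ fun h => ?_) (single_toLat_eq ?_ fun h => ?_)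
  · have := zpow_odd hs (-(ν a : ℤ) + ν a.rev) 1
    rw [Nat.cast_one] at this
    rw [this]
    simp only [toLat, smul_eq_mul, qp_add hs, qp_sub hs, qp_neg, qp_one]
    field_simp
  · have hb := one_le_of_qNum_ne (left_ne_zero_of_mul h)
    rw [toLat_add, toLat_sub_single hb, toLat_single]
    push_cast; abel
  · simp only [zpow_eq_qp, toLat, smul_eq_mul, qp_add hs, qp_sub hs, qp_neg, qp_one]
    field_simp
  · have hb := one_le_of_qNumOne_ne (left_ne_zero_of_mul h)
    rw [toLat_add, toLat_sub_single hb, toLat_single]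
    push_cast; abel

/-- The weight of a Laurent monomial. -/
def latWt {N : ℕ} (ν : Lat N) : Fin (N / 2) → ℤ := fun i =>
  let a : Fin N := ⟨i, by omega⟩
  ν a - ν a.rev

/-- The operators of the natural action of `U_q(so_N)` on Laurent monomials. -/
def soExt (s : ℂ) (N : ℕ) : SoGen (N / 2) → Module.End ℂ (LaurentSpace N)
  | .E i =>
      if (i : ℕ) + 1 < N / 2 then raiseExt s ⟨i, by omega⟩ ⟨(i : ℕ) + 1, by omega⟩
      else if N % 2 = 1 then raiseShortExt s ⟨i, by omega⟩ ⟨(i : ℕ) + 1, by omega⟩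
      else raiseExt s ⟨(i : ℕ) - 1, by omega⟩ ⟨(i : ℕ) + 1, by omega⟩
  | .F i =>
      if (i : ℕ) + 1 < N / 2 then
        -raiseExt s (Fin.rev ⟨i, by omega⟩) (Fin.rev ⟨(i : ℕ) + 1, by omega⟩)
      else if N % 2 = 1 then
        -s⁻¹ • raiseShortExt s (Fin.rev ⟨i, by omega⟩) ⟨(i : ℕ) + 1, by omega⟩
      else -raiseExt s (Fin.rev ⟨(i : ℕ) - 1, by omega⟩) (Fin.rev ⟨(i : ℕ) + 1, by omega⟩)
  | .K i => shiftOp (fun ν => qp s (wtDot (simpleRoot i) (latWt ν))) 0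
  | .Kinv i => shiftOp (fun ν => qp s (-wtDot (simpleRoot i) (latWt ν))) 0

/-- The formulas define operators on all Laurent monomials; on exponents in `ℕ` they agree because
the coefficients vanish wherever an exponent would become negative. -/
theorem soOp_extends (hs : s ≠ 0) (hq : NotRootOfUnity s) (g : SoGen (N / 2)) :
    Extends hs hq (soOp s N g) (soExt s N g) := by
  cases g with
  | E i =>
    simp only [soOp, soExt]
    split_ifs
    · exact raiseOp_extends hs hq _ _
    · exact raiseOdd_extends hs hq _ _
    · exact raiseOp_extends hs hq _ _
  | F i =>
    simp only [soOp, soExt]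
    split_ifs
    · exact lowerOp_extends hs hq _ _
    · exact lowerOdd_extends hs hq _ _
    · exact lowerOp_extends hs hq _ _
  | K i =>
    refine monoOp_extends hs hq fun ν => ?_
    rw [toLaurent_smul_mono, soExt, shiftOp_single, add_zero, mul_one]
    rfl
  | Kinv i =>
    refine monoOp_extends hs hq fun ν => ?_
    rw [toLaurent_smul_mono, soExt, shiftOp_single, add_zero, mul_one]
    rfl

theorem qPowGamma_extends (hs : s ≠ 0) (hq : NotRootOfUnity s) (c : ℤ) :
    Extends hs hq (qPowGamma s N c) (shiftOp (fun ν => qp s (c * totalDeg ν)) 0) := by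
  refine monoOp_extends hs hq fun ν => ?_
  rw [toLaurent_smul_mono, shiftOp_single, add_zero, mul_one]
  simp [totalDeg, lin, toLat, qp]

/-- The value `q ^ ρ_1 + q ^ (-ρ_1)`. -/
def radNorm (s : ℂ) (N : ℕ) : ℂ := s ^ ((N : ℤ) - 2) + s ^ (-((N : ℤ) - 2))

/-- By `sum_interval`, left multiplication by `Q` is a weighted sum over the pairs `{j, j'}` in
which each summand only raises the exponents at `j` and `j'`. -/
theorem QHat_extends (hs : s ≠ 0) (hq : NotRootOfUnity s) :
    Extends hs hq (QHat s N) (radNorm s N • radSum s N 0) := by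
  have h1 : Extends hs hq (QHat s N) (∑ i : Fin N, s ^ twoRho i.rev • (xOp s i * xOp s i.rev)) :=
    Extends.sum _ fun i => ((mulLeft_extends hs hq i).mul (mulLeft_extends hs hq i.rev)).smul _
  refine h1.congr ?_
  have h2 := sum_xOp_mul_xOp_rev (N := N) hs hq (Nat.zero_le _)
  have h3 : radOp s N 0 = radSum s N 0 := by
    have : shiftOp (fun ν : Lat N => (qp s (0 : ℕ))⁻¹ * (qp s (2 * leftSum 0 ν))⁻¹) 0 = 1 := by
      refine Finsupp.lhom_ext fun ν c => ?_
      simp [leftSum, lin, qp_zero]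
    rw [radOp, this, one_mul]
  simp only [zero_le, and_self, Finset.filter_true, Nat.cast_zero, mul_zero, sub_zero] at h2
  rw [h2, h3, radNorm]

end

section

variable {s : ℂ} {N : ℕ}

/-! ### The Laplace operator on Laurent monomials -/

/-- The numerical part of the weight with which the Laplace operator lowers the exponents at `j`
and `j'`. -/
def lapCoeff (s : ℂ) {N : ℕ} (j : Fin N) (ν : Lat N) : ℂ :=
  if j = j.rev then
    (s + s⁻¹)⁻¹ * (qNumOne s (ν j - 1) * qNumOne s (ν j) * qp s (1 - ν j))
  else qNum s (ν j) * qNum s (ν j.rev)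

/-- The summand of the Laplace operator that lowers the exponents at `j` and `j'`. -/
def lapTerm (s : ℂ) {N : ℕ} (j : Fin N) : Module.End ℂ (LaurentSpace N) :=
  shiftOp (fun ν => qp s (j : ℕ) * lapCoeff s j ν * qp s (outerSum j ν))
    (-(Pi.single j 1 + Pi.single j.rev 1))

/-- The part of the Laplace operator that involves only lowering inside `[k, k']`. -/
def lapSum (s : ℂ) (N k : ℕ) : Module.End ℂ (LaurentSpace N) :=
  ∑ j ∈ pairsFrom N k, lapTerm s j

/-- The sum of the exponents to the right of `i`. -/
def rightSum {N : ℕ} (i : ℕ) (ν : Lat N) : ℤ := lin (fun l => if i < (l : ℕ) then 1 else 0) ν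

/-- The extension of `partialD`. -/
def dOp (s : ℂ) {N : ℕ} (i : Fin N) : Module.End ℂ (LaurentSpace N) :=
  if i < i.rev then shiftOp (fun ν => qNum s (ν i) * qp s (rightSum i ν)) (-Pi.single i 1)
  else if i = i.rev then
    shiftOp (fun ν => qNumOne s (ν i) * qp s (rightSum i ν)) (-Pi.single i 1)
  else
    shiftOp (fun ν => qNum s (ν i) * qp s (ν i.rev + rightSum i ν)) (-Pi.single i 1) +
      ((s ^ 2 - (s ^ 2)⁻¹) * (qp s (i.rev : ℕ))⁻¹) •
        (shiftOp (fun ν => (qp s (leftSum i.rev ν))⁻¹) (Pi.single i.rev 1) *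
          lapSum s N (i.rev + 1))

theorem lapSum_eq_add {k : Fin N} (hk : (k : ℕ) ≤ (k.rev : ℕ)) :
    lapSum s N k = lapTerm s k + lapSum s N (k + 1) := by
  have : pairsFrom N k = insert k (pairsFrom N (k + 1)) := by
    ext j
    simp only [mem_pairsFrom, Finset.mem_insert, Fin.ext_iff]
    have := Fin.val_rev k; have := Fin.val_rev j
    omega
  rw [lapSum, this, Finset.sum_insert (by simp [mem_pairsFrom]), lapSum]

theorem lapSum_eq_zero {k : ℕ} (hk : N < 2 * k + 1) : lapSum s N k = 0 := by
  rw [lapSum, Finset.sum_eq_zero]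
  intro j hj
  rw [mem_pairsFrom, Fin.val_rev] at hj
  omega

theorem sum_toLat_eq_lin (S : Finset (Fin N)) (ν : Fin N → ℕ) :
    ∑ l ∈ S, (ν l : ℤ) = lin (fun l => if l ∈ S then 1 else 0) (toLat ν) := by
  simp [lin, toLat]

theorem sum_Ioi_eq (i : Fin N) (ν : Fin N → ℕ) :
    ∑ l ∈ Finset.Ioi i, (ν l : ℤ) = rightSum i (toLat ν) := by
  rw [sum_toLat_eq_lin, rightSum]
  simp only [Finset.mem_Ioi, Fin.lt_def]

theorem partialD_extends (hs : s ≠ 0) (hq : NotRootOfUnity s) (i : Fin N) :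
    Extends hs hq (partialD s i) (dOp s i) := by
  have hiv := Fin.val_rev i
  refine monoOp_extends hs hq fun ν => ?_
  unfold dOp
  simp only [sum_Ioi_eq, zpow_eq_qp]
  split_ifs with h1 h2
  · rw [toLaurent_smul_mono, shiftOp_single, mul_one]
    refine single_toLat_eq rfl fun h => ?_
    rw [toLat_sub_single (one_le_of_qNum_ne (left_ne_zero_of_mul h)), sub_eq_add_neg]
    rfl
  · rw [toLaurent_smul_mono, shiftOp_single, mul_one]
    refine single_toLat_eq rfl fun h => ?_
    rw [toLat_sub_single (one_le_of_qNumOne_ne (left_ne_zero_of_mul h)), sub_eq_add_neg]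
    rfl
  · have hlt : (i.rev : ℕ) < i := by
      rcases lt_trichotomy i i.rev with h | h | h
      · exact absurd h h1
      · exact absurd h h2
      · exact h
    set k := i.rev with hk
    have hkr : k.rev = i := by rw [hk, Fin.rev_rev]
    rw [map_add, map_add, map_sum, map_sum, toLaurent_smul_mono, LinearMap.add_apply, add_assoc]
    refine congrArg₂ _ ?_ ?_
    · rw [shiftOp_single, mul_one]
      refine single_toLat_eq rfl fun h => ?_
      rw [toLat_sub_single (one_le_of_qNum_ne (left_ne_zero_of_mul h)), sub_eq_add_neg]
      rfl
    · have hpairs : pairsFrom N (k + 1) =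
          (Finset.univ.filter fun j : Fin N => k < j ∧ j < j.rev) ∪
            Finset.univ.filter fun j : Fin N => j = j.rev := by
        ext j
        have := Fin.val_rev j
        simp only [mem_pairsFrom, Finset.mem_union, Finset.mem_filter, Finset.mem_univ, true_and,
          Fin.lt_def, Fin.ext_iff]
        omega
      have hdisj : Disjoint (Finset.univ.filter fun j : Fin N => k < j ∧ j < j.rev)
          (Finset.univ.filter fun j : Fin N => j = j.rev) := by
        rw [Finset.disjoint_left]
        intro j hj hj'
        exact (Finset.mem_filter.1 hj).2.2.ne (Finset.mem_filter.1 hj').2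
      rw [LinearMap.smul_apply, Module.End.mul_apply, lapSum, hpairs, Finset.sum_union hdisj,
        LinearMap.add_apply, map_add, smul_add, LinearMap.sum_apply, LinearMap.sum_apply, map_sum,
        map_sum, Finset.smul_sum, Finset.smul_sum]
      refine congrArg₂ _ (Finset.sum_congr rfl fun j hj => ?_) (Finset.sum_congr rfl fun m hm => ?_)
      · obtain ⟨hkj, hjr⟩ := (Finset.mem_filter.1 hj).2
        have hjv := Fin.val_rev j
        rw [Fin.lt_def] at hkj hjr
        rw [toLaurent_smul_mono, lapTerm, shiftOp_single, shiftOp_single, Finsupp.smul_single,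
          mul_one]
        refine single_toLat_eq ?_ fun h => ?_
        · rw [lapCoeff, if_neg (fun e => by rw [← e] at hjr; omega), smul_eq_mul]
          have e1 : s ^ (twoRho k - twoRho j) = qp s (j : ℕ) * (qp s (k : ℕ))⁻¹ := by
            rw [twoRho, twoRho, if_pos (Fin.lt_def.2 (by rw [hkr]; exact hlt)),
              if_pos (Fin.lt_def.2 hjr), ← qp_sub hs, ← zpow_two_mul_eq_qp]
            congr 1
            ring
          have e2 : (∑ l ∈ Finset.Ico k j, (ν l : ℤ)) + rightSum (j.rev : ℕ) (toLat ν) =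
              outerSum j (toLat ν) - leftSum k (toLat ν) := by
            rw [sum_toLat_eq_lin]
            simp only [rightSum, outerSum, leftSum, lin, ← Finset.sum_add_distrib,
              ← Finset.sum_sub_distrib, ← add_mul, ← sub_mul]
            refine Finset.sum_congr rfl fun l _ => ?_
            congr 1
            have := Fin.val_rev l
            have := l.2
            simp only [Finset.mem_Ico, Fin.lt_def, Fin.le_def]
            split_ifs <;> omega
          have e3 : leftSum (k : ℕ) (toLat ν + -(Pi.single j 1 + Pi.single j.rev 1)) =
              leftSum k (toLat ν) := by
            simp only [leftSum, lin_add, lin_neg, lin_single]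
            rw [if_neg (by omega), if_neg (by omega)]
            ring
          rw [e1, e2, e3, qp_sub hs]
          simp only [toLat]
          ring
        · have hj1 := one_le_of_qNum_ne (left_ne_zero_of_mul (left_ne_zero_of_mul
            (left_ne_zero_of_mul (left_ne_zero_of_mul h))))
          have hj2 := one_le_of_qNum_ne (right_ne_zero_of_mul (left_ne_zero_of_mul
            (left_ne_zero_of_mul (left_ne_zero_of_mul h))))
          have hne : j.rev ≠ j := fun e => by rw [e] at hjr; omega
          rw [toLat_sub_single, toLat_sub_single, toLat_add, toLat_single]
          · push_cast; abel
          · rw [Pi.add_apply]; omega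
          · rw [Pi.sub_apply, Pi.add_apply, Pi.single_eq_of_ne hne]; omega
      · have hmr := (Finset.mem_filter.1 hm).2
        have hmv := Fin.val_rev m
        have hmv' : (m : ℕ) = m.rev := congrArg Fin.val hmr
        rw [toLaurent_smul_mono, lapTerm, shiftOp_single, shiftOp_single, Finsupp.smul_single,
          mul_one]
        refine single_toLat_eq ?_ fun h => ?_
        · rw [lapCoeff, if_pos hmr, smul_eq_mul]
          have e1 : s ^ (twoRho k + 4) = qp s (m : ℕ) * (qp s (k : ℕ))⁻¹ * s ^ 3 := by
            rw [twoRho, if_pos (Fin.lt_def.2 (by rw [hkr]; exact hlt)), ← qp_sub hs,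
              ← zpow_odd hs]
            congr 1
            push_cast
            omega
          have e2 : (∑ l ∈ Finset.Ici k, (ν l : ℤ)) - 2 * ν m =
              outerSum m (toLat ν) - leftSum k (toLat ν) - ν m := by
            have e0 : (ν m : ℤ) = lin (Pi.single m 1) (toLat ν) := by
              simp [lin, Pi.single_apply, toLat]
            rw [sum_toLat_eq_lin, e0, ← sub_eq_zero]
            simp only [outerSum, leftSum, lin, Finset.mul_sum,
              ← Finset.sum_sub_distrib]
            refine Finset.sum_eq_zero fun l _ => ?_
            have := Fin.val_rev l
            have := l.2
            simp only [Finset.mem_Ici, Fin.le_def, Pi.single_apply, Fin.ext_iff]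
            split_ifs <;> first | (exfalso; omega) | ring
          have e3 : leftSum (k : ℕ) (toLat ν + -(Pi.single m 1 + Pi.single m.rev 1)) =
              leftSum k (toLat ν) := by
            simp only [leftSum, lin_add, lin_neg, lin_single]
            rw [if_neg (by omega), if_neg (by omega)]
            ring
          rw [e1, e2, e3, qp_sub hs, qp_sub hs, qp_sub hs, qp_one]
          simp only [toLat]
          have := sq_add_one_ne_zero hs hq
          have h3 : 1 + s ^ 2 ≠ 0 := by rwa [add_comm]
          have h4 : s + s⁻¹ = (1 + s ^ 2) / s := by field_simp; ring
          rw [h4]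
          field_simp
        · have hm0 := right_ne_zero_of_mul (left_ne_zero_of_mul
            (left_ne_zero_of_mul (left_ne_zero_of_mul h)))
          have hm1 := left_ne_zero_of_mul (left_ne_zero_of_mul
            (left_ne_zero_of_mul (left_ne_zero_of_mul h)))
          have h2 : 2 ≤ ν m := by
            have := one_le_of_qNumOne_ne hm0
            have : ν m ≠ 1 := fun e => hm1 (by rw [e]; exact qNumOne_zero)
            omega
          rw [toLat_sub_single, toLat_add, toLat_single, ← hmr, ← Pi.single_add]
          · push_cast; abel
          · rw [Pi.add_apply]; omega

theorem mul_lapSum {A : Module.End ℂ (LaurentSpace N)} {k : ℕ} (t : ℂ)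
    (h : ∀ j : Fin N, k ≤ (j : ℕ) → (j : ℕ) ≤ (j.rev : ℕ) →
      A * lapTerm s j = t • (lapTerm s j * A)) :
    A * lapSum s N k = t • (lapSum s N k * A) := by
  rw [lapSum, Finset.mul_sum, Finset.sum_mul, Finset.smul_sum]
  exact Finset.sum_congr rfl fun j hj => h j (mem_pairsFrom.1 hj).1 (mem_pairsFrom.1 hj).2

/-- The numerical part of the weight of `lapTerm` depends only on the exponents at `j` and `j'`. -/
theorem lapCoeff_congr {j : Fin N} {ν μ : Lat N} (h1 : ν j = μ j) (h2 : ν j.rev = μ j.rev) :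
    lapCoeff s j ν = lapCoeff s j μ := by
  rw [lapCoeff, lapCoeff, h1, h2]

/-- The part of the Laplace operator belonging to `[k, k']`, normalized like `radOp`. -/
def lapOp (s : ℂ) (N k : ℕ) : Module.End ℂ (LaurentSpace N) :=
  lapSum s N k * shiftOp (fun ν => (qp s (k + 1))⁻¹ * qp s (totalDeg ν - 2 * leftSum k ν)) 0

theorem lapOp_eq_zero {k : ℕ} (hk : N < 2 * k + 1) : lapOp s N k = 0 := by
  rw [lapOp, lapSum_eq_zero hk, zero_mul]

theorem totalDeg_eq (k : Fin N) (ν : Lat N) :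
    totalDeg ν = leftSum k ν + ν k + rightSum k ν := by
  have : ν k = lin (Pi.single k 1) ν := by simp [lin, Pi.single_apply]
  rw [this]
  simp only [totalDeg, leftSum, rightSum, lin, ← Finset.sum_add_distrib, ← add_mul]
  refine Finset.sum_congr rfl fun l _ => ?_
  congr 1
  simp only [Pi.single_apply, Fin.ext_iff]
  split_ifs <;> omega

section

variable {k : Fin N}

theorem dOp_of_lt (hk : (k : ℕ) < (k.rev : ℕ)) :
    dOp s k = shiftOp (fun ν => qNum s (ν k) * qp s (rightSum k ν)) (-Pi.single k 1) :=
  if_pos (Fin.lt_def.2 hk)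

theorem dOp_rev_of_lt (hk : (k : ℕ) < (k.rev : ℕ)) :
    dOp s k.rev = shiftOp (fun ν => qNum s (ν k.rev) * qp s (ν k + rightSum k.rev ν))
        (-Pi.single k.rev 1) +
      ((s ^ 2 - (s ^ 2)⁻¹) * (qp s (k : ℕ))⁻¹) •
        (shiftOp (fun ν => (qp s (leftSum k ν))⁻¹) (Pi.single k 1) * lapSum s N (k + 1)) := by
  rw [dOp, Fin.rev_rev, if_neg (fun h => absurd (Fin.lt_def.1 h) hk.not_gt),
    if_neg (fun h => by rw [h] at hk; omega)]

theorem dOp_lapSum (hs : s ≠ 0) (hk : (k : ℕ) < (k.rev : ℕ)) :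
    dOp s k * lapSum s N (k + 1) = (s ^ 2)⁻¹ • (lapSum s N (k + 1) * dOp s k) := by
  refine mul_lapSum _ fun j hkj hj => ?_
  have h1 := Fin.val_rev j; have h2 := Fin.val_rev k
  rw [dOp_of_lt hk]
  refine shiftOp_comm _ fun ν => ?_
  rw [lapCoeff_congr (ν := ν + -Pi.single k 1) (μ := ν)]
  · simp only [rightSum, outerSum, lin_add, lin_neg, lin_single, Pi.add_apply, Pi.neg_apply,
      Pi.single_apply, Fin.ext_iff]
    rw [if_neg (show ¬ (k : ℕ) = j by omega), if_neg (show ¬ (k : ℕ) = j.rev by omega),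
      if_pos (show (k : ℕ) < j by omega), if_pos (show (k : ℕ) < j.rev by omega),
      if_pos (show (k : ℕ) < j ∨ (k.rev : ℕ) < j by omega)]
    simp only [mul_one, add_zero, neg_zero, qp_add hs, qp_neg, qp_one, neg_add_rev]
    field_simp
  · rw [Pi.add_apply, Pi.neg_apply, Pi.single_apply, if_neg (by rw [Fin.ext_iff]; omega),
      neg_zero, add_zero]
  · rw [Pi.add_apply, Pi.neg_apply, Pi.single_apply, if_neg (by rw [Fin.ext_iff]; omega),
      neg_zero, add_zero]

/-- A diagonal operator whose weight is changed by the factor `t` by each summand. -/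
theorem diag_lapSum {φ : Lat N → ℂ} {m : ℕ} (t : ℂ)
    (h : ∀ j : Fin N, m ≤ (j : ℕ) → (j : ℕ) ≤ (j.rev : ℕ) → ∀ ν,
      φ (ν + -(Pi.single j 1 + Pi.single j.rev 1)) = t * φ ν) :
    shiftOp φ 0 * lapSum s N m = t • (lapSum s N m * shiftOp φ 0) :=
  mul_lapSum _ fun j hm hj => shiftOp_comm _ fun ν => by rw [h j hm hj, add_zero]; ring

/-- The first hypothesis of `sum_interval`, for `y_i = ∂_{i'} ∂_i`. -/
theorem dOp_mul_rev_sub (hs : s ≠ 0) (hq : NotRootOfUnity s) (hk : (k : ℕ) < (k.rev : ℕ)) :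
    dOp s k * dOp s k.rev - dOp s k.rev * dOp s k =
      (s ^ 2 - (s ^ 2)⁻¹) • lapOp s N (k + 1) := by
  have h2 := Fin.val_rev k
  have hd := pow_four_sub_one_ne_zero hs hq
  set S := shiftOp (fun ν => qNum s (ν k.rev) * qp s (ν k + rightSum k.rev ν))
        (-Pi.single k.rev 1) with hS
  set Y := shiftOp (fun ν => (qp s (leftSum k ν))⁻¹) (Pi.single k 1) with hY
  set G := lapSum s N (k + 1) with hG
  set c := (s ^ 2 - (s ^ 2)⁻¹) * (qp s (k : ℕ))⁻¹ with hc
  have hne : k.rev ≠ k := fun h => by rw [h] at hk; omega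
  have e1 : dOp s k * S = S * dOp s k := by
    rw [dOp_of_lt hk]
    refine shiftOp_commute fun ν => ?_
    simp only [rightSum, lin_add, lin_neg, lin_single, Pi.add_apply, Pi.neg_apply,
      Pi.single_eq_same, Pi.single_eq_of_ne hne, Pi.single_eq_of_ne hne.symm, if_pos hk,
      if_neg hk.not_gt, mul_one, neg_zero, add_zero, qp_add hs, qp_neg, qp_one]
    ring
  have e2 : G * dOp s k = s ^ 2 • (dOp s k * G) := by
    rw [dOp_lapSum hs hk, smul_smul, mul_inv_cancel₀ (pow_ne_zero 2 hs), one_smul]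
  have e3 : dOp s k * Y - s ^ 2 • (Y * dOp s k) =
      shiftOp (fun ν => qp s (totalDeg ν - 2 * leftSum (k + 1) ν)) 0 := by
    rw [dOp_of_lt hk, hY, shiftOp_mul, shiftOp_mul, shiftOp_smul,
      shiftOp_congr (δ := Pi.single k 1 + -Pi.single k 1) (ε := 0) (by abel) fun _ => rfl,
      shiftOp_congr (δ := -Pi.single k 1 + Pi.single k 1) (ε := 0) (by abel) fun _ => rfl,
      shiftOp_sub]
    refine shiftOp_congr rfl fun ν => ?_
    rw [leftSum_succ, totalDeg_eq k]
    simp only [rightSum, leftSum, lin_add, lin_neg, lin_single, Pi.add_apply,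
      Pi.single_eq_same, lt_self_iff_false, if_false, mul_one, neg_zero, add_zero,
      qNum_eq, qp_add hs, qp_sub hs, qp_two_mul hs, qp_one]
    have a1 := qp_ne hs (ν k)
    have a2 := qp_ne hs (lin (fun l => if (l : ℕ) < k then 1 else 0) ν)
    have a3 := qp_ne hs (lin (fun l => if (k : ℕ) < l then 1 else 0) ν)
    field_simp
    ring
  have e4 : shiftOp (fun ν => qp s (totalDeg ν - 2 * leftSum (k + 1) ν)) 0 * G =
      (qp s 2)⁻¹ • (G * shiftOp (fun ν => qp s (totalDeg ν - 2 * leftSum (k + 1) ν)) 0) := by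
    refine diag_lapSum _ fun j hm hj ν => ?_
    simp only [totalDeg, leftSum, lin_add, lin_neg, lin_single, mul_one]
    rw [if_neg (show ¬ (j : ℕ) < k + 1 by omega), if_neg (show ¬ (j.rev : ℕ) < k + 1 by omega),
      ← qp_neg, ← qp_add hs]
    congr 1; ring
  have e5 : lapOp s N (k + 1) = (qp s (k + 2 : ℕ))⁻¹ •
      (G * shiftOp (fun ν => qp s (totalDeg ν - 2 * leftSum (k + 1) ν)) 0) := by
    rw [lapOp, ← mul_smul_comm, shiftOp_smul]
    refine congrArg _ (shiftOp_congr rfl fun ν => ?_)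
    push_cast
    ring_nf
  have e6 : dOp s k * (Y * G) - Y * G * dOp s k =
      (dOp s k * Y - s ^ 2 • (Y * dOp s k)) * G := by
    rw [mul_assoc Y, e2, sub_mul (dOp s k * Y), mul_smul_comm, smul_mul_assoc, mul_assoc, mul_assoc]
  rw [dOp_rev_of_lt hk, mul_add, add_mul, e1, mul_smul_comm, smul_mul_assoc,
    add_sub_add_left_eq_sub (c • (dOp s k * (Y * G))), ← smul_sub c (dOp s k * (Y * G)), e6, e3, e4,
      e5, smul_smul, smul_smul]
  congr 1
  push_cast
  rw [qp_add hs, hc, mul_inv]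
  ring

/-- The second hypothesis of `sum_interval`, for `y_i = ∂_{i'} ∂_i`. -/
theorem lapOp_eq_add (hs : s ≠ 0) (hq : NotRootOfUnity s) (hk : (k : ℕ) < (k.rev : ℕ)) :
    lapOp s N k = dOp s k.rev * dOp s k + s ^ 2 • lapOp s N (k + 1) := by
  have h2 := Fin.val_rev k
  have hd := pow_four_sub_one_ne_zero hs hq
  set Y := shiftOp (fun ν => (qp s (leftSum k ν))⁻¹) (Pi.single k 1) with hY
  set G := lapSum s N (k + 1) with hG
  set c := (s ^ 2 - (s ^ 2)⁻¹) * (qp s (k : ℕ))⁻¹ with hc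
  have hne : k.rev ≠ k := fun h => by rw [h] at hk; omega
  have e1 : lapTerm s k *
        shiftOp (fun ν => (qp s (k + 1))⁻¹ * qp s (totalDeg ν - 2 * leftSum k ν)) 0 =
      shiftOp (fun ν => qNum s (ν k.rev) * qp s (ν k + rightSum k.rev ν)) (-Pi.single k.rev 1) *
        dOp s k := by
    rw [dOp_of_lt hk, lapTerm, shiftOp_mul, shiftOp_mul]
    refine shiftOp_congr (by abel) fun ν => ?_
    have hout : outerSum (k : ℕ) ν = leftSum k ν + rightSum k.rev ν := by
      simp only [outerSum, leftSum, rightSum, lin, ← Finset.sum_add_distrib, ← add_mul]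
      refine Finset.sum_congr rfl fun l _ => ?_
      have := Fin.val_rev l; have := l.2
      congr 1
      split_ifs <;> omega
    rw [lapCoeff, if_neg hne.symm, add_zero, hout, totalDeg_eq k]
    simp only [rightSum, lin_add, lin_neg, lin_single, Pi.add_apply, Pi.neg_apply,
      Pi.single_eq_same, Pi.single_eq_of_ne hne, if_neg hk.not_gt, mul_one, neg_zero,
      add_zero, qp_add hs, qp_sub hs, qp_two_mul hs, qp_one, qp_neg]
    field_simp [qp_ne hs]
  have e2 : G * dOp s k = s ^ 2 • (dOp s k * G) := by
    rw [dOp_lapSum hs hk, smul_smul, mul_inv_cancel₀ (pow_ne_zero 2 hs), one_smul]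
  have e3 : Y * dOp s k =
      shiftOp (fun ν => (qp s (leftSum k ν))⁻¹ * (qNum s (ν k) * qp s (rightSum k ν))) 0 := by
    rw [dOp_of_lt hk, hY, shiftOp_mul]
    refine shiftOp_congr (by abel) fun ν => ?_
    simp only [leftSum, lin_add, lin_neg, lin_single, lt_self_iff_false, if_false, neg_zero,
      zero_mul, add_zero]
  have e4 : Y * dOp s k * G = (qp s 2)⁻¹ • (G * (Y * dOp s k)) := by
    rw [e3]
    refine diag_lapSum _ fun j hm hj ν => ?_
    have h1 := Fin.val_rev j
    simp only [rightSum, leftSum, lin_add, lin_neg, lin_single, mul_one, Pi.add_apply,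
      Pi.neg_apply, Pi.single_apply, Fin.ext_iff]
    rw [if_neg (show ¬ (j : ℕ) < k by omega), if_neg (show ¬ (j.rev : ℕ) < k by omega),
      if_pos (show (k : ℕ) < j by omega), if_pos (show (k : ℕ) < j.rev by omega),
      if_neg (show ¬ (k : ℕ) = j by omega), if_neg (show ¬ (k : ℕ) = j.rev by omega)]
    simp only [add_zero, neg_zero, qp_add hs, neg_add_rev, qp_neg, qp_one, qp_two]
    field_simp
  have e5 : Y * G * dOp s k = (s ^ 2)⁻¹ • (G * (Y * dOp s k)) := by
    rw [mul_assoc, e2, mul_smul_comm, ← mul_assoc, e4, smul_smul, qp_two]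
    congr 1
    field_simp
  have e6 : shiftOp (fun ν => (qp s (k + 1))⁻¹ * qp s (totalDeg ν - 2 * leftSum k ν)) 0 =
      (c * (s ^ 2)⁻¹) • (Y * dOp s k) + s ^ 2 •
        shiftOp (fun ν => (qp s ((k + 1 : ℕ) + 1))⁻¹ *
          qp s (totalDeg ν - 2 * leftSum (k + 1) ν)) 0 := by
    rw [e3, shiftOp_smul, shiftOp_smul, shiftOp_add]
    refine shiftOp_congr rfl fun ν => ?_
    rw [leftSum_succ, totalDeg_eq k, hc]
    push_cast
    simp only [qNum_eq, qp_add hs, qp_sub hs, qp_two_mul hs, qp_one]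
    have a1 := qp_ne hs (ν k)
    have a2 := qp_ne hs (leftSum k ν)
    have a3 := qp_ne hs (rightSum k ν)
    have a4 := qp_ne hs (k : ℕ)
    field_simp
    ring
  rw [lapOp, lapSum_eq_add hk.le, add_mul, e1, dOp_rev_of_lt hk, add_mul, smul_mul_assoc, e5,
    smul_smul, add_assoc, lapOp, e6, mul_add, mul_smul_comm, mul_smul_comm]

theorem lapOp_middle (hs : s ≠ 0) (hq : NotRootOfUnity s) (hk : k = k.rev) :
    dOp s k * dOp s k = (s + s⁻¹) • lapOp s N k := by
  have hv : (k : ℕ) = k.rev := congrArg Fin.val hk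
  have h1 := Fin.val_rev k
  have h2 := sq_add_one_ne_zero hs hq
  have hd : dOp s k =
      shiftOp (fun ν => qNumOne s (ν k) * qp s (rightSum k ν)) (-Pi.single k 1) := by
    rw [dOp, if_neg (fun h => by rw [← hk] at h; exact lt_irrefl _ h), if_pos hk]
  rw [hd, lapOp, lapSum_eq_add hv.le, lapSum_eq_zero (by omega), add_zero, lapTerm, shiftOp_mul,
    shiftOp_mul, shiftOp_smul, ← hk]
  refine shiftOp_congr (by abel) fun ν => ?_
  have hout : outerSum (k : ℕ) ν = leftSum k ν + rightSum k ν := by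
    simp only [outerSum, leftSum, rightSum, lin, ← Finset.sum_add_distrib, ← add_mul]
    refine Finset.sum_congr rfl fun l _ => ?_
    have := Fin.val_rev l; have := l.2
    congr 1
    split_ifs <;> omega
  rw [lapCoeff, if_pos hk, add_zero, hout, totalDeg_eq k]
  simp only [rightSum, lin_sub, lin_single, Pi.sub_apply,
    Pi.single_eq_same, lt_self_iff_false, if_false, mul_one, sub_zero,
    qp_add hs, qp_sub hs, qp_two_mul hs, qp_one, ← sub_eq_add_neg]
  have a1 := qp_ne hs (ν k)
  have a2 := qp_ne hs (leftSum k ν)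
  have a3 := qp_ne hs (k : ℕ)
  have a4 : s + s⁻¹ ≠ 0 := by simpa using zpow_add_zpow_neg_ne_zero hs hq 1
  field_simp

end

/-- By `sum_interval`, the `q`-Laplace operator is a weighted sum over the pairs `{j, j'}` in which
each summand only lowers the exponents at `j` and `j'`. -/
theorem laplace_extends (hs : s ≠ 0) (hq : NotRootOfUnity s) :
    Extends hs hq (laplace s N) (radNorm s N •
      (lapSum s N 0 * shiftOp (fun ν => (s ^ 2)⁻¹ * qp s (totalDeg ν)) 0)) := by
  have h1 : Extends hs hq (laplace s N) (∑ i : Fin N, s ^ twoRho i • (dOp s i * dOp s i.rev)) :=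
    Extends.sum _ fun i => ((partialD_extends hs hq i).mul (partialD_extends hs hq i.rev)).smul _
  refine h1.congr ?_
  have h2 := sum_interval hs (fun i : Fin N => dOp s i.rev * dOp s i) (lapOp s N)
    (fun k hk => by rw [Fin.rev_rev]; exact dOp_mul_rev_sub hs hq hk)
    (fun k hk => lapOp_eq_add hs hq hk)
    (fun k hk => by rw [← hk]; exact lapOp_middle hs hq hk)
    (fun h => lapOp_eq_zero (by omega)) 0 (Nat.zero_le _)
  simp only [zero_le, and_self, Finset.filter_true, Nat.cast_zero, mul_zero, sub_zero] at h2
  rw [radNorm, ← Equiv.sum_comp Fin.revPerm]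
  simp only [Fin.revPerm_apply, Fin.rev_rev]
  rw [h2, lapOp]
  congr 2
  refine shiftOp_congr rfl fun ν => ?_
  have : leftSum 0 ν = 0 := by simp [leftSum, lin]
  rw [this, Nat.cast_zero, zero_add, mul_zero, sub_zero, qp_one]

/-! ### The relations of `U_q(sl_2)` -/

/-- The pairs `{j, j'}` act as tensor factors of a representation of `U_q(sl_2)`, so the
commutator telescopes. -/
theorem radSum_lapSum_commutator (hs : s ≠ 0) (hq : NotRootOfUnity s) (k : ℕ) (hk : k ≤ N / 2) :
    radSum s N k * lapSum s N k - lapSum s N k * radSum s N k =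
      shiftOp (fun ν => (s ^ 2 - (s ^ 2)⁻¹)⁻¹ *
        (qp s (2 * k - 1 + 2 * outerSum k ν - totalDeg ν) - qp s (N - 1 + totalDeg ν))) 0 := by
  have hd := pow_four_sub_one_ne_zero hs hq
  induction hm : N / 2 - k generalizing k with
  | zero =>
    obtain rfl : k = N / 2 := by omega
    have hout (ν : Lat N) : outerSum (N / 2) ν + (if h : N % 2 = 1 then ν ⟨N / 2,
      by omega⟩ else 0) =
        totalDeg ν := by
      have e0 : (if h : N % 2 = 1 then ν ⟨N / 2, by omega⟩ else 0) =
          lin (fun l => if N % 2 = 1 ∧ (l : ℕ) = N / 2 then 1 else 0) ν := by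
        split_ifs with h
        · have : (fun l : Fin N => if N % 2 = 1 ∧ (l : ℕ) = N / 2 then (1 : ℤ) else 0) =
              Pi.single ⟨N / 2, by omega⟩ 1 := by
            ext l
            simp only [Pi.single_apply, Fin.ext_iff, h, true_and]
          rw [this]
          simp [lin, Pi.single_apply]
        · simp [lin, h]
      rw [e0]
      simp only [totalDeg, outerSum, lin, ← Finset.sum_add_distrib, ← add_mul]
      refine Finset.sum_congr rfl fun l _ => ?_
      have := Fin.val_rev l; have := l.2
      congr 1
      split_ifs <;> omega
    rcases Nat.mod_two_eq_zero_or_one N with hN | hN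
    · rw [radSum_eq_zero (by omega), lapSum_eq_zero (by omega), mul_zero,
        sub_self (0 : Module.End ℂ (LaurentSpace N))]
      refine (shiftOp_eq_zero fun ν => ?_).symm
      have := hout ν
      rw [dif_neg (by omega), add_zero] at this
      rw [this, show 2 * ((N / 2 : ℕ) : ℤ) = N by omega]
      ring_nf
    · have hlt : N / 2 < N := by omega
      have hmr : (⟨N / 2, hlt⟩ : Fin N) = Fin.rev ⟨N / 2, hlt⟩ := by
        rw [Fin.ext_iff, Fin.val_rev]; simp only; omega
      rw [show radSum s N (N / 2) = radSum s N ((⟨N / 2, hlt⟩ : Fin N) : ℕ) from rfl,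
        show lapSum s N (N / 2) = lapSum s N ((⟨N / 2, hlt⟩ : Fin N) : ℕ) from rfl,
        radSum_eq_add (congrArg Fin.val hmr).le, lapSum_eq_add (congrArg Fin.val hmr).le,
        radSum_eq_zero (by simp only; omega), lapSum_eq_zero (by simp only; omega), add_zero,
        add_zero, radTerm, lapTerm, shiftOp_mul, shiftOp_mul, ← hmr,
        shiftOp_congr (δ := Pi.single _ 1 + Pi.single _ 1 + _) (ε := 0) (by abel) fun _ => rfl,
        shiftOp_congr (ε := 0) (by abel) fun _ => rfl, shiftOp_sub]
      refine shiftOp_congr rfl fun ν => ?_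
      have hin (μ : Lat N) : innerSum (N / 2) μ = 0 := by
        unfold innerSum lin
        refine Finset.sum_eq_zero fun l _ => ?_
        have := Fin.val_rev l
        dsimp only
        rw [if_neg (by omega), zero_mul]
      have h1 := hout ν
      rw [dif_pos hN] at h1
      set o := outerSum (N / 2) ν with ho
      have hout' : outerSum (N / 2) (ν + (Pi.single ⟨N / 2, hlt⟩ 1 + Pi.single ⟨N / 2, hlt⟩ 1)) =
          o := by
        rw [ho]
        simp only [outerSum, lin_add, lin_single]
        rw [if_neg (by rw [← hmr]; simp)]
        ring
      dsimp only
      rw [if_pos rfl, hin, hin, lapCoeff, lapCoeff, if_pos hmr, if_pos hmr, hout', ← h1,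
        show (N : ℤ) = (N / 2 : ℕ) + (N / 2 : ℕ) + 1 by omega]
      simp only [Pi.add_apply, Pi.single_eq_same, qNumOne_eq, qp_add hs, qp_sub hs, qp_two_mul hs,
        qp_one, qp_zero]
      have b1 := qp_ne hs (ν ⟨N / 2, hlt⟩)
      have b2 := qp_ne hs o
      have b3 := qp_ne hs (N / 2 : ℕ)
      have b4 := sq_add_one_ne_zero hs hq
      have b5 := one_sub_sq_ne_zero hq
      rw [show s + s⁻¹ = (s ^ 2 + 1) / s by field_simp]
      rw [show s ^ 2 - (s ^ 2)⁻¹ = -((1 - s ^ 2) * (s ^ 2 + 1) / s ^ 2) by field_simp; ring]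
      field_simp
      ring
  | succ d ih =>
    have hlt : k < N := by omega
    set i : Fin N := ⟨k, hlt⟩ with hi
    have hki : (i : ℕ) = k := rfl
    have hr := Fin.val_rev i
    have hir : (i : ℕ) < (i.rev : ℕ) := by omega
    have hne : i.rev ≠ i := fun h => by rw [h] at hir; omega
    have e1 : radTerm s i * lapSum s N (k + 1) = lapSum s N (k + 1) * radTerm s i := by
      rw [mul_lapSum 1 fun j hkj hj => ?_, one_smul]
      have h1 := Fin.val_rev j
      rw [one_smul]
      refine shiftOp_commute fun ν => ?_
      have hc : lapCoeff s j (ν + (Pi.single i 1 + Pi.single i.rev 1)) = lapCoeff s j ν := by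
        refine lapCoeff_congr ?_ ?_ <;>
        · simp only [Pi.add_apply, Pi.single_apply, Fin.ext_iff]
          rw [if_neg (by omega), if_neg (by omega), add_zero, add_zero]
      rw [hc]
      simp only [innerSum, outerSum, lin_add, lin_neg, lin_single, Fin.rev_rev]
      rw [if_pos (show (i : ℕ) < j ∧ (i : ℕ) < j.rev by omega),
        if_pos (show (i : ℕ) < j.rev ∧ (i : ℕ) < j by omega),
        if_pos (show (i : ℕ) < j ∨ (i.rev : ℕ) < j by omega),
        if_pos (show (i.rev : ℕ) < j ∨ (i : ℕ) < j by omega)]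
      simp only [mul_one, qp_add hs, qp_neg, qp_one, mul_inv, inv_inv]
      ring
    have e2 : radSum s N (k + 1) * lapTerm s i = lapTerm s i * radSum s N (k + 1) := by
      refine (commute_radSum fun j hkj hj => ?_).symm.eq
      have h1 := Fin.val_rev j
      refine shiftOp_commute fun ν => ?_
      have hc : lapCoeff s i (ν + (Pi.single j 1 + Pi.single j.rev 1)) = lapCoeff s i ν := by
        refine lapCoeff_congr ?_ ?_ <;>
        · simp only [Pi.add_apply, Pi.single_apply, Fin.ext_iff]
          rw [if_neg (by omega), if_neg (by omega), add_zero, add_zero]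
      rw [hc]
      simp only [innerSum, outerSum, lin_add, lin_neg, lin_single, Fin.rev_rev]
      rw [if_neg (show ¬ ((j : ℕ) < i ∨ (j.rev : ℕ) < i) by omega),
        if_neg (show ¬ ((j.rev : ℕ) < i ∨ (j : ℕ) < i) by omega),
        if_neg (show ¬ ((j : ℕ) < i ∧ (j : ℕ) < i.rev) by omega),
        if_neg (show ¬ ((j : ℕ) < i.rev ∧ (j : ℕ) < i) by omega)]
      simp only [zero_mul, add_zero, neg_zero]
      ring
    have e3 : radTerm s i * lapTerm s i - lapTerm s i * radTerm s i =
        shiftOp (fun ν => -(qp s (2 * k) * qp s (2 * outerSum k ν + ν i + ν i.rev - totalDeg ν) *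
          qNum s (ν i + ν i.rev + 1))) 0 := by
      rw [radTerm, lapTerm, shiftOp_mul, shiftOp_mul,
        shiftOp_congr (δ := Pi.single _ 1 + Pi.single _ 1 + _) (ε := 0) (by abel) fun _ => rfl,
        shiftOp_congr (δ := -_ + _) (ε := 0) (by abel) fun _ => rfl, shiftOp_sub]
      refine shiftOp_congr rfl fun ν => ?_
      have ht : totalDeg ν = outerSum k ν + ν i + ν i.rev + innerSum k ν := by
        have a1 : ν i = lin (Pi.single i 1) ν := by simp [lin, Pi.single_apply]
        have a2 : ν i.rev = lin (Pi.single i.rev 1) ν := by simp [lin, Pi.single_apply]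
        rw [a1, a2]
        simp only [totalDeg, outerSum, innerSum, lin, ← Finset.sum_add_distrib, ← add_mul]
        refine Finset.sum_congr rfl fun l _ => ?_
        have := Fin.val_rev l; have := l.2
        congr 1
        simp only [Pi.single_apply, Fin.ext_iff]
        split_ifs <;> omega
      have hio (μ : Lat N) (t : ℤ) (h : μ = t • (Pi.single i 1 + Pi.single i.rev 1)) :
          innerSum k (ν + μ) = innerSum k ν ∧ outerSum k (ν + μ) = outerSum k ν := by
        subst h
        have h3 : t • (Pi.single i 1 + Pi.single i.rev 1 : Lat N) =
            Pi.single i t + Pi.single i.rev t := by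
          rw [smul_add, ← Pi.single_smul, ← Pi.single_smul, smul_eq_mul, mul_one]
        rw [h3]
        simp only [innerSum, outerSum, lin_add, lin_single, Fin.rev_rev]
        rw [if_neg (by omega), if_neg (by omega), if_neg (by omega), if_neg (by omega)]
        simp
      rw [hki, (hio _ (-1) (by rw [neg_smul, one_smul])).1, (hio _ 1 (by rw [one_smul])).2,
        if_neg hne.symm, lapCoeff, lapCoeff, if_neg hne.symm, if_neg hne.symm, ht]
      simp only [Pi.add_apply, Pi.single_eq_same, Pi.single_eq_of_ne hne,
        Pi.single_eq_of_ne hne.symm,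
        add_zero, zero_add, qNum_eq, qp_add hs, qp_sub hs, qp_two_mul hs, qp_one]
      have b1 := qp_ne hs (ν i)
      have b2 := qp_ne hs (ν i.rev)
      have b3 := qp_ne hs (innerSum k ν)
      have b4 := qp_ne hs (outerSum k ν)
      field_simp
      ring
    have e4 : radSum s N k = radTerm s i + radSum s N (k + 1) := radSum_eq_add (k := i) hir.le
    have e5 : lapSum s N k = lapTerm s i + lapSum s N (k + 1) := lapSum_eq_add (k := i) hir.le
    have e6 : radSum s N k * lapSum s N k - lapSum s N k * radSum s N k =
        (radTerm s i * lapTerm s i - lapTerm s i * radTerm s i) +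
          (radSum s N (k + 1) * lapSum s N (k + 1) - lapSum s N (k + 1) * radSum s N (k + 1)) := by
      rw [e4, e5, mul_add, add_mul, add_mul, mul_add, add_mul, add_mul, e1, e2]
      abel
    rw [e6, e3, ih (k + 1) (by omega) (by omega), shiftOp_add]
    refine shiftOp_congr rfl fun ν => ?_
    have ho : outerSum (k + 1) ν = outerSum k ν + ν i + ν i.rev := by
      have a1 : ν i = lin (Pi.single i 1) ν := by simp [lin, Pi.single_apply]
      have a2 : ν i.rev = lin (Pi.single i.rev 1) ν := by simp [lin, Pi.single_apply]
      rw [a1, a2]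
      simp only [outerSum, lin, ← Finset.sum_add_distrib, ← add_mul]
      refine Finset.sum_congr rfl fun l _ => ?_
      have := Fin.val_rev l; have := l.2
      congr 1
      simp only [Pi.single_apply, Fin.ext_iff]
      split_ifs <;> omega
    rw [ho]
    push_cast
    simp only [qNum_eq, qp_add hs, qp_sub hs, qp_two_mul hs, qp_one]
    have b1 := qp_ne hs (ν i)
    have b2 := qp_ne hs (ν i.rev)
    have b3 := qp_ne hs (totalDeg ν)
    have b4 := qp_ne hs (outerSum k ν)
    have b5 := qp_ne hs (k : ℕ)
    have b6 := qp_ne hs (N : ℕ)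
    field_simp
    ring

end

section

variable {s : ℂ} {N : ℕ}

/-! ### The natural action commutes with the squared radius and the Laplace operator -/

/-- The positions `a`, `a'`, `b`, `b'` are distinct and the pairs `{a, a'}` and `{b, b'}` are
consecutive, the first one being the outer one.  The left member of the outer pair is `k`. -/
def AdjacentPairs {N : ℕ} (k : ℕ) (a b : Fin N) : Prop :=
  ((a : ℕ) = k ∨ (a.rev : ℕ) = k) ∧ ((b : ℕ) = k + 1 ∨ (b.rev : ℕ) = k + 1) ∧ 2 * k + 3 < N

theorem val_add_rev (j : Fin N) : (j : ℕ) + j.rev + 1 = N := by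
  have := Fin.val_rev j
  have := j.2
  omega

theorem pairsFrom_zero_eq {k l : Fin N} (hk : (k : ℕ) ≤ k.rev) (hl : (l : ℕ) ≤ l.rev)
    (hkl : k ≠ l) : ∃ S : Finset (Fin N), pairsFrom N 0 = insert k (insert l S) ∧
      k ∉ insert l S ∧ l ∉ S ∧ ∀ j ∈ S, j ≠ k ∧ j ≠ l ∧ (j : ℕ) ≤ j.rev := by
  refine ⟨(pairsFrom N 0).filter fun j => j ≠ k ∧ j ≠ l, ?_, ?_, ?_, ?_⟩
  · ext j
    simp only [Finset.mem_insert, Finset.mem_filter, mem_pairsFrom, zero_le, true_and]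
    constructor
    · intro h; tauto
    · rintro (rfl | rfl | h)
      · exact hk
      · exact hl
      · exact h.1
  · simp [hkl]
  · simp
  · intro j hj
    simp only [Finset.mem_filter, mem_pairsFrom] at hj
    exact ⟨hj.2.1, hj.2.2, hj.1.2⟩

/-- An operator commutes with a sum over all pairs if it commutes with all the summands but two,
and with the sum of these two. -/
theorem commute_sum_pairs {A : Module.End ℂ (LaurentSpace N)}
    {t : Fin N → Module.End ℂ (LaurentSpace N)} {k l : Fin N} (hk : (k : ℕ) ≤ k.rev)
    (hl : (l : ℕ) ≤ l.rev) (hkl : k ≠ l) (h : Commute A (t k + t l))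
    (h' : ∀ j, j ≠ k → j ≠ l → (j : ℕ) ≤ j.rev → Commute A (t j)) :
    Commute A (∑ j ∈ pairsFrom N 0, t j) := by
  obtain ⟨S, hS, h1, h2, h3⟩ := pairsFrom_zero_eq hk hl hkl
  rw [hS, Finset.sum_insert h1, Finset.sum_insert h2, ← add_assoc]
  exact h.add_right (Commute.sum_right _ _ _ fun j hj =>
    h' j (h3 j hj).1 (h3 j hj).2.1 (h3 j hj).2.2)

theorem commute_sub_left {A B X : Module.End ℂ (LaurentSpace N)} (h1 : Commute A X)
    (h2 : Commute B X) : Commute (A - B) X :=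
  Commute.sub_left (R := Module.End ℂ (LaurentSpace N)) h1 h2

theorem mul_add_eq_of_shift_groups {R : Type*} [Ring R] {A B X Y : R} (h1 : A * X = X * A)
    (h2 : B * Y = Y * B) (h3 : A * Y - Y * A = B * X - X * B) :
    (A - B) * (X + Y) = (X + Y) * (A - B) := by
  have e3 : A * Y = B * X - X * B + Y * A := by rw [← h3]; abel
  rw [sub_mul, mul_add, mul_add, mul_sub, add_mul, add_mul, h1, h2, e3]
  abel

/-- Vanishing of the commutator of `A - B` with `X + Y` when the terms are grouped by their total
shift: `A`, `X` and `B`, `Y` commute, and the remaining four products have the same shift. -/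
theorem commute_of_shift_groups {A B X Y : Module.End ℂ (LaurentSpace N)} (h1 : Commute A X)
    (h2 : Commute B Y) (h3 : A * Y - Y * A = B * X - X * B) : Commute (A - B) (X + Y) :=
  mul_add_eq_of_shift_groups (R := Module.End ℂ (LaurentSpace N)) h1 h2 h3

section

variable {k : ℕ} {a b : Fin N}

theorem AdjacentPairs.lt (h : AdjacentPairs k a b) : k + 1 < N := by
  have := h.2.2; omega

theorem AdjacentPairs.ne (h : AdjacentPairs k a b) :
    a ≠ b ∧ a ≠ b.rev ∧ a.rev ≠ b ∧ a.rev ≠ b.rev ∧ b ≠ b.rev ∧ a ≠ a.rev := by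
  obtain ⟨ha, hb, hN⟩ := h
  have h1 := val_add_rev a
  have h2 := val_add_rev b
  simp only [ne_eq, Fin.ext_iff]
  omega

theorem innerSum_eq_add {b : Fin N} (hb : (b : ℕ) = k + 1 ∨ (b.rev : ℕ) = k + 1)
    (hN : 2 * k + 3 < N) (ν : Lat N) : innerSum k ν = ν b + ν b.rev + innerSum (k + 1) ν := by
  have a1 : ν b = lin (Pi.single b 1) ν := by simp [lin, Pi.single_apply]
  have a2 : ν b.rev = lin (Pi.single b.rev 1) ν := by simp [lin, Pi.single_apply]
  rw [a1, a2]
  simp only [innerSum, lin, ← Finset.sum_add_distrib, ← add_mul]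
  refine Finset.sum_congr rfl fun l _ => ?_
  have h1 := val_add_rev l
  have h2 := val_add_rev b
  congr 1
  simp only [Pi.single_apply, Fin.ext_iff]
  rcases hb with hb | hb <;> split_ifs <;> omega

theorem outerSum_eq_add {a : Fin N} (ha : (a : ℕ) = k ∨ (a.rev : ℕ) = k)
    (hN : 2 * k + 1 < N) (ν : Lat N) : outerSum (k + 1) ν = ν a + ν a.rev + outerSum k ν := by
  have a1 : ν a = lin (Pi.single a 1) ν := by simp [lin, Pi.single_apply]
  have a2 : ν a.rev = lin (Pi.single a.rev 1) ν := by simp [lin, Pi.single_apply]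
  rw [a1, a2]
  simp only [outerSum, lin, ← Finset.sum_add_distrib, ← add_mul]
  refine Finset.sum_congr rfl fun l _ => ?_
  have h1 := val_add_rev l
  have h2 := val_add_rev a
  congr 1
  simp only [Pi.single_apply, Fin.ext_iff]
  rcases ha with ha | ha <;> split_ifs <;> omega

theorem hopOp_radTerm (hs : s ≠ 0) (h : AdjacentPairs k a b) {j : Fin N} (hj : (j : ℕ) ≤ j.rev)
    (h1 : (j : ℕ) ≠ k + 1) : Commute (hopOp s a b) (radTerm s j) := by
  obtain ⟨ha, hb, hN⟩ := h
  have := val_add_rev j; have := val_add_rev a; have := val_add_rev b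
  have := a.2; have := b.2
  refine shiftOp_commute fun ν => ?_
  by_cases hja : (j : ℕ) = k
  · have c1 : ((j : ℕ) < b ∧ (j : ℕ) < b.rev) ↔ True := iff_true_intro (by omega)
    have c2 : ((j : ℕ) < a ∧ (j : ℕ) < a.rev) ↔ False := iff_false_intro (by omega)
    have c3 : b ≠ j := fun e => by rw [e] at hb; omega
    have c4 : b ≠ j.rev := fun e => by rw [e, Fin.rev_rev] at hb; omega
    have c5 : (Pi.single j 1 : Lat N) a + (Pi.single j.rev 1 : Lat N) a = 1 := by
      simp only [Pi.single_apply, Fin.ext_iff]; split_ifs <;> omega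
    simp only [innerSum, lin_add, lin_sub, lin_single, Pi.add_apply, c1, c2, c5,
      Pi.single_eq_of_ne c3, Pi.single_eq_of_ne c4, if_true, if_false, mul_one, zero_sub,
      qp_add hs, qp_sub hs, qp_neg, qp_one, add_zero, mul_inv, inv_inv]
    ring
  · have c3 : b ≠ j := fun e => by rw [e] at hb; omega
    have c4 : b ≠ j.rev := fun e => by rw [e, Fin.rev_rev] at hb; omega
    have c5 : a ≠ j := fun e => by rw [e] at ha; omega
    have c6 : a ≠ j.rev := fun e => by rw [e, Fin.rev_rev] at ha; omega
    have c7 : ((j : ℕ) < a ∧ (j : ℕ) < a.rev) ↔ ((j : ℕ) < b ∧ (j : ℕ) < b.rev) := by omega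
    simp only [innerSum, lin_add, lin_sub, lin_single, Pi.add_apply, c7,
      Pi.single_eq_of_ne c3, Pi.single_eq_of_ne c4, Pi.single_eq_of_ne c5, Pi.single_eq_of_ne c6,
      sub_self, add_zero]
    ring

theorem hopOpRev_radTerm (h : AdjacentPairs k a b) {j : Fin N} (hj : (j : ℕ) ≤ j.rev)
    (h1 : (j : ℕ) ≠ k) : Commute (hopOpRev s a b) (radTerm s j) := by
  obtain ⟨ha, hb, hN⟩ := h
  have := val_add_rev j; have := val_add_rev a; have := val_add_rev b
  have := a.2; have := b.2
  refine shiftOp_commute fun ν => ?_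
  have c5 : a ≠ j := fun e => by rw [e] at ha; omega
  have c6 : a ≠ j.rev := fun e => by rw [e, Fin.rev_rev] at ha; omega
  have c5' : a.rev ≠ j := fun e => by rw [← e, Fin.rev_rev] at c6; exact c6 rfl
  have c6' : a.rev ≠ j.rev := fun e => c5 (Fin.rev_injective e)
  have c7 : ((j : ℕ) < a ∧ (j : ℕ) < a.rev) ↔ ((j : ℕ) < b ∧ (j : ℕ) < b.rev) := by omega
  have c8 : ((j : ℕ) < a.rev ∧ (j : ℕ) < a) ↔ ((j : ℕ) < b.rev ∧ (j : ℕ) < b) := by omega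
  have c9 : (Pi.single j 1 : Lat N) b + (Pi.single j.rev 1 : Lat N) b =
      (Pi.single j 1 : Lat N) b.rev + (Pi.single j.rev 1 : Lat N) b.rev := by
    simp only [Pi.single_apply, Fin.ext_iff]; split_ifs <;> omega
  simp only [innerSum, lin_add, lin_sub, lin_single, Pi.add_apply, c8, c9, Fin.rev_rev,
    Pi.single_eq_of_ne c5, Pi.single_eq_of_ne c6, Pi.single_eq_of_ne c5', Pi.single_eq_of_ne c6',
    sub_self, add_zero]
  ring_nf

/-- Only the summands of the two pairs involved fail to commute with `raiseExt`, and their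
contributions to the common shift `ε_a + ε_{b'}` cancel. -/
theorem raiseExt_radSum (hs : s ≠ 0) (hq : NotRootOfUnity s) (h : AdjacentPairs k a b) :
    Commute (raiseExt s a b) (radSum s N 0) := by
  have hlt := h.lt
  have hN := h.2.2
  set i : Fin N := ⟨k, by omega⟩ with hi
  set l : Fin N := ⟨k + 1, hlt⟩ with hl
  have hiv : (i : ℕ) = k := rfl
  have hlv : (l : ℕ) = k + 1 := rfl
  have h1 := val_add_rev i; have h2 := val_add_rev l
  have hd := pow_four_sub_one_ne_zero hs hq
  have f1 : i ≠ i.rev := fun e => by have := congrArg Fin.val e; omega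
  have f2 : l ≠ l.rev := fun e => by have := congrArg Fin.val e; omega
  refine commute_sum_pairs (k := i) (l := l) (by omega) (by omega)
    (fun e => by rw [e] at hiv; omega) ?_ fun j hji hjl hj => ?_
  · refine commute_of_shift_groups (hopOp_radTerm hs h (j := i) (by omega) (by omega))
      (hopOpRev_radTerm (s := s) h (j := l) (by omega) (by omega)) ?_
    obtain ⟨n1, n2, n3, n4, n5, n6⟩ := h.ne
    obtain ⟨ha, hb, _⟩ := h
    have := val_add_rev a; have := val_add_rev b
    have := a.2; have := b.2
    have c1 : (k < a ∧ k < a.rev) ↔ False := iff_false_intro (by omega)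
    have c2 : (k < b ∧ k < b.rev) ↔ True := iff_true_intro (by omega)
    have c3 : (k + 1 < a ∧ k + 1 < a.rev) ↔ False := iff_false_intro (by omega)
    have c4 : (k + 1 < b ∧ k + 1 < b.rev) ↔ False := iff_false_intro (by omega)
    have c1' : (k < a.rev ∧ k < a) ↔ False := iff_false_intro (by omega)
    have c2' : (k < b.rev ∧ k < b) ↔ True := iff_true_intro (by omega)
    have e1 : (Pi.single i 1 + Pi.single i.rev 1 : Lat N) = Pi.single a 1 + Pi.single a.rev 1 := by
      rcases ha with ha | ha
      · obtain rfl : a = i := Fin.ext ha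
        rfl
      · obtain rfl : a = i.rev := by rw [← Fin.rev_inj, Fin.rev_rev]; exact Fin.ext ha
        rw [Fin.rev_rev, add_comm]
    have e2 : (Pi.single l 1 + Pi.single l.rev 1 : Lat N) = Pi.single b 1 + Pi.single b.rev 1 := by
      rcases hb with hb | hb
      · obtain rfl : b = l := Fin.ext hb
        rfl
      · obtain rfl : b = l.rev := by rw [← Fin.rev_inj, Fin.rev_rev]; exact Fin.ext hb
        rw [Fin.rev_rev, add_comm]
    simp only [hopOp, hopOpRev, radTerm, shiftOp_mul, e1, e2, if_neg f1, if_neg f2, hiv, hlv]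
    rw [shiftOp_congr (δ := Pi.single b 1 + Pi.single b.rev 1 + (Pi.single a 1 - Pi.single b 1))
        (ε := Pi.single a 1 + Pi.single b.rev 1) (by abel) fun _ => rfl,
      shiftOp_congr (δ := Pi.single a 1 - Pi.single b 1 + (Pi.single b 1 + Pi.single b.rev 1))
        (ε := Pi.single a 1 + Pi.single b.rev 1) (by abel) fun _ => rfl,
      shiftOp_congr (δ := Pi.single a 1 + Pi.single a.rev 1 +
        (Pi.single b.rev 1 - Pi.single a.rev 1))
        (ε := Pi.single a 1 + Pi.single b.rev 1) (by abel) fun _ => rfl,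
      shiftOp_congr (δ := Pi.single b.rev 1 - Pi.single a.rev 1 + (Pi.single a 1 +
        Pi.single a.rev 1))
        (ε := Pi.single a 1 + Pi.single b.rev 1) (by abel) fun _ => rfl, shiftOp_sub, shiftOp_sub]
    refine shiftOp_congr rfl fun ν => ?_
    simp only [innerSum_eq_add hb hN]
    simp only [innerSum, lin_add, lin_sub, lin_single, Pi.add_apply, Pi.sub_apply, c3, c4,
      Fin.rev_rev, if_false, zero_mul, and_comm (a := k + 1 < (b.rev : ℕ)),
      and_comm (a := k + 1 < (a.rev : ℕ)), Pi.single_eq_same,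
      Pi.single_eq_of_ne n1, Pi.single_eq_of_ne n2, Pi.single_eq_of_ne n3, Pi.single_eq_of_ne n4,
      Pi.single_eq_of_ne n5, Pi.single_eq_of_ne n6, Pi.single_eq_of_ne n1.symm,
      Pi.single_eq_of_ne n2.symm, Pi.single_eq_of_ne n3.symm, Pi.single_eq_of_ne n4.symm,
      Pi.single_eq_of_ne n5.symm, Pi.single_eq_of_ne n6.symm, add_zero, zero_add, sub_zero,
        zero_sub,
      qNum_eq, qp_add hs, qp_sub hs, qp_neg, qp_one, Nat.cast_add, Nat.cast_one, mul_one]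
    have b1 := qp_ne hs (ν a)
    have b2 := qp_ne hs (ν b)
    have b3 := qp_ne hs (ν a.rev)
    have b4 := qp_ne hs (ν b.rev)
    field_simp
    ring
  · have p1 : (j : ℕ) ≠ k := fun e => hji (Fin.ext e)
    have p2 : (j : ℕ) ≠ k + 1 := fun e => hjl (Fin.ext e)
    exact commute_sub_left (hopOp_radTerm hs h hj p2) (hopOpRev_radTerm (s := s) h hj p1)

theorem hopOp_lapTerm (hs : s ≠ 0) (h : AdjacentPairs k a b) {j : Fin N} (hj : (j : ℕ) ≤ j.rev)
    (h1 : (j : ℕ) ≠ k) : Commute (hopOp s a b) (lapTerm s j) := by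
  obtain ⟨ha, hb, hN⟩ := h
  have := val_add_rev j; have := val_add_rev a; have := val_add_rev b
  have := a.2; have := b.2
  refine shiftOp_commute fun ν => ?_
  have c3 : a ≠ j := fun e => by rw [e] at ha; omega
  have c4 : a ≠ j.rev := fun e => by rw [e, Fin.rev_rev] at ha; omega
  by_cases hjb : (j : ℕ) = k + 1
  · have c1 : ((a : ℕ) < j ∨ (a.rev : ℕ) < j) ↔ True := iff_true_intro (by omega)
    have c2 : ((b : ℕ) < j ∨ (b.rev : ℕ) < j) ↔ False := iff_false_intro (by omega)
    have c5 : (Pi.single j 1 : Lat N) b + (Pi.single j.rev 1 : Lat N) b = 1 := by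
      simp only [Pi.single_apply, Fin.ext_iff]; split_ifs <;> omega
    have hjr : j ≠ j.rev := fun e => by have := congrArg Fin.val e; omega
    have key : lapCoeff s j (ν + (Pi.single a 1 - Pi.single b 1)) * qNum s (ν b) =
        qNum s (ν b - 1) * lapCoeff s j ν := by
      rw [lapCoeff, lapCoeff, if_neg hjr, if_neg hjr]
      rcases hb with hb | hb
      · obtain rfl : b = j := Fin.ext (by omega)
        simp only [Pi.add_apply, Pi.sub_apply, Pi.single_eq_same, Pi.single_eq_of_ne c3.symm,
          Pi.single_eq_of_ne c4.symm, Pi.single_eq_of_ne hjr.symm, sub_zero, add_zero, zero_sub,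
          ← sub_eq_add_neg]
        ring
      · obtain rfl : b = j.rev := by rw [← Fin.rev_inj, Fin.rev_rev]; exact Fin.ext (by omega)
        simp only [Pi.add_apply, Pi.sub_apply, Pi.single_eq_same, Pi.single_eq_of_ne c3.symm,
          Pi.single_eq_of_ne c4.symm, Pi.single_eq_of_ne hjr, sub_zero, add_zero, zero_sub,
          ← sub_eq_add_neg]
        ring
    simp only [outerSum, lin_add, lin_sub, lin_single, Pi.add_apply, Pi.neg_apply, c1, c2,
      c5, Pi.single_eq_of_ne c3, Pi.single_eq_of_ne c4, if_true, if_false, mul_one, sub_zero,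
      qp_add hs, qp_sub hs, qp_one, add_zero, neg_zero, ← sub_eq_add_neg, mul_inv, inv_inv]
    linear_combination (-(qp s j * qp s (lin (fun l => if (l : ℕ) < j ∨
      (l.rev : ℕ) < j then 1 else 0) ν) *
      qp s (ν a) * (qp s (ν b))⁻¹ * s ^ 2 * s ^ 2)) * key
  · have c5 : b ≠ j := fun e => by rw [e] at hb; omega
    have c6 : b ≠ j.rev := fun e => by rw [e, Fin.rev_rev] at hb; omega
    have c7 : ((a : ℕ) < j ∨ (a.rev : ℕ) < j) ↔ ((b : ℕ) < j ∨ (b.rev : ℕ) < j) := by omega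
    have hc : lapCoeff s j (ν + (Pi.single a 1 - Pi.single b 1)) = lapCoeff s j ν := by
      refine lapCoeff_congr ?_ ?_ <;>
      simp only [Pi.add_apply, Pi.sub_apply, Pi.single_eq_of_ne c3.symm, Pi.single_eq_of_ne c4.symm,
        Pi.single_eq_of_ne c5.symm, Pi.single_eq_of_ne c6.symm, sub_self, add_zero]
    rw [hc]
    simp only [outerSum, lin_add, lin_sub, lin_single, Pi.add_apply, Pi.neg_apply, c7,
      Pi.single_eq_of_ne c3, Pi.single_eq_of_ne c4, Pi.single_eq_of_ne c5, Pi.single_eq_of_ne c6,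
      sub_self, add_zero, neg_zero]
    ring

theorem hopOpRev_lapTerm (h : AdjacentPairs k a b) {j : Fin N} (hj : (j : ℕ) ≤ j.rev)
    (h1 : (j : ℕ) ≠ k + 1) : Commute (hopOpRev s a b) (lapTerm s j) := by
  obtain ⟨ha, hb, hN⟩ := h
  have := val_add_rev j; have := val_add_rev a; have := val_add_rev b
  have := a.2; have := b.2
  refine shiftOp_commute fun ν => ?_
  have c3 : b.rev ≠ j := fun e => by have := congrArg Fin.val e; omega
  have c4 : b ≠ j := fun e => by rw [e] at hb; omega
  have c4' : b.rev ≠ j.rev := fun e => c4 (Fin.rev_injective e)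
  have c3' : b ≠ j.rev := fun e => c3 (by rw [e, Fin.rev_rev])
  by_cases hja : (j : ℕ) = k
  · have c1 : ((a : ℕ) < j ∨ (a.rev : ℕ) < j) ↔ False := iff_false_intro (by omega)
    have c1' : ((a.rev : ℕ) < j ∨ (a : ℕ) < j) ↔ False := iff_false_intro (by omega)
    have c2 : ((b : ℕ) < j ∨ (b.rev : ℕ) < j) ↔ False := iff_false_intro (by omega)
    have c2' : ((b.rev : ℕ) < j ∨ (b : ℕ) < j) ↔ False := iff_false_intro (by omega)
    have hjr : j ≠ j.rev := fun e => by have := congrArg Fin.val e; omega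
    have c5 : (Pi.single j 1 : Lat N) a + (Pi.single j.rev 1 : Lat N) a = 1 := by
      simp only [Pi.single_apply, Fin.ext_iff]; split_ifs <;> omega
    have c6 : (Pi.single j 1 : Lat N) a.rev + (Pi.single j.rev 1 : Lat N) a.rev = 1 := by
      simp only [Pi.single_apply, Fin.ext_iff]; split_ifs <;> omega
    have key : lapCoeff s j (ν + (Pi.single b.rev 1 - Pi.single a.rev 1)) * qNum s (ν a.rev) =
        qNum s (ν a.rev - 1) * lapCoeff s j ν := by
      rw [lapCoeff, lapCoeff, if_neg hjr, if_neg hjr]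
      rcases ha with ha | ha
      · obtain rfl : a = j := Fin.ext (by omega)
        simp only [Pi.add_apply, Pi.sub_apply, Pi.single_eq_same, Pi.single_eq_of_ne c3.symm,
          Pi.single_eq_of_ne c4'.symm, Pi.single_eq_of_ne hjr, sub_zero, add_zero, zero_sub,
          ← sub_eq_add_neg]
        ring
      · obtain rfl : a = j.rev := by rw [← Fin.rev_inj, Fin.rev_rev]; exact Fin.ext (by omega)
        rw [Fin.rev_rev]
        simp only [Pi.add_apply, Pi.sub_apply, Pi.single_eq_same, Pi.single_eq_of_ne c3.symm,
          Pi.single_eq_of_ne c4'.symm, Pi.single_eq_of_ne hjr.symm, sub_zero, add_zero, zero_sub,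
          ← sub_eq_add_neg]
        ring
    simp only [outerSum, lin_add, lin_sub, lin_single, Pi.add_apply, Pi.neg_apply, c1', c2',
      c5, c6, Fin.rev_rev, Pi.single_eq_of_ne c3, Pi.single_eq_of_ne c4, Pi.single_eq_of_ne c3',
      Pi.single_eq_of_ne c4', if_false, mul_one, sub_zero,
      add_zero, neg_zero, ← sub_eq_add_neg]
    rw [show ν a - 1 - ν b - (ν a.rev - 1) + ν b.rev + 1 = ν a - ν b - ν a.rev + ν b.rev +
      1 by ring]
    linear_combination (-(qp s j * qp s (lin (fun l => if (l : ℕ) < j ∨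
      (l.rev : ℕ) < j then 1 else 0) ν) *
      qp s (ν a - ν b - ν a.rev + ν b.rev + 1))) * key
  · have c5 : a.rev ≠ j := fun e => by have := congrArg Fin.val e; omega
    have c6 : a ≠ j := fun e => by rw [e] at ha; omega
    have c5' : a ≠ j.rev := fun e => c5 (by rw [e, Fin.rev_rev])
    have c6' : a.rev ≠ j.rev := fun e => c6 (Fin.rev_injective e)
    have c7 : ((a.rev : ℕ) < j ∨ (a : ℕ) < j) ↔ ((b.rev : ℕ) < j ∨ (b : ℕ) < j) := by omega
    have hc : lapCoeff s j (ν + (Pi.single b.rev 1 - Pi.single a.rev 1)) = lapCoeff s j ν := by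
      refine lapCoeff_congr ?_ ?_ <;>
      simp only [Pi.add_apply, Pi.sub_apply, Pi.single_eq_of_ne c3.symm,
        Pi.single_eq_of_ne c4'.symm,
        Pi.single_eq_of_ne c5.symm, Pi.single_eq_of_ne c6'.symm, sub_self, add_zero]
    rw [hc]
    simp only [outerSum, lin_add, lin_sub, lin_single, Pi.add_apply, Pi.neg_apply, c7, Fin.rev_rev,
      Pi.single_eq_of_ne c3, Pi.single_eq_of_ne c4, Pi.single_eq_of_ne c5, Pi.single_eq_of_ne c6,
      Pi.single_eq_of_ne c3', Pi.single_eq_of_ne c4', Pi.single_eq_of_ne c5',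
        Pi.single_eq_of_ne c6',
      sub_self, add_zero, neg_zero]
    ring

/-- The analogue of `raiseExt_radSum` for the lowering summands. -/
theorem raiseExt_lapSum (hs : s ≠ 0) (hq : NotRootOfUnity s) (h : AdjacentPairs k a b) :
    Commute (raiseExt s a b) (lapSum s N 0) := by
  have hlt := h.lt
  have hN := h.2.2
  set i : Fin N := ⟨k, by omega⟩ with hi
  set l : Fin N := ⟨k + 1, hlt⟩ with hl
  have hiv : (i : ℕ) = k := rfl
  have hlv : (l : ℕ) = k + 1 := rfl
  have h1 := val_add_rev i; have h2 := val_add_rev l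
  have hd := pow_four_sub_one_ne_zero hs hq
  have f1 : i ≠ i.rev := fun e => by have := congrArg Fin.val e; omega
  have f2 : l ≠ l.rev := fun e => by have := congrArg Fin.val e; omega
  refine commute_sum_pairs (k := l) (l := i) (by omega) (by omega)
    (fun e => by rw [e] at hlv; omega) ?_ fun j hjl hji hj => ?_
  · refine commute_of_shift_groups (hopOp_lapTerm hs h (j := l) (by omega) (by omega))
      (hopOpRev_lapTerm (s := s) h (j := i) (by omega) (by omega)) ?_
    obtain ⟨n1, n2, n3, n4, n5, n6⟩ := h.ne
    obtain ⟨ha, hb, _⟩ := h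
    have := val_add_rev a; have := val_add_rev b
    have := a.2; have := b.2
    have c1 : ((a : ℕ) < k ∨ (a.rev : ℕ) < k) ↔ False := iff_false_intro (by omega)
    have c2 : ((b : ℕ) < k ∨ (b.rev : ℕ) < k) ↔ False := iff_false_intro (by omega)
    have c1' : ((a.rev : ℕ) < k ∨ (a : ℕ) < k) ↔ False := iff_false_intro (by omega)
    have c2' : ((b.rev : ℕ) < k ∨ (b : ℕ) < k) ↔ False := iff_false_intro (by omega)
    have e1 : lapTerm s i = shiftOp (fun ν => qp s k * (qNum s (ν a) * qNum s (ν a.rev)) *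
        qp s (outerSum k ν)) (-(Pi.single a 1 + Pi.single a.rev 1)) := by
      rcases ha with ha | ha
      · obtain rfl : a = i := Fin.ext ha
        exact shiftOp_congr rfl fun ν => by rw [lapCoeff, if_neg f1]
      · obtain rfl : a = i.rev := by rw [← Fin.rev_inj, Fin.rev_rev]; exact Fin.ext ha
        refine shiftOp_congr (by rw [Fin.rev_rev, add_comm]) fun ν => ?_
        rw [lapCoeff, if_neg f1, Fin.rev_rev, hiv]
        ring
    have e2 : lapTerm s l = shiftOp (fun ν => qp s (k + 1 : ℕ) * (qNum s (ν b) * qNum s (ν b.rev)) *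
        qp s (outerSum (k + 1) ν)) (-(Pi.single b 1 + Pi.single b.rev 1)) := by
      rcases hb with hb | hb
      · obtain rfl : b = l := Fin.ext hb
        exact shiftOp_congr rfl fun ν => by rw [lapCoeff, if_neg f2]
      · obtain rfl : b = l.rev := by rw [← Fin.rev_inj, Fin.rev_rev]; exact Fin.ext hb
        refine shiftOp_congr (by rw [Fin.rev_rev, add_comm]) fun ν => ?_
        rw [lapCoeff, if_neg f2, Fin.rev_rev, hlv]
        ring
    simp only [hopOp, hopOpRev, e1, e2, shiftOp_mul]
    rw [shiftOp_congr (δ := -(Pi.single a 1 + Pi.single a.rev 1) + (Pi.single a 1 - Pi.single b 1))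
        (ε := -Pi.single a.rev 1 - Pi.single b 1) (by abel) fun _ => rfl,
      shiftOp_congr (δ := Pi.single a 1 - Pi.single b 1 + -(Pi.single a 1 + Pi.single a.rev 1))
        (ε := -Pi.single a.rev 1 - Pi.single b 1) (by abel) fun _ => rfl,
      shiftOp_congr (δ := -(Pi.single b 1 + Pi.single b.rev 1) +
        (Pi.single b.rev 1 - Pi.single a.rev 1))
        (ε := -Pi.single a.rev 1 - Pi.single b 1) (by abel) fun _ => rfl,
      shiftOp_congr (δ := Pi.single b.rev 1 - Pi.single a.rev 1 + -(Pi.single b 1 +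
        Pi.single b.rev 1))
        (ε := -Pi.single a.rev 1 - Pi.single b 1) (by abel) fun _ => rfl, shiftOp_sub, shiftOp_sub]
    refine shiftOp_congr rfl fun ν => ?_
    simp only [outerSum_eq_add ha (show 2 * k + 1 < N by omega)]
    simp only [outerSum, lin_add, lin_sub, lin_single, Pi.add_apply, Pi.sub_apply, Pi.neg_apply,
      c1, c2, c1', c2', Fin.rev_rev, if_false, zero_mul, Pi.single_eq_same,
      Pi.single_eq_of_ne n1, Pi.single_eq_of_ne n2, Pi.single_eq_of_ne n3, Pi.single_eq_of_ne n4,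
      Pi.single_eq_of_ne n5, Pi.single_eq_of_ne n6, Pi.single_eq_of_ne n1.symm,
      Pi.single_eq_of_ne n3.symm, Pi.single_eq_of_ne n4.symm,
      Pi.single_eq_of_ne n5.symm, Pi.single_eq_of_ne n6.symm, add_zero, zero_add, sub_zero,
        zero_sub,
      neg_zero, qNum_eq, qp_add hs, qp_sub hs, qp_neg, qp_one, Nat.cast_add, Nat.cast_one]
    have b1 := qp_ne hs (ν a)
    have b2 := qp_ne hs (ν b)
    have b3 := qp_ne hs (ν a.rev)
    have b4 := qp_ne hs (ν b.rev)
    field_simp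
    ring
  · have p1 : (j : ℕ) ≠ k := fun e => hji (Fin.ext e)
    have p2 : (j : ℕ) ≠ k + 1 := fun e => hjl (Fin.ext e)
    exact commute_sub_left (hopOp_lapTerm hs h hj p1) (hopOpRev_lapTerm (s := s) h hj p2)

end
end

section

variable {s : ℂ} {N : ℕ}

/-! ### The short simple root -/

/-- The position `c` is the middle one and the pair `{a, a'}`, whose left member is `k`, is the
innermost one. -/
def InnermostPair {N : ℕ} (k : ℕ) (a c : Fin N) : Prop :=
  ((a : ℕ) = k ∨ (a.rev : ℕ) = k) ∧ (c : ℕ) = k + 1 ∧ N = 2 * k + 3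

section

variable {k : ℕ} {a c : Fin N}

theorem InnermostPair.rev_eq (h : InnermostPair k a c) : c.rev = c := by
  have := val_add_rev c
  obtain ⟨-, h1, h2⟩ := h
  rw [Fin.ext_iff]
  omega

theorem InnermostPair.ne (h : InnermostPair k a c) : a ≠ c ∧ a.rev ≠ c ∧ a ≠ a.rev := by
  obtain ⟨ha, hc, hN⟩ := h
  have h1 := val_add_rev a
  have h2 := val_add_rev c
  simp only [ne_eq, Fin.ext_iff]
  omega

theorem innerSum_innermost (hc : (c : ℕ) = k + 1) (hN : N = 2 * k + 3) (ν : Lat N) :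
    innerSum k ν = ν c := by
  have a1 : ν c = lin (Pi.single c 1) ν := by simp [lin, Pi.single_apply]
  rw [a1]
  simp only [innerSum, lin]
  refine Finset.sum_congr rfl fun l _ => ?_
  have h1 := val_add_rev l
  congr 1
  simp only [Pi.single_apply, Fin.ext_iff]
  split_ifs <;> omega

theorem innerSum_middle (hN : N = 2 * k + 3) (ν : Lat N) : innerSum (k + 1) ν = 0 := by
  rw [innerSum, lin]
  refine Finset.sum_eq_zero fun l _ => ?_
  have h1 := val_add_rev l
  rw [if_neg (by omega), zero_mul]

theorem InnermostPair.ne_of_outer (h : InnermostPair k a c) {j : Fin N} (hj : (j : ℕ) < k) :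
    a ≠ j ∧ a ≠ j.rev ∧ a.rev ≠ j ∧ a.rev ≠ j.rev ∧ c ≠ j ∧ c ≠ j.rev := by
  obtain ⟨ha, hc, hN⟩ := h
  have h1 := val_add_rev a
  have h2 := val_add_rev c
  have h3 := val_add_rev j
  simp only [ne_eq, Fin.ext_iff]
  omega

theorem InnermostPair.single_pair_eq (h : InnermostPair k a c) {j : Fin N} (hj : (j : ℕ) = k) :
    (Pi.single j 1 + Pi.single j.rev 1 : Lat N) = Pi.single a 1 + Pi.single a.rev 1 := by
  rcases h.1 with ha | ha
  · obtain rfl : a = j := Fin.ext (ha.trans hj.symm)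
    rfl
  · obtain rfl : a = j.rev := by rw [← Fin.rev_inj, Fin.rev_rev]; exact Fin.ext (ha.trans hj.symm)
    rw [Fin.rev_rev, add_comm]

theorem InnermostPair.radTerm_pair (h : InnermostPair k a c) {j : Fin N} (hj : (j : ℕ) = k) :
    radTerm s j = shiftOp (fun ν => qp s k * (qp s (ν c))⁻¹) (Pi.single a 1 + Pi.single a.rev 1) :=
      by
  have f1 : j ≠ j.rev := fun e => by
    have h1 := congrArg Fin.val e; have h2 := val_add_rev j; have := h.2.2; omega
  refine shiftOp_congr (h.single_pair_eq hj) fun ν => ?_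
  rw [if_neg f1, hj, innerSum_innermost h.2.1 h.2.2, mul_one]

theorem InnermostPair.radTerm_middle (h : InnermostPair k a c) :
    radTerm s c = shiftOp (fun _ => qp s (k + 1) * (s + s⁻¹)⁻¹) (Pi.single c 2) := by
  refine shiftOp_congr (by rw [h.rev_eq, ← Pi.single_add]; rfl) fun ν => ?_
  rw [if_pos h.rev_eq.symm, h.2.1, innerSum_middle h.2.2, qp_zero, inv_one, mul_one, Nat.cast_add,
    Nat.cast_one]

theorem hopShort_radTerm_of_lt (h : InnermostPair k a c) {j : Fin N} (hj : (j : ℕ) < k) :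
    Commute (hopShort s a c) (radTerm s j) := by
  obtain ⟨n1, n2, n3, n4, n5, n6⟩ := h.ne_of_outer hj
  obtain ⟨ha, hc, hN⟩ := h
  refine shiftOp_commute fun ν => ?_
  have c7 : ((j : ℕ) < a ∧ (j : ℕ) < a.rev) ↔ ((j : ℕ) < c ∧ (j : ℕ) < c.rev) := by
    have := val_add_rev a; have := val_add_rev c; omega
  simp only [innerSum, lin_add, lin_sub, lin_single, Pi.add_apply, c7,
    Pi.single_eq_of_ne n1, Pi.single_eq_of_ne n2, Pi.single_eq_of_ne n5, Pi.single_eq_of_ne n6,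
    sub_self, add_zero]
  ring

theorem hopShortRev_radTerm_of_lt (h : InnermostPair k a c) {j : Fin N} (hj : (j : ℕ) < k) :
    Commute (hopShortRev s a c) (radTerm s j) := by
  obtain ⟨n1, n2, n3, n4, n5, n6⟩ := h.ne_of_outer hj
  obtain ⟨ha, hc, hN⟩ := h
  refine shiftOp_commute fun ν => ?_
  have c7 : ((j : ℕ) < a.rev ∧ (j : ℕ) < a) ↔ ((j : ℕ) < c ∧ (j : ℕ) < c.rev) := by
    have := val_add_rev a; have := val_add_rev c; omega
  simp only [innerSum, lin_add, lin_sub, lin_single, Pi.add_apply, c7, Fin.rev_rev,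
    Pi.single_eq_of_ne n1, Pi.single_eq_of_ne n2, Pi.single_eq_of_ne n3, Pi.single_eq_of_ne n4,
    sub_self, add_zero]
  ring

/-- As for `raiseExt_radSum`, with the middle summand in place of the inner pair. -/
theorem raiseShortExt_radSum (hs : s ≠ 0) (hq : NotRootOfUnity s) (h : InnermostPair k a c) :
    Commute (raiseShortExt s a c) (radSum s N 0) := by
  obtain ⟨n1, n2, n3⟩ := h.ne
  have hN := h.2.2
  have hc := h.2.1
  set i : Fin N := ⟨k, by omega⟩ with hi
  have hiv : (i : ℕ) = k := rfl
  have h1 := val_add_rev i; have h2 := val_add_rev c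
  have hd := sq_add_one_ne_zero hs hq
  have hd' := pow_four_sub_one_ne_zero hs hq
  have hd1 := one_sub_sq_ne_zero hq
  refine commute_sum_pairs (k := i) (l := c) (by omega) (by omega)
    (fun e => by rw [← e] at hc; omega) ?_ fun j hji hjc hj => ?_
  · rw [h.radTerm_pair hiv, h.radTerm_middle]
    refine commute_of_shift_groups (shiftOp_commute fun ν => ?_) (shiftOp_commute fun ν => ?_) ?_
    · simp only [Pi.add_apply, Pi.sub_apply, Pi.single_eq_same, Pi.single_eq_of_ne n1,
        Pi.single_eq_of_ne n1.symm, Pi.single_eq_of_ne n2.symm, Pi.single_eq_of_ne n3, add_zero,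
        zero_add, zero_sub, sub_zero, qp_add hs, qp_sub hs, qp_neg, qp_one]
      have b2 := qp_ne hs (ν c)
      field_simp
    · simp only [Pi.add_apply, Pi.single_eq_of_ne n1, Pi.single_eq_of_ne n2, add_zero]
      ring
    · simp only [hopShort, hopShortRev, shiftOp_mul]
      have e : (Pi.single c 2 : Lat N) = Pi.single c 1 + Pi.single c 1 := by
        rw [← Pi.single_add]; rfl
      rw [shiftOp_congr (δ := Pi.single c 2 + (Pi.single a 1 - Pi.single c 1))
          (ε := Pi.single a 1 + Pi.single c 1) (by rw [e]; abel) fun _ => rfl,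
        shiftOp_congr (δ := Pi.single a 1 - Pi.single c 1 + Pi.single c 2)
          (ε := Pi.single a 1 + Pi.single c 1) (by rw [e]; abel) fun _ => rfl,
        shiftOp_congr (δ := Pi.single a 1 + Pi.single a.rev 1 + (Pi.single c 1 - Pi.single a.rev 1))
          (ε := Pi.single a 1 + Pi.single c 1) (by abel) fun _ => rfl,
        shiftOp_congr (δ := Pi.single c 1 - Pi.single a.rev 1 + (Pi.single a 1 + Pi.single a.rev 1))
          (ε := Pi.single a 1 + Pi.single c 1) (by abel) fun _ => rfl, shiftOp_sub, shiftOp_sub]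
      refine shiftOp_congr rfl fun ν => ?_
      simp only [Pi.add_apply, Pi.sub_apply, Pi.single_eq_same, Pi.single_eq_of_ne n1,
        Pi.single_eq_of_ne n1.symm, Pi.single_eq_of_ne n2, Pi.single_eq_of_ne n2.symm,
        Pi.single_eq_of_ne n3, Pi.single_eq_of_ne n3.symm, add_zero, zero_add, sub_zero,
        qNum_eq, qNumOne_eq, qp_add hs, qp_sub hs, qp_one, qp_two]
      have b1 := qp_ne hs (ν a)
      have b2 := qp_ne hs (ν c)
      have b3 := qp_ne hs (ν a.rev)
      field_simp
      ring
  · have p1 : (j : ℕ) ≠ k := fun e => hji (Fin.ext e)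
    have p2 : (j : ℕ) ≠ k + 1 := fun e => hjc (Fin.ext (e.trans hc.symm))
    have := val_add_rev j
    exact commute_sub_left (hopShort_radTerm_of_lt h (by omega))
      (hopShortRev_radTerm_of_lt h (by omega))

theorem InnermostPair.lapTerm_pair (h : InnermostPair k a c) {j : Fin N} (hj : (j : ℕ) = k) :
    lapTerm s j = shiftOp (fun ν => qp s k * (qNum s (ν a) * qNum s (ν a.rev)) *
      qp s (outerSum k ν)) (-(Pi.single a 1 + Pi.single a.rev 1)) := by
  have f1 : j ≠ j.rev := fun e => by
    have h1 := congrArg Fin.val e; have h2 := val_add_rev j; have := h.2.2; omega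
  refine shiftOp_congr (by rw [h.single_pair_eq hj]) fun ν => ?_
  rw [lapCoeff, if_neg f1, hj]
  rcases h.1 with ha | ha
  · obtain rfl : a = j := Fin.ext (ha.trans hj.symm)
    rfl
  · obtain rfl : a = j.rev := by rw [← Fin.rev_inj, Fin.rev_rev]; exact Fin.ext (ha.trans hj.symm)
    rw [Fin.rev_rev]
    ring

theorem InnermostPair.lapTerm_middle (h : InnermostPair k a c) :
    lapTerm s c = shiftOp (fun ν => qp s (k + 1) * ((s + s⁻¹)⁻¹ *
      (qNumOne s (ν c - 1) * qNumOne s (ν c) * qp s (1 - ν c))) *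
      qp s (ν a + ν a.rev + outerSum k ν)) (-Pi.single c 2) := by
  refine shiftOp_congr (by rw [h.rev_eq, ← Pi.single_add]; rfl) fun ν => ?_
  have hN := h.2.2
  rw [lapCoeff, if_pos h.rev_eq.symm, h.2.1, outerSum_eq_add h.1 (by omega), Nat.cast_add,
    Nat.cast_one]

theorem hopShort_lapTerm_of_lt (h : InnermostPair k a c) {j : Fin N} (hj : (j : ℕ) < k) :
    Commute (hopShort s a c) (lapTerm s j) := by
  obtain ⟨n1, n2, n3, n4, n5, n6⟩ := h.ne_of_outer hj
  obtain ⟨ha, hc, hN⟩ := h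
  refine shiftOp_commute fun ν => ?_
  have c7 : ((a : ℕ) < j ∨ (a.rev : ℕ) < j) ↔ ((c : ℕ) < j ∨ (c.rev : ℕ) < j) := by
    have := val_add_rev a; have := val_add_rev c; omega
  have e : lapCoeff s j (ν + (Pi.single a 1 - Pi.single c 1)) = lapCoeff s j ν := by
    refine lapCoeff_congr ?_ ?_ <;>
    simp only [Pi.add_apply, Pi.sub_apply, Pi.single_eq_of_ne n1.symm, Pi.single_eq_of_ne n2.symm,
      Pi.single_eq_of_ne n5.symm, Pi.single_eq_of_ne n6.symm, sub_self, add_zero]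
  rw [e]
  simp only [outerSum, lin_add, lin_sub, lin_single, Pi.add_apply, Pi.neg_apply, c7,
    Pi.single_eq_of_ne n1, Pi.single_eq_of_ne n2, Pi.single_eq_of_ne n5, Pi.single_eq_of_ne n6,
    sub_self, add_zero, neg_zero]
  ring

theorem hopShortRev_lapTerm_of_lt (h : InnermostPair k a c) {j : Fin N} (hj : (j : ℕ) < k) :
    Commute (hopShortRev s a c) (lapTerm s j) := by
  obtain ⟨n1, n2, n3, n4, n5, n6⟩ := h.ne_of_outer hj
  obtain ⟨ha, hc, hN⟩ := h
  refine shiftOp_commute fun ν => ?_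
  have c7 : ((a.rev : ℕ) < j ∨ (a : ℕ) < j) ↔ ((c : ℕ) < j ∨ (c.rev : ℕ) < j) := by
    have := val_add_rev a; have := val_add_rev c; omega
  have e : lapCoeff s j (ν + (Pi.single c 1 - Pi.single a.rev 1)) = lapCoeff s j ν := by
    refine lapCoeff_congr ?_ ?_ <;>
    simp only [Pi.add_apply, Pi.sub_apply, Pi.single_eq_of_ne n3.symm, Pi.single_eq_of_ne n4.symm,
      Pi.single_eq_of_ne n5.symm, Pi.single_eq_of_ne n6.symm, sub_self, add_zero]
  rw [e]
  simp only [outerSum, lin_add, lin_sub, lin_single, Pi.add_apply, Pi.neg_apply, c7, Fin.rev_rev,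
    Pi.single_eq_of_ne n1, Pi.single_eq_of_ne n2, Pi.single_eq_of_ne n3, Pi.single_eq_of_ne n4,
    sub_self, add_zero, neg_zero]
  ring

/-- As for `raiseExt_lapSum`, with the middle summand in place of the inner pair. -/
theorem raiseShortExt_lapSum (hs : s ≠ 0) (hq : NotRootOfUnity s) (h : InnermostPair k a c) :
    Commute (raiseShortExt s a c) (lapSum s N 0) := by
  obtain ⟨n1, n2, n3⟩ := h.ne
  have hN := h.2.2
  have hc := h.2.1
  set i : Fin N := ⟨k, by omega⟩ with hi
  have hiv : (i : ℕ) = k := rfl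
  have h1 := val_add_rev i; have h2 := val_add_rev c; have h3 := val_add_rev a
  have hd := sq_add_one_ne_zero hs hq
  have hd' := pow_four_sub_one_ne_zero hs hq
  have hd1 := one_sub_sq_ne_zero hq
  have o1 : ((a : ℕ) < k ∨ (a.rev : ℕ) < k) ↔ False := by have := h.1; simp; omega
  have o2 : ((c : ℕ) < k ∨ (c.rev : ℕ) < k) ↔ False := by simp; omega
  have o3 : ((a.rev : ℕ) < k ∨ (a : ℕ) < k) ↔ False := by have := h.1; simp; omega
  refine commute_sum_pairs (k := c) (l := i) (by omega) (by omega)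
    (fun e => by rw [e] at hc; omega) ?_ fun j hjc hji hj => ?_
  · rw [h.lapTerm_pair hiv, h.lapTerm_middle]
    refine commute_of_shift_groups (shiftOp_commute fun ν => ?_) (shiftOp_commute fun ν => ?_) ?_
    · simp only [outerSum, lin_add, lin_sub, lin_neg, lin_single, o1, o2, o3, Fin.rev_rev, if_false,
        zero_mul, Pi.add_apply, Pi.sub_apply, Pi.neg_apply, Pi.single_eq_same,
          Pi.single_eq_of_ne n1,
        Pi.single_eq_of_ne n1.symm, Pi.single_eq_of_ne n2, Pi.single_eq_of_ne n3.symm, add_zero,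
        sub_zero, neg_zero, zero_sub, qNumOne_eq, qp_add hs, qp_sub hs, qp_neg, qp_one, qp_two]
      have b2 := qp_ne hs (ν c)
      field_simp
    · simp only [outerSum, lin_add, lin_sub, lin_neg, lin_single, o1, o2, o3, Fin.rev_rev, if_false,
        zero_mul, Pi.add_apply, Pi.sub_apply, Pi.neg_apply, Pi.single_eq_same,
          Pi.single_eq_of_ne n1,
        Pi.single_eq_of_ne n2, Pi.single_eq_of_ne n3, Pi.single_eq_of_ne n3.symm, add_zero,
          zero_add,
        sub_zero, neg_zero, zero_sub, qNum_eq, qp_add hs, qp_sub hs, qp_neg, qp_one]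
      have b2 := qp_ne hs (ν a)
      have b3 := qp_ne hs (ν a.rev)
      field_simp
    · simp only [hopShort, hopShortRev, shiftOp_mul]
      have e : (Pi.single c 2 : Lat N) = Pi.single c 1 + Pi.single c 1 := by
        rw [← Pi.single_add]; rfl
      rw [shiftOp_congr (δ := -(Pi.single a 1 + Pi.single a.rev 1) +
        (Pi.single a 1 - Pi.single c 1))
          (ε := -Pi.single a.rev 1 - Pi.single c 1) (by abel) fun _ => rfl,
        shiftOp_congr (δ := Pi.single a 1 - Pi.single c 1 + -(Pi.single a 1 + Pi.single a.rev 1))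
          (ε := -Pi.single a.rev 1 - Pi.single c 1) (by abel) fun _ => rfl,
        shiftOp_congr (δ := -Pi.single c 2 + (Pi.single c 1 - Pi.single a.rev 1))
          (ε := -Pi.single a.rev 1 - Pi.single c 1) (by rw [e]; abel) fun _ => rfl,
        shiftOp_congr (δ := Pi.single c 1 - Pi.single a.rev 1 + -Pi.single c 2)
          (ε := -Pi.single a.rev 1 - Pi.single c 1) (by rw [e]; abel) fun _ => rfl, shiftOp_sub,
        shiftOp_sub]
      refine shiftOp_congr rfl fun ν => ?_
      simp only [outerSum, lin_add, lin_sub, lin_neg, lin_single, o1, o2, o3, Fin.rev_rev, if_false,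
        zero_mul, Pi.add_apply, Pi.sub_apply, Pi.neg_apply, Pi.single_eq_same,
          Pi.single_eq_of_ne n1,
        Pi.single_eq_of_ne n1.symm, Pi.single_eq_of_ne n2, Pi.single_eq_of_ne n2.symm,
        Pi.single_eq_of_ne n3, Pi.single_eq_of_ne n3.symm, add_zero, zero_add, sub_zero, zero_sub,
        neg_zero, qNum_eq, qNumOne_eq, qp_add hs, qp_sub hs, qp_neg, qp_one, qp_two]
      have b1 := qp_ne hs (ν a)
      have b2 := qp_ne hs (ν c)
      have b3 := qp_ne hs (ν a.rev)
      field_simp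
      ring
  · have p1 : (j : ℕ) ≠ k := fun e => hji (Fin.ext e)
    have p2 : (j : ℕ) ≠ k + 1 := fun e => hjc (Fin.ext (e.trans hc.symm))
    have := val_add_rev j
    exact commute_sub_left (hopShort_lapTerm_of_lt h (by omega))
      (hopShortRev_lapTerm_of_lt h (by omega))

end
end

section

variable {s : ℂ} {N : ℕ}

/-! ### Simple roots in both orientations -/

theorem latWt_add (ν μ : Lat N) : latWt (ν + μ) = latWt ν + latWt μ := by
  ext i; simp only [latWt, Pi.add_apply]; ring

theorem latWt_neg (ν : Lat N) : latWt (-ν) = -latWt ν := by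
  ext i; simp only [latWt, Pi.neg_apply]; ring

theorem latWt_sub (ν μ : Lat N) : latWt (ν - μ) = latWt ν - latWt μ := by
  ext i; simp only [latWt, Pi.sub_apply]; ring

theorem latWt_single_rev (j : Fin N) (t : ℤ) :
    latWt (Pi.single j.rev t) = -latWt (Pi.single j t) := by
  ext i
  have h (k l : Fin N) : (Pi.single l.rev t : Lat N) k.rev = (Pi.single l t : Lat N) k := by
    simp only [Pi.single_apply, Fin.rev_inj]
  simp only [latWt, Pi.neg_apply, h]
  have := h (Fin.rev ⟨i, by omega⟩) j
  rw [Fin.rev_rev] at this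
  rw [this]
  ring

theorem latWt_pair (j : Fin N) : latWt (Pi.single j 1 + Pi.single j.rev 1 : Lat N) = 0 := by
  rw [latWt_add, latWt_single_rev, add_neg_cancel]

/-- The operators of the Cartan part are diagonal. -/
def cartanExt (s : ℂ) {N : ℕ} (α : Fin (N / 2) → ℤ) : Module.End ℂ (LaurentSpace N) :=
  shiftOp (fun ν => qp s (wtDot α (latWt ν))) 0

theorem cartanExt_radSum (α : Fin (N / 2) → ℤ) : Commute (cartanExt s α) (radSum s N 0) :=
  Commute.sum_right _ _ _ fun j _ => shiftOp_commute fun ν => by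
    rw [latWt_add, latWt_pair, add_zero, add_zero, mul_comm]

theorem cartanExt_lapSum (α : Fin (N / 2) → ℤ) : Commute (cartanExt s α) (lapSum s N 0) :=
  Commute.sum_right _ _ _ fun j _ => shiftOp_commute fun ν => by
    rw [latWt_add, latWt_neg, latWt_pair, neg_zero, add_zero, add_zero, mul_comm]

theorem soExt_K (i : Fin (N / 2)) : soExt s N (.K i) = cartanExt s (simpleRoot i) := rfl

theorem wtDot_neg_left {n : ℕ} (α β : Fin n → ℤ) : wtDot (-α) β = -wtDot α β := by
  simp [wtDot]

theorem soExt_Kinv (i : Fin (N / 2)) : soExt s N (.Kinv i) = cartanExt s (-simpleRoot i) := by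
  simp only [soExt, cartanExt, wtDot_neg_left]

/-- The operator attached to the index `i` and the orientation: the second argument is the identity
for the raising operators and the flip `j ↦ j'` for the lowering ones. -/
def stepExt (s : ℂ) {N : ℕ} (i : Fin (N / 2)) (θ : Fin N → Fin N) :
    Module.End ℂ (LaurentSpace N) :=
  if (i : ℕ) + 1 < N / 2 then raiseExt s (θ ⟨i, by omega⟩) (θ ⟨(i : ℕ) + 1, by omega⟩)
  else if N % 2 = 1 then raiseShortExt s (θ ⟨i, by omega⟩) ⟨(i : ℕ) + 1, by omega⟩
  else raiseExt s (θ ⟨(i : ℕ) - 1, by omega⟩) (θ ⟨(i : ℕ) + 1, by omega⟩)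

theorem soExt_E (i : Fin (N / 2)) : soExt s N (.E i) = stepExt s i id := rfl

theorem soExt_F (i : Fin (N / 2)) : soExt s N (.F i) =
    (if (i : ℕ) + 1 < N / 2 then -1 else if N % 2 = 1 then -s⁻¹ else -1 : ℂ) •
      stepExt s i Fin.rev := by
  simp only [soExt, stepExt]
  split_ifs
  · module
  · rfl
  · module

/-- The two orientations. -/
def IsOrientation (θ : Fin N → Fin N) : Prop := θ = id ∨ θ = Fin.rev

/-- A property of the operators of the simple roots, in either orientation, may be checked on two
consecutive pairs and, for odd `N`, on the innermost pair with the middle position.  The last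
simple root for even `N` is of the first kind because `b` may be the right member of its pair. -/
theorem stepExt_cases (hN : 3 ≤ N) (i : Fin (N / 2)) {θ : Fin N → Fin N} (hθ : IsOrientation θ)
    {P : Module.End ℂ (LaurentSpace N) → Prop}
    (h1 : ∀ k a b, AdjacentPairs k a b → P (raiseExt s a b))
    (h2 : ∀ k a c, InnermostPair k a c → P (raiseShortExt s a c)) : P (stepExt s i θ) := by
  have hi := i.2
  have key (k : ℕ) (hk : k < N) : (θ ⟨k, hk⟩ : ℕ) = k ∨ ((θ ⟨k, hk⟩).rev : ℕ) = k := by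
    rcases hθ with rfl | rfl
    · exact Or.inl rfl
    · exact Or.inr (by rw [Fin.rev_rev])
  have key' (k : ℕ) (hk : k < N) : (θ ⟨k, hk⟩ : ℕ) = N - 1 - k ∨
      ((θ ⟨k, hk⟩).rev : ℕ) = N - 1 - k := by
    rcases hθ with rfl | rfl
    · exact Or.inr (by rw [Fin.val_rev]; show N - (k + 1) = _; omega)
    · exact Or.inl (by rw [Fin.val_rev]; show N - (k + 1) = _; omega)
  unfold stepExt
  split_ifs with c1 c2
  · exact h1 i _ _ ⟨key _ _, key _ _, by omega⟩
  · exact h2 i _ _ ⟨key _ _, rfl, by omega⟩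
  · refine h1 (i - 1) _ _ ⟨key _ _, ?_, by omega⟩
    have := key' (i + 1) (by omega)
    rwa [show N - 1 - ((i : ℕ) + 1) = i - 1 + 1 by omega] at this

theorem commute_smul_left {A X : Module.End ℂ (LaurentSpace N)} (c : ℂ) (h : Commute A X) :
    Commute (c • A) X := h.smul_left c

theorem stepExt_radSum (hs : s ≠ 0) (hq : NotRootOfUnity s) (hN : 3 ≤ N) (i : Fin (N / 2))
    {θ : Fin N → Fin N} (hθ : IsOrientation θ) : Commute (stepExt s i θ) (radSum s N 0) :=
  stepExt_cases (P := fun T => Commute T (radSum s N 0)) hN i hθ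
    (fun _ _ _ h => raiseExt_radSum hs hq h) fun _ _ _ h => raiseShortExt_radSum hs hq h

theorem stepExt_lapSum (hs : s ≠ 0) (hq : NotRootOfUnity s) (hN : 3 ≤ N) (i : Fin (N / 2))
    {θ : Fin N → Fin N} (hθ : IsOrientation θ) : Commute (stepExt s i θ) (lapSum s N 0) :=
  stepExt_cases (P := fun T => Commute T (lapSum s N 0)) hN i hθ
    (fun _ _ _ h => raiseExt_lapSum hs hq h) fun _ _ _ h => raiseShortExt_lapSum hs hq h

theorem soExt_radSum (hs : s ≠ 0) (hq : NotRootOfUnity s) (hN : 3 ≤ N) (g : SoGen (N / 2)) :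
    Commute (soExt s N g) (radSum s N 0) := by
  cases g with
  | E i => rw [soExt_E]; exact stepExt_radSum hs hq hN i (Or.inl rfl)
  | F i => rw [soExt_F]; exact commute_smul_left _ (stepExt_radSum hs hq hN i (Or.inr rfl))
  | K i => exact cartanExt_radSum _
  | Kinv i => rw [soExt_Kinv]; exact cartanExt_radSum _

theorem soExt_lapSum (hs : s ≠ 0) (hq : NotRootOfUnity s) (hN : 3 ≤ N) (g : SoGen (N / 2)) :
    Commute (soExt s N g) (lapSum s N 0) := by
  cases g with
  | E i => rw [soExt_E]; exact stepExt_lapSum hs hq hN i (Or.inl rfl)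
  | F i => rw [soExt_F]; exact commute_smul_left _ (stepExt_lapSum hs hq hN i (Or.inr rfl))
  | K i => exact cartanExt_lapSum _
  | Kinv i => rw [soExt_Kinv]; exact cartanExt_lapSum _

theorem raiseExt_totalDeg (a b : Fin N) (φ : ℤ → ℂ) :
    Commute (raiseExt s a b) (shiftOp (fun ν => φ (totalDeg ν)) 0) := by
  refine commute_sub_left ?_ ?_ <;>
  · refine shiftOp_commute fun ν => ?_
    simp only [totalDeg, lin_add, lin_sub, lin_single, sub_self, add_zero]
    ring

theorem raiseShortExt_totalDeg (a c : Fin N) (φ : ℤ → ℂ) :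
    Commute (raiseShortExt s a c) (shiftOp (fun ν => φ (totalDeg ν)) 0) := by
  refine commute_sub_left ?_ ?_ <;>
  · refine shiftOp_commute fun ν => ?_
    simp only [totalDeg, lin_add, lin_sub, lin_single, sub_self, add_zero]
    ring

theorem soExt_totalDeg (hN : 3 ≤ N) (g : SoGen (N / 2)) (φ : ℤ → ℂ) :
    Commute (soExt s N g) (shiftOp (fun ν => φ (totalDeg ν)) 0) := by
  have key (i : Fin (N / 2)) {θ : Fin N → Fin N} (hθ : IsOrientation θ) :
      Commute (stepExt s i θ) (shiftOp (fun ν => φ (totalDeg ν)) 0) :=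
    stepExt_cases (P := fun T => Commute T (shiftOp (fun ν => φ (totalDeg ν)) 0)) hN i hθ
      (fun _ _ _ _ => raiseExt_totalDeg _ _ _) fun _ _ _ _ => raiseShortExt_totalDeg _ _ _
  cases g with
  | E i => rw [soExt_E]; exact key i (Or.inl rfl)
  | F i => rw [soExt_F]; exact commute_smul_left _ (key i (Or.inr rfl))
  | K i => exact shiftOp_commute fun ν => by rw [add_zero, mul_comm]
  | Kinv i => exact shiftOp_commute fun ν => by rw [add_zero, mul_comm]

end

/-! ### The `q`-Serre relations for long roots -/

section serre

variable {R : Type*} [Ring R] [Algebra ℂ R]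

/-- The left-hand side of the `q`-Serre relation for `a_{ij} = -1`. -/
def serreOne (t : ℂ) (X Y : R) : R := X ^ 2 * Y - (t + t⁻¹) • (X * Y * X) + Y * X ^ 2

/-- The left-hand side of the `q`-Serre relation for `a_{ij} = -2`. -/
def serreTwo (t : ℂ) (X Y : R) : R :=
  X ^ 3 * Y - (t ^ 2 + 1 + (t ^ 2)⁻¹) • (X ^ 2 * Y * X) +
    (t ^ 2 + 1 + (t ^ 2)⁻¹) • (X * Y * X ^ 2) - Y * X ^ 3

theorem serreOne_smul {t : ℂ} {X Y : R} (c d : ℂ) (h : serreOne t X Y = 0) :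
    serreOne t (c • X) (d • Y) = 0 := by
  have : serreOne t (c • X) (d • Y) = (c ^ 2 * d) • serreOne t X Y := by
    simp only [serreOne, pow_two, smul_mul_assoc, mul_smul_comm, mul_assoc]
    module
  rw [this, h, smul_zero]

theorem serreTwo_smul {t : ℂ} {X Y : R} (c d : ℂ) (h : serreTwo t X Y = 0) :
    serreTwo t (c • X) (d • Y) = 0 := by
  have : serreTwo t (c • X) (d • Y) = (c ^ 3 * d) • serreTwo t X Y := by
    simp only [serreTwo, pow_three, pow_two X, pow_two (c • X), smul_mul_assoc, mul_smul_comm,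
      mul_assoc]
    module
  rw [this, h, smul_zero]

/-- The `q`-Serre relation for sums of two operators follows from the one for the corresponding
summands, as soon as the other pairs `q`-commute in the right way. -/
theorem serreOne_add {t : ℂ} (ht : t ≠ 0) {A B C D : R} (c d : ℂ) (h1 : serreOne t A C = 0)
    (h2 : serreOne t B D = 0) (hBA : B * A = t ^ 2 • (A * B)) (hBC : B * C = t⁻¹ • (C * B))
    (hDA : D * A = t⁻¹ • (A * D)) : serreOne t (A + c • B) (C + d • D) = 0 := by
  have gBA (Z : R) : B * (A * Z) = t ^ 2 • (A * (B * Z)) := by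
    rw [← mul_assoc, hBA, smul_mul_assoc, mul_assoc]
  have gBC (Z : R) : B * (C * Z) = t⁻¹ • (C * (B * Z)) := by
    rw [← mul_assoc, hBC, smul_mul_assoc, mul_assoc]
  have gDA (Z : R) : D * (A * Z) = t⁻¹ • (A * (D * Z)) := by
    rw [← mul_assoc, hDA, smul_mul_assoc, mul_assoc]
  have key : serreOne t (A + c • B) (C + d • D) =
      serreOne t A C + (c ^ 2 * d) • serreOne t B D := by
    simp only [serreOne, pow_two A, pow_two B, pow_two (A + _), mul_add, add_mul, smul_mul_assoc,
      mul_smul_comm, mul_assoc, hBA, hBC, hDA, gBA, gBC, gDA]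
    match_scalars <;> field_simp <;> ring
  rw [key, h1, h2, smul_zero, add_zero]

/-- The cubic `q`-Serre relation holds as soon as the corresponding iterated `q`-commutator
vanishes, the `q`-commutators being taken in the order `r`, `r⁻¹`, `1`. -/
theorem serreTwo_of_qcomm {t r : ℂ} (hr : r ≠ 0) (htr : t ^ 2 + (t ^ 2)⁻¹ = r + r⁻¹) {X Y U V : R}
    (hU : X * Y = r • (Y * X) + U) (hV : X * U = r⁻¹ • (U * X) + V) (hXV : X * V = V * X) :
    serreTwo t X Y = 0 := by
  have gU (Z : R) : X * (Y * Z) = r • (Y * (X * Z)) + U * Z := by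
    rw [← mul_assoc, hU, add_mul, smul_mul_assoc, mul_assoc]
  have gV (Z : R) : X * (U * Z) = r⁻¹ • (U * (X * Z)) + V * Z := by
    rw [← mul_assoc, hV, add_mul, smul_mul_assoc, mul_assoc]
  have gXV (Z : R) : X * (V * Z) = V * (X * Z) := by rw [← mul_assoc, hXV, mul_assoc]
  have e : t ^ 2 + 1 + (t ^ 2)⁻¹ = r + 1 + r⁻¹ := by linear_combination htr
  simp only [serreTwo, e, pow_three, pow_two X, mul_add, add_mul, smul_mul_assoc, mul_smul_comm,
    mul_assoc, hU, hV, hXV,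
    gU, gV, gXV]
  match_scalars <;> field_simp <;> ring

theorem serreTwo_sub_right {t : ℂ} {X Y Z : R} (c : ℂ) (h1 : serreTwo t X Y = 0)
    (h2 : serreTwo t X Z = 0) : serreTwo t X (Y + c • Z) = 0 := by
  have : serreTwo t X (Y + c • Z) = serreTwo t X Y + c • serreTwo t X Z := by
    simp only [serreTwo, mul_add, add_mul, smul_mul_assoc, mul_smul_comm]
    module
  rw [this, h1, h2, smul_zero, add_zero]

end serre

section

variable {s : ℂ} {N : ℕ}

theorem serreOne_shiftOp {t : ℂ} {φ ψ : Lat N → ℂ} {δ ε : Lat N}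
    (h : ∀ ν, φ (ν + ε + δ) * φ (ν + ε) * ψ ν -
      (t + t⁻¹) * (φ (ν + δ + ε) * ψ (ν + δ) * φ ν) + ψ (ν + δ + δ) * φ (ν + δ) * φ ν = 0) :
    serreOne (R := Module.End ℂ (LaurentSpace N)) t (shiftOp φ δ) (shiftOp ψ ε) = 0 := by
  refine Finsupp.lhom_ext fun ν c => ?_
  have e1 : ν + δ + ε + δ = ν + ε + δ + δ := by abel
  have e2 : ν + δ + δ + ε = ν + ε + δ + δ := by abel
  simp only [serreOne, pow_two, LinearMap.add_apply, LinearMap.sub_apply, LinearMap.smul_apply,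
    Module.End.mul_apply, shiftOp_single, e1, e2, LinearMap.zero_apply, Finsupp.smul_single,
    ← Finsupp.single_sub, ← Finsupp.single_add, smul_eq_mul]
  rw [Finsupp.single_eq_zero]
  linear_combination c * h ν

/-- The positions `a`, `b`, `c` and their mirror images are distinct. -/
structure DistinctTriple {N : ℕ} (a b c : Fin N) : Prop where
  ab : a ≠ b
  ac : a ≠ c
  bc : b ≠ c
  ab' : a ≠ b.rev
  ac' : a ≠ c.rev
  bc' : b ≠ c.rev
  aa' : a ≠ a.rev
  bb' : b ≠ b.rev
  cc' : c ≠ c.rev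

namespace DistinctTriple

variable {a b c : Fin N}

theorem swap (h : DistinctTriple a b c) : b.rev ≠ a ∧ c.rev ≠ a ∧ c.rev ≠ b ∧ a.rev ≠ b ∧
    a.rev ≠ c ∧ b.rev ≠ c ∧ b ≠ a.rev ∧ c ≠ a.rev ∧ c ≠ b.rev := by
  have g {i j : Fin N} (hij : i ≠ j.rev) : i.rev ≠ j := fun e => hij (by rw [← e, Fin.rev_rev])
  exact ⟨h.ab'.symm, h.ac'.symm, h.bc'.symm, g h.ab', g h.ac', g h.bc', (g h.ab').symm,
    (g h.ac').symm, (g h.bc').symm⟩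

theorem hop_hop (hs : s ≠ 0) (hq : NotRootOfUnity s) (h : DistinctTriple a b c) :
    serreOne (s ^ 2) (hopOp s a b) (hopOp s b c) = 0 := by
  refine serreOne_shiftOp fun ν => ?_
  simp only [Pi.add_apply, Pi.sub_apply, Pi.single_apply, h.ab, h.ac, h.bc, h.ab.symm, h.ac.symm,
    h.bc.symm, if_true, if_false, add_zero, sub_zero, zero_sub, zero_add, qNum_eq, qp_add hs,
    qp_sub hs, qp_neg, qp_one, qp_zero]
  have b1 := qp_ne hs (ν a)
  have b2 := qp_ne hs (ν b)
  have b3 := qp_ne hs (ν c)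
  have hd := pow_four_sub_one_ne_zero hs hq
  field_simp
  ring

theorem hop_hop' (hs : s ≠ 0) (hq : NotRootOfUnity s) (h : DistinctTriple a b c) :
    serreOne (s ^ 2) (hopOp s b c) (hopOp s a b) = 0 := by
  refine serreOne_shiftOp fun ν => ?_
  simp only [Pi.add_apply, Pi.sub_apply, Pi.single_apply, h.ab, h.ac, h.bc, h.ab.symm, h.ac.symm,
    h.bc.symm, if_true, if_false, add_zero, sub_zero, zero_sub, zero_add, qNum_eq, qp_add hs,
    qp_sub hs, qp_neg, qp_one, qp_zero]
  have b1 := qp_ne hs (ν a)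
  have b2 := qp_ne hs (ν b)
  have b3 := qp_ne hs (ν c)
  have hd := pow_four_sub_one_ne_zero hs hq
  field_simp
  ring

theorem rev_rev (hs : s ≠ 0) (hq : NotRootOfUnity s) (h : DistinctTriple a b c) :
    serreOne (s ^ 2) (hopOpRev s a b) (hopOpRev s b c) = 0 := by
  obtain ⟨g1, g2, g3, g4, g5, g6, g7, g8, g9⟩ := h.swap
  refine serreOne_shiftOp fun ν => ?_
  simp only [Pi.add_apply, Pi.sub_apply, Pi.single_apply, Fin.rev_inj, h.ab, h.ac, h.bc, h.ab.symm,
    h.ac.symm, h.bc.symm, h.ab', h.ac', h.bc', h.aa', h.bb', h.cc', h.aa'.symm, h.bb'.symm,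
    h.cc'.symm, g1, g2, g3, g4, g5, g6, g7, g8, g9,
    if_true, if_false, add_zero, sub_zero, zero_sub, zero_add, qNum_eq, qp_add hs,
    qp_sub hs, qp_neg, qp_one, qp_zero]
  have b1 := qp_ne hs (ν a)
  have b2 := qp_ne hs (ν b)
  have b3 := qp_ne hs (ν c)
  have b4 := qp_ne hs (ν a.rev)
  have b5 := qp_ne hs (ν b.rev)
  have b6 := qp_ne hs (ν c.rev)
  have hd := pow_four_sub_one_ne_zero hs hq
  field_simp
  ring

theorem rev_rev' (hs : s ≠ 0) (hq : NotRootOfUnity s) (h : DistinctTriple a b c) :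
    serreOne (s ^ 2) (hopOpRev s b c) (hopOpRev s a b) = 0 := by
  obtain ⟨g1, g2, g3, g4, g5, g6, g7, g8, g9⟩ := h.swap
  refine serreOne_shiftOp fun ν => ?_
  simp only [Pi.add_apply, Pi.sub_apply, Pi.single_apply, Fin.rev_inj, h.ab, h.ac, h.bc, h.ab.symm,
    h.ac.symm, h.bc.symm, h.ab', h.ac', h.bc', h.aa', h.bb', h.cc', h.aa'.symm, h.bb'.symm,
    h.cc'.symm, g1, g2, g3, g4, g5, g6, g7, g8, g9,
    if_true, if_false, add_zero, sub_zero, zero_sub, zero_add, qNum_eq, qp_add hs,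
    qp_sub hs, qp_neg, qp_one, qp_zero]
  have b1 := qp_ne hs (ν a)
  have b2 := qp_ne hs (ν b)
  have b3 := qp_ne hs (ν c)
  have b4 := qp_ne hs (ν a.rev)
  have b5 := qp_ne hs (ν b.rev)
  have b6 := qp_ne hs (ν c.rev)
  have hd := pow_four_sub_one_ne_zero hs hq
  field_simp
  ring

theorem rev_hop (hs : s ≠ 0) (h : DistinctTriple a b c) :
    hopOpRev s b c * hopOp s a b = (s ^ 2)⁻¹ • (hopOp s a b * hopOpRev s b c) := by
  obtain ⟨g1, g2, g3, g4, g5, g6, g7, g8, g9⟩ := h.swap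
  refine shiftOp_comm _ fun ν => ?_
  simp only [Pi.add_apply, Pi.sub_apply, Pi.single_apply, Fin.rev_inj, h.ab, h.ac, h.bc, h.ab.symm,
    h.ac.symm, h.bc.symm, h.ab', h.ac', h.bc', h.aa', h.bb', h.cc', h.aa'.symm, h.bb'.symm,
    h.cc'.symm, g1, g2, g3, g4, g5, g6, g7, g8, g9,
    if_true, if_false, add_zero, sub_zero, zero_sub, zero_add, qp_add hs,
    qp_sub hs, qp_neg, qp_one, qp_zero]
  have b2 := qp_ne hs (ν b)
  field_simp

theorem rev_hop' (hs : s ≠ 0) (h : DistinctTriple a b c) :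
    hopOpRev s a b * hopOp s b c = (s ^ 2)⁻¹ • (hopOp s b c * hopOpRev s a b) := by
  obtain ⟨g1, g2, g3, g4, g5, g6, g7, g8, g9⟩ := h.swap
  refine shiftOp_comm _ fun ν => ?_
  simp only [Pi.add_apply, Pi.sub_apply, Pi.single_apply, Fin.rev_inj, h.ab, h.ac, h.bc, h.ab.symm,
    h.ac.symm, h.bc.symm, h.ab', h.ac', h.bc', h.aa', h.bb', h.cc', h.aa'.symm, h.bb'.symm,
    h.cc'.symm, g1, g2, g3, g4, g5, g6, g7, g8, g9,
    if_true, if_false, add_zero, sub_zero, zero_sub, zero_add, qp_add hs,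
    qp_sub hs, qp_neg, qp_one, qp_zero]
  have b2 := qp_ne hs (ν b)
  field_simp

end DistinctTriple

theorem hopOpRev_hopOp (hs : s ≠ 0) {a b : Fin N} (ab : a ≠ b) (ab' : a ≠ b.rev) (aa' : a ≠ a.rev)
    (bb' : b ≠ b.rev) : hopOpRev s a b * hopOp s a b = (s ^ 2) ^ 2 • (hopOp s a b *
      hopOpRev s a b) := by
  have g : a.rev ≠ b := fun e => ab' (by rw [← e, Fin.rev_rev])
  refine shiftOp_comm _ fun ν => ?_
  simp only [Pi.add_apply, Pi.sub_apply, Pi.single_apply, Fin.rev_inj, ab, ab', aa', bb', ab.symm,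
    ab'.symm, aa'.symm, bb'.symm, g, g.symm,
    if_true, if_false, add_zero, sub_zero, zero_sub, zero_add, qp_add hs,
    qp_sub hs, qp_neg, qp_one, qp_zero]
  have b2 := qp_ne hs (ν b)
  field_simp

theorem raiseExt_eq (a b : Fin N) : raiseExt s a b = hopOp s a b + (-1 : ℂ) • hopOpRev s a b := by
  rw [raiseExt]; module

/-- The two summands of `raiseExt` satisfy the relation separately, and `q`-commute with each other.
-/
theorem raiseExt_serre (hs : s ≠ 0) (hq : NotRootOfUnity s) {a b c : Fin N}
    (h : DistinctTriple a b c) : serreOne (s ^ 2) (raiseExt s a b) (raiseExt s b c) = 0 := by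
  rw [raiseExt_eq, raiseExt_eq]
  exact serreOne_add (R := Module.End ℂ (LaurentSpace N)) (pow_ne_zero 2 hs) _ _ (h.hop_hop hs hq)
    (h.rev_rev hs hq) (hopOpRev_hopOp hs h.ab h.ab' h.aa' h.bb') (h.rev_hop' hs) (h.rev_hop hs)

theorem raiseExt_serre' (hs : s ≠ 0) (hq : NotRootOfUnity s) {a b c : Fin N}
    (h : DistinctTriple a b c) : serreOne (s ^ 2) (raiseExt s b c) (raiseExt s a b) = 0 := by
  rw [raiseExt_eq, raiseExt_eq]
  exact serreOne_add (R := Module.End ℂ (LaurentSpace N)) (pow_ne_zero 2 hs) _ _ (h.hop_hop' hs hq)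
    (h.rev_rev' hs hq) (hopOpRev_hopOp hs h.bc h.bc' h.bb' h.cc') (h.rev_hop hs) (h.rev_hop' hs)

end

section

variable {s : ℂ} {N : ℕ}

/-! ### Commutators of raising and lowering operators -/

theorem mul_sub_eq_of_commute {R : Type*} [Ring R] {A B C D : R} (h1 : A * C = C * A)
    (h2 : A * D = D * A) (h3 : B * C = C * B) (h4 : B * D = D * B) :
    (A - B) * (C - D) = (C - D) * (A - B) := by
  simp only [mul_sub, sub_mul, h1, h2, h3, h4]
  abel

theorem commute_sub_sub {A B C D : Module.End ℂ (LaurentSpace N)} (h1 : Commute A C)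
    (h2 : Commute A D) (h3 : Commute B C) (h4 : Commute B D) : Commute (A - B) (C - D) :=
  mul_sub_eq_of_commute (R := Module.End ℂ (LaurentSpace N)) h1 h2 h3 h4

theorem commutator_eq_of_ring {R : Type*} [Ring R] {A B C D P Q : R} (h1 : A * C = C * A)
    (h2 : B * D = D * B) (h3 : A * D - D * A = P) (h4 : B * C - C * B = Q) :
    (A - B) * (C - D) - (C - D) * (A - B) = -(P + Q) := by
  rw [← h3, ← h4]
  simp only [mul_sub, sub_mul, h1, h2]
  abel

theorem commutator_eq {A B C D P Q : Module.End ℂ (LaurentSpace N)} (h1 : Commute A C)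
    (h2 : Commute B D) (h3 : A * D - D * A = P) (h4 : B * C - C * B = Q) :
    (A - B) * (C - D) - (C - D) * (A - B) = -(P + Q) :=
  commutator_eq_of_ring (R := Module.End ℂ (LaurentSpace N)) h1 h2 h3 h4

theorem shiftOp_commutator {φ ψ χ : Lat N → ℂ} {δ ε ζ : Lat N} (hζ : ε + δ = ζ)
    (h : ∀ ν, φ (ν + ε) * ψ ν - ψ (ν + δ) * φ ν = χ ν) :
    shiftOp φ δ * shiftOp ψ ε - shiftOp ψ ε * shiftOp φ δ = shiftOp χ ζ := by
  rw [shiftOp_mul, shiftOp_mul, add_comm δ ε, shiftOp_sub]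
  exact shiftOp_congr hζ h

theorem shiftOp_qcomm {φ ψ χ : Lat N → ℂ} {δ ε ζ : Lat N} {r : ℂ} (hζ : ε + δ = ζ)
    (h : ∀ ν, φ (ν + ε) * ψ ν = r * (ψ (ν + δ) * φ ν) + χ ν) :
    shiftOp φ δ * shiftOp ψ ε = r • (shiftOp ψ ε * shiftOp φ δ) + shiftOp χ ζ := by
  rw [shiftOp_mul, shiftOp_mul, shiftOp_smul, add_comm δ ε, ← hζ, shiftOp_add]
  exact shiftOp_congr rfl h

/-- Operators of nodes that are not linked commute. -/
theorem raiseExt_commute_raiseExt {a b c d : Fin N} (h1 : a ≠ c ∧ a ≠ c.rev ∧ a ≠ d ∧ a ≠ d.rev)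
    (h2 : b ≠ c ∧ b ≠ c.rev ∧ b ≠ d ∧ b ≠ d.rev) : Commute (raiseExt s a b) (raiseExt s c d) := by
  obtain ⟨k1, k2, k3, k4⟩ := h1
  obtain ⟨l1, l2, l3, l4⟩ := h2
  have g {i j : Fin N} (hij : i ≠ j.rev) : i.rev ≠ j := fun e => hij (by rw [← e, Fin.rev_rev])
  refine commute_sub_sub ?_ ?_ ?_ ?_ <;>
  · refine shiftOp_commute fun ν => ?_
    simp only [Pi.add_apply, Pi.sub_apply, Pi.single_apply, Fin.rev_inj, k1, k2, k3, k4, l1, l2, l3,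
      l4, k1.symm, k2.symm, k3.symm, k4.symm, l1.symm, l2.symm, l3.symm, l4.symm, g k2, g k4, g l2,
      g l4, (g k2).symm, (g k4).symm, (g l2).symm, (g l4).symm, if_false, sub_zero, add_zero]
    ring

theorem raiseExt_commute_raiseShortExt {a b c d : Fin N}
    (h1 : a ≠ c ∧ a ≠ c.rev ∧ a ≠ d ∧ a.rev ≠ d) (h2 : b ≠ c ∧ b ≠ c.rev ∧ b ≠ d ∧ b.rev ≠ d) :
    Commute (raiseExt s a b) (raiseShortExt s c d) := by
  obtain ⟨k1, k2, k3, k4⟩ := h1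
  obtain ⟨l1, l2, l3, l4⟩ := h2
  have g {i j : Fin N} (hij : i ≠ j.rev) : i.rev ≠ j := fun e => hij (by rw [← e, Fin.rev_rev])
  refine commute_sub_sub ?_ ?_ ?_ ?_ <;>
  · refine shiftOp_commute fun ν => ?_
    simp only [Pi.add_apply, Pi.sub_apply, Pi.single_apply, Fin.rev_inj, k1, k2, k3, k4, l1, l2, l3,
      l4, k1.symm, k2.symm, k3.symm, k4.symm, l1.symm, l2.symm, l3.symm, l4.symm, g k2, g l2,
      (g k2).symm, (g l2).symm, if_false, sub_zero, add_zero]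
    ring

set_option maxHeartbeats 1000000 in
/-- Raising and lowering operators of linked nodes commute. -/
theorem DistinctTriple.cross (hs : s ≠ 0) {a b c : Fin N} (h : DistinctTriple a b c) :
    Commute (raiseExt s a b) (raiseExt s b.rev c.rev) := by
  obtain ⟨g1, g2, g3, g4, g5, g6, g7, g8, g9⟩ := h.swap
  refine commute_sub_sub ?_ ?_ ?_ ?_ <;>
  · refine shiftOp_commute fun ν => ?_
    simp only [Pi.add_apply, Pi.sub_apply, Pi.single_apply, Fin.rev_inj, Fin.rev_rev, h.ab, h.ac,
      h.bc, h.ab.symm, h.ac.symm, h.bc.symm, h.ab', h.ac', h.bc', h.aa', h.bb', h.cc', h.aa'.symm,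
      h.bb'.symm, h.cc'.symm, g1, g2, g3, g4, g5, g6, g7, g8, g9, if_true, if_false, add_zero,
      sub_zero, zero_sub, zero_add, qp_add hs, qp_sub hs, qp_neg, qp_one, qp_zero]
    have b2 := qp_ne hs (ν b)
    have b3 := qp_ne hs (ν b.rev)
    field_simp

section pair

variable {a b : Fin N}

theorem commute_fork (hs : s ≠ 0) (hq : NotRootOfUnity s) (ab : a ≠ b) (ab' : a ≠ b.rev)
    (aa' : a ≠ a.rev) (bb' : b ≠ b.rev) : Commute (raiseExt s a b) (raiseExt s a b.rev) := by
  have g : a.rev ≠ b := fun e => ab' (by rw [← e, Fin.rev_rev])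
  have hd := pow_four_sub_one_ne_zero hs hq
  refine sub_eq_zero.mp ((commutator_eq (shiftOp_commute fun ν => ?_) (shiftOp_commute fun ν => ?_)
    (shiftOp_commutator (χ := fun ν => qNum s (ν a.rev) *
      qp s (2 * ν a - ν b.rev - ν a.rev - ν b + 1)) (ζ := Pi.single a 1 - Pi.single a.rev 1)
      (by rw [Fin.rev_rev]; abel) fun ν => ?_)
    (shiftOp_commutator (χ := fun ν => -(qNum s (ν a.rev) *
      qp s (2 * ν a - ν b.rev - ν a.rev - ν b + 1))) (ζ := Pi.single a 1 - Pi.single a.rev 1)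
      (by abel) fun ν => ?_)).trans ?_)
  on_goal 5 => rw [shiftOp_add, shiftOp_eq_zero fun ν => add_neg_cancel _]; module
  all_goals
    simp only [two_mul, Pi.add_apply, Pi.sub_apply, Pi.single_apply, Fin.rev_rev, Fin.rev_inj, ab,
      ab', aa', bb', ab.symm, ab'.symm,
      aa'.symm, bb'.symm, g, g.symm,
      if_true, if_false, add_zero, sub_zero, zero_sub, zero_add, qNum_eq, qNumOne_eq, qp_add hs,
      qp_sub hs, qp_neg, qp_one, qp_zero]
    have b0 := qp_ne hs (ν a)
    have b1 := qp_ne hs (ν b)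
    have b2 := qp_ne hs (ν a.rev)
    have b3 := qp_ne hs (ν b.rev)
    field_simp
    try ring

theorem commute_fork_cross (hs : s ≠ 0) (hq : NotRootOfUnity s) (ab : a ≠ b) (ab' : a ≠ b.rev)
    (aa' : a ≠ a.rev) (bb' : b ≠ b.rev) : Commute (raiseExt s a b) (raiseExt s a.rev b) := by
  have g : a.rev ≠ b := fun e => ab' (by rw [← e, Fin.rev_rev])
  have hd := pow_four_sub_one_ne_zero hs hq
  refine sub_eq_zero.mp ((commutator_eq (shiftOp_commute fun ν => ?_) (shiftOp_commute fun ν => ?_)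
    (shiftOp_commutator (χ := fun ν => -(qNum s (ν b) *
      qp s (ν a + ν a.rev - 2 * ν b + ν b.rev + 1 + 1))) (ζ := Pi.single b.rev 1 - Pi.single b 1)
      (by rw [Fin.rev_rev]; abel) fun ν => ?_)
    (shiftOp_commutator (χ := fun ν => qNum s (ν b) *
      qp s (ν a + ν a.rev - 2 * ν b + ν b.rev + 1 + 1)) (ζ := Pi.single b.rev 1 - Pi.single b 1)
      (by abel) fun ν => ?_)).trans ?_)
  on_goal 5 => rw [shiftOp_add, shiftOp_eq_zero fun ν => neg_add_cancel _]; module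
  all_goals
    simp only [two_mul, Pi.add_apply, Pi.sub_apply, Pi.single_apply, Fin.rev_rev, Fin.rev_inj, ab,
      ab', aa', bb', ab.symm, ab'.symm,
      aa'.symm, bb'.symm, g, g.symm,
      if_true, if_false, add_zero, sub_zero, zero_sub, zero_add, qNum_eq, qNumOne_eq, qp_add hs,
      qp_sub hs, qp_neg, qp_one, qp_zero]
    have b0 := qp_ne hs (ν a)
    have b1 := qp_ne hs (ν b)
    have b2 := qp_ne hs (ν a.rev)
    have b3 := qp_ne hs (ν b.rev)
    field_simp
    try ring

/-- The operator `raiseExt s a' b'` lowers along the root along which `raiseExt s a b` raises; only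
the products with total shift zero survive in the commutator. -/
theorem raiseExt_commutator (hs : s ≠ 0) (hq : NotRootOfUnity s) (ab : a ≠ b) (ab' : a ≠ b.rev)
    (aa' : a ≠ a.rev) (bb' : b ≠ b.rev) :
    raiseExt s a b * raiseExt s a.rev b.rev - raiseExt s a.rev b.rev * raiseExt s a b =
      -shiftOp (fun ν => (s ^ 2 - (s ^ 2)⁻¹)⁻¹ * (qp s (ν a - ν a.rev - (ν b - ν b.rev)) -
        qp s (-(ν a - ν a.rev - (ν b - ν b.rev))))) 0 := by
  have g : a.rev ≠ b := fun e => ab' (by rw [← e, Fin.rev_rev])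
  have hd := pow_four_sub_one_ne_zero hs hq
  refine (commutator_eq (shiftOp_commute fun ν => ?_) (shiftOp_commute fun ν => ?_)
    (shiftOp_commutator (χ := fun ν => qp s (ν a.rev - ν b.rev) * qNum s (ν a - ν b))
      (by rw [Fin.rev_rev, Fin.rev_rev, sub_add_sub_cancel', sub_self]) fun ν => ?_)
    (shiftOp_commutator (χ := fun ν => qp s (ν a - ν b) * qNum s (ν b.rev - ν a.rev))
      (by rw [sub_add_sub_cancel, sub_self]) fun ν => ?_)).trans
    (congrArg _ ((shiftOp_add _ _ _).trans (shiftOp_congr rfl fun ν => ?_)))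
  all_goals
    simp only [Pi.add_apply, Pi.sub_apply, Pi.single_apply, Fin.rev_rev, Fin.rev_inj, ab, ab', aa',
      bb', ab.symm, ab'.symm,
      aa'.symm, bb'.symm, g, g.symm,
      if_true, if_false, add_zero, sub_zero, zero_sub, zero_add, qNum_eq, qNumOne_eq, qp_add hs,
      qp_sub hs, qp_neg, qp_one, qp_zero]
    have b0 := qp_ne hs (ν a)
    have b1 := qp_ne hs (ν b)
    have b2 := qp_ne hs (ν a.rev)
    have b3 := qp_ne hs (ν b.rev)
    field_simp
    try ring

end pair
end

section

variable {s : ℂ} {N : ℕ}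

/-- The positions `a`, `b`, their mirror images and `c` are distinct. -/
structure DistinctShort {N : ℕ} (a b c : Fin N) : Prop where
  ab : a ≠ b
  ab' : a ≠ b.rev
  aa' : a ≠ a.rev
  bb' : b ≠ b.rev
  ac : a ≠ c
  bc : b ≠ c
  ac' : a.rev ≠ c
  bc' : b.rev ≠ c

theorem raiseShortExt_eq (a b : Fin N) :
    raiseShortExt s a b = hopShort s a b + (-1 : ℂ) • hopShortRev s a b := by
  rw [raiseShortExt]; module

theorem raiseShortExt_commutator (hs : s ≠ 0) (hq : NotRootOfUnity s) {a c : Fin N} (n1 : a ≠ c)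
    (n2 : a.rev ≠ c) (n3 : a ≠ a.rev) :
    raiseShortExt s a c * raiseShortExt s a.rev c - raiseShortExt s a.rev c * raiseShortExt s a c =
      -shiftOp (fun ν => s * (s ^ 2 - (s ^ 2)⁻¹)⁻¹ * (qp s (ν a - ν a.rev) -
        qp s (-(ν a - ν a.rev)))) 0 := by
  have hd := pow_four_sub_one_ne_zero hs hq
  have hd1 := one_sub_sq_ne_zero hq
  refine (commutator_eq (shiftOp_commute fun ν => ?_) (shiftOp_commute fun ν => ?_)
    (shiftOp_commutator (χ := fun ν => s ^ 3 * qp s (ν a.rev - ν c) *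
        (qNumOne s (ν c + 1) * qNum s (ν a) * (s ^ 2)⁻¹ - qNum s (ν a + 1) * qNumOne s (ν c)))
      (by rw [Fin.rev_rev, sub_add_sub_cancel, sub_self]) fun ν => ?_)
    (shiftOp_commutator (χ := fun ν => s ^ 3 * qp s (ν a - ν c) *
        (qNum s (ν a.rev + 1) * qNumOne s (ν c) - qNumOne s (ν c + 1) * qNum s (ν a.rev) *
          (s ^ 2)⁻¹))
      (by rw [sub_add_sub_cancel, sub_self]) fun ν => ?_)).trans
    (congrArg _ ((shiftOp_add _ _ _).trans (shiftOp_congr rfl fun ν => ?_)))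
  all_goals
    simp only [Pi.add_apply, Pi.sub_apply, Pi.single_apply, Fin.rev_rev, Fin.rev_inj,
        n1, n2, n3, n1.symm, n2.symm, n3.symm,
        if_true, if_false, add_zero, sub_zero, zero_sub, zero_add, qNum_eq, qNumOne_eq, qp_add hs,
        qp_sub hs, qp_neg, qp_one, qp_zero]
    have b0 := qp_ne hs (ν a)
    have b1 := qp_ne hs (ν c)
    have b2 := qp_ne hs (ν a.rev)
    field_simp
    try ring

/-! ### The `q`-Serre relation for the short root -/

/-- The `q`-commutator of `hopShort s b c` with `hopOp s a b`: it moves one unit of exponent from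
the middle position `c` to `a`. -/
def hopSkew (s : ℂ) {N : ℕ} (a b c : Fin N) : Module.End ℂ (LaurentSpace N) :=
  shiftOp (fun ν => -(s ^ 3 * qNumOne s (ν c) * qp s (ν a - ν c - ν b - 1)))
    (Pi.single a 1 - Pi.single c 1)

/-- Up to sign, the `q`-commutator of `hopShortRev s b c` with `hopSkew s a b c`: it moves one unit
of exponent from `b'` to `a`. -/
def hopSkewTwo (s : ℂ) {N : ℕ} (a b : Fin N) : Module.End ℂ (LaurentSpace N) :=
  shiftOp (fun ν => -(s ^ 3 * qNum s (ν b.rev) * qp s (ν a - ν b.rev)))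
    (Pi.single a 1 - Pi.single b.rev 1)

/-- The `q`-commutator of `hopShortRev s b c` with `hopOpRev s a b`: it moves one unit of exponent
from `a'` to the middle position `c`. -/
def hopSkewRev (s : ℂ) {N : ℕ} (a b c : Fin N) : Module.End ℂ (LaurentSpace N) :=
  shiftOp (fun ν => qNum s (ν a.rev) * qp s (ν a - ν a.rev - ν b.rev + 1))
    (Pi.single c 1 - Pi.single a.rev 1)

/-- Up to sign, the `q`-commutator of `hopShort s b c` with `hopSkewRev s a b c`: it moves one unit
of exponent from `a'` to `b`. -/
def hopSkewRevTwo (s : ℂ) {N : ℕ} (a b : Fin N) : Module.End ℂ (LaurentSpace N) :=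
  shiftOp (fun ν => -(s ^ 3 * qNum s (ν a.rev) * qp s (ν a + ν b - ν a.rev - ν b.rev)))
    (Pi.single b 1 - Pi.single a.rev 1)

/-- Combination of the `q`-commutators of `A` and `B` with `Y` into the one of `A - B`. -/
theorem qcomm_sub {A B Y U V : Module.End ℂ (LaurentSpace N)} {r : ℂ} (h1 : A * Y = r • (Y * A) + U)
    (h2 : B * Y = r • (Y * B) + V) :
    (A + (-1 : ℂ) • B) * Y = r • (Y * (A + (-1 : ℂ) • B)) + (U + (-1 : ℂ) • V) := by
  rw [add_mul, mul_add, smul_mul_assoc, mul_smul_comm, h1, h2]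
  module

namespace DistinctShort

variable {a b c : Fin N}

theorem rev_ne (h : DistinctShort a b c) : a.rev ≠ b :=
  fun e => h.ab' (by rw [← e, Fin.rev_rev])

/-- Raising and lowering operators of linked nodes commute. -/
theorem cross (hs : s ≠ 0) (h : DistinctShort a b c) :
    Commute (raiseExt s a b) (raiseShortExt s b.rev c) := by
  have g := h.rev_ne
  refine commute_sub_sub ?_ ?_ ?_ ?_ <;>
  · refine shiftOp_commute fun ν => ?_
    simp only [Pi.add_apply, Pi.sub_apply, Pi.single_apply, Fin.rev_rev, Fin.rev_inj,
        h.ab, h.ab', h.aa', h.bb', h.ac, h.bc, h.ac', h.bc', h.ab.symm, h.ab'.symm, h.aa'.symm,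
        h.bb'.symm, h.ac.symm, h.bc.symm, h.ac'.symm, h.bc'.symm, g, g.symm,
        if_true, if_false, add_zero, sub_zero, zero_sub, zero_add, qp_add hs,
        qp_sub hs, qp_neg, qp_one, qp_zero]
    have b0 := qp_ne hs (ν b)
    have b1 := qp_ne hs (ν c)
    have b2 := qp_ne hs (ν b.rev)
    field_simp
    try ring

theorem hop_hopShort (hs : s ≠ 0) (hq : NotRootOfUnity s) (h : DistinctShort a b c) :
    serreOne (s ^ 2) (hopOp s a b) (hopShort s b c) = 0 := by
  have g := h.rev_ne
  have hd := pow_four_sub_one_ne_zero hs hq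
  have hd1 := one_sub_sq_ne_zero hq
  refine serreOne_shiftOp fun ν => ?_
  simp only [Pi.add_apply, Pi.sub_apply, Pi.single_apply, Fin.rev_rev, Fin.rev_inj,
      h.ab, h.ab', h.aa', h.bb', h.ac, h.bc, h.ac', h.bc', h.ab.symm, h.ab'.symm, h.aa'.symm,
      h.bb'.symm, h.ac.symm, h.bc.symm, h.ac'.symm, h.bc'.symm, g, g.symm,
      if_true, if_false, add_zero, sub_zero, zero_sub, zero_add, qNum_eq, qNumOne_eq, qp_add hs,
      qp_sub hs, qp_neg, qp_one, qp_zero]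
  have b0 := qp_ne hs (ν a)
  have b1 := qp_ne hs (ν b)
  have b2 := qp_ne hs (ν c)
  have b3 := qp_ne hs (ν a.rev)
  have b4 := qp_ne hs (ν b.rev)
  field_simp
  try ring

theorem rev_hopShortRev (hs : s ≠ 0) (hq : NotRootOfUnity s) (h : DistinctShort a b c) :
    serreOne (s ^ 2) (hopOpRev s a b) (hopShortRev s b c) = 0 := by
  have g := h.rev_ne
  have hd := pow_four_sub_one_ne_zero hs hq
  have hd1 := one_sub_sq_ne_zero hq
  refine serreOne_shiftOp fun ν => ?_
  simp only [Pi.add_apply, Pi.sub_apply, Pi.single_apply, Fin.rev_rev, Fin.rev_inj,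
      h.ab, h.ab', h.aa', h.bb', h.ac, h.bc, h.ac', h.bc', h.ab.symm, h.ab'.symm, h.aa'.symm,
      h.bb'.symm, h.ac.symm, h.bc.symm, h.ac'.symm, h.bc'.symm, g, g.symm,
      if_true, if_false, add_zero, sub_zero, zero_sub, zero_add, qNum_eq, qNumOne_eq, qp_add hs,
      qp_sub hs, qp_neg, qp_one, qp_zero]
  have b0 := qp_ne hs (ν a)
  have b1 := qp_ne hs (ν b)
  have b2 := qp_ne hs (ν c)
  have b3 := qp_ne hs (ν a.rev)
  have b4 := qp_ne hs (ν b.rev)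
  field_simp
  try ring

theorem rev_hopShort (hs : s ≠ 0) (h : DistinctShort a b c) :
    hopOpRev s a b * hopShort s b c = (s ^ 2)⁻¹ • (hopShort s b c * hopOpRev s a b) := by
  have g := h.rev_ne
  refine shiftOp_comm _ fun ν => ?_
  simp only [Pi.add_apply, Pi.sub_apply, Pi.single_apply, Fin.rev_rev, Fin.rev_inj,
      h.ab, h.ab', h.aa', h.bb', h.ac, h.bc, h.ac', h.bc', h.ab.symm, h.ab'.symm, h.aa'.symm,
      h.bb'.symm, h.ac.symm, h.bc.symm, h.ac'.symm, h.bc'.symm, g, g.symm,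
      if_true, if_false, add_zero, sub_zero, zero_sub, zero_add, qp_add hs,
      qp_sub hs, qp_neg, qp_one, qp_zero]
  have b0 := qp_ne hs (ν a)
  have b1 := qp_ne hs (ν b)
  have b2 := qp_ne hs (ν c)
  have b3 := qp_ne hs (ν a.rev)
  have b4 := qp_ne hs (ν b.rev)
  field_simp
  try ring

theorem hopShortRev_hop (hs : s ≠ 0) (h : DistinctShort a b c) :
    hopShortRev s b c * hopOp s a b = (s ^ 2)⁻¹ • (hopOp s a b * hopShortRev s b c) := by
  have g := h.rev_ne
  refine shiftOp_comm _ fun ν => ?_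
  simp only [Pi.add_apply, Pi.sub_apply, Pi.single_apply, Fin.rev_rev, Fin.rev_inj,
      h.ab, h.ab', h.aa', h.bb', h.ac, h.bc, h.ac', h.bc', h.ab.symm, h.ab'.symm, h.aa'.symm,
      h.bb'.symm, h.ac.symm, h.bc.symm, h.ac'.symm, h.bc'.symm, g, g.symm,
      if_true, if_false, add_zero, sub_zero, zero_sub, zero_add, qp_add hs,
      qp_sub hs, qp_neg, qp_one, qp_zero]
  have b0 := qp_ne hs (ν a)
  have b1 := qp_ne hs (ν b)
  have b2 := qp_ne hs (ν c)
  have b3 := qp_ne hs (ν a.rev)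
  have b4 := qp_ne hs (ν b.rev)
  field_simp
  try ring

theorem serreOne_raiseExt (hs : s ≠ 0) (hq : NotRootOfUnity s) (h : DistinctShort a b c) :
    serreOne (s ^ 2) (raiseExt s a b) (raiseShortExt s b c) = 0 := by
  rw [raiseExt_eq, raiseShortExt_eq]
  exact serreOne_add (R := Module.End ℂ (LaurentSpace N)) (pow_ne_zero 2 hs) _ _
    (h.hop_hopShort hs hq) (h.rev_hopShortRev hs hq) (hopOpRev_hopOp hs h.ab h.ab' h.aa' h.bb')
    (h.rev_hopShort hs) (h.hopShortRev_hop hs)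

theorem hopShort_hop (hs : s ≠ 0) (hq : NotRootOfUnity s) (h : DistinctShort a b c) :
    hopShort s b c * hopOp s a b = (s ^ 2)⁻¹ • (hopOp s a b * hopShort s b c) + hopSkew s a b c :=
      by
  have g := h.rev_ne
  have hd := pow_four_sub_one_ne_zero hs hq
  have hd1 := one_sub_sq_ne_zero hq
  refine shiftOp_qcomm (by abel) fun ν => ?_
  simp only [Pi.add_apply, Pi.sub_apply, Pi.single_apply, Fin.rev_rev, Fin.rev_inj,
      h.ab, h.ab', h.aa', h.bb', h.ac, h.bc, h.ac', h.bc', h.ab.symm, h.ab'.symm, h.aa'.symm,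
      h.bb'.symm, h.ac.symm, h.bc.symm, h.ac'.symm, h.bc'.symm, g, g.symm,
      if_true, if_false, add_zero, sub_zero, zero_sub, zero_add, qNum_eq, qNumOne_eq, qp_add hs,
      qp_sub hs, qp_neg, qp_one, qp_zero]
  have b0 := qp_ne hs (ν a)
  have b1 := qp_ne hs (ν b)
  have b2 := qp_ne hs (ν c)
  have b3 := qp_ne hs (ν a.rev)
  have b4 := qp_ne hs (ν b.rev)
  field_simp
  try ring

theorem hopShort_hopSkew (hs : s ≠ 0) (h : DistinctShort a b c) :
    hopShort s b c * hopSkew s a b c = s ^ 2 • (hopSkew s a b c * hopShort s b c) := by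
  have g := h.rev_ne
  refine shiftOp_comm _ fun ν => ?_
  simp only [Pi.add_apply, Pi.sub_apply, Pi.single_apply, Fin.rev_rev, Fin.rev_inj,
      h.ab, h.ab', h.aa', h.bb', h.ac, h.bc, h.ac', h.bc', h.ab.symm, h.ab'.symm, h.aa'.symm,
      h.bb'.symm, h.ac.symm, h.bc.symm, h.ac'.symm, h.bc'.symm, g, g.symm,
      if_true, if_false, add_zero, sub_zero, zero_sub, zero_add, qp_add hs,
      qp_sub hs, qp_neg, qp_one, qp_zero]
  have b0 := qp_ne hs (ν a)
  have b1 := qp_ne hs (ν b)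
  have b2 := qp_ne hs (ν c)
  have b3 := qp_ne hs (ν a.rev)
  have b4 := qp_ne hs (ν b.rev)
  field_simp
  try ring

theorem hopShortRev_hopSkew (hs : s ≠ 0) (hq : NotRootOfUnity s) (h : DistinctShort a b c) :
    hopShortRev s b c * hopSkew s a b c = s ^ 2 • (hopSkew s a b c * hopShortRev s b c) + (-1 : ℂ) •
      hopSkewTwo s a b := by
  have g := h.rev_ne
  have hd := pow_four_sub_one_ne_zero hs hq
  have hd1 := one_sub_sq_ne_zero hq
  rw [hopSkewTwo, shiftOp_smul]
  refine shiftOp_qcomm (by abel) fun ν => ?_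
  simp only [Pi.add_apply, Pi.sub_apply, Pi.single_apply, Fin.rev_rev, Fin.rev_inj,
      h.ab, h.ab', h.aa', h.bb', h.ac, h.bc, h.ac', h.bc', h.ab.symm, h.ab'.symm, h.aa'.symm,
      h.bb'.symm, h.ac.symm, h.bc.symm, h.ac'.symm, h.bc'.symm, g, g.symm,
      if_true, if_false, add_zero, sub_zero, zero_sub, zero_add, qNum_eq, qNumOne_eq, qp_add hs,
      qp_sub hs, qp_neg, qp_one, qp_zero]
  have b0 := qp_ne hs (ν a)
  have b1 := qp_ne hs (ν b)
  have b2 := qp_ne hs (ν c)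
  have b3 := qp_ne hs (ν a.rev)
  have b4 := qp_ne hs (ν b.rev)
  field_simp
  try ring

theorem hopShort_hopSkewTwo (hs : s ≠ 0) (h : DistinctShort a b c) : Commute (hopShort s b c)
    (hopSkewTwo s a b) := by
  have g := h.rev_ne
  refine shiftOp_commute fun ν => ?_
  simp only [Pi.add_apply, Pi.sub_apply, Pi.single_apply, Fin.rev_rev, Fin.rev_inj,
      h.ab, h.ab', h.aa', h.bb', h.ac, h.bc, h.ac', h.bc', h.ab.symm, h.ab'.symm, h.aa'.symm,
      h.bb'.symm, h.ac.symm, h.bc.symm, h.ac'.symm, h.bc'.symm, g, g.symm,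
      if_true, if_false, add_zero, sub_zero, zero_sub, zero_add, qNum_eq, qNumOne_eq, qp_add hs,
      qp_sub hs, qp_neg, qp_one, qp_zero]
  have b0 := qp_ne hs (ν a)
  have b1 := qp_ne hs (ν b)
  have b2 := qp_ne hs (ν c)
  have b3 := qp_ne hs (ν a.rev)
  have b4 := qp_ne hs (ν b.rev)
  field_simp
  try ring

theorem hopShortRev_hopSkewTwo (hs : s ≠ 0) (h : DistinctShort a b c) : Commute (hopShortRev s b c)
    (hopSkewTwo s a b) := by
  have g := h.rev_ne
  refine shiftOp_commute fun ν => ?_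
  simp only [Pi.add_apply, Pi.sub_apply, Pi.single_apply, Fin.rev_rev, Fin.rev_inj,
      h.ab, h.ab', h.aa', h.bb', h.ac, h.bc, h.ac', h.bc', h.ab.symm, h.ab'.symm, h.aa'.symm,
      h.bb'.symm, h.ac.symm, h.bc.symm, h.ac'.symm, h.bc'.symm, g, g.symm,
      if_true, if_false, add_zero, sub_zero, zero_sub, zero_add, qNum_eq, qNumOne_eq, qp_add hs,
      qp_sub hs, qp_neg, qp_one, qp_zero]
  have b0 := qp_ne hs (ν a)
  have b1 := qp_ne hs (ν b)
  have b2 := qp_ne hs (ν c)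
  have b3 := qp_ne hs (ν a.rev)
  have b4 := qp_ne hs (ν b.rev)
  field_simp
  try ring

theorem hopShort_rev (hs : s ≠ 0) (h : DistinctShort a b c) :
    hopShort s b c * hopOpRev s a b = s ^ 2 • (hopOpRev s a b * hopShort s b c) := by
  have g := h.rev_ne
  refine shiftOp_comm _ fun ν => ?_
  simp only [Pi.add_apply, Pi.sub_apply, Pi.single_apply, Fin.rev_rev, Fin.rev_inj,
      h.ab, h.ab', h.aa', h.bb', h.ac, h.bc, h.ac', h.bc', h.ab.symm, h.ab'.symm, h.aa'.symm,
      h.bb'.symm, h.ac.symm, h.bc.symm, h.ac'.symm, h.bc'.symm, g, g.symm,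
      if_true, if_false, add_zero, sub_zero, zero_sub, zero_add, qp_add hs,
      qp_sub hs, qp_neg, qp_one, qp_zero]
  have b0 := qp_ne hs (ν a)
  have b1 := qp_ne hs (ν b)
  have b2 := qp_ne hs (ν c)
  have b3 := qp_ne hs (ν a.rev)
  have b4 := qp_ne hs (ν b.rev)
  field_simp
  try ring

theorem hopShortRev_rev (hs : s ≠ 0) (hq : NotRootOfUnity s) (h : DistinctShort a b c) :
    hopShortRev s b c * hopOpRev s a b = s ^ 2 • (hopOpRev s a b * hopShortRev s b c) +
      hopSkewRev s a b c := by
  have g := h.rev_ne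
  have hd := pow_four_sub_one_ne_zero hs hq
  have hd1 := one_sub_sq_ne_zero hq
  refine shiftOp_qcomm (by abel) fun ν => ?_
  simp only [Pi.add_apply, Pi.sub_apply, Pi.single_apply, Fin.rev_rev, Fin.rev_inj,
      h.ab, h.ab', h.aa', h.bb', h.ac, h.bc, h.ac', h.bc', h.ab.symm, h.ab'.symm, h.aa'.symm,
      h.bb'.symm, h.ac.symm, h.bc.symm, h.ac'.symm, h.bc'.symm, g, g.symm,
      if_true, if_false, add_zero, sub_zero, zero_sub, zero_add, qNum_eq, qNumOne_eq, qp_add hs,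
      qp_sub hs, qp_neg, qp_one, qp_zero]
  have b0 := qp_ne hs (ν a)
  have b1 := qp_ne hs (ν b)
  have b2 := qp_ne hs (ν c)
  have b3 := qp_ne hs (ν a.rev)
  have b4 := qp_ne hs (ν b.rev)
  field_simp
  try ring

theorem hopShort_hopSkewRev (hs : s ≠ 0) (hq : NotRootOfUnity s) (h : DistinctShort a b c) :
    hopShort s b c * hopSkewRev s a b c = (s ^ 2)⁻¹ • (hopSkewRev s a b c * hopShort s b c) +
      (-1 : ℂ) • hopSkewRevTwo s a b := by
  have g := h.rev_ne
  have hd := pow_four_sub_one_ne_zero hs hq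
  have hd1 := one_sub_sq_ne_zero hq
  rw [hopSkewRevTwo, shiftOp_smul]
  refine shiftOp_qcomm (by abel) fun ν => ?_
  simp only [Pi.add_apply, Pi.sub_apply, Pi.single_apply, Fin.rev_rev, Fin.rev_inj,
      h.ab, h.ab', h.aa', h.bb', h.ac, h.bc, h.ac', h.bc', h.ab.symm, h.ab'.symm, h.aa'.symm,
      h.bb'.symm, h.ac.symm, h.bc.symm, h.ac'.symm, h.bc'.symm, g, g.symm,
      if_true, if_false, add_zero, sub_zero, zero_sub, zero_add, qNum_eq, qNumOne_eq, qp_add hs,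
      qp_sub hs, qp_neg, qp_one, qp_zero]
  have b0 := qp_ne hs (ν a)
  have b1 := qp_ne hs (ν b)
  have b2 := qp_ne hs (ν c)
  have b3 := qp_ne hs (ν a.rev)
  have b4 := qp_ne hs (ν b.rev)
  field_simp
  try ring

theorem hopShortRev_hopSkewRev (hs : s ≠ 0) (h : DistinctShort a b c) :
    hopShortRev s b c * hopSkewRev s a b c = (s ^ 2)⁻¹ • (hopSkewRev s a b c * hopShortRev s b c) :=
      by
  have g := h.rev_ne
  refine shiftOp_comm _ fun ν => ?_
  simp only [Pi.add_apply, Pi.sub_apply, Pi.single_apply, Fin.rev_rev, Fin.rev_inj,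
      h.ab, h.ab', h.aa', h.bb', h.ac, h.bc, h.ac', h.bc', h.ab.symm, h.ab'.symm, h.aa'.symm,
      h.bb'.symm, h.ac.symm, h.bc.symm, h.ac'.symm, h.bc'.symm, g, g.symm,
      if_true, if_false, add_zero, sub_zero, zero_sub, zero_add, qp_add hs,
      qp_sub hs, qp_neg, qp_one, qp_zero]
  have b0 := qp_ne hs (ν a)
  have b1 := qp_ne hs (ν b)
  have b2 := qp_ne hs (ν c)
  have b3 := qp_ne hs (ν a.rev)
  have b4 := qp_ne hs (ν b.rev)
  field_simp
  try ring

theorem hopShort_hopSkewRevTwo (hs : s ≠ 0) (h : DistinctShort a b c) : Commute (hopShort s b c)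
    (hopSkewRevTwo s a b) := by
  have g := h.rev_ne
  refine shiftOp_commute fun ν => ?_
  simp only [Pi.add_apply, Pi.sub_apply, Pi.single_apply, Fin.rev_rev, Fin.rev_inj,
      h.ab, h.ab', h.aa', h.bb', h.ac, h.bc, h.ac', h.bc', h.ab.symm, h.ab'.symm, h.aa'.symm,
      h.bb'.symm, h.ac.symm, h.bc.symm, h.ac'.symm, h.bc'.symm, g, g.symm,
      if_true, if_false, add_zero, sub_zero, zero_sub, zero_add, qNum_eq, qNumOne_eq, qp_add hs,
      qp_sub hs, qp_neg, qp_one, qp_zero]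
  have b0 := qp_ne hs (ν a)
  have b1 := qp_ne hs (ν b)
  have b2 := qp_ne hs (ν c)
  have b3 := qp_ne hs (ν a.rev)
  have b4 := qp_ne hs (ν b.rev)
  field_simp
  try ring

theorem hopShortRev_hopSkewRevTwo (hs : s ≠ 0) (h : DistinctShort a b c) :
    Commute (hopShortRev s b c) (hopSkewRevTwo s a b) := by
  have g := h.rev_ne
  refine shiftOp_commute fun ν => ?_
  simp only [Pi.add_apply, Pi.sub_apply, Pi.single_apply, Fin.rev_rev, Fin.rev_inj,
      h.ab, h.ab', h.aa', h.bb', h.ac, h.bc, h.ac', h.bc', h.ab.symm, h.ab'.symm, h.aa'.symm,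
      h.bb'.symm, h.ac.symm, h.bc.symm, h.ac'.symm, h.bc'.symm, g, g.symm,
      if_true, if_false, add_zero, sub_zero, zero_sub, zero_add, qNum_eq, qNumOne_eq, qp_add hs,
      qp_sub hs, qp_neg, qp_one, qp_zero]
  have b0 := qp_ne hs (ν a)
  have b1 := qp_ne hs (ν b)
  have b2 := qp_ne hs (ν c)
  have b3 := qp_ne hs (ν a.rev)
  have b4 := qp_ne hs (ν b.rev)
  field_simp
  try ring

theorem serreTwo_hop (hs : s ≠ 0) (hq : NotRootOfUnity s) (h : DistinctShort a b c) :
    serreTwo s (raiseShortExt s b c) (hopOp s a b) = 0 := by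
  rw [raiseShortExt_eq]
  refine serreTwo_of_qcomm (R := Module.End ℂ (LaurentSpace N)) (r := (s ^ 2)⁻¹)
    (U := hopSkew s a b c) (V := hopSkewTwo s a b) (inv_ne_zero (pow_ne_zero 2 hs))
    (by rw [inv_inv, add_comm]) ?_ ?_ ?_
  · refine (qcomm_sub (V := 0) (h.hopShort_hop hs hq)
      ((h.hopShortRev_hop hs).trans (add_zero _).symm)).trans ?_
    rw [smul_zero, add_zero]
  · rw [inv_inv]
    refine (qcomm_sub (U := 0) ((h.hopShort_hopSkew hs).trans (add_zero _).symm)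
      (h.hopShortRev_hopSkew hs hq)).trans ?_
    module
  · exact (h.hopShort_hopSkewTwo hs).add_left ((h.hopShortRev_hopSkewTwo hs).smul_left _)

theorem serreTwo_rev (hs : s ≠ 0) (hq : NotRootOfUnity s) (h : DistinctShort a b c) :
    serreTwo s (raiseShortExt s b c) (hopOpRev s a b) = 0 := by
  rw [raiseShortExt_eq]
  refine serreTwo_of_qcomm (R := Module.End ℂ (LaurentSpace N)) (r := s ^ 2)
    (U := (-1 : ℂ) • hopSkewRev s a b c) (V := hopSkewRevTwo s a b) (pow_ne_zero 2 hs) rfl ?_ ?_ ?_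
  · refine (qcomm_sub (U := 0) ((h.hopShort_rev hs).trans (add_zero _).symm)
      (h.hopShortRev_rev hs hq)).trans ?_
    module
  · have := qcomm_sub (V := 0) (h.hopShort_hopSkewRev hs hq)
      ((h.hopShortRev_hopSkewRev hs).trans (add_zero _).symm)
    rw [mul_smul_comm, this, smul_mul_assoc]
    module
  · exact (h.hopShort_hopSkewRevTwo hs).add_left ((h.hopShortRev_hopSkewRevTwo hs).smul_left _)

/-- The relation is linear in the long root operator, and it holds for each of its two summands. -/
theorem serreTwo_raiseExt (hs : s ≠ 0) (hq : NotRootOfUnity s) (h : DistinctShort a b c) :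
    serreTwo s (raiseShortExt s b c) (raiseExt s a b) = 0 := by
  rw [raiseExt_eq]
  exact serreTwo_sub_right (R := Module.End ℂ (LaurentSpace N)) _ (h.serreTwo_hop hs hq)
    (h.serreTwo_rev hs hq)

end DistinctShort
end

section

variable {s : ℂ} {N : ℕ}

/-! ### Weights and roots -/

theorem wtDot_add_left {n : ℕ} (α β γ : Fin n → ℤ) : wtDot (α + β) γ = wtDot α γ + wtDot β γ := by
  simp [wtDot, add_mul, Finset.sum_add_distrib]

theorem wtDot_comm {n : ℕ} (α β : Fin n → ℤ) : wtDot α β = wtDot β α := by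
  simp [wtDot, mul_comm]

theorem wtDot_add_right {n : ℕ} (α β γ : Fin n → ℤ) : wtDot α (β + γ) = wtDot α β + wtDot α γ := by
  rw [wtDot_comm, wtDot_add_left, wtDot_comm β, wtDot_comm γ]

theorem wtDot_neg_right {n : ℕ} (α β : Fin n → ℤ) : wtDot α (-β) = -wtDot α β := by
  rw [wtDot_comm, wtDot_neg_left, wtDot_comm]

theorem wtDot_sub_left {n : ℕ} (α β γ : Fin n → ℤ) : wtDot (α - β) γ = wtDot α γ - wtDot β γ := by
  rw [sub_eq_add_neg, wtDot_add_left, wtDot_neg_left, sub_eq_add_neg]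

theorem wtDot_single {n : ℕ} (i : Fin n) (β : Fin n → ℤ) : wtDot (Pi.single i 1) β = β i := by
  simp [wtDot, Pi.single_apply]

theorem wtDot_simpleRoot_self (hN : 3 ≤ N) (i : Fin (N / 2)) :
    wtDot (simpleRoot i) (simpleRoot i) = if (i : ℕ) + 1 = N / 2 ∧ N % 2 = 1 then 1 else 2 := by
  have := i.2
  unfold simpleRoot
  split_ifs <;>
  · simp only [wtDot_sub_left, wtDot_add_left, wtDot_single, Pi.sub_apply, Pi.add_apply,
      Pi.single_apply, Fin.ext_iff]
    split_ifs <;> omega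

theorem wtDot_simpleRoot_of_lt {i j : Fin (N / 2)} (h : i < j) :
    wtDot (simpleRoot i) (simpleRoot j) =
      if ((j : ℕ) + 1 < N / 2 ∨ N % 2 = 1) ∧ (i : ℕ) + 1 = j then -1
      else if (j : ℕ) + 1 = N / 2 ∧ N % 2 = 0 ∧ (i : ℕ) + 2 = j then -1 else 0 := by
  have := j.2
  have hij : (i : ℕ) < j := h
  have h1 : (i : ℕ) + 1 < N / 2 := by omega
  unfold simpleRoot
  rw [dif_pos h1]
  by_cases c1 : (j : ℕ) + 1 < N / 2
  · rw [dif_pos c1]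
    simp only [wtDot_sub_left, wtDot_single, Pi.sub_apply, Pi.single_apply, Fin.ext_iff]
    split_ifs <;> omega
  · rw [dif_neg c1]
    by_cases c2 : N % 2 = 1
    · rw [if_pos c2]
      simp only [wtDot_sub_left, wtDot_single, Pi.single_apply, Fin.ext_iff]
      split_ifs <;> omega
    · rw [if_neg c2]
      simp only [wtDot_sub_left, wtDot_single, Pi.add_apply, Pi.single_apply, Fin.ext_iff]
      split_ifs <;> omega

theorem latWt_single_of_lt {p : ℕ} (hp : p < N / 2) (h : p < N) :
    latWt (Pi.single (⟨p, h⟩ : Fin N) 1) = Pi.single (⟨p, hp⟩ : Fin (N / 2)) 1 := by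
  ext i
  have := i.2
  have h1 := val_add_rev (⟨i, by omega⟩ : Fin N)
  simp only [latWt, Pi.single_apply, Fin.ext_iff] at h1 ⊢
  split_ifs <;> omega

theorem latWt_single_of_rev {a c : Fin N} (h : a.rev = c) (t : ℤ) :
    latWt (Pi.single c t) = -latWt (Pi.single a t) := by
  rw [← h, latWt_single_rev]

theorem latWt_middle {c : Fin N} (h : c.rev = c) (t : ℤ) : latWt (Pi.single c t) = 0 := by
  have h1 := latWt_single_of_rev h t
  ext i
  have := congrFun h1 i
  simp only [Pi.neg_apply, Pi.zero_apply] at this ⊢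
  omega

/-! ### The relations of `U_q(so_N)` for the extended operators -/

theorem cartanExt_shiftOp (hs : s ≠ 0) (α : Fin (N / 2) → ℤ) (φ : Lat N → ℂ) (δ : Lat N) :
    cartanExt s α * shiftOp φ δ = qp s (wtDot α (latWt δ)) • (shiftOp φ δ * cartanExt s α) := by
  refine shiftOp_comm _ fun ν => ?_
  rw [latWt_add, wtDot_add_right, qp_add hs, add_zero]
  ring

theorem mul_sub_eq_smul {A B T : Module.End ℂ (LaurentSpace N)} {t : ℂ} (h1 : T * A = t • (A * T))
    (h2 : T * B = t • (B * T)) : T * (A + (-1 : ℂ) • B) = t • ((A + (-1 : ℂ) • B) * T) := by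
  rw [mul_add, add_mul, mul_smul_comm, smul_mul_assoc, h1, h2]
  module

theorem cartanExt_raiseExt (hs : s ≠ 0) (α : Fin (N / 2) → ℤ) (a b : Fin N) :
    cartanExt s α * raiseExt s a b =
      qp s (wtDot α (latWt (Pi.single a 1) - latWt (Pi.single b 1))) •
        (raiseExt s a b * cartanExt s α) := by
  rw [raiseExt_eq]
  refine mul_sub_eq_smul ?_ ?_
  · rw [← latWt_sub]; exact cartanExt_shiftOp hs _ _ _
  · have : latWt (Pi.single a 1) - latWt (Pi.single b 1) =
        latWt (Pi.single b.rev 1 - Pi.single a.rev 1 : Lat N) := by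
      rw [latWt_sub, latWt_single_rev, latWt_single_rev]; abel
    rw [this]; exact cartanExt_shiftOp hs _ _ _

theorem cartanExt_raiseShortExt (hs : s ≠ 0) (α : Fin (N / 2) → ℤ) (a : Fin N) {c : Fin N}
    (hc : c.rev = c) : cartanExt s α * raiseShortExt s a c =
      qp s (wtDot α (latWt (Pi.single a 1))) • (raiseShortExt s a c * cartanExt s α) := by
  rw [raiseShortExt_eq]
  refine mul_sub_eq_smul ?_ ?_
  · have : latWt (Pi.single a 1) = latWt (Pi.single a 1 - Pi.single c 1 : Lat N) := by
      rw [latWt_sub, latWt_middle hc, sub_zero]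
    rw [this]; exact cartanExt_shiftOp hs _ _ _
  · have : latWt (Pi.single a 1) = latWt (Pi.single c 1 - Pi.single a.rev 1 : Lat N) := by
      rw [latWt_sub, latWt_middle hc, zero_sub, latWt_single_rev, neg_neg]
    rw [this]; exact cartanExt_shiftOp hs _ _ _

theorem cartanExt_stepExt (hs : s ≠ 0) (hN : 3 ≤ N) (α : Fin (N / 2) → ℤ) (i : Fin (N / 2)) :
    cartanExt s α * stepExt s i id =
      qp s (wtDot α (simpleRoot i)) • (stepExt s i id * cartanExt s α) ∧
    cartanExt s α * stepExt s i Fin.rev =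
      qp s (-wtDot α (simpleRoot i)) • (stepExt s i Fin.rev * cartanExt s α) := by
  have hi := i.2
  unfold stepExt simpleRoot
  split_ifs with c1 c2
  · refine ⟨(cartanExt_raiseExt hs _ _ _).trans ?_, (cartanExt_raiseExt hs _ _ _).trans ?_⟩
    · simp only [id]
      rw [latWt_single_of_lt i.2, latWt_single_of_lt c1]
    · rw [latWt_single_rev, latWt_single_rev, latWt_single_of_lt i.2, latWt_single_of_lt c1,
        ← wtDot_neg_right, neg_sub, neg_sub_neg]
  · have hc : (⟨(i : ℕ) + 1, by omega⟩ : Fin N).rev = ⟨(i : ℕ) + 1, by omega⟩ := by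
      have := val_add_rev (⟨(i : ℕ) + 1, by omega⟩ : Fin N)
      rw [Fin.ext_iff]
      simp only at this ⊢
      omega
    refine ⟨(cartanExt_raiseShortExt hs _ _ hc).trans ?_,
      (cartanExt_raiseShortExt hs _ _ hc).trans ?_⟩
    · simp only [id]
      rw [latWt_single_of_lt i.2]
    · rw [latWt_single_rev, latWt_single_of_lt i.2, ← wtDot_neg_right]
  · have hr : (⟨i, by omega⟩ : Fin N).rev = ⟨(i : ℕ) + 1, by omega⟩ := by
      have := val_add_rev (⟨i, by omega⟩ : Fin N)
      rw [Fin.ext_iff]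
      simp only at this ⊢
      omega
    refine ⟨(cartanExt_raiseExt hs _ _ _).trans ?_, (cartanExt_raiseExt hs _ _ _).trans ?_⟩
    · simp only [id]
      rw [latWt_single_of_lt (show (i : ℕ) - 1 < N / 2 by omega), latWt_single_of_rev hr,
        latWt_single_of_lt i.2, sub_neg_eq_add]
    · rw [latWt_single_rev, latWt_single_rev,
        latWt_single_of_lt (show (i : ℕ) - 1 < N / 2 by omega), latWt_single_of_rev hr,
        latWt_single_of_lt i.2, ← wtDot_neg_right, neg_neg, neg_add, sub_eq_add_neg]

theorem IsOrientation.ne {θ : Fin N → Fin N} (hθ : IsOrientation θ) {j l : Fin N}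
    (h : (j : ℕ) ≠ l) : θ j ≠ θ l := by
  rcases hθ with rfl | rfl
  · exact fun e => h (congrArg Fin.val e)
  · exact fun e => h (congrArg Fin.val (Fin.rev_injective e))

theorem IsOrientation.ne_rev {θ : Fin N → Fin N} (hθ : IsOrientation θ) {j l : Fin N}
    (h : (j : ℕ) + l + 1 ≠ N) : θ j ≠ (θ l).rev := by
  have := val_add_rev l
  rcases hθ with rfl | rfl
  · exact fun e => by have := congrArg Fin.val e; simp only [id] at this; omega
  · exact fun e => by rw [Fin.rev_rev] at e; rw [← e, Fin.rev_rev] at this; omega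

theorem IsOrientation.rev_ne {θ : Fin N → Fin N} (hθ : IsOrientation θ) {j l : Fin N}
    (h : (j : ℕ) + l + 1 ≠ N) : (θ j).rev ≠ θ l := fun e =>
  hθ.ne_rev (j := l) (l := j) (by omega) e.symm

theorem IsOrientation.middle {θ : Fin N → Fin N} (hθ : IsOrientation θ) {c : Fin N}
    (h : 2 * (c : ℕ) + 1 = N) : c = θ c := by
  have := val_add_rev c
  rcases hθ with rfl | rfl
  · rfl
  · rw [Fin.ext_iff]; omega

/-- Raising and lowering operators of different simple roots commute. -/
theorem stepExt_commute_cross (hs : s ≠ 0) (hq : NotRootOfUnity s) {i j : Fin (N / 2)} (h : i < j)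
    {θ : Fin N → Fin N} (hθ : IsOrientation θ) :
    Commute (stepExt s i θ) (stepExt s j fun l => (θ l).rev) := by
  have := j.2
  have hij : (i : ℕ) < j := h
  have h1 : (i : ℕ) + 1 < N / 2 := by omega
  unfold stepExt
  rw [if_pos h1]
  split_ifs with c1 c2
  · by_cases e : (i : ℕ) + 1 = j
    · have e' : (⟨j, by omega⟩ : Fin N) = ⟨(i : ℕ) + 1, by omega⟩ := Fin.ext e.symm
      rw [e']
      refine DistinctTriple.cross hs ?_
      constructor <;> first | (refine hθ.ne ?_; simp only; omega) |
        (refine hθ.ne_rev ?_; simp only; omega)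
    · refine raiseExt_commute_raiseExt ?_ ?_ <;>
      · simp only [Fin.rev_rev]
        refine ⟨hθ.ne_rev ?_, hθ.ne ?_, hθ.ne_rev ?_, hθ.ne ?_⟩ <;> simp only <;> omega
  · have hm : (⟨(j : ℕ) + 1, by omega⟩ : Fin N) = θ ⟨(j : ℕ) + 1, by omega⟩ := hθ.middle (by
      simp only; omega)
    rw [hm]
    by_cases e : (i : ℕ) + 1 = j
    · have e' : (⟨j, by omega⟩ : Fin N) = ⟨(i : ℕ) + 1, by omega⟩ := Fin.ext e.symm
      rw [e']
      refine DistinctShort.cross hs ?_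
      refine ⟨hθ.ne ?_, hθ.ne_rev ?_, hθ.ne_rev ?_, hθ.ne_rev ?_, hθ.ne ?_, hθ.ne ?_, hθ.rev_ne ?_,
        hθ.rev_ne ?_⟩ <;> simp only <;> omega
    · refine raiseExt_commute_raiseShortExt ?_ ?_ <;>
      · simp only [Fin.rev_rev]
        refine ⟨hθ.ne_rev ?_, hθ.ne ?_, hθ.ne ?_, hθ.rev_ne ?_⟩ <;> simp only <;> omega
  · by_cases e : (i : ℕ) + 1 = j
    · have e' : (⟨(j : ℕ) - 1, by omega⟩ : Fin N) = ⟨i, by omega⟩ := Fin.ext (by simp only; omega)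
      have e2 : (θ ⟨(j : ℕ) + 1, by omega⟩).rev = θ ⟨(i : ℕ) + 1, by omega⟩ := by
        by_contra hne
        rcases hθ with rfl | rfl
        · have := val_add_rev (⟨(j : ℕ) + 1, by omega⟩ : Fin N)
          simp only [id, Fin.ext_iff] at this hne; omega
        · have := val_add_rev (⟨(i : ℕ) + 1, by omega⟩ : Fin N)
          rw [Fin.rev_rev, Fin.ext_iff] at hne
          simp only at this hne; omega
      rw [e']
      beta_reduce
      rw [e2]
      refine commute_fork_cross hs hq ?_ ?_ ?_ ?_
      exacts [hθ.ne (by simp only; omega), hθ.ne_rev (by simp only; omega),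
        hθ.ne_rev (by simp only; omega), hθ.ne_rev (by simp only; omega)]
    by_cases e : (i : ℕ) + 2 = j
    · have e' : (⟨(j : ℕ) - 1, by omega⟩ : Fin N) = ⟨(i : ℕ) + 1, by omega⟩ :=
        Fin.ext (by simp only; omega)
      rw [e']
      refine DistinctTriple.cross hs ?_
      constructor <;> first | (refine hθ.ne ?_; simp only; omega) |
        (refine hθ.ne_rev ?_; simp only; omega)
    · refine raiseExt_commute_raiseExt ?_ ?_ <;>
      · simp only [Fin.rev_rev]
        refine ⟨hθ.ne_rev ?_, hθ.ne ?_, hθ.ne_rev ?_, hθ.ne ?_⟩ <;> simp only <;> omega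

/-- The operators of two different nodes: either the nodes are not linked and the operators commute,
or the `q`-Serre relations hold. -/
theorem stepExt_serre_cases (hs : s ≠ 0) (hq : NotRootOfUnity s) {i j : Fin (N / 2)} (h : i < j)
    {θ : Fin N → Fin N} (hθ : IsOrientation θ) :
    (wtDot (simpleRoot i) (simpleRoot j) = 0 ∧ Commute (stepExt s i θ) (stepExt s j θ)) ∨
    (wtDot (simpleRoot i) (simpleRoot j) = -1 ∧
      wtDot (simpleRoot i) (simpleRoot i) = 2 ∧ serreOne (s ^ 2) (stepExt s i θ) (stepExt s j θ) =
        0 ∧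
      ((wtDot (simpleRoot j) (simpleRoot j) = 2 ∧
          serreOne (s ^ 2) (stepExt s j θ) (stepExt s i θ) = 0) ∨
        (wtDot (simpleRoot j) (simpleRoot j) = 1 ∧
          serreTwo s (stepExt s j θ) (stepExt s i θ) = 0))) := by
  have := j.2
  have hij : (i : ℕ) < j := h
  have h1 : (i : ℕ) + 1 < N / 2 := by omega
  have hN : 3 ≤ N := by omega
  rw [wtDot_simpleRoot_of_lt h, wtDot_simpleRoot_self hN, wtDot_simpleRoot_self hN,
    if_neg (show ¬((i : ℕ) + 1 = N / 2 ∧ N % 2 = 1) by omega)]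
  unfold stepExt
  rw [if_pos h1]
  by_cases c1 : (j : ℕ) + 1 < N / 2
  · simp only [if_pos c1]
    rw [if_neg (show ¬((j : ℕ) + 1 = N / 2 ∧ N % 2 = 1) by omega),
      if_neg (show ¬((j : ℕ) + 1 = N / 2 ∧ N % 2 = 0 ∧ (i : ℕ) + 2 = j) by omega)]
    by_cases e : (i : ℕ) + 1 = j
    · rw [if_pos ⟨Or.inl c1, e⟩]
      have e' : (⟨j, by omega⟩ : Fin N) = ⟨(i : ℕ) + 1, by omega⟩ := Fin.ext e.symm
      rw [e']
      have hd : DistinctTriple (θ ⟨i, by omega⟩) (θ ⟨(i : ℕ) + 1, by omega⟩)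
          (θ ⟨(j : ℕ) + 1, by omega⟩) := by
        constructor <;> first | (refine hθ.ne ?_; simp only; omega) |
          (refine hθ.ne_rev ?_; simp only; omega)
      exact Or.inr ⟨rfl, trivial, raiseExt_serre hs hq hd, Or.inl ⟨rfl, raiseExt_serre' hs hq hd⟩⟩
    · rw [if_neg fun h => e h.2]
      refine Or.inl ⟨rfl, raiseExt_commute_raiseExt ?_ ?_⟩ <;>
      · refine ⟨hθ.ne ?_, hθ.ne_rev ?_, hθ.ne ?_, hθ.ne_rev ?_⟩ <;> simp only <;> omega
  simp only [if_neg c1]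
  by_cases c2 : N % 2 = 1
  · simp only [if_pos c2]
    rw [if_pos (show (j : ℕ) + 1 = N / 2 ∧ N % 2 = 1 by omega),
      if_neg (show ¬((j : ℕ) + 1 = N / 2 ∧ N % 2 = 0 ∧ (i : ℕ) + 2 = j) by omega)]
    have hm : (⟨(j : ℕ) + 1, by omega⟩ : Fin N) = θ ⟨(j : ℕ) + 1, by omega⟩ := hθ.middle (by
      simp only; omega)
    rw [hm]
    by_cases e : (i : ℕ) + 1 = j
    · rw [if_pos ⟨Or.inr c2, e⟩]
      have e' : (⟨j, by omega⟩ : Fin N) = ⟨(i : ℕ) + 1, by omega⟩ := Fin.ext e.symm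
      rw [e']
      have hd : DistinctShort (θ ⟨i, by omega⟩) (θ ⟨(i : ℕ) + 1, by omega⟩)
          (θ ⟨(j : ℕ) + 1, by omega⟩) := by
        refine ⟨hθ.ne ?_, hθ.ne_rev ?_, hθ.ne_rev ?_, hθ.ne_rev ?_, hθ.ne ?_, hθ.ne ?_,
          hθ.rev_ne ?_, hθ.rev_ne ?_⟩ <;> simp only <;> omega
      exact Or.inr ⟨rfl, trivial, hd.serreOne_raiseExt hs hq,
        Or.inr ⟨rfl, hd.serreTwo_raiseExt hs hq⟩⟩
    · rw [if_neg fun h => e h.2]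
      refine Or.inl ⟨rfl, raiseExt_commute_raiseShortExt ?_ ?_⟩ <;>
      · refine ⟨hθ.ne ?_, hθ.ne_rev ?_, hθ.ne ?_, hθ.rev_ne ?_⟩ <;> simp only <;> omega
  · simp only [if_neg c2]
    rw [if_neg (show ¬((j : ℕ) + 1 = N / 2 ∧ N % 2 = 1) by omega),
      if_neg (show ¬(((j : ℕ) + 1 < N / 2 ∨ N % 2 = 1) ∧ (i : ℕ) + 1 = j) by omega)]
    by_cases e : (i : ℕ) + 1 = j
    · rw [if_neg (by omega)]
      have e' : (⟨(j : ℕ) - 1, by omega⟩ : Fin N) = ⟨i, by omega⟩ := Fin.ext (by simp only; omega)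
      have e2 : θ ⟨(j : ℕ) + 1, by omega⟩ = (θ ⟨(i : ℕ) + 1, by omega⟩).rev := by
        by_contra hne
        rcases hθ with rfl | rfl
        · have := val_add_rev (⟨(i : ℕ) + 1, by omega⟩ : Fin N)
          simp only [id, Fin.ext_iff] at this hne; omega
        · have := val_add_rev (⟨(j : ℕ) + 1, by omega⟩ : Fin N)
          rw [Fin.rev_rev, Fin.ext_iff] at hne
          simp only at this hne; omega
      rw [e', e2]
      refine Or.inl ⟨rfl, commute_fork hs hq ?_ ?_ ?_ ?_⟩
      exacts [hθ.ne (by simp only; omega), hθ.ne_rev (by simp only; omega),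
        hθ.ne_rev (by simp only; omega), hθ.ne_rev (by simp only; omega)]
    by_cases e : (i : ℕ) + 2 = j
    · rw [if_pos (by omega)]
      have e' : (⟨(j : ℕ) - 1, by omega⟩ : Fin N) = ⟨(i : ℕ) + 1, by omega⟩ :=
        Fin.ext (by simp only; omega)
      rw [e']
      have hd : DistinctTriple (θ ⟨i, by omega⟩) (θ ⟨(i : ℕ) + 1, by omega⟩)
          (θ ⟨(j : ℕ) + 1, by omega⟩) := by
        constructor <;> first | (refine hθ.ne ?_; simp only; omega) |
          (refine hθ.ne_rev ?_; simp only; omega)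
      exact Or.inr ⟨rfl, trivial, raiseExt_serre hs hq hd, Or.inl ⟨rfl, raiseExt_serre' hs hq hd⟩⟩
    · rw [if_neg (by omega)]
      refine Or.inl ⟨rfl, raiseExt_commute_raiseExt ?_ ?_⟩ <;>
      · refine ⟨hθ.ne ?_, hθ.ne_rev ?_, hθ.ne ?_, hθ.ne_rev ?_⟩ <;> simp only <;> omega

end

section

variable {s : ℂ} {N : ℕ}

theorem cartanExt_sub_neg (α : Fin (N / 2) → ℤ) (t : ℂ) :
    t • (cartanExt s α - cartanExt s (-α)) =
      shiftOp (fun ν : Lat N => t * (qp s (wtDot α (latWt ν)) - qp s (-wtDot α (latWt ν)))) 0 := by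
  rw [cartanExt, cartanExt, shiftOp_sub, shiftOp_smul]
  exact shiftOp_congr rfl fun ν => by rw [wtDot_neg_left]

theorem mul_smul_sub_smul_mul {A B : Module.End ℂ (LaurentSpace N)} (t : ℂ) :
    A * (t • B) - (t • B) * A = t • (A * B - B * A) := by
  rw [mul_smul_comm, smul_mul_assoc]; module

theorem neg_one_smul_neg_shiftOp (φ : Lat N → ℂ) :
    (-1 : ℂ) • -shiftOp φ 0 = shiftOp φ 0 := by
  module

theorem soExt_E_F (hs : s ≠ 0) (hq : NotRootOfUnity s) (hN : 3 ≤ N) (i : Fin (N / 2)) :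
    soExt s N (.E i) * soExt s N (.F i) - soExt s N (.F i) * soExt s N (.E i) =
      (s ^ 2 - (s ^ 2)⁻¹)⁻¹ • (soExt s N (.K i) - soExt s N (.Kinv i)) := by
  have hi := i.2
  have hθ : IsOrientation (id : Fin N → Fin N) := Or.inl rfl
  rw [soExt_E, soExt_F, soExt_K, soExt_Kinv, cartanExt_sub_neg, mul_smul_sub_smul_mul]
  unfold stepExt simpleRoot
  by_cases c1 : (i : ℕ) + 1 < N / 2
  · simp only [if_pos c1, dif_pos c1]
    have h1 := raiseExt_commutator hs hq (a := (⟨i, by omega⟩ : Fin N))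
      (b := ⟨(i : ℕ) + 1, by omega⟩) (hθ.ne (by simp only; omega))
      (hθ.ne_rev (by simp only; omega)) (hθ.ne_rev (by simp only; omega))
      (hθ.ne_rev (by simp only; omega))
    refine (congrArg _ h1).trans ((neg_one_smul_neg_shiftOp _).trans ?_)
    refine shiftOp_congr rfl fun ν => ?_
    rw [wtDot_sub_left, wtDot_single, wtDot_single]
    rfl
  · simp only [if_neg c1, dif_neg c1]
    by_cases c2 : N % 2 = 1
    · simp only [if_pos c2]
      have h1 := raiseShortExt_commutator hs hq (a := (⟨i, by omega⟩ : Fin N))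
        (c := ⟨(i : ℕ) + 1, by omega⟩) (hθ.ne (by simp only; omega))
        (hθ.rev_ne (j := ⟨i, by omega⟩) (by simp only; omega))
        (hθ.ne_rev (by simp only; omega))
      refine (congrArg _ h1).trans ?_
      rw [shiftOp_neg, shiftOp_smul]
      refine shiftOp_congr rfl fun ν => ?_
      rw [wtDot_single]
      simp only [latWt]
      field_simp
    · simp only [if_neg c2]
      have h1 := raiseExt_commutator hs hq (a := (⟨(i : ℕ) - 1, by omega⟩ : Fin N))
        (b := ⟨(i : ℕ) + 1, by omega⟩) (hθ.ne (by simp only; omega))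
        (hθ.ne_rev (by simp only; omega)) (hθ.ne_rev (by simp only; omega))
        (hθ.ne_rev (by simp only; omega))
      refine (congrArg _ h1).trans ((neg_one_smul_neg_shiftOp _).trans ?_)
      · refine shiftOp_congr rfl fun ν => ?_
        rw [wtDot_add_left, wtDot_single, wtDot_single]
        have e : (⟨(i : ℕ) + 1, by omega⟩ : Fin N) = (⟨i, by omega⟩ : Fin N).rev := by
          have := val_add_rev (⟨i, by omega⟩ : Fin N)
          rw [Fin.ext_iff]
          simp only at this ⊢
          omega
        simp only [latWt, e, Fin.rev_rev]
        ring_nf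

theorem cartanExt_zero : cartanExt s (0 : Fin (N / 2) → ℤ) = 1 := by
  refine Finsupp.lhom_ext fun ν c => ?_
  simp [cartanExt, wtDot, qp_zero]

theorem cartanExt_mul (hs : s ≠ 0) (α β : Fin (N / 2) → ℤ) :
    cartanExt s α * cartanExt s β = cartanExt s (α + β) := by
  rw [cartanExt, cartanExt, shiftOp_mul, add_zero]
  exact shiftOp_congr rfl fun ν => by rw [add_zero, wtDot_add_left, qp_add hs]

/-- The `q`-Serre relations for both orientations at once. -/
theorem stepExt_serre (hs : s ≠ 0) (hq : NotRootOfUnity s) (hN : 3 ≤ N) (i j : Fin (N / 2))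
    {θ : Fin N → Fin N} (hθ : IsOrientation θ) :
    (wtDot (simpleRoot i) (simpleRoot j) = 0 → Commute (stepExt s i θ) (stepExt s j θ)) ∧
    (2 * wtDot (simpleRoot i) (simpleRoot j) = -wtDot (simpleRoot i) (simpleRoot i) →
      serreOne (s ^ wtDot (simpleRoot i) (simpleRoot i)) (stepExt s i θ) (stepExt s j θ) = 0) ∧
    (wtDot (simpleRoot i) (simpleRoot j) = -wtDot (simpleRoot i) (simpleRoot i) →
      serreTwo (s ^ wtDot (simpleRoot i) (simpleRoot i)) (stepExt s i θ) (stepExt s j θ) = 0) := by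
  have e2 : s ^ (2 : ℤ) = s ^ 2 := zpow_natCast s 2
  have hn := wtDot_simpleRoot_self hN i
  have hnorm : wtDot (simpleRoot i) (simpleRoot i) = 1 ∨ wtDot (simpleRoot i) (simpleRoot i) = 2 :=
    by
    rw [hn]; split_ifs <;> simp
  rcases lt_trichotomy i j with h | rfl | h
  · rcases stepExt_serre_cases hs hq h hθ with ⟨h0, hc⟩ | ⟨h1, h2, h3, -⟩
    · exact ⟨fun _ => hc, fun h => by omega, fun h => by omega⟩
    · refine ⟨fun h => by omega, fun _ => ?_, fun h => by omega⟩
      rw [h2, e2]; exact h3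
  · exact ⟨fun h => by omega, fun h => by omega, fun h => by omega⟩
  · rcases stepExt_serre_cases hs hq h hθ with ⟨h0, hc⟩ | ⟨h1, h2, h3, h4⟩
    · rw [wtDot_comm] at h0
      exact ⟨fun _ => hc.symm, fun h => by omega, fun h => by omega⟩
    · rw [wtDot_comm] at h1
      rcases h4 with ⟨h4, h5⟩ | ⟨h4, h5⟩
      · refine ⟨fun h => by omega, fun _ => ?_, fun h => by omega⟩
        rw [h4, e2]; exact h5
      · refine ⟨fun h => by omega, fun h => by omega, fun _ => ?_⟩
        rw [h4, zpow_one]; exact h5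

theorem stepExt_cross_ne (hs : s ≠ 0) (hq : NotRootOfUnity s) {i j : Fin (N / 2)} (h : i ≠ j) :
    Commute (stepExt s i id) (stepExt s j Fin.rev) := by
  rcases lt_or_gt_of_ne h with h | h
  · exact stepExt_commute_cross hs hq h (Or.inl rfl)
  · have := stepExt_commute_cross hs hq h (θ := Fin.rev) (Or.inr rfl)
    simp only [Fin.rev_rev] at this
    exact this.symm

theorem commute_smul_right {A X : Module.End ℂ (LaurentSpace N)} (c : ℂ) (h : Commute A X) :
    Commute A (c • X) := h.smul_right c

/-- The extended operators satisfy the relations of `U_q(so_N)`. -/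
theorem soExt_rel (hs : s ≠ 0) (hq : NotRootOfUnity s) (hN : 3 ≤ N)
    ⦃a b : FreeAlgebra ℂ (SoGen (N / 2))⦄ (h : SoRel s N a b) :
    FreeAlgebra.lift ℂ (soExt s N) a = FreeAlgebra.lift ℂ (soExt s N) b := by
  cases h with
  | K_Kinv i =>
    rw [map_mul, map_one, FreeAlgebra.lift_ι_apply, FreeAlgebra.lift_ι_apply, soExt_K, soExt_Kinv,
      cartanExt_mul hs, add_neg_cancel, cartanExt_zero]
  | Kinv_K i =>
    rw [map_mul, map_one, FreeAlgebra.lift_ι_apply, FreeAlgebra.lift_ι_apply, soExt_K, soExt_Kinv,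
      cartanExt_mul hs, neg_add_cancel, cartanExt_zero]
  | K_K i j =>
    rw [map_mul, map_mul, FreeAlgebra.lift_ι_apply, FreeAlgebra.lift_ι_apply, soExt_K, soExt_K,
      cartanExt_mul hs, cartanExt_mul hs, add_comm]
  | K_E i j =>
    rw [map_smul, map_mul, map_mul, FreeAlgebra.lift_ι_apply, FreeAlgebra.lift_ι_apply, soExt_K,
      soExt_E]
    exact (cartanExt_stepExt hs hN _ _).1
  | K_F i j =>
    rw [map_smul, map_mul, map_mul, FreeAlgebra.lift_ι_apply, FreeAlgebra.lift_ι_apply, soExt_K,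
      soExt_F, mul_smul_comm, smul_mul_assoc, (cartanExt_stepExt hs hN _ _).2, smul_comm]
    rfl
  | E_F i =>
    rw [map_sub, map_smul, map_sub, map_mul, map_mul]
    simp only [FreeAlgebra.lift_ι_apply]
    exact soExt_E_F hs hq hN i
  | E_F_ne i j h =>
    rw [map_mul, map_mul, FreeAlgebra.lift_ι_apply, FreeAlgebra.lift_ι_apply, soExt_E, soExt_F]
    exact commute_smul_right _ (stepExt_cross_ne hs hq h)
  | serreE_zero i j h =>
    rw [map_mul, map_mul, FreeAlgebra.lift_ι_apply, FreeAlgebra.lift_ι_apply, soExt_E, soExt_E]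
    exact (stepExt_serre hs hq hN i j (Or.inl rfl)).1 h
  | serreE_one i j h t ht =>
    simp only [map_add, map_sub, map_smul, map_mul, map_pow, map_zero, FreeAlgebra.lift_ι_apply, ht,
      soExt_E]
    exact (stepExt_serre hs hq hN i j (Or.inl rfl)).2.1 h
  | serreE_two i j h t ht =>
    simp only [map_add, map_sub, map_smul, map_mul, map_pow, map_zero, FreeAlgebra.lift_ι_apply, ht,
      soExt_E]
    exact (stepExt_serre hs hq hN i j (Or.inl rfl)).2.2 h
  | serreF_zero i j h =>
    rw [map_mul, map_mul, FreeAlgebra.lift_ι_apply, FreeAlgebra.lift_ι_apply, soExt_F, soExt_F]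
    exact commute_smul_right _ (commute_smul_left _
      ((stepExt_serre hs hq hN i j (Or.inr rfl)).1 h))
  | serreF_one i j h t ht =>
    simp only [map_add, map_sub, map_smul, map_mul, map_pow, map_zero, FreeAlgebra.lift_ι_apply, ht,
      soExt_F]
    exact serreOne_smul (R := Module.End ℂ (LaurentSpace N)) _ _
      ((stepExt_serre hs hq hN i j (Or.inr rfl)).2.1 h)
  | serreF_two i j h t ht =>
    simp only [map_add, map_sub, map_smul, map_mul, map_pow, map_zero, FreeAlgebra.lift_ι_apply, ht,
      soExt_F]
    exact serreTwo_smul (R := Module.End ℂ (LaurentSpace N)) _ _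
      ((stepExt_serre hs hq hN i j (Or.inr rfl)).2.2 h)

end

section

variable {s : ℂ} {N : ℕ}

/-! ### The two commuting representations on `𝒜` -/

/-- The natural representation of `U_q(so_N)` on `𝒜`. -/
def soRep (hs : s ≠ 0) (hq : NotRootOfUnity s) (hN : 3 ≤ N) :
    Uso s N →ₐ[ℂ] Module.End ℂ (Space s N) :=
  RingQuot.liftAlgHom ℂ ⟨FreeAlgebra.lift ℂ (soOp s N), fun _ _ h =>
    (Extends.lift (soOp_extends hs hq) _).eq (Extends.lift (soOp_extends hs hq) _)
      (soExt_rel hs hq hN h)⟩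

theorem soRep_so (hs : s ≠ 0) (hq : NotRootOfUnity s) (hN : 3 ≤ N) (g : SoGen (N / 2)) :
    soRep hs hq hN (so s N g) = soOp s N g := by
  rw [soRep, so, RingQuot.liftAlgHom_mkAlgHom_apply, FreeAlgebra.lift_ι_apply]

/-- The operators of the representation of `U_q(sl_2)` on `𝒜`. -/
def sl2Op (s : ℂ) (N : ℕ) : Sl2Gen → Module.End ℂ (Space s N)
  | .e => QHat s N
  | .f => (s ^ N / (1 + (s ^ 2) ^ (N - 2)) ^ 2) • (-(laplace s N * qPowGamma s N (-1)))
  | .k => s ^ N • qPowGamma s N 1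
  | .kinv => (s ^ N)⁻¹ • qPowGamma s N (-1)

/-- The operators of the representation of `U_q(sl_2)` on Laurent monomials. -/
def sl2Ext (s : ℂ) (N : ℕ) : Sl2Gen → Module.End ℂ (LaurentSpace N)
  | .e => radNorm s N • radSum s N 0
  | .f => (-(s ^ 2 * (s ^ N)⁻¹) / radNorm s N) • lapSum s N 0
  | .k => shiftOp (fun ν => s ^ N * qp s (totalDeg ν)) 0
  | .kinv => shiftOp (fun ν => (s ^ N)⁻¹ * (qp s (totalDeg ν))⁻¹) 0

theorem radNorm_ne_zero (hs : s ≠ 0) (hq : NotRootOfUnity s) : radNorm s N ≠ 0 :=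
  zpow_add_zpow_neg_ne_zero hs hq _

theorem pow_mul_radNorm (hs : s ≠ 0) (hN : 3 ≤ N) :
    s ^ N * radNorm s N = s ^ 2 * (1 + (s ^ 2) ^ (N - 2)) := by
  obtain ⟨n, rfl⟩ : ∃ n, N = n + 2 := ⟨N - 2, by omega⟩
  have e : ((n + 2 : ℕ) : ℤ) - 2 = n := by push_cast; ring
  rw [radNorm, e, zpow_neg, zpow_natCast, Nat.add_sub_cancel]
  field_simp
  ring

theorem sl2Op_extends (hs : s ≠ 0) (hq : NotRootOfUnity s) (hN : 3 ≤ N) (g : Sl2Gen) :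
    Extends hs hq (sl2Op s N g) (sl2Ext s N g) := by
  cases g with
  | e => exact QHat_extends hs hq
  | f =>
    have h1 := ((laplace_extends hs hq (N := N)).mul (qPowGamma_extends hs hq (-1))).smul
      (-(s ^ N / (1 + (s ^ 2) ^ (N - 2)) ^ 2))
    have e : sl2Op s N .f = (-(s ^ N / (1 + (s ^ 2) ^ (N - 2)) ^ 2)) •
        (laplace s N * qPowGamma s N (-1)) := by
      rw [sl2Op]; module
    rw [e]
    refine h1.congr ?_
    have h2 : shiftOp (fun ν : Lat N => (s ^ 2)⁻¹ * qp s (totalDeg ν)) 0 *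
        shiftOp (fun ν => qp s (-1 * totalDeg ν)) 0 = (s ^ 2)⁻¹ •
          (1 : Module.End ℂ (LaurentSpace N)) := by
      refine Finsupp.lhom_ext fun ν c => ?_
      have := qp_ne hs (totalDeg ν)
      simp only [Module.End.mul_apply, shiftOp_single, add_zero, neg_mul, one_mul, qp_neg,
        LinearMap.smul_apply, Module.End.one_apply, Finsupp.smul_single, smul_eq_mul]
      congr 1
      field_simp
    rw [smul_mul_assoc, mul_assoc, h2, mul_smul_comm, mul_one, smul_smul, smul_smul, sl2Ext]
    congr 1
    have h3 := radNorm_ne_zero hs hq (N := N)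
    have h4 := pow_mul_radNorm hs hN
    have h5 : 1 + (s ^ 2) ^ (N - 2) ≠ 0 := by
      intro h
      rw [h, mul_zero] at h4
      exact mul_ne_zero (pow_ne_zero _ hs) h3 h4
    have h6 : s ^ N ≠ 0 := pow_ne_zero _ hs
    have h7 : radNorm s N = s ^ 2 * (1 + (s ^ 2) ^ (N - 2)) / s ^ N := by
      rw [← h4]; field_simp
    rw [h7]
    field_simp
  | k =>
    refine ((qPowGamma_extends hs hq 1).smul _).congr ?_
    rw [shiftOp_smul]
    exact shiftOp_congr rfl fun ν => by rw [one_mul]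
  | kinv =>
    refine ((qPowGamma_extends hs hq (-1)).smul _).congr ?_
    rw [shiftOp_smul]
    exact shiftOp_congr rfl fun ν => by rw [neg_one_mul, qp_neg]

theorem degOp_radSum (φ : ℤ → ℂ) : shiftOp (fun ν : Lat N => φ (totalDeg ν)) 0 * radSum s N 0 =
    radSum s N 0 * shiftOp (fun ν => φ (totalDeg ν + 2)) 0 := by
  rw [radSum, Finset.mul_sum, Finset.sum_mul]
  refine Finset.sum_congr rfl fun j _ => ?_
  rw [radTerm, shiftOp_mul, shiftOp_mul]
  refine shiftOp_congr (by rw [add_zero, zero_add]) fun ν => ?_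
  simp only [totalDeg, lin_add, lin_single, add_zero, add_assoc]
  rw [mul_comm]
  norm_num

theorem degOp_lapSum (φ : ℤ → ℂ) : shiftOp (fun ν : Lat N => φ (totalDeg ν)) 0 * lapSum s N 0 =
    lapSum s N 0 * shiftOp (fun ν => φ (totalDeg ν - 2)) 0 := by
  rw [lapSum, Finset.mul_sum, Finset.sum_mul]
  refine Finset.sum_congr rfl fun j _ => ?_
  rw [lapTerm, shiftOp_mul, shiftOp_mul]
  refine shiftOp_congr (by rw [add_zero, zero_add]) fun ν => ?_
  simp only [totalDeg, lin_add, lin_neg, lin_single, add_zero]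
  rw [mul_comm]
  norm_num [sub_eq_add_neg]

theorem shiftOp_one_eq : shiftOp (fun _ : Lat N => 1) 0 = 1 := by
  refine Finsupp.lhom_ext fun ν c => ?_
  simp

/-- The extended operators satisfy the relations of `U_q(sl_2)`. -/
theorem sl2Ext_rel (hs : s ≠ 0) (hq : NotRootOfUnity s) ⦃a b : FreeAlgebra ℂ Sl2Gen⦄
    (h : Sl2Rel s a b) :
    FreeAlgebra.lift ℂ (sl2Ext s N) a = FreeAlgebra.lift ℂ (sl2Ext s N) b := by
  have hN : s ^ N ≠ 0 := pow_ne_zero _ hs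
  cases h with
  | k_kinv =>
    rw [map_mul, map_one, FreeAlgebra.lift_ι_apply, FreeAlgebra.lift_ι_apply, sl2Ext, sl2Ext,
      shiftOp_mul, ← shiftOp_one_eq]
    refine shiftOp_congr (add_zero 0) fun ν => ?_
    have := qp_ne hs (totalDeg ν)
    rw [add_zero]
    field_simp
  | kinv_k =>
    rw [map_mul, map_one, FreeAlgebra.lift_ι_apply, FreeAlgebra.lift_ι_apply, sl2Ext, sl2Ext,
      shiftOp_mul, ← shiftOp_one_eq]
    refine shiftOp_congr (add_zero 0) fun ν => ?_
    have := qp_ne hs (totalDeg ν)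
    rw [add_zero]
    field_simp
  | k_e =>
    rw [map_mul, map_smul, map_mul, FreeAlgebra.lift_ι_apply, FreeAlgebra.lift_ι_apply, sl2Ext,
      sl2Ext, mul_smul_comm, smul_mul_assoc, degOp_radSum fun d => s ^ N * qp s d]
    have e : shiftOp (fun ν : Lat N => s ^ N * qp s (totalDeg ν + 2)) 0 =
        (s ^ 2) ^ 2 • shiftOp (fun ν : Lat N => s ^ N * qp s (totalDeg ν)) 0 := by
      rw [shiftOp_smul]
      refine shiftOp_congr rfl fun ν => ?_
      rw [qp_add hs, qp_two]
      ring
    rw [e, mul_smul_comm, smul_comm]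
  | k_f =>
    rw [map_mul, map_smul, map_mul, FreeAlgebra.lift_ι_apply, FreeAlgebra.lift_ι_apply, sl2Ext,
      sl2Ext, mul_smul_comm, smul_mul_assoc, degOp_lapSum fun d => s ^ N * qp s d]
    have e : shiftOp (fun ν : Lat N => s ^ N * qp s (totalDeg ν - 2)) 0 =
        (s ^ 2) ^ (-2 : ℤ) • shiftOp (fun ν : Lat N => s ^ N * qp s (totalDeg ν)) 0 := by
      rw [shiftOp_smul]
      refine shiftOp_congr rfl fun ν => ?_
      rw [qp_sub hs, zpow_eq_qp, qp_neg]
      ring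
    rw [e, mul_smul_comm, smul_comm]
  | e_f =>
    have h0 (ν : Lat N) : outerSum 0 ν = 0 := by simp [outerSum, lin]
    have h1 := radSum_lapSum_commutator hs hq (N := N) (k := 0) (Nat.zero_le _)
    have h3 := radNorm_ne_zero hs hq (N := N)
    simp only [map_sub, map_mul, map_smul, FreeAlgebra.lift_ι_apply, sl2Ext]
    have h2 : radNorm s N • radSum s N 0 * (-(s ^ 2 * (s ^ N)⁻¹) / radNorm s N) • lapSum s N 0 -
        (-(s ^ 2 * (s ^ N)⁻¹) / radNorm s N) • lapSum s N 0 * radNorm s N • radSum s N 0 =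
        (-(s ^ 2 * (s ^ N)⁻¹)) • (radSum s N 0 * lapSum s N 0 - lapSum s N 0 * radSum s N 0) := by
      simp only [smul_mul_assoc, mul_smul_comm]
      match_scalars <;> field_simp
    rw [h2, h1, shiftOp_smul, shiftOp_sub, shiftOp_smul]
    refine shiftOp_congr rfl fun ν => ?_
    have e1 : qp s (N : ℤ) = s ^ N * s ^ N := by
      rw [qp, zpow_natCast, ← pow_mul, two_mul, pow_add]
    have hd := pow_four_sub_one_ne_zero hs hq
    simp only [h0, Nat.cast_zero, mul_zero, zero_sub, add_zero, qp_sub hs, qp_add hs, qp_neg,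
      qp_one, e1]
    have := qp_ne hs (totalDeg ν)
    field_simp
    ring

/-- The representation of `U_q(sl_2)` on `𝒜`. -/
def sl2Rep (hs : s ≠ 0) (hq : NotRootOfUnity s) (hN : 3 ≤ N) :
    Usl2 s →ₐ[ℂ] Module.End ℂ (Space s N) :=
  RingQuot.liftAlgHom ℂ ⟨FreeAlgebra.lift ℂ (sl2Op s N), fun _ _ h =>
    (Extends.lift (sl2Op_extends hs hq hN) _).eq (Extends.lift (sl2Op_extends hs hq hN) _)
      (sl2Ext_rel hs hq h)⟩

theorem sl2Rep_sl2 (hs : s ≠ 0) (hq : NotRootOfUnity s) (hN : 3 ≤ N) (g : Sl2Gen) :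
    sl2Rep hs hq hN (sl2 s g) = sl2Op s N g := by
  rw [sl2Rep, sl2, RingQuot.liftAlgHom_mkAlgHom_apply, FreeAlgebra.lift_ι_apply]

/-- Induction over an algebra given by generators and relations. -/
theorem ringQuot_induction {ι : Type*} {r : FreeAlgebra ℂ ι → FreeAlgebra ℂ ι → Prop}
    {P : RingQuot r → Prop} (h0 : ∀ c, P (algebraMap ℂ _ c))
    (h1 : ∀ i, P (RingQuot.mkAlgHom ℂ r (FreeAlgebra.ι ℂ i))) (h2 : ∀ a b, P a → P b → P (a * b))
    (h3 : ∀ a b, P a → P b → P (a + b)) (u : RingQuot r) : P u := by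
  obtain ⟨u, rfl⟩ := RingQuot.mkAlgHom_surjective ℂ r u
  induction u using FreeAlgebra.induction with
  | grade0 c => rw [AlgHom.commutes]; exact h0 c
  | grade1 i => exact h1 i
  | mul a b ha hb => rw [map_mul]; exact h2 _ _ ha hb
  | add a b ha hb => rw [map_add]; exact h3 _ _ ha hb

theorem usl2_induction {P : Usl2 s → Prop} (h0 : ∀ c, P (algebraMap ℂ _ c))
    (h1 : ∀ g, P (sl2 s g)) (h2 : ∀ a b, P a → P b → P (a * b))
    (h3 : ∀ a b, P a → P b → P (a + b)) (u : Usl2 s) : P u :=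
  ringQuot_induction h0 h1 h2 h3 u

theorem uso_induction {P : Uso s N → Prop} (h0 : ∀ c, P (algebraMap ℂ _ c))
    (h1 : ∀ g, P (so s N g)) (h2 : ∀ a b, P a → P b → P (a * b))
    (h3 : ∀ a b, P a → P b → P (a + b)) (u : Uso s N) : P u :=
  ringQuot_induction h0 h1 h2 h3 u

theorem sl2Ext_soExt_commute (hs : s ≠ 0) (hq : NotRootOfUnity s) (hN : 3 ≤ N) (g : Sl2Gen)
    (g' : SoGen (N / 2)) : Commute (sl2Ext s N g) (soExt s N g') := by
  cases g with
  | e => exact commute_smul_left _ (soExt_radSum hs hq hN g').symm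
  | f => exact commute_smul_left _ (soExt_lapSum hs hq hN g').symm
  | k => exact (soExt_totalDeg hN g' fun d => s ^ N * qp s d).symm
  | kinv => exact (soExt_totalDeg hN g' fun d => (s ^ N)⁻¹ * (qp s d)⁻¹).symm

theorem sl2Op_soOp_commute (hs : s ≠ 0) (hq : NotRootOfUnity s) (hN : 3 ≤ N) (g : Sl2Gen)
    (g' : SoGen (N / 2)) : Commute (sl2Op s N g) (soOp s N g') :=
  Extends.eq ((sl2Op_extends hs hq hN g).mul (soOp_extends hs hq g'))
    ((soOp_extends hs hq g').mul (sl2Op_extends hs hq hN g)) (sl2Ext_soExt_commute hs hq hN g g')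

theorem sl2Rep_soRep_commute (hs : s ≠ 0) (hq : NotRootOfUnity s) (hN : 3 ≤ N) (u : Usl2 s)
    (X : Uso s N) : Commute (sl2Rep hs hq hN u) (soRep hs hq hN X) := by
  induction u using usl2_induction with
  | h0 c => rw [AlgHom.commutes]; exact Algebra.commutes c _
  | h1 g =>
    induction X using uso_induction with
    | h0 c => rw [AlgHom.commutes]; exact (Algebra.commutes c _).symm
    | h1 g' => rw [sl2Rep_sl2, soRep_so]; exact sl2Op_soOp_commute hs hq hN g g'
    | h2 a b ha hb => rw [map_mul]; exact ha.mul_right hb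
    | h3 a b ha hb => rw [map_add]; exact ha.add_right hb
  | h2 a b ha hb => rw [map_mul]; exact ha.mul_left hb
  | h3 a b ha hb => rw [map_add]; exact ha.add_left hb

end

section

variable {s : ℂ} {N : ℕ}

/-! ### Homogeneous and harmonic polynomials -/

/-- The basis of ordered monomials. -/
def monoBasis (hs : s ≠ 0) (hq : NotRootOfUnity s) : Module.Basis (Fin N → ℕ) ℂ (Space s N) :=
  Module.Basis.mk (monomialsFormBasis hs hq).1 (monomialsFormBasis hs hq).2.ge

theorem monoBasis_apply (hs : s ≠ 0) (hq : NotRootOfUnity s) (ν : Fin N → ℕ) :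
    monoBasis hs hq ν = mono s ν := Module.Basis.mk_apply _ _ _

theorem qPowGamma_mono (hs : s ≠ 0) (hq : NotRootOfUnity s) (c : ℤ) (ν : Fin N → ℕ) :
    qPowGamma s N c (mono s ν) = qp s (c * ∑ i, (ν i : ℤ)) • mono s ν :=
  monoOp_mono (monomialsFormBasis hs hq) _ ν

theorem qPowGamma_of_mem (hs : s ≠ 0) (hq : NotRootOfUnity s) (c : ℤ) {m : ℕ} {a : Space s N}
    (ha : a ∈ homog s N m) : qPowGamma s N c a = qp s (c * m) • a := by
  induction ha using Submodule.span_induction with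
  | mem a ha =>
    obtain ⟨ν, hν, rfl⟩ := ha
    rw [qPowGamma_mono hs hq, ← Nat.cast_sum, hν]
  | zero => simp
  | add a b _ _ ha hb => rw [map_add, ha, hb, smul_add]
  | smul t a _ ha => rw [map_smul, ha, smul_comm]

theorem repr_qPowGamma (hs : s ≠ 0) (hq : NotRootOfUnity s) (a : Space s N) (ν : Fin N → ℕ) :
    (monoBasis hs hq).repr (qPowGamma s N 1 a) ν =
      qp s (∑ i, (ν i : ℤ)) * (monoBasis hs hq).repr a ν := by
  have : (Finsupp.lapply ν ∘ₗ (monoBasis hs hq).repr.toLinearMap) ∘ₗ qPowGamma s N 1 =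
      qp s (∑ i, (ν i : ℤ)) • (Finsupp.lapply ν ∘ₗ (monoBasis (N := N) hs hq).repr.toLinearMap) :=
        by
    refine (monoBasis hs hq).ext fun μ => ?_
    have h1 : qPowGamma s N 1 (monoBasis hs hq μ) =
        qp s (∑ i, (μ i : ℤ)) • monoBasis hs hq μ := by
      rw [monoBasis_apply, qPowGamma_mono hs hq, one_mul]
    rw [LinearMap.comp_apply, h1, map_smul, LinearMap.smul_apply, LinearMap.comp_apply,
      LinearEquiv.coe_coe, Module.Basis.repr_self, Finsupp.lapply_apply]
    by_cases h : μ = ν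
    · rw [h]
    · rw [Finsupp.single_eq_of_ne (Ne.symm h), smul_zero, smul_zero]
  exact LinearMap.congr_fun this a

theorem sum_eq_of_repr_ne_zero (hs : s ≠ 0) (hq : NotRootOfUnity s) {a : Space s N} {t : ℤ}
    (h : qPowGamma s N 1 a = qp s t • a) {ν : Fin N → ℕ} (hν : (monoBasis hs hq).repr a ν ≠ 0) :
    ∑ i, (ν i : ℤ) = t := by
  have h1 := repr_qPowGamma hs hq a ν
  rw [h, map_smul, Finsupp.smul_apply, smul_eq_mul] at h1
  have h2 := mul_right_cancel₀ hν h1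
  have h3 : qp s (t - ∑ i, (ν i : ℤ)) = 1 := by
    rw [qp_sub hs, h2, mul_inv_cancel₀ (qp_ne hs _)]
  have := (qp_eq_one_iff hq).1 h3
  omega

theorem mono_mem_homog (ν : Fin N → ℕ) : mono s ν ∈ homog s N (∑ i, ν i) :=
  Submodule.subset_span ⟨ν, rfl, rfl⟩

theorem mem_homog_iff (hs : s ≠ 0) (hq : NotRootOfUnity s) {m : ℕ} {a : Space s N} :
    a ∈ homog s N m ↔ qPowGamma s N 1 a = qp s m • a := by
  refine ⟨fun h => by rw [qPowGamma_of_mem hs hq 1 h, one_mul], fun h => ?_⟩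
  rw [← (monoBasis hs hq).linearCombination_repr a, Finsupp.linearCombination_apply]
  refine Submodule.sum_mem _ fun ν hν => Submodule.smul_mem _ _ ?_
  have := sum_eq_of_repr_ne_zero hs hq h (Finsupp.mem_support_iff.1 hν)
  rw [monoBasis_apply]
  have h2 : ∑ i, ν i = m := by exact_mod_cast this
  rw [← h2]
  exact mono_mem_homog ν

theorem eq_zero_of_qPowGamma (hs : s ≠ 0) (hq : NotRootOfUnity s) {a : Space s N} {t : ℤ}
    (h : qPowGamma s N 1 a = qp s t • a) (ht : t < 0) : a = 0 := by
  refine (LinearEquiv.map_eq_zero_iff (monoBasis hs hq).repr).1 (Finsupp.ext fun ν => ?_)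
  by_contra hν
  have h1 := sum_eq_of_repr_ne_zero hs hq h hν
  have h2 : 0 ≤ ∑ i, (ν i : ℤ) := Finset.sum_nonneg fun i _ => Int.natCast_nonneg _
  omega

theorem iSup_homog (hs : s ≠ 0) (hq : NotRootOfUnity s) : ⨆ m, homog s N m = ⊤ := by
  refine top_unique ?_
  rw [← (monomialsFormBasis (N := N) hs hq).2, Submodule.span_le]
  rintro _ ⟨ν, rfl⟩
  exact Submodule.mem_iSup_of_mem _ (mono_mem_homog ν)

theorem qp_injective (hs : s ≠ 0) (hq : NotRootOfUnity s) : Function.Injective (qp s) := by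
  intro a b h
  have h3 : qp s (a - b) = 1 := by rw [qp_sub hs, h, mul_inv_cancel₀ (qp_ne hs _)]
  have := (qp_eq_one_iff hq).1 h3
  omega

theorem iSupIndep_homog (hs : s ≠ 0) (hq : NotRootOfUnity s) : iSupIndep (homog s N) := by
  have h1 := (Module.End.eigenspaces_iSupIndep (qPowGamma s N 1)).comp
    (f := fun m : ℕ => qp s m) fun a b h => by exact_mod_cast qp_injective hs hq h
  convert h1 using 1
  ext m a
  rw [mem_homog_iff hs hq, Function.comp_apply, Module.End.mem_eigenspace_iff]

/-! ### The action of `U_q(sl_2)` -/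

theorem sl2Op_rel (hs : s ≠ 0) (hq : NotRootOfUnity s) (hN : 3 ≤ N) ⦃a b : FreeAlgebra ℂ Sl2Gen⦄
    (h : Sl2Rel s a b) :
    FreeAlgebra.lift ℂ (sl2Op s N) a = FreeAlgebra.lift ℂ (sl2Op s N) b :=
  (Extends.lift (sl2Op_extends hs hq hN) _).eq (Extends.lift (sl2Op_extends hs hq hN) _)
    (sl2Ext_rel hs hq h)

theorem sl2Op_k_of_mem (hs : s ≠ 0) (hq : NotRootOfUnity s) {m : ℕ} {a : Space s N}
    (ha : a ∈ homog s N m) : sl2Op s N .k a = s ^ (2 * m + N : ℤ) • a := by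
  rw [sl2Op, LinearMap.smul_apply, qPowGamma_of_mem hs hq _ ha, smul_smul, zpow_add₀ hs,
    zpow_two_mul_eq_qp, zpow_natCast, one_mul, mul_comm]

theorem sl2Op_kinv_of_mem (hs : s ≠ 0) (hq : NotRootOfUnity s) {m : ℕ} {a : Space s N}
    (ha : a ∈ homog s N m) : sl2Op s N .kinv a = s ^ (-(2 * m + N : ℤ)) • a := by
  rw [sl2Op, LinearMap.smul_apply, qPowGamma_of_mem hs hq _ ha, smul_smul, zpow_neg, zpow_add₀ hs,
    zpow_two_mul_eq_qp, zpow_natCast, neg_one_mul, qp_neg, mul_inv, mul_comm]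

theorem qPowGamma_eq (hs : s ≠ 0) (a : Space s N) :
    qPowGamma s N 1 a = (s ^ N)⁻¹ • sl2Op s N .k a := by
  rw [sl2Op, LinearMap.smul_apply, smul_smul, inv_mul_cancel₀ (pow_ne_zero _ hs), one_smul]

theorem QHat_mem (hs : s ≠ 0) (hq : NotRootOfUnity s) (hN : 3 ≤ N) {m : ℕ} {a : Space s N}
    (ha : a ∈ homog s N m) : QHat s N a ∈ homog s N (m + 2) := by
  have h1 := LinearMap.congr_fun (sl2Op_rel hs hq hN .k_e) a
  simp only [map_mul, map_smul, FreeAlgebra.lift_ι_apply, Module.End.mul_apply,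
    LinearMap.smul_apply, sl2Op_k_of_mem hs hq ha] at h1
  rw [mem_homog_iff hs hq, qPowGamma_eq hs]
  refine (congrArg _ h1).trans ?_
  rw [smul_smul, smul_smul, zpow_add₀ hs, zpow_two_mul_eq_qp, zpow_natCast]
  have : s ^ N ≠ 0 := pow_ne_zero _ hs
  refine congrArg₂ _ ?_ rfl
  rw [Nat.cast_add, Nat.cast_two, qp_add hs, qp_two]
  field_simp

theorem qPowGamma_f (hs : s ≠ 0) (hq : NotRootOfUnity s) (hN : 3 ≤ N) {m : ℕ} {a : Space s N}
    (ha : a ∈ homog s N m) :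
    qPowGamma s N 1 (sl2Op s N .f a) = qp s ((m : ℤ) - 2) • sl2Op s N .f a := by
  have h1 := LinearMap.congr_fun (sl2Op_rel hs hq hN .k_f) a
  simp only [map_mul, map_smul, FreeAlgebra.lift_ι_apply, Module.End.mul_apply,
    LinearMap.smul_apply, sl2Op_k_of_mem hs hq ha] at h1
  rw [qPowGamma_eq hs]
  refine (congrArg _ h1).trans ?_
  rw [smul_smul, smul_smul, zpow_add₀ hs, zpow_two_mul_eq_qp, zpow_natCast]
  have : s ^ N ≠ 0 := pow_ne_zero _ hs
  refine congrArg₂ _ ?_ rfl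
  rw [qp_sub hs, zpow_eq_qp, qp_neg]
  field_simp

theorem f_mem (hs : s ≠ 0) (hq : NotRootOfUnity s) (hN : 3 ≤ N) {m : ℕ} {a : Space s N}
    (ha : a ∈ homog s N (m + 2)) : sl2Op s N .f a ∈ homog s N m := by
  rw [mem_homog_iff hs hq, qPowGamma_f hs hq hN ha, Nat.cast_add, Nat.cast_two,
    add_sub_cancel_right]

theorem f_eq_zero (hs : s ≠ 0) (hq : NotRootOfUnity s) (hN : 3 ≤ N) {m : ℕ} (hm : m < 2)
    {a : Space s N} (ha : a ∈ homog s N m) : sl2Op s N .f a = 0 :=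
  eq_zero_of_qPowGamma hs hq (qPowGamma_f hs hq hN ha) (by omega)

theorem mem_harmonicSpace_iff (hs : s ≠ 0) (hq : NotRootOfUnity s) (hN : 3 ≤ N) {m : ℕ}
    {a : Space s N} : a ∈ harmonicSpace s N m ↔ a ∈ homog s N m ∧ sl2Op s N .f a = 0 := by
  rw [harmonicSpace, Submodule.mem_inf]
  refine and_congr_right fun ha => ?_
  have h4 := pow_mul_radNorm hs hN
  have h5 : 1 + (s ^ 2) ^ (N - 2) ≠ 0 := by
    intro h
    rw [h, mul_zero] at h4
    exact mul_ne_zero (pow_ne_zero _ hs) (radNorm_ne_zero hs hq) h4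
  have h6 : sl2Op s N .f a =
      -(s ^ N / (1 + (s ^ 2) ^ (N - 2)) ^ 2 * qp s (-1 * m)) • laplace s N a := by
    rw [sl2Op, LinearMap.smul_apply, LinearMap.neg_apply, Module.End.mul_apply,
      qPowGamma_of_mem hs hq _ ha, map_smul]
    module
  rw [LinearMap.mem_ker, h6, smul_eq_zero, neg_eq_zero, or_iff_right]
  exact mul_ne_zero (div_ne_zero (pow_ne_zero _ hs) (pow_ne_zero _ h5)) (qp_ne hs _)

theorem zpow_ne_one (hs : s ≠ 0) (hq : NotRootOfUnity s) {a : ℤ} (ha : a ≠ 0) : s ^ a ≠ s ^ (-a) :=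
    by
  intro h
  have h1 : qp s a = 1 := by
    rw [← zpow_two_mul_eq_qp, two_mul, zpow_add₀ hs]
    nth_rewrite 1 [h]
    rw [← zpow_add₀ hs, neg_add_cancel, zpow_zero]
  exact ha ((qp_eq_one_iff hq).1 h1)

theorem qNumHalf_ne_zero (hs : s ≠ 0) (hq : NotRootOfUnity s) {a : ℤ} (ha : a ≠ 0) :
    qNumHalf s a ≠ 0 :=
  div_ne_zero (sub_ne_zero.2 (zpow_ne_one hs hq ha)) (sq_sub_inv_ne_zero hs hq)

theorem qNum_ne_zero (hs : s ≠ 0) (hq : NotRootOfUnity s) {a : ℤ} (ha : a ≠ 0) : qNum s a ≠ 0 := by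
  have : qNum s a = qNumHalf s (2 * a) := by
    rw [qNum, qNumHalf, zpow_eq_qp, zpow_eq_qp, zpow_two_mul_eq_qp, ← mul_neg, zpow_two_mul_eq_qp]
  rw [this]
  exact qNumHalf_ne_zero hs hq (by omega)

/-! ### The discrete series -/

section discrete

theorem discreteGen_e (L r : ℕ) (c : ℂ) : discreteGen s L .e (Finsupp.single r c) =
    Finsupp.single (r + 1) (qNumHalf s (2 * r + L) * c) := by simp [discreteGen]

theorem discreteGen_f (L r : ℕ) (c : ℂ) : discreteGen s L .f (Finsupp.single r c) =
    Finsupp.single (r - 1) (-qNum s r * c) := by simp [discreteGen]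

theorem discreteGen_k (L r : ℕ) (c : ℂ) : discreteGen s L .k (Finsupp.single r c) =
    Finsupp.single r (s ^ (4 * r + L : ℤ) * c) := by simp [discreteGen]

theorem discreteGen_kinv (L r : ℕ) (c : ℂ) : discreteGen s L .kinv (Finsupp.single r c) =
    Finsupp.single r (s ^ (-(4 * r + L : ℤ)) * c) := by simp [discreteGen]

theorem discreteSeries_sl2 (hs : s ≠ 0) (L : ℕ) (g : Sl2Gen) :
    discreteSeries hs L (sl2 s g) = discreteGen s L g := by
  rw [discreteSeries, sl2, RingQuot.liftAlgHom_mkAlgHom_apply, FreeAlgebra.lift_ι_apply]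

end discrete

/-- The map that sends `|r⟩` to `([l]_q ⋯ [l + r - 1]_q)⁻¹ Q ^ r h`, where `l = m + N / 2`. -/
def ladder (s : ℂ) (N m : ℕ) (h : Space s N) : (ℕ →₀ ℂ) →ₗ[ℂ] Space s N :=
  Finsupp.linearCombination ℂ fun r =>
    (∏ j ∈ Finset.range r, qNumHalf s (2 * j + 2 * m + N))⁻¹ • (QHat s N ^ r) h

theorem ladder_single (m r : ℕ) (h : Space s N) (c : ℂ) : ladder s N m h (Finsupp.single r c) =
    c • (∏ j ∈ Finset.range r, qNumHalf s (2 * j + 2 * m + N))⁻¹ • (QHat s N ^ r) h :=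
  Finsupp.linearCombination_single _ _ _

theorem QHat_pow_mem (hs : s ≠ 0) (hq : NotRootOfUnity s) (hN : 3 ≤ N) {m : ℕ} {a : Space s N}
    (ha : a ∈ homog s N m) (r : ℕ) : (QHat s N ^ r) a ∈ homog s N (m + 2 * r) := by
  induction r with
  | zero => exact ha
  | succ r ih =>
    rw [pow_succ', Module.End.mul_apply]
    exact QHat_mem hs hq hN ih

theorem ladder_single_mem (hs : s ≠ 0) (hq : NotRootOfUnity s) (hN : 3 ≤ N) {m : ℕ} {h : Space s N}
    (hh : h ∈ homog s N m) (r : ℕ) (c : ℂ) :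
    ladder s N m h (Finsupp.single r c) ∈ homog s N (m + 2 * r) := by
  rw [ladder_single]
  exact Submodule.smul_mem _ _ (Submodule.smul_mem _ _ (QHat_pow_mem hs hq hN hh r))

theorem ladder_e (hs : s ≠ 0) (hq : NotRootOfUnity s) (hN : 3 ≤ N) (m : ℕ) (h : Space s N)
    (p : ℕ →₀ ℂ) : ladder s N m h (discreteGen s (2 * m + N) .e p) = QHat s N (ladder s N m h p) :=
      by
  induction p using Finsupp.induction_linear with
  | zero => simp
  | add p p' h1 h2 => simp only [map_add, h1, h2]
  | single r c =>
    have h0 : qNumHalf s (2 * r + 2 * m + N) ≠ 0 := qNumHalf_ne_zero hs hq (by omega)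
    have h1 : (2 * r + (2 * m + N : ℕ) : ℤ) = 2 * r + 2 * m + N := by push_cast; ring
    rw [discreteGen_e, ladder_single, ladder_single, map_smul, map_smul, ← Module.End.mul_apply,
      ← pow_succ', smul_smul, smul_smul, Finset.prod_range_succ, h1]
    congr 1
    field_simp

theorem ladder_k (hs : s ≠ 0) (hq : NotRootOfUnity s) (hN : 3 ≤ N) {m : ℕ} {h : Space s N}
    (hh : h ∈ homog s N m) (p : ℕ →₀ ℂ) :
    ladder s N m h (discreteGen s (2 * m + N) .k p) = sl2Op s N .k (ladder s N m h p) := by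
  induction p using Finsupp.induction_linear with
  | zero => simp
  | add p p' h1 h2 => simp only [map_add, h1, h2]
  | single r c =>
    rw [discreteGen_k, sl2Op_k_of_mem hs hq (ladder_single_mem hs hq hN hh r c), ← smul_eq_mul,
      ← Finsupp.smul_single, map_smul]
    congr 2
    push_cast; ring

theorem ladder_kinv (hs : s ≠ 0) (hq : NotRootOfUnity s) (hN : 3 ≤ N) {m : ℕ} {h : Space s N}
    (hh : h ∈ homog s N m) (p : ℕ →₀ ℂ) :
    ladder s N m h (discreteGen s (2 * m + N) .kinv p) = sl2Op s N .kinv (ladder s N m h p) := by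
  induction p using Finsupp.induction_linear with
  | zero => simp
  | add p p' h1 h2 => simp only [map_add, h1, h2]
  | single r c =>
    rw [discreteGen_kinv, sl2Op_kinv_of_mem hs hq (ladder_single_mem hs hq hN hh r c),
      ← smul_eq_mul, ← Finsupp.smul_single, map_smul]
    congr 2
    push_cast; ring

/-- The operator `f` is intertwined because both sides satisfy the same recurrence, which comes
from the relation for `e f - f e`. -/
theorem ladder_f (hs : s ≠ 0) (hq : NotRootOfUnity s) (hN : 3 ≤ N) {m : ℕ} {h : Space s N}
    (hh : h ∈ harmonicSpace s N m) (p : ℕ →₀ ℂ) :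
    ladder s N m h (discreteGen s (2 * m + N) .f p) = sl2Op s N .f (ladder s N m h p) := by
  obtain ⟨hm, hf⟩ := (mem_harmonicSpace_iff hs hq hN).1 hh
  have hD (p : ℕ →₀ ℂ) := LinearMap.congr_fun (discreteGen_rel hs (2 * m + N) .e_f) p
  have hV (a : Space s N) := LinearMap.congr_fun (sl2Op_rel hs hq hN .e_f) a
  simp only [map_sub, map_mul, map_smul, FreeAlgebra.lift_ι_apply, LinearMap.sub_apply,
    Module.End.mul_apply, LinearMap.smul_apply] at hD hV
  have key (r : ℕ) : ladder s N m h (discreteGen s (2 * m + N) .f (Finsupp.single r 1)) =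
      sl2Op s N .f (ladder s N m h (Finsupp.single r 1)) := by
    induction r with
    | zero =>
      rw [discreteGen_f, ladder_single, ladder_single, Nat.cast_zero, qNum_zero]
      simp [hf]
    | succ r ih =>
      have h0 : qNumHalf s (2 * r + (2 * m + N : ℕ)) ≠ 0 := qNumHalf_ne_zero hs hq (by omega)
      have h1 : (Finsupp.single (r + 1) 1 : ℕ →₀ ℂ) =
          (qNumHalf s (2 * r + (2 * m + N : ℕ)))⁻¹ •
            discreteGen s (2 * m + N) .e (Finsupp.single r 1) := by
        rw [discreteGen_e, Finsupp.smul_single, smul_eq_mul, mul_one, inv_mul_cancel₀ h0]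
      have h2 := congrArg (ladder s N m h) (hD (Finsupp.single r 1))
      have h3 := hV (ladder s N m h (Finsupp.single r 1))
      rw [map_sub, map_smul, map_sub, ladder_e hs hq hN, ladder_k hs hq hN hm,
        ladder_kinv hs hq hN hm, ih, ← h3] at h2
      have h4 := (sub_right_inj (a := QHat s N (sl2Op s N .f (ladder s N m h
        (Finsupp.single r 1))))).1 h2
      rw [h1, map_smul, map_smul, map_smul, map_smul, h4, ladder_e hs hq hN]
      rfl
  induction p using Finsupp.induction_linear with
  | zero => simp
  | add p p' h1 h2 => simp only [map_add, h1, h2]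
  | single r c =>
    have e : (Finsupp.single r c : ℕ →₀ ℂ) = c • Finsupp.single r 1 := by
      rw [Finsupp.smul_single, smul_eq_mul, mul_one]
    rw [e, map_smul, map_smul, map_smul, map_smul, key]

/-- For a harmonic polynomial `h` of degree `m` the map `ladder s N m h` intertwines the discrete
series representation of lowest weight `m + N / 2` with the representation on `𝒜`. -/
theorem ladder_discreteSeries (hs : s ≠ 0) (hq : NotRootOfUnity s) (hN : 3 ≤ N) {m : ℕ}
    {h : Space s N} (hh : h ∈ harmonicSpace s N m) (u : Usl2 s) (p : ℕ →₀ ℂ) :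
    ladder s N m h (discreteSeries hs (2 * m + N) u p) = sl2Rep hs hq hN u (ladder s N m h p) := by
  have hm := ((mem_harmonicSpace_iff hs hq hN).1 hh).1
  induction u using usl2_induction generalizing p with
  | h0 c => simp only [AlgHom.commutes, Module.algebraMap_end_apply, map_smul]
  | h1 g =>
    rw [discreteSeries_sl2, sl2Rep_sl2]
    cases g with
    | e => exact ladder_e hs hq hN m h p
    | f => exact ladder_f hs hq hN hh p
    | k => exact ladder_k hs hq hN hm p
    | kinv => exact ladder_kinv hs hq hN hm p
  | h2 a b ha hb => rw [map_mul, map_mul, Module.End.mul_apply, Module.End.mul_apply, ha, hb]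
  | h3 a b ha hb => rw [map_add, map_add, LinearMap.add_apply, LinearMap.add_apply, map_add, ha, hb]

end

section

variable {s : ℂ} {N : ℕ}

/-! ### Locally nilpotent operators, subrepresentations and outer tensor products -/

/-- An invariant subspace of a locally nilpotent operator meets its kernel. -/
theorem exists_mem_ker_of_locally_nilpotent {V : Type*} [AddCommMonoid V] [Module ℂ V]
    {f : Module.End ℂ V} {S : Submodule ℂ V} (hf : ∀ v, ∃ k, (f ^ k) v = 0)
    (hS : ∀ v ∈ S, f v ∈ S) (h0 : S ≠ ⊥) : ∃ y ∈ S, y ≠ 0 ∧ f y = 0 := by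
  classical
  obtain ⟨v, hv, hv0⟩ := S.ne_bot_iff.1 h0
  have hk := Nat.find_spec (hf v)
  obtain ⟨k, e⟩ : ∃ k, Nat.find (hf v) = k + 1 := by
    refine Nat.exists_eq_succ_of_ne_zero fun e => hv0 ?_
    rw [e] at hk
    exact hk
  have hS' (k : ℕ) : (f ^ k) v ∈ S := by
    induction k with
    | zero => exact hv
    | succ k ih => rw [pow_succ']; exact hS _ ih
  refine ⟨(f ^ k) v, hS' k, Nat.find_min (hf v) (by omega), ?_⟩
  rw [e, pow_succ'] at hk
  exact hk

theorem pow_apply_add_eq_zero {V : Type*} [AddCommMonoid V] [Module ℂ V] {f : Module.End ℂ V}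
    {v w : V} (hv : ∃ k, (f ^ k) v = 0) (hw : ∃ k, (f ^ k) w = 0) : ∃ k, (f ^ k) (v + w) = 0 := by
  obtain ⟨k, hk⟩ := hv
  obtain ⟨l, hl⟩ := hw
  refine ⟨l + k, ?_⟩
  rw [map_add, pow_add, Module.End.mul_apply, hk, map_zero, zero_add, ← pow_add, add_comm, pow_add,
    Module.End.mul_apply, hl, map_zero]

/-- The restriction of a representation to an invariant subspace. -/
def subRep {U V : Type*} [Ring U] [Algebra ℂ U] [AddCommGroup V] [Module ℂ V]
    (ρ : U →ₐ[ℂ] Module.End ℂ V) (S : Submodule ℂ V) (h : ∀ u, ∀ v ∈ S, ρ u v ∈ S) :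
    U →ₐ[ℂ] Module.End ℂ S :=
  AlgHom.ofLinearMap
    { toFun := fun u => (ρ u).restrict (h u)
      map_add' := fun a b => LinearMap.ext fun v => Subtype.ext (by
        simp only [LinearMap.coe_restrict_apply, LinearMap.add_apply, map_add, Submodule.coe_add])
      map_smul' := fun c a => LinearMap.ext fun v => Subtype.ext (by
        simp only [LinearMap.coe_restrict_apply, LinearMap.smul_apply, map_smul, Submodule.coe_smul,
          RingHom.id_apply]) }
    (LinearMap.ext fun v => Subtype.ext (by
      simp only [LinearMap.coe_mk, AddHom.coe_mk, LinearMap.coe_restrict_apply, map_one,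
        Module.End.one_apply]))
    (fun a b => LinearMap.ext fun v => Subtype.ext (by
      simp only [LinearMap.coe_mk, AddHom.coe_mk, LinearMap.coe_restrict_apply, map_mul,
        Module.End.mul_apply]))

theorem outerTensor_tmul {U U' V W : Type*} [Ring U] [Algebra ℂ U] [Ring U'] [Algebra ℂ U']
    [AddCommMonoid V] [Module ℂ V] [AddCommMonoid W] [Module ℂ W]
    (ρ : U →ₐ[ℂ] Module.End ℂ V) (σ : U' →ₐ[ℂ] Module.End ℂ W) (u : U) (u' : U') :
    outerTensor ρ σ (u ⊗ₜ u') = TensorProduct.map (ρ u) (σ u') := rfl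

/-! ### Irreducibility of the discrete series -/

theorem discreteGen_f_nilpotent (L : ℕ) (p : ℕ →₀ ℂ) : ∃ k, (discreteGen s L .f ^ k) p = 0 := by
  induction p using Finsupp.induction_linear with
  | zero => exact ⟨0, rfl⟩
  | add p p' h1 h2 => exact pow_apply_add_eq_zero h1 h2
  | single r c =>
    refine ⟨r + 1, ?_⟩
    induction r generalizing c with
    | zero => simp [discreteGen_f, qNum_zero]
    | succ r ih => rw [pow_succ, Module.End.mul_apply, discreteGen_f, Nat.add_sub_cancel, ih]

section tensor

variable {W : Type*} [AddCommMonoid W] [Module ℂ W]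

/-- The coefficient at `|r⟩` of an element of `D ⊗ W`. -/
def ladderCoeff (W : Type*) [AddCommMonoid W] [Module ℂ W] (r : ℕ) : (ℕ →₀ ℂ) ⊗[ℂ] W →ₗ[ℂ] W :=
  (TensorProduct.lid ℂ W).toLinearMap ∘ₗ (Finsupp.lapply r).rTensor W

theorem ladderCoeff_tmul (r : ℕ) (p : ℕ →₀ ℂ) (w : W) : ladderCoeff W r (p ⊗ₜ w) = p r • w := rfl

theorem ladderCoeff_ext {t t' : (ℕ →₀ ℂ) ⊗[ℂ] W} (h : ∀ r, ladderCoeff W r t = ladderCoeff W r t') :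
    t = t' := by
  classical
  have key (r : ℕ) (t : (ℕ →₀ ℂ) ⊗[ℂ] W) :
      TensorProduct.finsuppScalarLeft ℂ W ℕ t r = ladderCoeff W r t := by
    induction t with
    | zero => simp
    | tmul p w => rw [TensorProduct.finsuppScalarLeft_apply_tmul_apply, ladderCoeff_tmul]
    | add t t' h1 h2 => rw [map_add, map_add, Finsupp.add_apply, h1, h2]
  exact (TensorProduct.finsuppScalarLeft ℂ W ℕ).injective
    (Finsupp.ext fun r => by rw [key, key, h])

theorem ladderCoeff_f (L r : ℕ) (t : (ℕ →₀ ℂ) ⊗[ℂ] W) :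
    ladderCoeff W r ((discreteGen s L .f).rTensor W t) =
      -qNum s (r + 1 : ℕ) • ladderCoeff W (r + 1) t := by
  induction t with
  | zero => simp
  | add t t' h1 h2 => simp only [map_add, smul_add, h1, h2]
  | tmul p w =>
    rw [LinearMap.rTensor_tmul, ladderCoeff_tmul, ladderCoeff_tmul, smul_smul]
    congr 1
    induction p using Finsupp.induction_linear with
    | zero => simp
    | add p p' h1 h2 => rw [map_add, Finsupp.add_apply, Finsupp.add_apply, h1, h2, mul_add]
    | single k c =>
      rw [discreteGen_f]
      rcases k with _ | k
      · simp [qNum_zero]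
      · rw [Nat.add_sub_cancel]
        by_cases hk : r = k
        · rw [hk, Finsupp.single_eq_same, Finsupp.single_eq_same]
        · rw [Finsupp.single_eq_of_ne hk, Finsupp.single_eq_of_ne (by omega), mul_zero]

theorem eq_tmul_of_f_eq_zero (hs : s ≠ 0) (hq : NotRootOfUnity s) {L : ℕ} {t : (ℕ →₀ ℂ) ⊗[ℂ] W}
    (h : (discreteGen s L .f).rTensor W t = 0) :
    t = Finsupp.single 0 1 ⊗ₜ ladderCoeff W 0 t := by
  refine ladderCoeff_ext fun r => ?_
  rw [ladderCoeff_tmul]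
  rcases r with _ | r
  · rw [Finsupp.single_eq_same, one_smul]
  · have h1 := ladderCoeff_f (s := s) L r t
    rw [h, map_zero] at h1
    have h2 : -qNum s (r + 1 : ℕ) ≠ 0 := neg_ne_zero.2 (qNum_ne_zero hs hq (by omega))
    rw [Finsupp.single_eq_of_ne (by omega), zero_smul, ← one_smul ℂ (ladderCoeff W (r + 1) t),
      ← inv_mul_cancel₀ h2, mul_smul, ← h1, smul_zero]

theorem f_rTensor_nilpotent (L : ℕ) (t : (ℕ →₀ ℂ) ⊗[ℂ] W) :
    ∃ k, (((discreteGen s L .f).rTensor W : Module.End ℂ _) ^ k) t = 0 := by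
  induction t with
  | zero => exact ⟨0, rfl⟩
  | add t t' h1 h2 =>
    exact pow_apply_add_eq_zero (f := (discreteGen s L .f).rTensor W) h1 h2
  | tmul p w =>
    obtain ⟨k, hk⟩ := discreteGen_f_nilpotent (s := s) L p
    refine ⟨k, ?_⟩
    rw [LinearMap.rTensor_pow, LinearMap.rTensor_tmul, hk, TensorProduct.zero_tmul]

/-- The outer tensor product of a representation of the discrete series with an irreducible
representation is irreducible. -/
theorem isIrred_outerTensor_discreteSeries (hs : s ≠ 0) (hq : NotRootOfUnity s) {L : ℕ}
    (hL : 0 < L) {U : Type*} [Ring U] [Algebra ℂ U] {T : U →ₐ[ℂ] Module.End ℂ W} (hT : IsIrred T) :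
    IsIrred (outerTensor (discreteSeries hs L) T) := by
  have hact (u : Usl2 s) (t : (ℕ →₀ ℂ) ⊗[ℂ] W) : outerTensor (discreteSeries hs L) T (u ⊗ₜ 1) t =
      (discreteSeries hs L u).rTensor W t := by
    rw [outerTensor_tmul, map_one]; rfl
  refine ⟨?_, fun S hS => or_iff_not_imp_left.2 fun h0 => ?_⟩
  · obtain ⟨w, hw⟩ := @exists_ne _ hT.1 (0 : W)
    refine ⟨Finsupp.single 0 1 ⊗ₜ w, 0, fun h => hw ?_⟩
    have := congrArg (ladderCoeff W 0) h
    rwa [map_zero, ladderCoeff_tmul, Finsupp.single_eq_same, one_smul] at this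
  obtain ⟨y, hy, hy0, hfy⟩ := exists_mem_ker_of_locally_nilpotent (S := S)
    (f_rTensor_nilpotent (s := s) L) (fun v hv => by
      have := hS (sl2 s .f ⊗ₜ 1) v hv
      rwa [hact, discreteSeries_sl2] at this) h0
  have hy' := eq_tmul_of_f_eq_zero hs hq hfy
  let S' : Submodule ℂ W := S.comap (TensorProduct.mk ℂ (ℕ →₀ ℂ) W (Finsupp.single 0 1))
  have hS' : S' = ⊤ := by
    refine (hT.2 S' fun u w hw => ?_).resolve_left ?_
    · have := hS (1 ⊗ₜ u) _ hw
      rw [outerTensor_tmul, map_one] at this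
      exact this
    · refine S'.ne_bot_iff.2 ⟨ladderCoeff W 0 y, ?_, fun h => hy0 ?_⟩
      · change Finsupp.single 0 1 ⊗ₜ ladderCoeff W 0 y ∈ S
        rwa [← hy']
      · rw [hy', h, TensorProduct.tmul_zero]
  have key (r : ℕ) (w : W) : (Finsupp.single r 1 : ℕ →₀ ℂ) ⊗ₜ[ℂ] w ∈ S := by
    induction r with
    | zero =>
      have : w ∈ S' := hS' ▸ Submodule.mem_top
      exact this
    | succ r ih =>
      have h1 := hS (sl2 s .e ⊗ₜ 1) _ ih
      rw [hact, discreteSeries_sl2, LinearMap.rTensor_tmul, discreteGen_e] at h1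
      have h2 : qNumHalf s (2 * r + L) ≠ 0 := qNumHalf_ne_zero hs hq (by omega)
      have h3 := S.smul_mem (qNumHalf s (2 * r + L))⁻¹ h1
      rwa [TensorProduct.smul_tmul', Finsupp.smul_single, smul_eq_mul, mul_one,
        inv_mul_cancel₀ h2] at h3
  refine (Submodule.eq_top_iff' (p := S)).2 fun t => ?_
  induction t with
  | zero => exact S.zero_mem
  | add t t' h1 h2 => exact S.add_mem h1 h2
  | tmul p w =>
    induction p using Finsupp.induction_linear with
    | zero => rw [TensorProduct.zero_tmul]; exact S.zero_mem
    | add p p' h1 h2 => rw [TensorProduct.add_tmul]; exact S.add_mem h1 h2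
    | single r c =>
      rw [← mul_one c, ← smul_eq_mul, ← Finsupp.smul_single, ← TensorProduct.smul_tmul']
      exact S.smul_mem _ (key r w)

end tensor

theorem discreteSeries_isIrred (hs : s ≠ 0) (hq : NotRootOfUnity s) {L : ℕ} (hL : 0 < L) :
    IsIrred (discreteSeries hs L) := by
  refine ⟨inferInstance, fun S hS => or_iff_not_imp_left.2 fun h0 => ?_⟩
  obtain ⟨y, hy, hy0, hfy⟩ := exists_mem_ker_of_locally_nilpotent (S := S)
    (discreteGen_f_nilpotent (s := s) L) (fun v hv => by
      have := hS (sl2 s .f) v hv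
      rwa [discreteSeries_sl2] at this) h0
  have hy' : y = y 0 • Finsupp.single 0 1 := by
    have h1 := eq_tmul_of_f_eq_zero hs hq (L := L) (t := y ⊗ₜ[ℂ] (1 : ℂ)) (by
      rw [LinearMap.rTensor_tmul, hfy, TensorProduct.zero_tmul])
    have h2 := congrArg (TensorProduct.rid ℂ (ℕ →₀ ℂ)) h1
    rwa [TensorProduct.rid_tmul, one_smul, TensorProduct.rid_tmul, ladderCoeff_tmul, smul_eq_mul,
      mul_one] at h2
  have key (r : ℕ) : (Finsupp.single r 1 : ℕ →₀ ℂ) ∈ S := by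
    induction r with
    | zero =>
      have h1 : y 0 ≠ 0 := fun h => hy0 (by rw [hy', h, zero_smul])
      have h2 := S.smul_mem (y 0)⁻¹ hy
      rw [hy', smul_smul] at h2
      simpa [h1] using h2
    | succ r ih =>
      have h1 := hS (sl2 s .e) _ ih
      rw [discreteSeries_sl2, discreteGen_e] at h1
      have h2 : qNumHalf s (2 * r + L) ≠ 0 := qNumHalf_ne_zero hs hq (by omega)
      have h3 := S.smul_mem (qNumHalf s (2 * r + L))⁻¹ h1
      rwa [Finsupp.smul_single, smul_eq_mul, mul_one, inv_mul_cancel₀ h2] at h3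
  refine (Submodule.eq_top_iff' (p := S)).2 fun p => ?_
  induction p using Finsupp.induction_linear with
  | zero => exact S.zero_mem
  | add p p' h1 h2 => exact S.add_mem h1 h2
  | single r c =>
    rw [← mul_one c, ← smul_eq_mul, ← Finsupp.smul_single]
    exact S.smul_mem _ (key r)

/-- The lowest weight is an invariant of the equivalence class: it is read off from the action of
`k` on the kernel of `f`. -/
theorem discreteSeries_lowestWeight_unique (hs : s ≠ 0) (hq : NotRootOfUnity s) {L L' : ℕ}
    (h : RepEquiv (discreteSeries hs L) (discreteSeries hs L')) : (L : ℤ) = L' := by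
  obtain ⟨Φ, hΦ⟩ := h
  have hf := hΦ (sl2 s .f) (Finsupp.single 0 1)
  have hk := hΦ (sl2 s .k) (Finsupp.single 0 1)
  rw [discreteSeries_sl2, discreteSeries_sl2, discreteGen_f, Nat.cast_zero, qNum_zero] at hf
  rw [discreteSeries_sl2, discreteSeries_sl2, discreteGen_k] at hk
  set y := Φ (Finsupp.single 0 1) with hy
  have hy0 : y ≠ 0 := fun h => by
    have := Φ.map_eq_zero_iff.1 h
    simp at this
  have hfy : discreteGen s L' .f y = 0 := by rw [← hf]; simp
  have hy' : y = Finsupp.single 0 (y 0) := by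
    have h1 := eq_tmul_of_f_eq_zero hs hq (L := L') (t := y ⊗ₜ[ℂ] (1 : ℂ)) (by
      rw [LinearMap.rTensor_tmul, hfy, TensorProduct.zero_tmul])
    have h2 := congrArg (TensorProduct.rid ℂ (ℕ →₀ ℂ)) h1
    rwa [TensorProduct.rid_tmul, one_smul, TensorProduct.rid_tmul, ladderCoeff_tmul, smul_eq_mul,
      mul_one, Finsupp.smul_single, smul_eq_mul, mul_one] at h2
  have h1 : y 0 ≠ 0 := fun h => hy0 (by rw [hy', h, Finsupp.single_zero])
  have h2 : (Finsupp.single 0 (s ^ (4 * (0 : ℕ) + L : ℤ) * 1) : ℕ →₀ ℂ) =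
      s ^ (4 * (0 : ℕ) + L : ℤ) • Finsupp.single 0 1 := by rw [Finsupp.smul_single, smul_eq_mul]
  rw [h2, map_smul, ← hy, hy', discreteGen_k, Finsupp.smul_single, smul_eq_mul] at hk
  have h3 := mul_right_cancel₀ h1 (Finsupp.single_injective _ hk)
  rw [Nat.cast_zero, mul_zero, zero_add, zero_add] at h3
  refine qp_injective hs hq ?_
  rw [← zpow_two_mul_eq_qp, ← zpow_two_mul_eq_qp, two_mul, two_mul, zpow_add₀ hs, zpow_add₀ hs, h3]

end

section

variable {s : ℂ} {N : ℕ}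

/-! ### The decomposition of `𝒜` -/

theorem soRep_qPowGamma (hs : s ≠ 0) (hq : NotRootOfUnity s) (hN : 3 ≤ N) (X : Uso s N)
    (a : Space s N) :
    qPowGamma s N 1 (soRep hs hq hN X a) = soRep hs hq hN X (qPowGamma s N 1 a) := by
  have h := LinearMap.congr_fun (sl2Rep_soRep_commute hs hq hN (sl2 s .k) X).eq a
  rw [sl2Rep_sl2, Module.End.mul_apply, Module.End.mul_apply] at h
  rw [qPowGamma_eq hs, qPowGamma_eq hs, map_smul, h]

theorem soRep_mem_homog (hs : s ≠ 0) (hq : NotRootOfUnity s) (hN : 3 ≤ N) {m : ℕ} (X : Uso s N)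
    {a : Space s N} (ha : a ∈ homog s N m) : soRep hs hq hN X a ∈ homog s N m := by
  rw [mem_homog_iff hs hq] at ha ⊢
  rw [soRep_qPowGamma, ha, map_smul]

theorem soRep_mem_harmonicSpace (hs : s ≠ 0) (hq : NotRootOfUnity s) (hN : 3 ≤ N) (m : ℕ)
    (X : Uso s N) (a : Space s N) (ha : a ∈ harmonicSpace s N m) :
    soRep hs hq hN X a ∈ harmonicSpace s N m := by
  rw [mem_harmonicSpace_iff hs hq hN] at ha ⊢
  refine ⟨soRep_mem_homog hs hq hN X ha.1, ?_⟩
  have h := LinearMap.congr_fun (sl2Rep_soRep_commute hs hq hN (sl2 s .f) X).eq a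
  rw [sl2Rep_sl2, Module.End.mul_apply, Module.End.mul_apply, ha.2, map_zero] at h
  exact h

/-- The representation of `U_q(so_N)` on the harmonic polynomials of degree `m`. -/
def harmonicRep (hs : s ≠ 0) (hq : NotRootOfUnity s) (hN : 3 ≤ N) (m : ℕ) :
    Uso s N →ₐ[ℂ] Module.End ℂ (harmonicSpace s N m) :=
  subRep (soRep hs hq hN) (harmonicSpace s N m) (soRep_mem_harmonicSpace hs hq hN m)

theorem harmonicRep_apply (hs : s ≠ 0) (hq : NotRootOfUnity s) (hN : 3 ≤ N) (m : ℕ) (X : Uso s N)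
    (h : harmonicSpace s N m) : (harmonicRep hs hq hN m X h : Space s N) = soRep hs hq hN X h := rfl

/-- The domain of the decomposition map. -/
abbrev LadderSum (s : ℂ) (N : ℕ) : Type := ⨁ m : ℕ, (ℕ →₀ ℂ) ⊗[ℂ] harmonicSpace s N m

/-- The map `|r⟩ ⊗ h ↦ ([l]_q ⋯ [l + r - 1]_q)⁻¹ Q ^ r h` on `D ⊗ ℋ_m`, where `l = m + N / 2`. -/
def ladderMap (s : ℂ) (N m : ℕ) : (ℕ →₀ ℂ) ⊗[ℂ] harmonicSpace s N m →ₗ[ℂ] Space s N :=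
  TensorProduct.lift (Finsupp.linearCombination ℂ fun r =>
    (∏ j ∈ Finset.range r, qNumHalf s (2 * j + 2 * m + N))⁻¹ •
      (QHat s N ^ r) ∘ₗ (harmonicSpace s N m).subtype)

theorem ladderMap_tmul (m : ℕ) (p : ℕ →₀ ℂ) (h : harmonicSpace s N m) :
    ladderMap s N m (p ⊗ₜ h) = ladder s N m h p := by
  rw [ladderMap, TensorProduct.lift.tmul, ladder, Finsupp.linearCombination_apply,
    Finsupp.linearCombination_apply, Finsupp.sum, Finsupp.sum, LinearMap.sum_apply]
  rfl

/-- The decomposition map `⨁ D ⊗ ℋ_m → 𝒜`. -/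
def ladderSumMap (s : ℂ) (N : ℕ) : LadderSum s N →ₗ[ℂ] Space s N :=
  DirectSum.toModule ℂ ℕ _ (ladderMap s N)

theorem ladderSumMap_lof (m : ℕ) (t : (ℕ →₀ ℂ) ⊗[ℂ] harmonicSpace s N m) :
    ladderSumMap s N (DirectSum.lof ℂ ℕ (fun m => (ℕ →₀ ℂ) ⊗[ℂ] harmonicSpace s N m) m t) =
      ladderMap s N m t :=
  DirectSum.toModule_lof _ _ _

theorem ladderMap_outerTensor (hs : s ≠ 0) (hq : NotRootOfUnity s) (hN : 3 ≤ N) (m : ℕ)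
    (a : Usl2 s ⊗[ℂ] Uso s N) (t : (ℕ →₀ ℂ) ⊗[ℂ] harmonicSpace s N m) :
    ladderMap s N m (outerTensor (discreteSeries hs (2 * m + N)) (harmonicRep hs hq hN m) a t) =
      Algebra.TensorProduct.lift (sl2Rep hs hq hN) (soRep hs hq hN)
        (sl2Rep_soRep_commute hs hq hN) a (ladderMap s N m t) := by
  induction a with
  | zero => simp only [map_zero, LinearMap.zero_apply]
  | add a b ha hb => rw [map_add, map_add, LinearMap.add_apply, LinearMap.add_apply, map_add, ha,
    hb]
  | tmul u X =>
    rw [outerTensor_tmul, Algebra.TensorProduct.lift_tmul, Module.End.mul_apply]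
    induction t with
    | zero => simp only [map_zero]
    | add t t' h1 h2 => simp only [map_add, h1, h2]
    | tmul p h =>
      rw [TensorProduct.map_tmul, ladderMap_tmul, ladderMap_tmul,
        ladder_discreteSeries hs hq hN (Submodule.coe_mem _), harmonicRep_apply]
      congr 1
      induction p using Finsupp.induction_linear with
      | zero => simp only [map_zero]
      | add p p' h1 h2 => simp only [map_add, h1, h2]
      | single r c =>
        rw [ladder_single, ladder_single, map_smul, map_smul]
        have h1 := ((sl2Rep_soRep_commute hs hq hN (sl2 s .e) X).pow_left r).eq
        rw [sl2Rep_sl2] at h1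
        have h2 := LinearMap.congr_fun h1 h
        rw [Module.End.mul_apply, Module.End.mul_apply] at h2
        congr 2

/-- The span of the polynomials `Q ^ r h` of degree `d` with `h` harmonic. -/
def ladderSpan (s : ℂ) (N d : ℕ) : Submodule ℂ (Space s N) :=
  Submodule.span ℂ {a | ∃ m r : ℕ, m + 2 * r = d ∧ ∃ h ∈ harmonicSpace s N m,
    a = ladder s N m h (Finsupp.single r 1)}

theorem ladderSpan_le_homog (hs : s ≠ 0) (hq : NotRootOfUnity s) (hN : 3 ≤ N) (d : ℕ) :
    ladderSpan s N d ≤ homog s N d := by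
  refine Submodule.span_le.2 ?_
  rintro _ ⟨m, r, rfl, h, hh, rfl⟩
  exact ladder_single_mem hs hq hN ((mem_harmonicSpace_iff hs hq hN).1 hh).1 r 1

theorem exists_f_eq_of_mem_ladderSpan (hs : s ≠ 0) (hq : NotRootOfUnity s) (hN : 3 ≤ N) {d : ℕ}
    {w : Space s N} (hw : w ∈ ladderSpan s N d) :
    ∃ u ∈ ladderSpan s N (d + 2), sl2Op s N .f u = w := by
  induction hw using Submodule.span_induction with
  | zero => exact ⟨0, Submodule.zero_mem _, map_zero _⟩
  | add a b _ _ ha hb =>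
    obtain ⟨u, hu, rfl⟩ := ha
    obtain ⟨v, hv, rfl⟩ := hb
    exact ⟨u + v, Submodule.add_mem _ hu hv, map_add _ _ _⟩
  | smul t a _ ha =>
    obtain ⟨u, hu, rfl⟩ := ha
    exact ⟨t • u, Submodule.smul_mem _ _ hu, map_smul _ _ _⟩
  | mem a ha =>
    obtain ⟨m, r, rfl, h, hh, rfl⟩ := ha
    have h0 : -qNum s (r + 1 : ℕ) ≠ 0 := neg_ne_zero.2 (qNum_ne_zero hs hq (by omega))
    refine ⟨(-qNum s (r + 1 : ℕ))⁻¹ • ladder s N m h (Finsupp.single (r + 1) 1),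
      Submodule.smul_mem _ _ (Submodule.subset_span ⟨m, r + 1, by ring, h, hh, rfl⟩), ?_⟩
    have h2 : (Finsupp.single r (-qNum s (r + 1 : ℕ) * 1) : ℕ →₀ ℂ) =
        (-qNum s (r + 1 : ℕ)) • Finsupp.single r 1 := by rw [Finsupp.smul_single, smul_eq_mul]
    rw [map_smul, ← ladder_f hs hq hN hh, discreteGen_f, Nat.add_sub_cancel, h2, map_smul,
      smul_smul, inv_mul_cancel₀ h0, one_smul]

theorem mem_ladderSpan_of_mem_harmonicSpace {m : ℕ} {h : Space s N}
    (hh : h ∈ harmonicSpace s N m) : h ∈ ladderSpan s N m := by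
  refine Submodule.subset_span ⟨m, 0, by ring, h, hh, ?_⟩
  rw [ladder_single]
  simp

/-- A polynomial is corrected by a polynomial in the span to a harmonic one, since `f` maps the span
in degree `d + 2` onto the span in degree `d`. -/
theorem homog_le_ladderSpan (hs : s ≠ 0) (hq : NotRootOfUnity s) (hN : 3 ≤ N) (d : ℕ) :
    homog s N d ≤ ladderSpan s N d := by
  induction d using Nat.strong_induction_on with
  | _ d ih =>
    intro v hv
    by_cases hd : d < 2
    · exact mem_ladderSpan_of_mem_harmonicSpace
        ((mem_harmonicSpace_iff hs hq hN).2 ⟨hv, f_eq_zero hs hq hN hd hv⟩)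
    · obtain ⟨d, rfl⟩ : ∃ e, d = e + 2 := ⟨d - 2, by omega⟩
      obtain ⟨u, hu, huv⟩ := exists_f_eq_of_mem_ladderSpan hs hq hN
        (ih d (by omega) (f_mem hs hq hN hv))
      have h1 : v - u ∈ harmonicSpace s N (d + 2) := by
        refine (mem_harmonicSpace_iff hs hq hN).2
          ⟨Submodule.sub_mem _ hv (ladderSpan_le_homog hs hq hN _ hu), ?_⟩
        rw [map_sub, huv, sub_self]
      have h2 := Submodule.add_mem _ (mem_ladderSpan_of_mem_harmonicSpace h1) hu
      rwa [sub_add_cancel] at h2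

theorem ladderSumMap_surjective (hs : s ≠ 0) (hq : NotRootOfUnity s) (hN : 3 ≤ N) :
    Function.Surjective (ladderSumMap s N) := by
  rw [← LinearMap.range_eq_top, ← top_le_iff, ← iSup_homog hs hq]
  refine iSup_le fun d => (homog_le_ladderSpan hs hq hN d).trans (Submodule.span_le.2 ?_)
  rintro _ ⟨m, r, -, h, hh, rfl⟩
  exact ⟨DirectSum.lof ℂ ℕ _ m (Finsupp.single r 1 ⊗ₜ ⟨h, hh⟩), by
    rw [ladderSumMap_lof, ladderMap_tmul]⟩

/-- The kernel is invariant under the locally nilpotent operator `f`; on the kernel of `f`, spanned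
by the `|0⟩ ⊗ h`, the map is injective because the spaces of homogeneous polynomials are
independent. -/
theorem ladderSumMap_injective (hs : s ≠ 0) (hq : NotRootOfUnity s) (hN : 3 ≤ N) :
    Function.Injective (ladderSumMap s N) := by
  let f : Module.End ℂ (LadderSum s N) :=
    DirectSum.lmap fun m => (discreteGen s (2 * m + N) .f).rTensor (harmonicSpace s N m)
  have hf_lof (m : ℕ) (t : (ℕ →₀ ℂ) ⊗[ℂ] harmonicSpace s N m) :
      f (DirectSum.lof ℂ ℕ _ m t) = DirectSum.lof ℂ ℕ _ m
        ((discreteGen s (2 * m + N) .f).rTensor (harmonicSpace s N m) t) :=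
    DirectSum.lmap_lof _ _ _
  have hf (y : LadderSum s N) : ladderSumMap s N (f y) = sl2Op s N .f (ladderSumMap s N y) := by
    refine LinearMap.congr_fun (f := ladderSumMap s N ∘ₗ f)
      (g := sl2Op s N .f ∘ₗ ladderSumMap s N) (DirectSum.linearMap_ext _ fun m => ?_) y
    refine TensorProduct.ext' fun p h => ?_
    simp only [LinearMap.comp_apply, hf_lof, ladderSumMap_lof, LinearMap.rTensor_tmul,
      ladderMap_tmul]
    exact ladder_f hs hq hN h.2 p
  have hnil (y : LadderSum s N) : ∃ k, (f ^ k) y = 0 := by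
    induction y using DirectSum.induction_on with
    | zero => exact ⟨0, rfl⟩
    | add y y' h1 h2 => exact pow_apply_add_eq_zero h1 h2
    | of m t =>
      obtain ⟨k, hk⟩ := f_rTensor_nilpotent (s := s) (2 * m + N) t
      refine ⟨k, ?_⟩
      have (l : ℕ) : (f ^ l) (DirectSum.lof ℂ ℕ _ m t) = DirectSum.lof ℂ ℕ _ m
          ((((discreteGen s (2 * m + N) .f).rTensor (harmonicSpace s N m) :
            Module.End ℂ _) ^ l) t) := by
        induction l with
        | zero => rfl
        | succ l ih => rw [pow_succ', pow_succ', Module.End.mul_apply, ih, hf_lof]; rfl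
      exact (this k).trans (by rw [hk, map_zero])
  let _ : AddCommGroup (LadderSum s N) := Module.addCommMonoidToAddCommGroup ℂ
  refine LinearMap.ker_eq_bot.1 ?_
  by_contra h0
  obtain ⟨y, hy, hy0, hfy⟩ := exists_mem_ker_of_locally_nilpotent hnil (fun v hv => by
    rw [LinearMap.mem_ker] at hv ⊢
    rw [hf, hv, map_zero]) h0
  have hcomp (m : ℕ) : y m = Finsupp.single 0 1 ⊗ₜ ladderCoeff (harmonicSpace s N m) 0 (y m) := by
    refine eq_tmul_of_f_eq_zero hs hq (L := 2 * m + N) ?_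
    have h1 := DFunLike.congr_fun hfy m
    exact h1
  let g : LadderSum s N →ₗ[ℂ] ⨁ m, homog s N m := DirectSum.lmap fun m =>
    (Submodule.inclusion inf_le_left : harmonicSpace s N m →ₗ[ℂ] homog s N m) ∘ₗ
      ladderCoeff (harmonicSpace s N m) 0
  let P : Module.End ℂ (LadderSum s N) := DirectSum.lmap fun m =>
    (TensorProduct.mk ℂ (ℕ →₀ ℂ) (harmonicSpace s N m) (Finsupp.single 0 1)) ∘ₗ
      ladderCoeff (harmonicSpace s N m) 0
  have hP : P y = y := DFunLike.ext _ _ fun m => (hcomp m).symm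
  have hg (y : LadderSum s N) :
      ladderSumMap s N (P y) = DFinsupp.lsum ℕ (fun m => (homog s N m).subtype) (g y) := by
    induction y using DirectSum.induction_on with
    | zero => simp only [map_zero]
    | add y y' h1 h2 => simp only [map_add, h1, h2]
    | of m t =>
      have e1 : P (DirectSum.lof ℂ ℕ _ m t) = DirectSum.lof ℂ ℕ _ m
        (Finsupp.single 0 1 ⊗ₜ ladderCoeff (harmonicSpace s N m) 0 t) := DirectSum.lmap_lof _ _ _
      have e2 : g (DirectSum.lof ℂ ℕ _ m t) = DirectSum.lof ℂ ℕ _ m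
        (Submodule.inclusion inf_le_left (ladderCoeff (harmonicSpace s N m) 0 t)) :=
          DirectSum.lmap_lof _ _ _
      have e3 (a : homog s N m) : DFinsupp.lsum ℕ (fun m => (homog s N m).subtype)
        (DirectSum.lof ℂ ℕ (fun m => homog s N m) m a) = a := DFinsupp.lsum_single _ _ _ _
      rw [← DirectSum.lof_eq_of ℂ, e1, e2, e3, ladderSumMap_lof, ladderMap_tmul, ladder_single,
        one_smul,
        Finset.range_zero, Finset.prod_empty, inv_one, one_smul]
      rfl
  have h1 : g y = 0 := by
    refine (iSupIndep_homog hs hq).dfinsupp_lsum_injective ?_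
    rw [map_zero]
    exact (hg y).symm.trans (hP.symm ▸ hy)
  refine hy0 (DFunLike.ext _ _ fun m => ?_)
  have h2 := DFunLike.congr_fun h1 m
  have h3 : ladderCoeff (harmonicSpace s N m) 0 (y m) = 0 :=
    Submodule.inclusion_injective inf_le_left (h2.trans (map_zero _).symm)
  rw [hcomp m, h3, TensorProduct.tmul_zero]
  rfl

/-- The decomposition of `𝒜` as a linear isomorphism. -/
def ladderSumEquiv (hs : s ≠ 0) (hq : NotRootOfUnity s) (hN : 3 ≤ N) :
    LadderSum s N ≃ₗ[ℂ] Space s N :=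
  LinearEquiv.ofBijective (ladderSumMap s N)
    ⟨ladderSumMap_injective hs hq hN, ladderSumMap_surjective hs hq hN⟩

end

section

variable {s : ℂ} {N : ℕ}

/-! ### Coefficients of polynomials -/

theorem shiftOp_apply (φ : Lat N → ℂ) (δ : Lat N) (c : LaurentSpace N) (μ : Lat N) :
    shiftOp φ δ c μ = φ (μ - δ) * c (μ - δ) := by
  induction c using Finsupp.induction_linear with
  | zero => simp
  | add c d h1 h2 => rw [map_add, Finsupp.add_apply, Finsupp.add_apply, h1, h2, mul_add]
  | single ν t =>
    rw [shiftOp_single]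
    by_cases h : μ = ν + δ
    · rw [h, add_sub_cancel_right, Finsupp.single_eq_same, Finsupp.single_eq_same]
    · rw [Finsupp.single_eq_of_ne h, Finsupp.single_eq_of_ne, mul_zero]
      exact fun h' => h (by rw [← h', sub_add_cancel])

theorem shiftOp_apply_add (φ : Lat N → ℂ) (δ : Lat N) (c : LaurentSpace N) (μ : Lat N) :
    shiftOp φ δ c (μ + δ) = φ μ * c μ := by
  rw [shiftOp_apply, add_sub_cancel_right]

theorem mono_induction (hs : s ≠ 0) (hq : NotRootOfUnity s) {P : Space s N → Prop} (h0 : P 0)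
    (h1 : ∀ ν, P (mono s ν)) (h2 : ∀ a b, P a → P b → P (a + b)) (h3 : ∀ (t : ℂ) a, P a → P (t • a))
    (a : Space s N) : P a := by
  have ha : a ∈ Submodule.span ℂ (Set.range fun ν : Fin N → ℕ => mono s ν) := by
    rw [(monomialsFormBasis hs hq).2]; trivial
  induction ha using Submodule.span_induction with
  | mem a ha => obtain ⟨ν, rfl⟩ := ha; exact h1 ν
  | zero => exact h0
  | add a b _ _ ha hb => exact h2 a b ha hb
  | smul t a _ ha => exact h3 t a ha

theorem toLaurent_nonneg (hs : s ≠ 0) (hq : NotRootOfUnity s) {a : Space s N} {ν : Lat N}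
    (h : toLaurent hs hq a ν ≠ 0) (i : Fin N) : 0 ≤ ν i := by
  contrapose! h
  induction a using mono_induction hs hq with
  | h0 => rw [map_zero]; rfl
  | h1 μ =>
    rw [toLaurent_mono, Finsupp.single_eq_of_ne]
    rintro rfl
    exact absurd h (not_lt.2 (Int.natCast_nonneg _))
  | h2 a b ha hb => rw [map_add, Finsupp.add_apply, ha, hb, add_zero]
  | h3 t a ha => rw [map_smul, Finsupp.smul_apply, ha, smul_zero]

theorem toLaurent_of_mem_homog (hs : s ≠ 0) (hq : NotRootOfUnity s) {m : ℕ} {a : Space s N}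
    (ha : a ∈ homog s N m) {ν : Lat N} (h : toLaurent hs hq a ν ≠ 0) : totalDeg ν = m := by
  contrapose! h
  induction ha using Submodule.span_induction with
  | mem a ha =>
    obtain ⟨μ, hμ, rfl⟩ := ha
    rw [toLaurent_mono, Finsupp.single_eq_of_ne]
    rintro rfl
    refine h ?_
    simp only [totalDeg, lin, one_mul, toLat]
    exact_mod_cast hμ
  | zero => rw [map_zero]; rfl
  | add a b _ _ ha hb => rw [map_add, Finsupp.add_apply, ha, hb, add_zero]
  | smul t a _ ha => rw [map_smul, Finsupp.smul_apply, ha, smul_zero]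

/-- The exponent of `x_1 ^ α x_N ^ β`. -/
def outerExp (N : ℕ) (α β : ℤ) : Lat N := fun i =>
  if (i : ℕ) = 0 then α else if (i.rev : ℕ) = 0 then β else 0

theorem outerExp_first {i : Fin N} (hi : (i : ℕ) = 0) (α β : ℤ) : outerExp N α β i = α := if_pos hi

theorem outerExp_last (hN : 3 ≤ N) {i : Fin N} (hi : (i : ℕ) = 0) (α β : ℤ) :
    outerExp N α β i.rev = β := by
  have h3 := val_add_rev i
  rw [outerExp, if_neg (by omega), Fin.rev_rev, if_pos hi]

theorem outerExp_inj (hN : 3 ≤ N) {α β α' β' : ℤ} :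
    outerExp N α β = outerExp N α' β' ↔ α = α' ∧ β = β' := by
  refine ⟨fun h => ?_, fun h => by rw [h.1, h.2]⟩
  let i0 : Fin N := ⟨0, by omega⟩
  have h1 := congrFun h i0
  have h2 := congrFun h i0.rev
  rw [outerExp_first rfl, outerExp_first rfl] at h1
  rw [outerExp_last hN rfl, outerExp_last hN rfl] at h2
  exact ⟨h1, h2⟩

theorem coeff_QHat (hs : s ≠ 0) (hq : NotRootOfUnity s) (hN : 3 ≤ N) (α β : ℤ) (a : Space s N) :
    toLaurent hs hq (QHat s N a) (outerExp N α β) ≠ 0 ↔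
      toLaurent hs hq a (outerExp N (α - 1) (β - 1)) ≠ 0 := by
  let i0 : Fin N := ⟨0, by omega⟩
  have hr := val_add_rev i0
  have hne : i0 ≠ i0.rev := fun h => by
    have := congrArg Fin.val h
    simp only [i0] at this hr
    omega
  have e1 : outerExp N α β - (Pi.single i0 1 + Pi.single i0.rev 1) =
      outerExp N (α - 1) (β - 1) := by
    ext l
    have hl := val_add_rev l
    have hl2 := val_add_rev i0
    simp only [Pi.sub_apply, Pi.add_apply, Pi.single_apply, outerExp]
    by_cases h1 : l = i0
    · have : l ≠ i0.rev := fun h => hne (h1.symm.trans h)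
      rw [if_pos h1, if_neg this, if_pos (by rw [h1]), if_pos (by rw [h1])]
      ring
    · have h1' : (l : ℕ) ≠ 0 := fun h => h1 (Fin.ext h)
      by_cases h2 : l = i0.rev
      · rw [if_neg h1, if_pos h2, if_neg h1', if_neg h1', h2, Fin.rev_rev, if_pos rfl, if_pos rfl]
        ring
      · have h2' : (l.rev : ℕ) ≠ 0 := fun h => h2 (by
          rw [← Fin.rev_rev l]; exact congrArg Fin.rev (Fin.ext h))
        rw [if_neg h1, if_neg h2, if_neg h1', if_neg h1', if_neg h2', if_neg h2']
        ring
  rw [QHat_extends hs hq a, LinearMap.smul_apply, Finsupp.smul_apply, radSum, LinearMap.sum_apply,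
    Finsupp.finsetSum_apply, Finset.sum_eq_single i0]
  · rw [radTerm, shiftOp_apply, e1, if_neg hne, smul_eq_mul, ← not_iff_not, not_not, not_not,
      mul_eq_zero_iff_left (radNorm_ne_zero hs hq), mul_eq_zero_iff_left]
    exact mul_ne_zero (mul_ne_zero (qp_ne hs _) one_ne_zero) (inv_ne_zero (qp_ne hs _))
  · intro j hj hj0
    rw [radTerm, shiftOp_apply]
    refine mul_eq_zero_of_right _ (by_contra fun h => ?_)
    have h1 := toLaurent_nonneg hs hq h j
    have h2 : (j : ℕ) ≠ 0 := fun h => hj0 (Fin.ext h)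
    have h3 := (Finset.mem_filter.1 hj).2
    have h4 : (0 : ℤ) ≤ (Pi.single j.rev 1 : Lat N) j := by
      rw [Pi.single_apply]; split_ifs <;> norm_num
    rw [Pi.sub_apply, Pi.add_apply, Pi.single_eq_same, outerExp, if_neg h2,
      if_neg (by omega)] at h1
    omega
  · intro h
    exact absurd (Finset.mem_filter.2 ⟨Finset.mem_univ _, Nat.zero_le _, Nat.zero_le _⟩) h

/-- The polynomial `x_1 ^ k`. -/
def topMono (s : ℂ) (N k : ℕ) : Space s N := mono s fun i => if (i : ℕ) = 0 then k else 0

theorem toLaurent_topMono (hs : s ≠ 0) (hq : NotRootOfUnity s) (k : ℕ) :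
    toLaurent hs hq (topMono s N k) = Finsupp.single (outerExp N k 0) 1 := by
  rw [topMono, toLaurent_mono]
  congr 1
  ext l
  simp only [toLat, outerExp]
  split_ifs <;> simp

/-- Among the monomials in `x_1` and `x_N` only `x_1 ^ (k + b) x_N ^ b` occurs in `Q ^ b x_1 ^ k`.
-/
theorem coeff_QHat_pow_topMono (hs : s ≠ 0) (hq : NotRootOfUnity s) (hN : 3 ≤ N) (k b : ℕ)
    (α β : ℤ) : toLaurent hs hq ((QHat s N ^ b) (topMono s N k)) (outerExp N α β) ≠ 0 ↔
      α = k + b ∧ β = b := by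
  induction b generalizing α β with
  | zero =>
    rw [pow_zero, Module.End.one_apply, toLaurent_topMono, Finsupp.single_apply]
    rw [Ne, ite_eq_right_iff, Classical.not_imp, eq_comm, outerExp_inj hN]
    simp
  | succ b ih =>
    rw [pow_succ', Module.End.mul_apply, coeff_QHat hs hq hN, ih]
    push_cast
    constructor <;> rintro ⟨h1, h2⟩ <;> constructor <;> omega

theorem totalDeg_outerExp (hN : 3 ≤ N) (α β : ℤ) : totalDeg (outerExp N α β) = α + β := by
  let i0 : Fin N := ⟨0, by omega⟩
  have hr := val_add_rev i0
  have hne : i0 ≠ i0.rev := fun h => by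
    have := congrArg Fin.val h
    simp only [i0] at this hr
    omega
  have e : outerExp N α β = Pi.single i0 α + Pi.single i0.rev β := by
    ext l
    rw [Pi.add_apply, Pi.single_apply, Pi.single_apply, outerExp]
    by_cases h1 : l = i0
    · rw [if_pos (by rw [h1]), if_pos h1, if_neg (h1 ▸ hne), add_zero]
    · rw [if_neg fun h => h1 (Fin.ext h), if_neg h1, zero_add]
      by_cases h2 : l = i0.rev
      · rw [if_pos h2, if_pos (by rw [h2, Fin.rev_rev])]
      · rw [if_neg h2, if_neg fun h => h2 (by
          rw [← Fin.rev_rev l]; exact congrArg Fin.rev (Fin.ext h))]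
  rw [e, totalDeg, lin_add, lin_single, lin_single, one_mul, one_mul]

theorem topMono_mem_homog (hN : 3 ≤ N) (k : ℕ) : topMono s N k ∈ homog s N k := by
  have h := mono_mem_homog (s := s) fun i : Fin N => if (i : ℕ) = 0 then k else 0
  have e : ∑ i : Fin N, (if (i : ℕ) = 0 then k else 0) = k := by
    rw [Finset.sum_eq_single (⟨0, by omega⟩ : Fin N)]
    · simp
    · intro j _ hj
      exact if_neg fun h => hj (Fin.ext h)
    · simp
  rwa [e] at h

theorem topMono_mem_harmonicSpace (hs : s ≠ 0) (hq : NotRootOfUnity s) (hN : 3 ≤ N) (k : ℕ) :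
    topMono s N k ∈ harmonicSpace s N k := by
  refine (mem_harmonicSpace_iff hs hq hN).2 ⟨topMono_mem_homog hN k, ?_⟩
  refine toLaurent_injective hs hq ?_
  rw [sl2Op_extends hs hq hN .f, toLaurent_topMono, map_zero, sl2Ext, LinearMap.smul_apply, lapSum,
    LinearMap.sum_apply, Finset.sum_eq_zero, smul_zero]
  intro j hj
  rw [lapTerm, shiftOp_single, lapCoeff]
  have h3 := (Finset.mem_filter.1 hj).2
  have h4 := val_add_rev j
  have h5 : outerExp N k 0 j.rev = 0 := by
    rw [outerExp, if_neg (by omega)]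
    exact ite_self _
  split_ifs with h
  · rw [← h] at h5
    simp [h5, qNumOne_zero]
  · simp [h5, qNum_zero]

theorem topMono_ne_zero (hs : s ≠ 0) (hq : NotRootOfUnity s) (k : ℕ) : topMono s N k ≠ 0 := by
  intro h
  have := toLaurent_topMono (N := N) hs hq k
  rw [h, map_zero] at this
  exact one_ne_zero (Finsupp.single_eq_zero.1 this.symm)

end

section

variable {s : ℂ} {N : ℕ}

/-! ### Primitive vectors -/

theorem ne_zero_of_shiftOp_sub_eq_zero {φ ψ : Lat N → ℂ} {δ ε : Lat N} {c : LaurentSpace N}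
    (h : (shiftOp φ δ - shiftOp ψ ε) c = 0) {ν : Lat N} (hφ : φ ν ≠ 0) (hc : c ν ≠ 0) :
    c (ν + δ - ε) ≠ 0 := by
  have h1 := DFunLike.congr_fun h (ν + δ)
  rw [LinearMap.sub_apply, Finsupp.sub_apply, shiftOp_apply_add, shiftOp_apply ψ,
    Finsupp.zero_apply, sub_eq_zero] at h1
  intro h2
  rw [h2, mul_zero] at h1
  exact mul_ne_zero hφ hc h1

theorem ne_zero_of_shiftOp_sub_eq_zero' {φ ψ : Lat N → ℂ} {δ ε : Lat N} {c : LaurentSpace N}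
    (h : (shiftOp φ δ - shiftOp ψ ε) c = 0) {ν : Lat N} (hψ : ψ ν ≠ 0) (hc : c ν ≠ 0) :
    c (ν + ε - δ) ≠ 0 := by
  refine ne_zero_of_shiftOp_sub_eq_zero (φ := ψ) (ψ := φ) (δ := ε) (ε := δ) ?_ hψ hc
  rw [LinearMap.sub_apply, sub_eq_zero] at h ⊢
  exact h.symm

/-- The change of exponent that replaces `x_b x_{b'}` by `x_a x_{a'}`. -/
def pairShift (a b : Fin N) : Lat N :=
  Pi.single a 1 + Pi.single a.rev 1 - (Pi.single b 1 + Pi.single b.rev 1)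

/-- A vector killed by a raising operator has its coefficients related in pairs: if the coefficient
of a monomial does not vanish, then neither does the one of the monomial in which `x_b x_{b'}` has
been replaced by `x_a x_{a'}`. -/
theorem raiseExt_replace (hs : s ≠ 0) (hq : NotRootOfUnity s) {a b : Fin N} {c : LaurentSpace N}
    (h : raiseExt s a b c = 0) {ν : Lat N} (hb : ν b ≠ 0) (hc : c ν ≠ 0) :
    c (ν + pairShift a b) ≠ 0 := by
  have h1 := ne_zero_of_shiftOp_sub_eq_zero h (mul_ne_zero (qNum_ne_zero hs hq hb) (qp_ne hs _)) hc
  convert h1 using 2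
  rw [pairShift]
  abel

theorem raiseExt_replace_rev (hs : s ≠ 0) (hq : NotRootOfUnity s) {a b : Fin N}
    {c : LaurentSpace N} (h : raiseExt s a b c = 0) {ν : Lat N} (ha : ν a.rev ≠ 0) (hc : c ν ≠ 0) :
    c (ν - pairShift a b) ≠ 0 := by
  have h1 := ne_zero_of_shiftOp_sub_eq_zero' h (mul_ne_zero (qNum_ne_zero hs hq ha) (qp_ne hs _)) hc
  convert h1 using 2
  rw [pairShift]
  abel

theorem qNumOne_ne_zero (hq : NotRootOfUnity s) {a : ℤ} (ha : a ≠ 0) : qNumOne s a ≠ 0 := by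
  rw [qNumOne_eq]
  refine div_ne_zero (sub_ne_zero.2 fun h => ha ((qp_eq_one_iff hq).1 h.symm))
    (sub_ne_zero.2 fun h => ?_)
  have := (qp_eq_one_iff hq (a := 1)).1 (by rw [qp_one, h])
  omega

theorem raiseShortExt_replace (hs : s ≠ 0) (hq : NotRootOfUnity s) {a b : Fin N} (hr : b.rev = b)
    {c : LaurentSpace N} (h : raiseShortExt s a b c = 0) {ν : Lat N} (hb : ν b ≠ 0)
    (hc : c ν ≠ 0) : c (ν + pairShift a b) ≠ 0 := by
  have h1 := ne_zero_of_shiftOp_sub_eq_zero h (mul_ne_zero (qNumOne_ne_zero hq hb)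
    (mul_ne_zero (qp_ne hs _) (pow_ne_zero _ hs))) hc
  convert h1 using 2
  rw [pairShift, hr]
  abel

theorem raiseShortExt_replace_rev (hs : s ≠ 0) (hq : NotRootOfUnity s) {a b : Fin N}
    (hr : b.rev = b) {c : LaurentSpace N} (h : raiseShortExt s a b c = 0) {ν : Lat N}
    (ha : ν a.rev ≠ 0) (hc : c ν ≠ 0) : c (ν - pairShift a b) ≠ 0 := by
  have h1 := ne_zero_of_shiftOp_sub_eq_zero' h (mul_ne_zero (qNum_ne_zero hs hq ha) (qp_ne hs _)) hc
  convert h1 using 2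
  rw [pairShift, hr]
  abel

/-- The space of polynomials killed by all the raising operators. -/
def primitiveSpace (s : ℂ) (N : ℕ) : Submodule ℂ (Space s N) :=
  ⨅ i, LinearMap.ker (soOp s N (.E i))

theorem mem_primitiveSpace {a : Space s N} :
    a ∈ primitiveSpace s N ↔ ∀ i, soOp s N (.E i) a = 0 := by
  simp only [primitiveSpace, Submodule.mem_iInf, LinearMap.mem_ker]

theorem stepExt_toLaurent_eq_zero (hs : s ≠ 0) (hq : NotRootOfUnity s) {a : Space s N}
    (ha : a ∈ primitiveSpace s N) (i : Fin (N / 2)) : stepExt s i id (toLaurent hs hq a) = 0 := by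
  rw [← soExt_E, ← soOp_extends hs hq (.E i) a, mem_primitiveSpace.1 ha, map_zero]

theorem topMono_mem_primitiveSpace (hs : s ≠ 0) (hq : NotRootOfUnity s) (k : ℕ) :
    topMono s N k ∈ primitiveSpace s N := by
  refine mem_primitiveSpace.2 fun i => toLaurent_injective hs hq ?_
  rw [soOp_extends hs hq (.E i), map_zero, toLaurent_topMono, soExt_E]
  have hz (l : Fin N) (hl : (l : ℕ) ≠ 0) : outerExp N k 0 l = 0 := by
    rw [outerExp, if_neg hl]; exact ite_self _
  have hi := i.2
  have key (a b : Fin N) (ha : (a.rev : ℕ) ≠ 0) (hb : (b : ℕ) ≠ 0) :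
      raiseExt s a b (Finsupp.single (outerExp N k 0) 1) = 0 := by
    rw [raiseExt, LinearMap.sub_apply, hopOp, hopOpRev, shiftOp_single, shiftOp_single, hz _ ha,
      hz _ hb, qNum_zero]
    simp
  unfold stepExt
  split_ifs
  · refine key _ _ ?_ (by simp)
    have := val_add_rev (⟨i, by omega⟩ : Fin N)
    simp only [id] at this ⊢
    omega
  · have h1 := val_add_rev (⟨i, by omega⟩ : Fin N)
    simp only [id] at h1 ⊢
    have e1 := hz ⟨(i : ℕ) + 1, by omega⟩ (by simp)
    have e2 := hz (Fin.rev ⟨(i : ℕ), by omega⟩) (by omega)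
    rw [raiseShortExt, LinearMap.sub_apply, hopShort, hopShortRev, shiftOp_single, shiftOp_single,
      e1, e2, qNum_zero, qNumOne_zero]
    simp
  · refine key _ _ ?_ (by simp)
    have := val_add_rev (⟨i - 1, by omega⟩ : Fin N)
    simp only [id] at this ⊢
    omega

theorem QHat_pow_mem_primitiveSpace (hs : s ≠ 0) (hq : NotRootOfUnity s) (hN : 3 ≤ N)
    {a : Space s N} (ha : a ∈ primitiveSpace s N) (b : ℕ) :
    (QHat s N ^ b) a ∈ primitiveSpace s N := by
  refine mem_primitiveSpace.2 fun i => ?_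
  have h := LinearMap.congr_fun ((sl2Op_soOp_commute hs hq hN .e (.E i)).pow_left b).eq a
  rw [Module.End.mul_apply, Module.End.mul_apply, mem_primitiveSpace.1 ha, map_zero] at h
  exact h.symm

/-- The distances of the factors of a monomial from the two ends, added up. -/
def depth (ν : Lat N) : ℤ := lin (fun j => min (j : ℤ) (j.rev : ℤ)) ν

theorem depth_add_pairShift (ν : Lat N) (a b : Fin N) : depth (ν + pairShift a b) =
    depth ν + 2 * (min (a : ℤ) (a.rev : ℤ) - min (b : ℤ) (b.rev : ℤ)) := by
  simp only [depth, pairShift, lin_add, lin_sub, lin_single, Fin.rev_rev, min_comm (Fin.rev _ : ℤ)]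
  ring

/-- A primitive vector that contains a monomial with a factor between `x_1` and `x_N` also contains
a monomial that is less deep. -/
theorem exists_depth_lt (hs : s ≠ 0) (hq : NotRootOfUnity s) {a : Space s N}
    (ha : a ∈ primitiveSpace s N) {ν : Lat N} (hν : toLaurent hs hq a ν ≠ 0) {j : Fin N}
    (hj : (j : ℕ) ≠ 0) (hj' : (j.rev : ℕ) ≠ 0) (hνj : ν j ≠ 0) :
    ∃ μ, toLaurent hs hq a μ ≠ 0 ∧ depth μ < depth ν := by
  have hnn (μ : Lat N) (hμ : toLaurent hs hq a μ ≠ 0) (i : Fin N) : 0 ≤ μ i :=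
    toLaurent_nonneg hs hq hμ i
  have hjr := val_add_rev j
  have hE := stepExt_toLaurent_eq_zero hs hq ha
  -- the left half
  have left (j : Fin N) (hj : (j : ℕ) ≠ 0) (hjN : (j : ℕ) < N / 2) (hνj : ν j ≠ 0) :
      ∃ μ, toLaurent hs hq a μ ≠ 0 ∧ depth μ < depth ν := by
    have h1 := hE ⟨j - 1, by omega⟩
    rw [stepExt, if_pos (by simp only; omega)] at h1
    have e : (⟨(j : ℕ) - 1 + 1, by omega⟩ : Fin N) = j := Fin.ext (by simp only; omega)
    simp only [id, e] at h1
    refine ⟨_, raiseExt_replace hs hq h1 hνj hν, ?_⟩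
    have h2 := val_add_rev j
    have h3 := val_add_rev (⟨(j : ℕ) - 1, by omega⟩ : Fin N)
    rw [depth_add_pairShift]
    simp only at h3 ⊢
    omega
  by_cases h1 : (j : ℕ) < N / 2
  · exact left j hj h1 hνj
  by_cases h2 : (j : ℕ) = j.rev
  · -- the middle factor
    have h3 := hE ⟨N / 2 - 1, by omega⟩
    rw [stepExt, if_neg (by simp only; omega), if_pos (by omega)] at h3
    have e : (⟨N / 2 - 1 + 1, by omega⟩ : Fin N) = j := Fin.ext (by simp only; omega)
    simp only [id, e] at h3
    refine ⟨_, raiseShortExt_replace hs hq (Fin.ext h2.symm) h3 hνj hν, ?_⟩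
    have h4 := val_add_rev (⟨N / 2 - 1, by omega⟩ : Fin N)
    rw [depth_add_pairShift]
    simp only at h4 ⊢
    omega
  by_cases h3 : ν j.rev = 0
  · -- `x_{j'}` does not occur, while `x_j` does
    have hneg (b : Fin N) (hb : j ≠ b) (hb' : j.rev ≠ b) :
        (ν - pairShift j.rev b) j.rev < 0 := by
      have hjj : j.rev ≠ j := fun h => h2 (congrArg Fin.val h).symm
      rw [Pi.sub_apply, h3, pairShift, Pi.sub_apply, Pi.add_apply, Pi.add_apply, Fin.rev_rev,
        Pi.single_eq_same, Pi.single_eq_of_ne hjj, Pi.single_eq_of_ne hb',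
        Pi.single_eq_of_ne fun h => hb (by rw [← Fin.rev_rev b, ← h, Fin.rev_rev])]
      norm_num
    by_cases h4 : (j.rev : ℕ) + 1 < N / 2
    · have h5 := hE ⟨j.rev, by omega⟩
      rw [stepExt, if_pos h4] at h5
      simp only [id] at h5
      have h6 := raiseExt_replace_rev hs hq h5 (ν := ν) (by rwa [Fin.rev_rev]) hν
      refine absurd (hnn _ h6 j.rev) (not_le.2 (hneg _ ?_ ?_)) <;>
        (simp only [ne_eq, Fin.ext_iff]; omega)
    by_cases h5 : N % 2 = 1
    · have h6 := hE ⟨j.rev, by omega⟩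
      rw [stepExt, if_neg h4, if_pos h5] at h6
      simp only [id] at h6
      have hr : (⟨(j.rev : ℕ) + 1, by omega⟩ : Fin N).rev = ⟨(j.rev : ℕ) + 1, by omega⟩ := by
        have := val_add_rev (⟨(j.rev : ℕ) + 1, by omega⟩ : Fin N)
        refine Fin.ext ?_
        simp only at this ⊢
        omega
      have h7 := raiseShortExt_replace_rev hs hq hr h6 (ν := ν) (by rwa [Fin.rev_rev]) hν
      refine absurd (hnn _ h7 j.rev) (not_le.2 (hneg _ ?_ ?_)) <;>
        (simp only [ne_eq, Fin.ext_iff]; omega)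
    · have h6 := hE ⟨j.rev, by omega⟩
      rw [stepExt, if_neg h4, if_neg h5] at h6
      have e : (⟨(j.rev : ℕ) + 1, by omega⟩ : Fin N) = j := Fin.ext (by simp only; omega)
      simp only [id, e] at h6
      refine ⟨_, raiseExt_replace hs hq h6 hνj hν, ?_⟩
      have h7 := val_add_rev (⟨(j.rev : ℕ) - 1, by omega⟩ : Fin N)
      rw [depth_add_pairShift]
      simp only at h7 ⊢
      omega
  · exact left j.rev hj' (by omega) h3

theorem depth_nonneg {ν : Lat N} (h : ∀ i, 0 ≤ ν i) : 0 ≤ depth ν := by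
  rw [depth, lin]
  exact Finset.sum_nonneg fun i _ => mul_nonneg (le_min (Int.natCast_nonneg _)
    (Int.natCast_nonneg _)) (h i)

/-- A primitive vector is determined by its coefficients at the monomials in `x_1` and `x_N`. -/
theorem eq_zero_of_coeff_outerExp (hs : s ≠ 0) (hq : NotRootOfUnity s) {a : Space s N}
    (ha : a ∈ primitiveSpace s N) (h : ∀ α β, toLaurent hs hq a (outerExp N α β) = 0) : a = 0 := by
  have key (n : ℕ) : ∀ ν, toLaurent hs hq a ν ≠ 0 → depth ν < n → False := by
    induction n with
    | zero =>
      intro ν hν hn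
      have := depth_nonneg fun i => toLaurent_nonneg hs hq hν i
      omega
    | succ n ih =>
      intro ν hν hn
      by_cases h1 : ∃ j : Fin N, (j : ℕ) ≠ 0 ∧ (j.rev : ℕ) ≠ 0 ∧ ν j ≠ 0
      · obtain ⟨j, hj, hj', hνj⟩ := h1
        obtain ⟨μ, hμ, hlt⟩ := exists_depth_lt hs hq ha hν hj hj' hνj
        exact ih μ hμ (by omega)
      · push Not at h1
        rcases Nat.eq_zero_or_pos N with rfl | hN
        · exact hν ((congrArg _ (Subsingleton.elim _ _)).trans (h 0 0))
        · refine hν ((congrArg _ ?_).trans (h (ν ⟨0, hN⟩) (ν (Fin.rev ⟨0, hN⟩))))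
          ext l
          rw [outerExp]
          split_ifs with h2 h3
          · exact congrArg ν (Fin.ext h2)
          · refine congrArg ν ?_
            rw [← Fin.rev_rev l]
            exact congrArg Fin.rev (Fin.ext h3)
          · exact h1 l h2 h3
  refine toLaurent_injective hs hq (Finsupp.ext fun ν => ?_)
  rw [map_zero, Finsupp.zero_apply]
  by_contra hν
  exact key ((depth ν).toNat + 1) ν hν (by omega)

/-- In a primitive vector `x_N` occurs at most as often as `x_1`. -/
theorem last_le_first (hs : s ≠ 0) (hq : NotRootOfUnity s) (hN : 3 ≤ N) {a : Space s N}
    (ha : a ∈ primitiveSpace s N) {i : Fin N} (hi : (i : ℕ) = 0) {ν : Lat N}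
    (hν : toLaurent hs hq a ν ≠ 0) : ν i.rev ≤ ν i := by
  have hir := val_add_rev i
  have step (ν : Lat N) (hν : toLaurent hs hq a ν ≠ 0) (h1 : ν i.rev ≠ 0) :
      ∃ μ, toLaurent hs hq a μ ≠ 0 ∧ μ i = ν i - 1 ∧ μ i.rev = ν i.rev - 1 := by
    have hval (b : Fin N) (hb : (b : ℕ) ≠ i) (hb' : (b.rev : ℕ) ≠ i) :
        (ν - pairShift i b) i = ν i - 1 ∧ (ν - pairShift i b) i.rev = ν i.rev - 1 := by
      have e1 : i ≠ i.rev := fun h => by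
        have := congrArg Fin.val h
        omega
      have e2 : i ≠ b := fun h => hb (by rw [h])
      have e3 : i ≠ b.rev := fun h => hb' (by rw [← h])
      have e4 : i.rev ≠ b := fun h => e3 (by rw [← h, Fin.rev_rev])
      have e5 : i.rev ≠ b.rev := fun h => e2 (Fin.rev_injective h)
      simp only [pairShift, Pi.sub_apply, Pi.add_apply, Pi.single_apply, e1, e2, e3, e4, e5,
        e1.symm, if_true, if_false]
      constructor <;> ring
    have hE := stepExt_toLaurent_eq_zero hs hq ha ⟨i, by omega⟩
    by_cases h2 : (i : ℕ) + 1 < N / 2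
    · rw [stepExt, if_pos h2] at hE
      have h3 := val_add_rev (⟨(i : ℕ) + 1, by omega⟩ : Fin N)
      exact ⟨_, raiseExt_replace_rev hs hq hE h1 hν, hval _ (by simp)
        (by simp only [id] at h3 ⊢; omega)⟩
    · have hr : (⟨(i : ℕ) + 1, by omega⟩ : Fin N).rev = ⟨(i : ℕ) + 1, by omega⟩ := by
        have := val_add_rev (⟨(i : ℕ) + 1, by omega⟩ : Fin N)
        refine Fin.ext ?_
        simp only at this ⊢
        omega
      rw [stepExt, if_neg h2, if_pos (by omega)] at hE
      refine ⟨_, raiseShortExt_replace_rev hs hq hr hE h1 hν, hval _ (by simp) ?_⟩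
      simp only [id, hr]
      simp
  obtain ⟨n, hn⟩ : ∃ n : ℕ, ν i ≤ n := ⟨(ν i).toNat, by omega⟩
  induction n generalizing ν with
  | zero =>
    by_contra hlt
    have h0 := toLaurent_nonneg hs hq hν i
    obtain ⟨μ, hμ, h1, h2⟩ := step ν hν (by omega)
    have h3 := toLaurent_nonneg hs hq hμ i
    omega
  | succ n ih =>
    by_cases h1 : ν i.rev = 0
    · rw [h1]
      exact toLaurent_nonneg hs hq hν i
    · obtain ⟨μ, hμ, h2, h3⟩ := step ν hν h1
      have h4 := ih hμ (by omega)
      omega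

end

section

variable {s : ℂ} {N : ℕ}

/-- The height of an exponent; the raising operators lower it. -/
def height (ν : Lat N) : ℤ := lin (fun j => (j : ℤ)) ν

/-- The raising operators move the support of a polynomial to smaller heights, so they are locally
nilpotent. -/
theorem exists_height_lt (hN : 3 ≤ N) (i : Fin (N / 2)) {c : LaurentSpace N} {μ : Lat N}
    (h : stepExt s i id c μ ≠ 0) : ∃ ν, c ν ≠ 0 ∧ height μ < height ν := by
  have shift {φ ψ : Lat N → ℂ} {δ ε : Lat N} (h : (shiftOp φ δ - shiftOp ψ ε) c μ ≠ 0)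
      (hδ : height δ < 0) (hε : height ε < 0) : ∃ ν, c ν ≠ 0 ∧ height μ < height ν := by
    rw [LinearMap.sub_apply, Finsupp.sub_apply, shiftOp_apply, shiftOp_apply] at h
    by_cases h1 : c (μ - δ) = 0
    · by_cases h2 : c (μ - ε) = 0
      · rw [h1, h2] at h; simp at h
      · refine ⟨_, h2, ?_⟩
        simp only [height, lin_sub] at hε ⊢
        omega
    · refine ⟨_, h1, ?_⟩
      simp only [height, lin_sub] at hδ ⊢
      omega
  have hi := i.2
  have raise (a b : Fin N) (hab : (a : ℕ) < b) (h : raiseExt s a b c μ ≠ 0) :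
      ∃ ν, c ν ≠ 0 ∧ height μ < height ν := by
    have ha := val_add_rev a
    have hb := val_add_rev b
    refine shift h ?_ ?_ <;> simp only [height, lin_sub, lin_single] <;> omega
  unfold stepExt at h
  split_ifs at h with h1 h2
  · exact raise _ _ (by simp) h
  · have ha := val_add_rev (⟨i, by omega⟩ : Fin N)
    refine shift h ?_ ?_ <;> simp only [height, lin_sub, lin_single, id] at ha ⊢ <;> omega
  · exact raise _ _ (by simp only [id]; omega) h

/-- A nonzero subspace that is invariant under the raising operators contains a nonzero primitive
vector. -/
theorem exists_primitive (hs : s ≠ 0) (hq : NotRootOfUnity s) (hN : 3 ≤ N)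
    {S : Submodule ℂ (Space s N)} (h0 : S ≠ ⊥)
    (hS : ∀ i, ∀ a ∈ S, soOp s N (.E i) a ∈ S) : ∃ a ∈ S, a ≠ 0 ∧ a ∈ primitiveSpace s N := by
  have hnn (a : Space s N) (ν : Lat N) (hν : toLaurent hs hq a ν ≠ 0) : 0 ≤ height ν := by
    rw [height, lin]
    exact Finset.sum_nonneg fun i _ =>
      mul_nonneg (Int.natCast_nonneg _) (toLaurent_nonneg hs hq hν i)
  have key (k : ℕ) : ∀ a ∈ S, a ≠ 0 → (∀ ν, toLaurent hs hq a ν ≠ 0 → height ν < k) →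
      ∃ a ∈ S, a ≠ 0 ∧ a ∈ primitiveSpace s N := by
    induction k with
    | zero =>
      intro a _ ha h
      refine absurd (toLaurent_injective hs hq (Finsupp.ext fun ν => ?_)) ha
      rw [map_zero, Finsupp.zero_apply]
      by_contra hν
      have h1 := h ν hν
      have h2 := hnn a ν hν
      omega
    | succ k ih =>
      intro a haS ha h
      by_cases hp : a ∈ primitiveSpace s N
      · exact ⟨a, haS, ha, hp⟩
      · rw [mem_primitiveSpace] at hp
        push Not at hp
        obtain ⟨i, hi⟩ := hp
        refine ih _ (hS i a haS) hi fun μ hμ => ?_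
        rw [soOp_extends hs hq (.E i) a, soExt_E] at hμ
        obtain ⟨ν, hν, hlt⟩ := exists_height_lt hN i hμ
        have := h ν hν
        omega
  obtain ⟨a, haS, ha⟩ := S.ne_bot_iff.1 h0
  refine key (∑ ν ∈ (toLaurent hs hq a).support, ((height ν).toNat + 1)) a haS ha fun ν hν => ?_
  have h1 := Finset.single_le_sum (f := fun ν => (height ν).toNat + 1) (fun _ _ => Nat.zero_le _)
    (Finsupp.mem_support_iff.2 hν)
  have h2 := hnn a ν hν
  omega

/-- On the ladder over a harmonic polynomial `f` lowers the power of `Q` with a nonzero factor. -/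
theorem f_QHat_pow (hs : s ≠ 0) (hq : NotRootOfUnity s) (hN : 3 ≤ N) {m : ℕ} {h : Space s N}
    (hh : h ∈ harmonicSpace s N m) (b : ℕ) :
    ∃ t : ℂ, t ≠ 0 ∧ sl2Op s N .f ((QHat s N ^ (b + 1)) h) = t • (QHat s N ^ b) h := by
  have hc (b : ℕ) : (∏ j ∈ Finset.range b, qNumHalf s (2 * j + 2 * m + N)) ≠ 0 :=
    Finset.prod_ne_zero_iff.2 fun j _ => qNumHalf_ne_zero hs hq (by omega)
  have h1 := ladder_f hs hq hN hh (Finsupp.single (b + 1) 1)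
  rw [discreteGen_f, Nat.add_sub_cancel, ladder_single, ladder_single, one_smul, map_smul,
    mul_one, smul_smul] at h1
  refine ⟨(∏ j ∈ Finset.range (b + 1), qNumHalf s (2 * j + 2 * m + N)) *
    (-qNum s (b + 1 : ℕ) * (∏ j ∈ Finset.range b, qNumHalf s (2 * j + 2 * m + N))⁻¹),
    mul_ne_zero (hc _) (mul_ne_zero (neg_ne_zero.2 (qNum_ne_zero hs hq (by omega)))
      (inv_ne_zero (hc _))), ?_⟩
  rw [mul_smul, h1, smul_smul, mul_inv_cancel₀ (hc _), one_smul]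

/-- The harmonic primitive vectors of degree `m` are the multiples of `x_1 ^ m`: by its coefficients
at the monomials in `x_1` and `x_N` a primitive vector is a combination of the
`Q ^ b x_1 ^ (m - 2b)`, and `f` detects the terms with `b > 0`. -/
theorem exists_eq_smul_topMono (hs : s ≠ 0) (hq : NotRootOfUnity s) (hN : 3 ≤ N) {m : ℕ}
    {a : Space s N} (hp : a ∈ primitiveSpace s N) (ha : a ∈ harmonicSpace s N m) :
    ∃ t : ℂ, a = t • topMono s N m := by
  obtain ⟨ham, haf⟩ := (mem_harmonicSpace_iff hs hq hN).1 ha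
  let v (b : ℕ) : Space s N := (QHat s N ^ b) (topMono s N (m - 2 * b))
  let t (b : ℕ) : ℂ := toLaurent hs hq a (outerExp N (m - b) b) /
    toLaurent hs hq (v b) (outerExp N (m - b) b)
  have hrange (b : ℕ) (hb : b ∈ Finset.range (m / 2 + 1)) : 2 * b ≤ m := by
    rw [Finset.mem_range] at hb; omega
  have hvb (b : ℕ) (hb : b ∈ Finset.range (m / 2 + 1)) :
      toLaurent hs hq (v b) (outerExp N (m - b) b) ≠ 0 := by
    have := hrange b hb
    refine (coeff_QHat_pow_topMono hs hq hN _ b _ _).2 ⟨?_, rfl⟩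
    omega
  have hv (b b' : ℕ) (α : ℤ) (hbb' : b ≠ b') : toLaurent hs hq (v b) (outerExp N α b') = 0 := by
    by_contra h
    have := ((coeff_QHat_pow_topMono hs hq hN _ b _ _).1 h).2
    omega
  have hsum : a = ∑ b ∈ Finset.range (m / 2 + 1), t b • v b := by
    rw [← sub_eq_zero]
    have hprim : a - ∑ b ∈ Finset.range (m / 2 + 1), t b • v b ∈ primitiveSpace s N :=
      Submodule.sub_mem _ hp (Submodule.sum_mem _ fun b _ => Submodule.smul_mem _ _
        (QHat_pow_mem_primitiveSpace hs hq hN (topMono_mem_primitiveSpace hs hq _) b))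
    have hdeg : a - ∑ b ∈ Finset.range (m / 2 + 1), t b • v b ∈ homog s N m := by
      refine Submodule.sub_mem _ ham (Submodule.sum_mem _ fun b hb => Submodule.smul_mem _ _ ?_)
      have h1 := QHat_pow_mem hs hq hN (topMono_mem_homog (s := s) hN (m - 2 * b)) b
      rwa [Nat.sub_add_cancel (hrange b hb)] at h1
    refine eq_zero_of_coeff_outerExp hs hq hprim fun α β => ?_
    by_contra h
    let i0 : Fin N := ⟨0, by omega⟩
    have h1 := toLaurent_of_mem_homog hs hq hdeg h
    have h2 := toLaurent_nonneg hs hq h i0.rev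
    have h3 := last_le_first hs hq hN hprim (i := i0) rfl h
    rw [totalDeg_outerExp hN] at h1
    rw [outerExp_last hN rfl] at h2
    rw [outerExp_last hN rfl, outerExp_first rfl] at h3
    obtain ⟨b, rfl⟩ := Int.eq_ofNat_of_zero_le h2
    have hb : b ∈ Finset.range (m / 2 + 1) := Finset.mem_range.2 (by omega)
    obtain rfl : α = m - b := by omega
    refine h ?_
    rw [map_sub, Finsupp.sub_apply, map_sum, Finsupp.finsetSum_apply, Finset.sum_eq_single b]
    · rw [map_smul, Finsupp.smul_apply, smul_eq_mul, div_mul_cancel₀ _ (hvb b hb), sub_self]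
    · intro b' _ hb'
      rw [map_smul, Finsupp.smul_apply, hv b' b _ hb', smul_zero]
    · exact fun h => absurd hb h
  have htop (k : ℕ) := topMono_mem_harmonicSpace hs hq hN k
  have ht (b : ℕ) (hb : b + 1 ∈ Finset.range (m / 2 + 1)) : t (b + 1) = 0 := by
    have h1 := haf
    rw [hsum, map_sum] at h1
    have h2 := DFunLike.congr_fun (congrArg (toLaurent hs hq) h1)
      (outerExp N (m - b - 2) b)
    rw [map_sum, Finsupp.finsetSum_apply, map_zero, Finsupp.zero_apply,
      Finset.sum_eq_single (b + 1)] at h2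
    · obtain ⟨c, hc, hfc⟩ := f_QHat_pow hs hq hN (htop (m - 2 * (b + 1))) b
      rw [map_smul, hfc, map_smul, map_smul, Finsupp.smul_apply, Finsupp.smul_apply, smul_eq_zero,
        or_iff_left] at h2
      · exact h2
      · refine smul_ne_zero hc ((coeff_QHat_pow_topMono hs hq hN _ b _ _).2 ⟨?_, rfl⟩)
        have := hrange _ hb
        omega
    · intro b' hb' hne
      rw [map_smul]
      rcases b' with _ | b'
      · have : sl2Op s N .f (v 0) = 0 := ((mem_harmonicSpace_iff hs hq hN).1 (htop _)).2
        rw [this, smul_zero, map_zero, Finsupp.zero_apply]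
      · obtain ⟨c, hc, hfc⟩ := f_QHat_pow hs hq hN (htop (m - 2 * (b' + 1))) b'
        rw [hfc, map_smul, map_smul, Finsupp.smul_apply, Finsupp.smul_apply]
        have h3 : toLaurent hs hq ((QHat s N ^ b') (topMono s N (m - 2 * (b' + 1))))
            (outerExp N (m - b - 2) b) = 0 := by
          by_contra h
          have := ((coeff_QHat_pow_topMono hs hq hN _ b' _ _).1 h).2
          omega
        rw [h3, smul_zero, smul_zero]
    · exact fun h => absurd hb h
  refine ⟨t 0, ?_⟩
  conv_lhs => rw [hsum]
  rw [Finset.sum_eq_single 0]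
  · rfl
  · intro b hb hb0
    obtain ⟨b, rfl⟩ := Nat.exists_eq_succ_of_ne_zero hb0
    rw [ht b hb, zero_smul]
  · exact fun h => absurd (Finset.mem_range.2 (Nat.succ_pos _)) h

end

section

variable {s : ℂ} {N : ℕ}

/-! ### The contravariant form -/

/-- The quotient of the values of the contravariant form at `x_i ^ t` and `x_i ^ (t - 1)`. -/
def formFactor (s : ℂ) {N : ℕ} (i : Fin N) (t : ℤ) : ℂ :=
  (if i = i.rev then qNumOne s t else qNum s t) * (qp s t)⁻¹

/-- The value of the contravariant form at a monomial. -/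
def formWt (s : ℂ) {N : ℕ} (ν : Lat N) : ℂ :=
  ∏ i, ∏ j ∈ Finset.range (ν i).toNat, formFactor s i (j + 1)

theorem formWt_ne_zero (hs : s ≠ 0) (hq : NotRootOfUnity s) (ν : Lat N) : formWt s ν ≠ 0 := by
  refine Finset.prod_ne_zero_iff.2 fun i _ => Finset.prod_ne_zero_iff.2 fun j _ => ?_
  refine mul_ne_zero ?_ (inv_ne_zero (qp_ne hs _))
  split_ifs
  · exact qNumOne_ne_zero hq (by omega)
  · exact qNum_ne_zero hs hq (by omega)

theorem formWt_add_single {ν : Lat N} {k : Fin N} (h : 0 ≤ ν k) :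
    formWt s (ν + Pi.single k 1) = formFactor s k (ν k + 1) * formWt s ν := by
  rw [formWt, formWt, ← Finset.mul_prod_erase _ _ (Finset.mem_univ k),
    ← Finset.mul_prod_erase _ _ (Finset.mem_univ k), ← mul_assoc]
  congr 1
  · rw [Pi.add_apply, Pi.single_eq_same, Int.toNat_add h zero_le_one, Int.toNat_one,
      Finset.prod_range_succ, Int.toNat_of_nonneg h, mul_comm]
  · refine Finset.prod_congr rfl fun i hi => ?_
    rw [Pi.add_apply, Pi.single_eq_of_ne (Finset.ne_of_mem_erase hi), add_zero]

/-- The ratio of the values of the form at two monomials that differ by moving one unit of exponent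
from `b` to `a`. -/
theorem formWt_hop {ν : Lat N} {a b : Fin N} (hab : a ≠ b) (h : ∀ i, 0 ≤ ν i)
    (h' : ∀ i, 0 ≤ (ν + (Pi.single a 1 - Pi.single b 1) : Lat N) i) :
    formFactor s b (ν b) * formWt s (ν + (Pi.single a 1 - Pi.single b 1)) =
      formFactor s a (ν a + 1) * formWt s ν := by
  have hb := h' b
  rw [Pi.add_apply, Pi.sub_apply, Pi.single_eq_of_ne hab.symm, Pi.single_eq_same] at hb
  obtain ⟨μ, rfl⟩ : ∃ μ : Lat N, ν = μ + Pi.single b 1 := ⟨ν - Pi.single b 1, by simp⟩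
  rw [Pi.add_apply, Pi.single_eq_same] at hb
  have ha := h a
  rw [Pi.add_apply, Pi.single_eq_of_ne hab, add_zero] at ha
  have e : μ + Pi.single b 1 + (Pi.single a 1 - Pi.single b 1) = μ + Pi.single a 1 := by abel
  rw [e, formWt_add_single ha, formWt_add_single (by omega), Pi.add_apply, Pi.add_apply,
    Pi.single_eq_same, Pi.single_eq_of_ne hab, add_zero]
  ring

/-- The contravariant form: the monomials are orthogonal. -/
def form (s : ℂ) (N : ℕ) : LaurentSpace N →ₗ[ℂ] LaurentSpace N →ₗ[ℂ] ℂ :=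
  Finsupp.lsum ℂ fun ν => LinearMap.toSpanSingleton ℂ _ (formWt s ν • Finsupp.lapply ν)

theorem form_single (ν : Lat N) (t : ℂ) (d : LaurentSpace N) :
    form s N (Finsupp.single ν t) d = t * (formWt s ν * d ν) := by
  simp [form]

/-- On polynomials, `T'` is adjoint to `T` with respect to the contravariant form. -/
def IsAdj (s : ℂ) {N : ℕ} (T T' : Module.End ℂ (LaurentSpace N)) : Prop :=
  ∀ ν μ : Lat N, (∀ i, 0 ≤ ν i) → (∀ i, 0 ≤ μ i) →
    form s N (T (Finsupp.single ν 1)) (Finsupp.single μ 1) =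
      form s N (Finsupp.single ν 1) (T' (Finsupp.single μ 1))

theorem IsAdj.sub {T₁ T₂ T₁' T₂' : Module.End ℂ (LaurentSpace N)} (h₁ : IsAdj s T₁ T₁')
    (h₂ : IsAdj s T₂ T₂') : IsAdj s (T₁ - T₂) (T₁' - T₂') := fun ν μ hν hμ => by
  rw [LinearMap.sub_apply, LinearMap.sub_apply, map_sub, map_sub, LinearMap.sub_apply, h₁ ν μ hν hμ,
    h₂ ν μ hν hμ]

theorem isAdj_shiftOp {φ ψ : Lat N → ℂ} {δ δ' : Lat N} (hδ : δ' = -δ)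
    (h : ∀ ν, (∀ i, 0 ≤ ν i) → (∀ i, 0 ≤ (ν + δ) i) →
      φ ν * formWt s (ν + δ) = ψ (ν + δ) * formWt s ν) :
    IsAdj s (shiftOp φ δ) (shiftOp ψ δ') := by
  subst hδ
  intro ν μ hν hμ
  rw [shiftOp_single, shiftOp_single, form_single, form_single]
  by_cases e : ν + δ = μ
  · subst e
    rw [add_neg_cancel_right, Finsupp.single_eq_same, Finsupp.single_eq_same]
    linear_combination h ν hν hμ
  · rw [Finsupp.single_eq_of_ne e, Finsupp.single_eq_of_ne, mul_zero, mul_zero, mul_zero, mul_zero]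
    rintro rfl
    exact e (neg_add_cancel_right _ _)

theorem qNum_eq_formFactor (hs : s ≠ 0) {i : Fin N} (hi : i ≠ i.rev) (t : ℤ) :
    qNum s t = formFactor s i t * qp s t := by
  rw [formFactor, if_neg hi, inv_mul_cancel_right₀ (qp_ne hs t)]

theorem qNumOne_eq_formFactor (hs : s ≠ 0) {i : Fin N} (hi : i = i.rev) (t : ℤ) :
    qNumOne s t = formFactor s i t * qp s t := by
  rw [formFactor, if_pos hi, inv_mul_cancel_right₀ (qp_ne hs t)]

/-- The weights of the form are chosen so that raising is adjoint to lowering, up to a factor from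
the Cartan part. -/
theorem raiseExt_isAdj (hs : s ≠ 0) {a b : Fin N} (hab : a ≠ b) (hab' : a ≠ b.rev) (ha : a ≠ a.rev)
    (hb : b ≠ b.rev) :
    IsAdj s (raiseExt s a b) (-raiseExt s a.rev b.rev *
      shiftOp (fun ν => qp s (ν a - ν a.rev - ν b + ν b.rev - 1)) 0) := by
  have hba' : a.rev ≠ b := fun h => hab' (by rw [← h, Fin.rev_rev])
  have hab'' : a.rev ≠ b.rev := fun h => hab (Fin.rev_injective h)
  have e : -raiseExt s a.rev b.rev *
      shiftOp (fun ν => qp s (ν a - ν a.rev - ν b + ν b.rev - 1)) 0 =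
      shiftOp (fun ν => qNum s (ν a)) (Pi.single b 1 - Pi.single a 1) -
        shiftOp (fun ν => qNum s (ν b.rev) * qp s (ν a - ν b))
          (Pi.single a.rev 1 - Pi.single b.rev 1) := by
    have e1 : -raiseExt s a.rev b.rev = hopOpRev s a.rev b.rev - hopOp s a.rev b.rev := by
      rw [raiseExt]; module
    rw [e1, hopOp, hopOpRev, sub_mul (α := Module.End ℂ (LaurentSpace N)), shiftOp_mul, shiftOp_mul]
    congr 1
    · refine shiftOp_congr (by rw [zero_add, Fin.rev_rev, Fin.rev_rev]) fun ν => ?_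
      rw [add_zero, Fin.rev_rev, Fin.rev_rev, mul_assoc, ← qp_add hs]
      ring_nf
      rw [qp_zero, mul_one]
    · refine shiftOp_congr (by rw [zero_add]) fun ν => ?_
      rw [add_zero, mul_assoc, ← qp_add hs]
      ring_nf
  rw [e, raiseExt, hopOp, hopOpRev]
  refine IsAdj.sub (isAdj_shiftOp (by abel) fun ν h1 h2 => ?_)
    (isAdj_shiftOp (by abel) fun ν h1 h2 => ?_)
  · have h3 := formWt_hop (s := s) hab h1 h2
    have h4 : (ν + (Pi.single a 1 - Pi.single b 1) : Lat N) a = ν a + 1 := by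
      simp [Pi.single_eq_of_ne hab]
    rw [h4, qNum_eq_formFactor hs hb, qNum_eq_formFactor hs ha,
      show ν a - ν b + 1 = (ν a + 1) - ν b by ring, qp_sub hs]
    have := qp_ne hs (ν b)
    field_simp
    linear_combination qp s (ν a + 1) * h3
  · have h3 := formWt_hop (s := s) hab''.symm h1 h2
    have h4 : (ν + (Pi.single b.rev 1 - Pi.single a.rev 1) : Lat N) b.rev = ν b.rev + 1 := by
      simp [Pi.single_eq_of_ne hab''.symm]
    have h5 : (ν + (Pi.single b.rev 1 - Pi.single a.rev 1) : Lat N) a = ν a := by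
      simp [Pi.single_eq_of_ne hab', Pi.single_eq_of_ne ha]
    have h6 : (ν + (Pi.single b.rev 1 - Pi.single a.rev 1) : Lat N) b = ν b := by
      simp [Pi.single_eq_of_ne hb, Pi.single_eq_of_ne hba'.symm]
    rw [h4, h5, h6, qNum_eq_formFactor (i := a.rev) hs (by rw [Fin.rev_rev]; exact ha.symm),
      qNum_eq_formFactor (i := b.rev) hs (by rw [Fin.rev_rev]; exact hb.symm),
      show ν a - ν b - ν a.rev + ν b.rev + 1 = (ν a - ν b) + (ν b.rev + 1) - ν a.rev by ring,
      qp_sub hs, qp_add hs]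
    have := qp_ne hs (ν a.rev)
    field_simp
    linear_combination qp s (ν a - ν b) * qp s (ν b.rev + 1) * h3

theorem raiseShortExt_isAdj (hs : s ≠ 0) {a c : Fin N} (hac : a ≠ c) (ha : a ≠ a.rev)
    (hc : c = c.rev) :
    IsAdj s (raiseShortExt s a c) (-s⁻¹ • raiseShortExt s a.rev c *
      shiftOp (fun ν => qp s (ν a - ν a.rev)) 0) := by
  have hac' : a.rev ≠ c := fun h => hac (by rw [hc, ← h, Fin.rev_rev])
  have e : -s⁻¹ • raiseShortExt s a.rev c * shiftOp (fun ν => qp s (ν a - ν a.rev)) 0 =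
      shiftOp (fun ν => s * qNum s (ν a)) (Pi.single c 1 - Pi.single a 1) -
        shiftOp (fun ν => qNumOne s (ν c) * qp s (ν a - ν c + 1))
          (Pi.single a.rev 1 - Pi.single c 1) := by
    have e1 : -s⁻¹ • raiseShortExt s a.rev c = s⁻¹ • hopShortRev s a.rev c -
        s⁻¹ • hopShort s a.rev c := by rw [raiseShortExt]; module
    rw [e1, hopShort, hopShortRev, sub_mul (α := Module.End ℂ (LaurentSpace N)), shiftOp_smul,
      shiftOp_smul, shiftOp_mul, shiftOp_mul]
    congr 1
    · refine shiftOp_congr (by rw [zero_add, Fin.rev_rev]) fun ν => ?_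
      rw [add_zero, Fin.rev_rev, mul_assoc, mul_assoc, ← qp_add hs]
      ring_nf
      rw [qp_one]
      field_simp
    · refine shiftOp_congr (by rw [zero_add]) fun ν => ?_
      rw [add_zero, show ν a - ν c + 1 = (ν a.rev - ν c) + (ν a - ν a.rev) + 1 by ring, qp_add hs,
        qp_add hs _ (ν a - ν a.rev), qp_one]
      field_simp
  rw [e, raiseShortExt, hopShort, hopShortRev]
  refine IsAdj.sub (isAdj_shiftOp (by abel) fun ν h1 h2 => ?_)
    (isAdj_shiftOp (by abel) fun ν h1 h2 => ?_)
  · have h3 := formWt_hop (s := s) hac h1 h2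
    have h4 : (ν + (Pi.single a 1 - Pi.single c 1) : Lat N) a = ν a + 1 := by
      simp [Pi.single_eq_of_ne hac]
    rw [h4, qNumOne_eq_formFactor hs hc, qNum_eq_formFactor hs ha, qp_add hs, qp_sub hs, qp_one]
    have := qp_ne hs (ν c)
    field_simp
    linear_combination qp s (ν a) * h3
  · have h3 := formWt_hop (s := s) hac'.symm h1 h2
    have h4 : (ν + (Pi.single c 1 - Pi.single a.rev 1) : Lat N) c = ν c + 1 := by
      simp [Pi.single_eq_of_ne hac'.symm]
    have h5 : (ν + (Pi.single c 1 - Pi.single a.rev 1) : Lat N) a = ν a := by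
      simp [Pi.single_eq_of_ne hac, Pi.single_eq_of_ne ha]
    rw [h4, h5, qNum_eq_formFactor (i := a.rev) hs (by rw [Fin.rev_rev]; exact ha.symm),
      qNumOne_eq_formFactor hs hc, show ν a - ν a.rev + 1 = (ν a + 1) - ν a.rev by ring,
      show ν a - (ν c + 1) + 1 = (ν a + 1) - (ν c + 1) by ring, qp_sub hs, qp_sub hs]
    have := qp_ne hs (ν a.rev)
    have := qp_ne hs (ν c + 1)
    field_simp
    linear_combination qp s (ν a + 1) * h3

/-- The operator `E_i` is adjoint to a multiple of `F_i K_i`. -/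
theorem exists_soExt_isAdj (hs : s ≠ 0) (hN : 3 ≤ N) (i : Fin (N / 2)) :
    ∃ t : ℂ, IsAdj s (soExt s N (.E i)) (soExt s N (.F i) * t • soExt s N (.K i)) := by
  have hi := i.2
  simp only [soExt]
  split_ifs with h1 h2
  · refine ⟨qp s (-1), ?_⟩
    have ha := val_add_rev (⟨i, by omega⟩ : Fin N)
    have hb := val_add_rev (⟨(i : ℕ) + 1, by omega⟩ : Fin N)
    have h := raiseExt_isAdj hs (a := (⟨i, by omega⟩ : Fin N)) (b := ⟨(i : ℕ) + 1, by omega⟩)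
      (by simp) (by rw [ne_eq, Fin.ext_iff]; simp only at hb ⊢; omega)
      (by rw [ne_eq, Fin.ext_iff]; simp only at ha ⊢; omega)
      (by rw [ne_eq, Fin.ext_iff]; simp only at hb ⊢; omega)
    convert h using 2
    rw [shiftOp_smul]
    refine shiftOp_congr rfl fun ν => ?_
    rw [← qp_add hs, simpleRoot, dif_pos h1, wtDot_sub_left, wtDot_single, wtDot_single]
    simp only [latWt]
    congr 1
    ring
  · refine ⟨1, ?_⟩
    have ha := val_add_rev (⟨i, by omega⟩ : Fin N)
    have hc := val_add_rev (⟨(i : ℕ) + 1, by omega⟩ : Fin N)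
    have h := raiseShortExt_isAdj hs (a := (⟨i, by omega⟩ : Fin N)) (c := ⟨(i : ℕ) + 1, by omega⟩)
      (by simp) (by rw [ne_eq, Fin.ext_iff]; simp only at ha ⊢; omega)
      (by rw [Fin.ext_iff]; simp only at hc ⊢; omega)
    convert h using 2
    rw [one_smul]
    refine shiftOp_congr rfl fun ν => ?_
    rw [simpleRoot, dif_neg h1, if_pos h2, wtDot_single]
    rfl
  · refine ⟨qp s (-1), ?_⟩
    have ha := val_add_rev (⟨(i : ℕ) - 1, by omega⟩ : Fin N)
    have hb := val_add_rev (⟨(i : ℕ) + 1, by omega⟩ : Fin N)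
    have h := raiseExt_isAdj hs (a := (⟨(i : ℕ) - 1, by omega⟩ : Fin N))
      (b := ⟨(i : ℕ) + 1, by omega⟩)
      (by rw [ne_eq, Fin.ext_iff]; simp only; omega)
      (by rw [ne_eq, Fin.ext_iff]; simp only at hb ⊢; omega)
      (by rw [ne_eq, Fin.ext_iff]; simp only at ha ⊢; omega)
      (by rw [ne_eq, Fin.ext_iff]; simp only at hb ⊢; omega)
    convert h using 2
    rw [shiftOp_smul]
    refine shiftOp_congr rfl fun ν => ?_
    have e : (⟨i, by omega⟩ : Fin N) = Fin.rev ⟨(i : ℕ) + 1, by omega⟩ := by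
      rw [Fin.ext_iff]; simp only at hb ⊢; omega
    rw [← qp_add hs, simpleRoot, dif_neg h1, if_neg h2, wtDot_add_left, wtDot_single, wtDot_single]
    simp only [latWt, e, Fin.rev_rev]
    congr 1
    ring

theorem form_E (hs : s ≠ 0) (hq : NotRootOfUnity s) (hN : 3 ≤ N) (i : Fin (N / 2)) :
    ∃ t : ℂ, ∀ a b : Space s N,
      form s N (toLaurent hs hq (soOp s N (.E i) a)) (toLaurent hs hq b) =
        form s N (toLaurent hs hq a)
          (toLaurent hs hq (soOp s N (.F i) (t • soOp s N (.K i) b))) := by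
  obtain ⟨t, ht⟩ := exists_soExt_isAdj hs hN i
  refine ⟨t, fun a b => ?_⟩
  have hE := soOp_extends hs hq (.E i)
  have hF : Extends hs hq (soOp s N (.F i) * t • soOp s N (.K i))
      (soExt s N (.F i) * t • soExt s N (.K i)) :=
    (soOp_extends hs hq (.F i)).mul ((soOp_extends hs hq (.K i)).smul t)
  have hF' := hF b
  rw [Module.End.mul_apply, LinearMap.smul_apply] at hF'
  rw [hE a, hF']
  clear hF'
  induction a using mono_induction hs hq with
  | h0 => simp only [map_zero, LinearMap.zero_apply]
  | h2 a a' h1 h2 => simp only [map_add, LinearMap.add_apply, h1, h2]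
  | h3 c a h1 => simp only [map_smul, LinearMap.smul_apply, h1]
  | h1 ν =>
    induction b using mono_induction hs hq with
    | h0 => simp only [map_zero]
    | h2 b b' h1 h2 => simp only [map_add, h1, h2]
    | h3 c b h1 => simp only [map_smul, h1]
    | h1 μ =>
      rw [toLaurent_mono, toLaurent_mono]
      exact ht _ _ (fun i => Int.natCast_nonneg _) fun i => Int.natCast_nonneg _

/-! ### Irreducibility of the spaces of harmonic polynomials -/

instance finiteDimensional_homog (m : ℕ) : FiniteDimensional ℂ (homog s N m) := by
  refine FiniteDimensional.span_of_finite ℂ ?_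
  refine ((Set.finite_Iic fun _ : Fin N => m).image (mono s)).subset ?_
  rintro _ ⟨ν, hν, rfl⟩
  exact ⟨ν, fun i => hν ▸ Finset.single_le_sum (fun _ _ => Nat.zero_le _) (Finset.mem_univ i), rfl⟩

instance finiteDimensional_harmonicSpace (m : ℕ) : FiniteDimensional ℂ (harmonicSpace s N m) :=
  Submodule.finiteDimensional_of_le inf_le_left

theorem topMono_mem_of_invariant (hs : s ≠ 0) (hq : NotRootOfUnity s) (hN : 3 ≤ N) {m : ℕ}
    {S : Submodule ℂ (Space s N)} (hSH : S ≤ harmonicSpace s N m) (h0 : S ≠ ⊥)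
    (hS : ∀ i, ∀ a ∈ S, soOp s N (.E i) a ∈ S) : topMono s N m ∈ S := by
  obtain ⟨a, haS, ha0, hap⟩ := exists_primitive hs hq hN h0 hS
  obtain ⟨t, rfl⟩ := exists_eq_smul_topMono hs hq hN hap (hSH haS)
  have ht : t ≠ 0 := fun h => ha0 (by rw [h, zero_smul])
  have := S.smul_mem t⁻¹ haS
  rwa [smul_smul, inv_mul_cancel₀ ht, one_smul] at this

theorem soOp_mem_harmonicSpace (hs : s ≠ 0) (hq : NotRootOfUnity s) (hN : 3 ≤ N) {m : ℕ}
    (g : SoGen (N / 2)) {a : Space s N} (ha : a ∈ harmonicSpace s N m) :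
    soOp s N g a ∈ harmonicSpace s N m := by
  rw [← soRep_so hs hq hN]
  exact soRep_mem_harmonicSpace hs hq hN m _ a ha

/-- A nonzero invariant subspace contains `x_1 ^ m`, and so would a nonzero orthogonal complement of
it with respect to the contravariant form; but `x_1 ^ m` is not isotropic. -/
theorem eq_harmonicSpace_of_invariant (hs : s ≠ 0) (hq : NotRootOfUnity s) (hN : 3 ≤ N) {m : ℕ}
    {S : Submodule ℂ (Space s N)} (hSH : S ≤ harmonicSpace s N m) (h0 : S ≠ ⊥)
    (hS : ∀ g, ∀ a ∈ S, soOp s N g a ∈ S) : S = harmonicSpace s N m := by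
  have htop := topMono_mem_of_invariant hs hq hN hSH h0 fun i => hS (.E i)
  let B : Space s N →ₗ[ℂ] Space s N →ₗ[ℂ] ℂ :=
    (form s N).compl₁₂ (toLaurent hs hq) (toLaurent hs hq)
  let B' : harmonicSpace s N m →ₗ[ℂ] Module.Dual ℂ S := B.domRestrict₁₂ _ _
  let O : Submodule ℂ (Space s N) := (LinearMap.ker B').map (harmonicSpace s N m).subtype
  have hO : O = ⊥ := by
    by_contra hO0
    have h1 : topMono s N m ∈ O := by
      refine topMono_mem_of_invariant hs hq hN (Submodule.map_subtype_le _ _) hO0 fun i a ha => ?_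
      obtain ⟨a, ha, rfl⟩ := ha
      obtain ⟨t, ht⟩ := form_E hs hq hN i
      refine ⟨⟨soOp s N (.E i) a, soOp_mem_harmonicSpace hs hq hN _ a.2⟩, ?_, rfl⟩
      refine LinearMap.mem_ker.2 (LinearMap.ext fun b => (ht a b).trans ?_)
      exact LinearMap.congr_fun (LinearMap.mem_ker.1 ha)
        ⟨_, hS (.F i) _ (S.smul_mem t (hS (.K i) _ b.2))⟩
    obtain ⟨a, ha, ha'⟩ := h1
    have h2 : form s N (toLaurent hs hq a) (toLaurent hs hq (topMono s N m)) = 0 :=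
      LinearMap.congr_fun (LinearMap.mem_ker.1 ha) ⟨_, htop⟩
    have h3 : (a : Space s N) = topMono s N m := ha'
    rw [h3, toLaurent_topMono, form_single, Finsupp.single_eq_same, one_mul, mul_one] at h2
    exact formWt_ne_zero hs hq _ h2
  have hB' : Function.Injective B' := by
    intro a b hab
    have h1 : (a : Space s N) - b ∈ O := by
      refine ⟨⟨(a : Space s N) - b, Submodule.sub_mem _ a.2 b.2⟩, LinearMap.mem_ker.2 ?_, rfl⟩
      refine LinearMap.ext fun c => ?_
      have h2 : B a c = B b c := LinearMap.congr_fun hab c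
      have h3 : B ((a : Space s N) - b) c = 0 := by
        rw [map_sub, LinearMap.sub_apply, h2, sub_self]
      exact h3
    rw [hO, Submodule.mem_bot, sub_eq_zero] at h1
    exact Subtype.ext h1
  have hfin : FiniteDimensional ℂ S := Submodule.finiteDimensional_of_le hSH
  have hfree : Module.Free ℂ S := Module.Free.of_divisionRing ℂ S
  refine Submodule.eq_of_le_of_finrank_le hSH ?_
  rw [← Module.finrank_linearMap_self ℂ ℂ S]
  exact LinearMap.finrank_le_finrank_of_injective hB'

end

section

variable {s : ℂ} {N : ℕ}

theorem harmonicRep_isIrred (hs : s ≠ 0) (hq : NotRootOfUnity s) (hN : 3 ≤ N) (m : ℕ) :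
    IsIrred (harmonicRep hs hq hN m) := by
  refine ⟨⟨⟨topMono s N m, topMono_mem_harmonicSpace hs hq hN m⟩, 0, fun h =>
    topMono_ne_zero hs hq m (congrArg Subtype.val h)⟩, fun S hS => or_iff_not_imp_left.2 fun h0 =>
      ?_⟩
  have h1 := eq_harmonicSpace_of_invariant hs hq hN (S := S.map (harmonicSpace s N m).subtype)
    (Submodule.map_subtype_le _ _) (fun h => h0 ?_) ?_
  · rw [eq_top_iff]
    rintro ⟨a, ha⟩ -
    rw [← h1] at ha
    obtain ⟨b, hb, rfl⟩ := ha
    exact hb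
  · refine (Submodule.eq_bot_iff _).2 fun a ha => Subtype.ext ?_
    exact (Submodule.eq_bot_iff _).1 h _ (Submodule.mem_map_of_mem ha)
  · rintro g _ ⟨a, ha, rfl⟩
    refine ⟨_, hS (so s N g) a ha, ?_⟩
    rw [← soRep_so hs hq hN]
    rfl

theorem soOp_K_topMono (hs : s ≠ 0) (hq : NotRootOfUnity s) (hN : 3 ≤ N) (i : Fin (N / 2)) (m : ℕ) :
    soOp s N (.K i) (topMono s N m) =
      (s ^ 2) ^ wtDot (simpleRoot i) (fun j => if (j : ℕ) = 0 then (m : ℤ) else 0) •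
        topMono s N m := by
  refine (monoOp_mono (monomialsFormBasis hs hq) _ _).trans ?_
  have e : monoWt (fun l : Fin N => if (l : ℕ) = 0 then m else 0) =
      fun j : Fin (N / 2) => if (j : ℕ) = 0 then (m : ℤ) else 0 := by
    ext j
    have h1 := val_add_rev (⟨j, by omega⟩ : Fin N)
    simp only [monoWt] at h1 ⊢
    rw [if_neg (show ¬((Fin.rev ⟨(j : ℕ), by omega⟩ : Fin N) : ℕ) = 0 by omega)]
    simp
  rw [e]
  rfl

theorem harmonicRep_isIrredHighestWeight (hs : s ≠ 0) (hq : NotRootOfUnity s) (hN : 3 ≤ N) (m : ℕ) :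
    IsIrredHighestWeight (harmonicRep hs hq hN m)
      (fun i => if (i : ℕ) = 0 then (m : ℤ) else 0) := by
  refine ⟨harmonicRep_isIrred hs hq hN m, ⟨topMono s N m, topMono_mem_harmonicSpace hs hq hN m⟩,
    fun h => topMono_ne_zero hs hq m (congrArg Subtype.val h), fun i => ⟨?_, ?_⟩⟩
  · refine Subtype.ext ?_
    rw [harmonicRep_apply, soRep_so]
    exact mem_primitiveSpace.1 (topMono_mem_primitiveSpace hs hq m) i
  · refine Subtype.ext ?_
    rw [harmonicRep_apply, soRep_so]
    exact soOp_K_topMono hs hq hN i m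

theorem wtDot_simpleRoot_zero (hN : 3 ≤ N) (m : ℤ) :
    wtDot (simpleRoot (⟨0, by omega⟩ : Fin (N / 2))) (fun j => if (j : ℕ) = 0 then m else 0) = m :=
      by
  unfold simpleRoot
  split_ifs with h1 h2
  · rw [wtDot_sub_left, wtDot_single, wtDot_single]
    simp
  · rw [wtDot_single]
    simp
  · simp only at h1
    omega

/-- The degree is an invariant of the equivalence class, since it is the highest weight. -/
theorem harmonicRep_degree_unique (hs : s ≠ 0) (hq : NotRootOfUnity s) (hN : 3 ≤ N) {m m' : ℕ}
    (h : RepEquiv (harmonicRep hs hq hN m) (harmonicRep hs hq hN m')) : m = m' := by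
  obtain ⟨Φ, hΦ⟩ := h
  let v : harmonicSpace s N m := ⟨topMono s N m, topMono_mem_harmonicSpace hs hq hN m⟩
  have hv : v ≠ 0 := fun h => topMono_ne_zero hs hq m (congrArg Subtype.val h)
  have hprim : (Φ v : Space s N) ∈ primitiveSpace s N := by
    refine mem_primitiveSpace.2 fun i => ?_
    have h1 : harmonicRep hs hq hN m (so s N (.E i)) v = 0 := by
      refine Subtype.ext ?_
      rw [harmonicRep_apply, soRep_so]
      exact mem_primitiveSpace.1 (topMono_mem_primitiveSpace hs hq m) i
    have h2 := hΦ (so s N (.E i)) v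
    rw [h1, map_zero] at h2
    have h3 := congrArg Subtype.val h2
    rw [harmonicRep_apply, soRep_so] at h3
    exact h3.symm
  obtain ⟨t, ht⟩ := exists_eq_smul_topMono hs hq hN hprim (Φ v).2
  have ht0 : t ≠ 0 := fun h => hv (Φ.map_eq_zero_iff.1 (Subtype.ext (by
    rw [ht, h, zero_smul]; rfl)))
  let i : Fin (N / 2) := ⟨0, by omega⟩
  have h1 : harmonicRep hs hq hN m (so s N (.K i)) v = qp s m • v := by
    refine Subtype.ext ?_
    rw [harmonicRep_apply, soRep_so]
    refine (soOp_K_topMono hs hq hN i m).trans ?_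
    rw [wtDot_simpleRoot_zero hN]
    rfl
  have h2 := congrArg Subtype.val (hΦ (so s N (.K i)) v)
  rw [h1, map_smul, harmonicRep_apply, soRep_so, Submodule.coe_smul, ht, map_smul,
    soOp_K_topMono hs hq hN, wtDot_simpleRoot_zero hN, zpow_eq_qp, smul_comm t] at h2
  have h3 := smul_left_injective ℂ (smul_ne_zero ht0 (topMono_ne_zero (N := N) hs hq m')) h2
  exact_mod_cast qp_injective hs hq h3

end

end QEuclid

end

theorem mainTheorem6 (N : ℕ) (hN : 3 ≤ N) (s : ℂ) (hs : s ≠ 0)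
    (hq : ∀ k : ℕ, 0 < k → (s ^ 2) ^ k ≠ 1) :
    MonomialsFormBasis s N ∧
    -- the natural action of `U_q(so_N)`
    ∃ L : Uso s N →ₐ[ℂ] Module.End ℂ (Space s N),
      (∀ g, L (so s N g) = soOp s N g) ∧
    -- the representation of `U_q(sl_2)`
    ∃ ω : Usl2 s →ₐ[ℂ] Module.End ℂ (Space s N),
      ω (sl2 s .k) = s ^ N • qPowGamma s N 1 ∧
      ω (sl2 s .e) = QHat s N ∧
      ω (sl2 s .f) =
        (s ^ N / (1 + (s ^ 2) ^ (N - 2)) ^ 2) • (-(laplace s N * qPowGamma s N (-1))) ∧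
    -- the two actions commute
    ∃ hcomm : ∀ u X, Commute (ω u) (L X),
    -- the discrete series representations are irreducible and pairwise inequivalent
    (∀ m : ℕ, IsIrred (discreteSeries hs (2 * m + N))) ∧
    (∀ m m' : ℕ, RepEquiv (discreteSeries hs (2 * m + N)) (discreteSeries hs (2 * m' + N)) →
      m = m') ∧
    -- the representation of `U_q(so_N)` on the harmonic polynomials of degree `m`
    ∃ T : ∀ m : ℕ, Uso s N →ₐ[ℂ] Module.End ℂ (harmonicSpace s N m),
      (∀ m X (h : harmonicSpace s N m), (T m X h : Space s N) = L X h) ∧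
      (∀ m, IsIrredHighestWeight (T m) (fun i => if (i : ℕ) = 0 then (m : ℤ) else 0)) ∧
      (∀ m m' : ℕ, RepEquiv (T m) (T m') → m = m') ∧
    -- the decomposition of `ω × L`
      (∀ m, IsIrred (outerTensor (discreteSeries hs (2 * m + N)) (T m))) ∧
      ∃ Φ : (⨁ m : ℕ, (ℕ →₀ ℂ) ⊗[ℂ] harmonicSpace s N m) ≃ₗ[ℂ] Space s N,
        (∀ (m : ℕ) (a : Usl2 s ⊗[ℂ] Uso s N) (t : (ℕ →₀ ℂ) ⊗[ℂ] harmonicSpace s N m),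
          Φ (DirectSum.lof ℂ ℕ (fun m => (ℕ →₀ ℂ) ⊗[ℂ] harmonicSpace s N m) m
              (outerTensor (discreteSeries hs (2 * m + N)) (T m) a t)) =
            Algebra.TensorProduct.lift ω L hcomm a
              (Φ (DirectSum.lof ℂ ℕ (fun m => (ℕ →₀ ℂ) ⊗[ℂ] harmonicSpace s N m) m t))) ∧
        ∀ (m r : ℕ) (h : harmonicSpace s N m),
          Φ (DirectSum.lof ℂ ℕ (fun m => (ℕ →₀ ℂ) ⊗[ℂ] harmonicSpace s N m) m
              (Finsupp.single r 1 ⊗ₜ[ℂ] h)) =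
            (∏ j ∈ Finset.range r, qNumHalf s (2 * j + 2 * m + N))⁻¹ • (QHat s N ^ r) h := by
  refine ⟨monomialsFormBasis hs hq, soRep hs hq hN, soRep_so hs hq hN, sl2Rep hs hq hN,
    sl2Rep_sl2 hs hq hN .k, sl2Rep_sl2 hs hq hN .e, sl2Rep_sl2 hs hq hN .f,
    sl2Rep_soRep_commute hs hq hN, fun m => discreteSeries_isIrred hs hq (by omega),
    fun m m' h => ?_, harmonicRep hs hq hN, fun m X h => rfl,
    harmonicRep_isIrredHighestWeight hs hq hN, fun m m' => harmonicRep_degree_unique hs hq hN,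
    fun m => isIrred_outerTensor_discreteSeries hs hq (by omega) (harmonicRep_isIrred hs hq hN m),
    ladderSumEquiv hs hq hN, fun m a t => ?_, fun m r h => ?_⟩
  · have := discreteSeries_lowestWeight_unique hs hq h
    omega
  · refine (ladderSumMap_lof m _).trans ((ladderMap_outerTensor hs hq hN m a t).trans ?_)
    exact congrArg _ (ladderSumMap_lof m t).symm
  · refine (ladderSumMap_lof m _).trans ?_
    rw [ladderMap_tmul, ladder_single, one_smul]
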